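/- **Setting.** Let $\widehat{\mathfrak g}$ be simply laced untwisted affine, of type $A_N^{(1)}$ ($N\ge2$), $D_N^{(1)}$ ($N\ge4$), $E_6^{(1)},E_7^{(1)}$ or $E_8^{(1)}$, with index set $I=\{0,\dots,N\}$ ($0$ the affine node), Cartan matrix $(a_{ij})$ and labels $a_i$ (so $\sum_j a_{ij}a_j=0$, $a_0=1$). Put $m_{ij}=\delta_{i,j+1}-\delta_{i+1,j}$ (indices mod $N+1$) in type $A$ and $m_{ij}=0$ otherwise. Let $\mathfrak h^*$ be the space of weights of $\mathfrak h=\mathrm{span}(h_0,\dots,h_N,d)$, with simple roots $\langle\alpha_j,h_i\rangle=a_{ij}$, $\langle\alpha_j,d\rangle=\delta_{j0}$, fundamental weights $\langle\Lambda_a,h_i\rangle=\delta_{ai}$, $\langle\Lambda_a,d\rangle=0$, and $\bar\Lambda_a=\Lambda_a-\Lambda_0$ for $a_a=1$. Let $H_P$ have basis $P_0,\dots,P_N$, define $Q_\mu\in H_P^*$ for $\mu\in\mathfrak h^*$ by $\langle Q_\mu,P_j\rangle=\langle\mu,h_j\rangle$, put $Q_j=Q_{\alpha_j}$, and let $\mathcal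 F$ be the field of meromorphic functions $g(h,P)$ on $H^*=\mathfrak h^*\oplus H_P^*$. Fix $q,\kappa,p\in\mathbb C^\times$ with $|q|,|p|,|p^*|<1$, $p^*=pq^{-2}$, and $q,\kappa$ multiplicatively independent, and $l\in\mathbb C$. **$\mathcal Z_{1,l}$-modules.** Write $(x;t)_\infty=\prod_{n\ge0}(1-t^nx)$ (a power series in $x$) and $\delta(z)=\sum_{n\in\mathbb Z}z^n$. A $\mathcal Z_{1,l}$-module is an $\mathcal F$-vector space spanned over $\mathbb C$ by weight vectors (a vector of weight $\xi\in H^*$ is one on which functions $g(h,P)$ act by $g(\xi)$), with $\mathbb C$-linear operators $\mathcal Z^\pm_{i,m}$, invertible $K_i^\pm$ and $q^d$, such that each vector is killed by $\mathcal Z^\pm_{i,m}$ for $m\gg0$ and, with $\mathcal Z_i^\pm(z)=\sum_m\mathcal Z^\pm_{i,m}z^{-m}$, the following hold as identities of formal series. * $\mathcal Z_j^+,\mathcal Z_j^-,K^\pm_j,q^d$ have weights $\eta=(\alpha_j,-Q_j),\,(-\alpha_j,0),\,(0,-Q_j),\,0$, i.e. $g\,T=T\,g(\cdot+\eta)$,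 both for scalars $g\in\mathcal F$ and for functions acting through weights. $q^d\mathcal Z^\pm_{j,m}q^{-d}=q^m\mathcal Z^\pm_{j,m}$. The $K$'s and $q^d$ commute. $K_i^{\epsilon}\mathcal Z_j^{\epsilon'}(z)(K_i^{\epsilon})^{-1}=q^{\epsilon\epsilon'a_{ij}}\mathcal Z_j^{\epsilon'}(z)$ ($\epsilon,\epsilon'=\pm$). $\prod_i(K_i^\pm)^{a_i}$ commute with all $\mathcal Z_j^\pm(z)$, and $\prod_i(K_i^+)^{a_i}=q^{-l}$ (level $(1,l)$). * $z\,A_{ij}(\kappa^{-m_{ij}}\tfrac wz)\,\mathcal Z_i^\pm(z)\mathcal Z_j^\pm(w)=-w\,\kappa^{-m_{ij}}A_{ij}(\kappa^{m_{ij}}\tfrac zw)\,\mathcal Z_j^\pm(w)\mathcal Z_i^\pm(z)$, where $A_{ij}(x)=(q^{-a_{ij}}x;q^2)_\infty/(q^{2+a_{ij}}x;q^2)_\infty$. * $B_{ij}(\kappa^{-m_{ij}}\tfrac wz)\mathcal Z_i^+(z)\mathcal Z_j^-(w)-B_{ij}(\kappa^{m_{ij}}\tfrac zw)\mathcal Z_j^-(w)\mathcal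 Z_i^+(z)=\frac{\delta_{ij}}{q-q^{-1}}\bigl(\delta(q\tfrac wz)K_i^+-\delta(q^{-1}\tfrac wz)K_i^-\bigr)$, where $B_{ij}(x)=(q^{a_{ij}+1}x;q^2)_\infty/(q^{-a_{ij}+1}x;q^2)_\infty$. * If $a_{ij}=0$, the modes of $\mathcal Z_i^\pm$ commute with those of $\mathcal Z_j^\pm$ (equal signs). If $a_{ij}=-1$, $$\sum_{\sigma\in\mathfrak S_2}G\bigl(\tfrac{z_{\sigma(2)}}{z_{\sigma(1)}}\bigr)\sum_{r=0}^2(-1)^r{2\brack r}\prod_{s\le r}D\bigl(\tfrac{\kappa^{-m_{ij}}w}{z_{\sigma(s)}}\bigr)\prod_{s>r}D\bigl(\tfrac{\kappa^{m_{ij}}z_{\sigma(s)}}{w}\bigr)\mathcal Z_i^\pm(z_{\sigma(1)})\cdots\mathcal Z_i^\pm(z_{\sigma(r)})\mathcal Z_j^\pm(w)\mathcal Z_i^\pm(z_{\sigma(r+1)})\cdots\mathcal Z_i^\pm(z_{\sigma(2)})=0,$$ with ${2\brack0}={2\brack2}=1$, ${2\brack1}=q+q^{-1}$, $G(x)=\frac{(cq^{-2}x;q^2)_\infty}{(cq^2x;q^2)_\infty}$,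 $D(x)=\frac{(cqx;q^2)_\infty}{(cq^{-1}x;q^2)_\infty}$, and $c=1$ for $\mathcal Z^+$, $c=q^2$ for $\mathcal Z^-$. Submodules are $\mathcal F$-subspaces stable under all these operators, the inverses, and all entire functions acting through weights; equivalences are $\mathcal F$-linear isomorphisms commuting with all of them. **The modules.** Let $\mathbb C[\mathcal Q]$ be the twisted group algebra of $\mathcal Q=\bigoplus_i\mathbb Z\alpha_i$, with $e^{\alpha_i}e^{\pm\alpha_j}=(-1)^{a_{ij}}\kappa^{\mp m_{ij}}e^{\pm\alpha_j}e^{\alpha_i}$, and $\mathbb C[\mathcal R_Q]$ the group algebra of the free group on the symbols $Q_0,\dots,Q_N$. For $a\in I$ with $a_a=1$, $\mu\in\mathfrak h^*$ and $\varepsilon\in\{0,1\}$ put $\Lambda=\bar\Lambda_a+\varepsilon\Lambda_0$ and $$\mathcal W_\varepsilon(\Lambda_a,\mu)=\mathcal F\otimes_{\mathbb C}e^{\bar\Lambda_a}\mathbb C[\mathcal Q]\otimes e^{Q_\mu}\mathbb C[\mathcal R_Q],$$ where in the last factor $e^{\sum_ja_jQ_j}$ is set equal to the number $q^{l+\varepsilon}$.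 Here $1\otimes e^\beta e^{\bar\Lambda_a}\otimes e^{Q_\mu}e^{Q_\nu}$ has weight $(\Lambda+\beta,Q_{\mu+\nu})$, $h_j$ acts on it by $\langle\Lambda+\beta,h_j\rangle$, $q^d$ by $q^{-(\beta,\beta)/2-(\Lambda,\beta)}$, and $$\mathcal Z_j^+(z)=e^{\alpha_j}z^{h_j+1}\otimes e^{-Q_j},\qquad \mathcal Z_j^-(z)=e^{-\alpha_j}z^{-h_j+1},\qquad K_j^\pm=q^{\pm h_j}\otimes e^{-Q_j},$$ the coefficients in $\mathcal F$ being translated as the weights of the operators require. **Elliptic modules.** Modules of level $(1,l)$ over $U_{q,\kappa,p}(\mathfrak g_{tor})$ are defined in the same way, with currents $x_i^\pm(z)=\sum_n x^\pm_{i,n}z^{-n}$ of the same weights and degrees as $\mathcal Z_i^\pm(z)$, elements $K_i^\pm,q^d$ with the same relations (so again $\prod_i(K_i^+)^{a_i}=q^{-l}$), and weight-$0$ operators $\alpha_{i,m}$ ($m\neq0$) commuting with the $K_j^\pm$ and with $q^d\alpha_{i,m}q^{-d}=q^m\alpha_{i,m}$; $q^{c/2}$ acts by $q^{1/2}$; each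 vector is killed by $x^\pm_{i,n}$ for $n\gg0$ and by all products of $\alpha_{i,m}$ ($m>0$) of large total degree. With $[n]=\frac{q^n-q^{-n}}{q-q^{-1}}$ and $g_{ij}(z;s)=\exp\bigl(-\sum_{m>0}\frac{q^{a_{ij}m}-q^{-a_{ij}m}}{m(1-s^m)}(sz)^m\bigr)$ the remaining relations are $$[\alpha_{i,m},\alpha_{j,n}]=\delta_{m+n,0}\tfrac{[a_{ij}m]}m\tfrac{q^m-q^{-m}}{q-q^{-1}}\tfrac{1-p^m}{1-p^{*m}}\kappa^{-m\,m_{ij}}q^{-m},$$ $$[\alpha_{i,m},x_j^+(z)]=\tfrac{[a_{ij}m]}m\tfrac{1-p^m}{1-p^{*m}}q^{-m}\kappa^{-m\,m_{ij}}z^mx_j^+(z),\qquad[\alpha_{i,m},x_j^-(z)]=-\tfrac{[a_{ij}m]}m\kappa^{-m\,m_{ij}}z^mx_j^-(z),$$ $$(\kappa^{m_{ij}}z-q^{a_{ij}}w)\,g_{ij}(\kappa^{-m_{ij}}\tfrac wz;p^*)\,x_i^+(z)x_j^+(w)=(\kappa^{m_{ij}}q^{a_{ij}}z-w)\,g_{ij}(\kappa^{m_{ij}}\tfrac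 zw;p^*)\,x_j^+(w)x_i^+(z),$$ $$(\kappa^{m_{ij}}z-q^{-a_{ij}}w)\,g_{ij}(\kappa^{-m_{ij}}\tfrac wz;p)^{-1}x_i^-(z)x_j^-(w)=(\kappa^{m_{ij}}q^{-a_{ij}}z-w)\,g_{ij}(\kappa^{m_{ij}}\tfrac zw;p)^{-1}x_j^-(w)x_i^-(z),$$ $$[x_i^+(z),x_j^-(w)]=\tfrac{\delta_{ij}}{q-q^{-1}}\bigl(\delta(q\tfrac wz)\phi_i^+(w)-\delta(q^{-1}\tfrac wz)\phi_i^-(w)\bigr),$$ with $$\phi_i^+(w)=K_i^+\exp\Bigl(-(q-q^{-1})\sum_{n>0}\tfrac{p^n\alpha_{i,-n}}{1-p^n}w^n\Bigr)\exp\Bigl((q-q^{-1})\sum_{n>0}\tfrac{\alpha_{i,n}}{1-p^n}w^{-n}\Bigr),$$ $$\phi_i^-(w)=K_i^-\exp\Bigl(-(q-q^{-1})\sum_{n>0}\tfrac{\alpha_{i,-n}}{1-p^n}w^n\Bigr)\exp\Bigl((q-q^{-1})\sum_{n>0}\tfrac{p^n\alpha_{i,n}}{1-p^n}w^{-n}\Bigr)$$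 (these are the currents usually written $\phi_i^\pm(q^{\pm c/2}w)$), and Serre relations of the form displayed above, with $G(x),D(x)$ replaced by $g_{ii}(x;p^*),g_{ij}(x;p^*)$ for $x^+$ and by $g_{ii}(x;p)^{-1},g_{ij}(x;p)^{-1}$ for $x^-$ (commuting modes of equal sign if $a_{ij}=0$). Let $\mathrm{Ind}\,\mathcal W_\varepsilon(\Lambda_a,\mu)=\mathbb C[\alpha_{i,-m}\mid i\in I,m>0]\otimes\mathcal W_\varepsilon(\Lambda_a,\mu)$, where $\alpha_{i,-m}$ ($m>0$) acts by multiplication, $\alpha_{i,m}$ acts by $\sum_j\frac{[a_{ij}m][m]}m\frac{1-p^m}{1-p^{*m}}q^{-m}\kappa^{-m\,m_{ij}}\frac{\partial}{\partial\alpha_{j,-m}}$, $q^d$ multiplies $\alpha_{i,-m}$ by $q^{-m}$ and acts on $\mathcal W_\varepsilon$ as before, $K_j^\pm$ act on $\mathcal W_\varepsilon$, and, with $\alpha'_{i,m}=\frac{1-p^{*m}}{1-p^m}q^m\alpha_{i,m}$, $$x_i^+(z)=\exp\Bigl(\sum_{m>0}\tfrac{\alpha_{i,-m}}{[m]}z^m\Bigr)\exp\Bigl(-\sum_{m>0}\tfrac{\alpha_{i,m}}{[m]}z^{-m}\Bigr)e^{\alpha_i}e^{-Q_i}z^{h_i+1},$$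 $$x_i^-(z)=\exp\Bigl(-\sum_{m>0}\tfrac{\alpha'_{i,-m}}{[m]}z^m\Bigr)\exp\Bigl(\sum_{m>0}\tfrac{\alpha'_{i,m}}{[m]}z^{-m}\Bigr)e^{-\alpha_i}z^{-h_i+1}.$$ **Theorem.** Let $\varepsilon\in\{0,1\}$, $\mu,\mu'\in\mathfrak h^*$, and let $a,b\in I$ have label $1$ (i.e. $\Lambda_a,\Lambda_b$ have level one). 1. $\mathcal W_\varepsilon(\Lambda_a,\mu)$ is an irreducible $\mathcal Z_{1,l}$-module. 2. If $\mathcal W_\varepsilon(\Lambda_a,\mu)$ and $\mathcal W_\varepsilon(\Lambda_b,\mu')$ are equivalent, then $a=b$. 3. $\mathrm{Ind}\,\mathcal W_\varepsilon(\Lambda_a,\mu)$ is an irreducible $U_{q,\kappa,p}(\mathfrak g_{tor})$-module of level $(1,l)$. The vector $v=1\otimes e^{\bar\Lambda_a}\otimes e^{Q_\mu}$ is nonzero, generates it, satisfies $f(h,P)v=f(\langle\Lambda,h\rangle,\langle Q_\mu,P\rangle)v$, and is killed by $\alpha_{i,n},x^\pm_{i,n}$ ($n>0$, $i\in I$) and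 by $x^+_{i,0}$ ($i\ne0$). 4. If $\varepsilon=1$ (so $\Lambda=\Lambda_a$), or if $a=0$, then moreover $x_{0,0}^+v=0$, so that $v$ is a highest weight vector, of weight $(\Lambda+\mu,\mu)$, i.e. $(\Lambda_a+\mu,\mu)$ for $\varepsilon=1$: it is killed by all $\alpha_{i,n}$ ($n>0$), $x^+_{i,n}$ ($n\ge0$), $x^-_{i,n}$ ($n>0$). 5. If $\varepsilon=0$, then on $\mathcal W_\varepsilon(\Lambda_a,\mu)$ and on $\mathrm{Ind}\,\mathcal W_\varepsilon(\Lambda_a,\mu)$ the operator $q^d$ is diagonalizable with eigenvalues $q^\omega$, and for each $\omega\in\mathbb C$ the eigenvalues $q^{\omega+n}$ do not occur for $n\gg0$. -/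

import Mathlib

/-! Elliptic quantum toroidal algebras of simply laced affine type at level `(1, l)`, their
`Z`-algebras, and the lattice modules. -/

noncomputable section

namespace EllToroidal

/-! ### Simply laced untwisted affine types -/

/-- The affine types `A_{n+2}^{(1)}`, `D_{n+4}^{(1)}`, `E_6^{(1)}`, `E_7^{(1)}`, `E_8^{(1)}`. -/
inductive AffineType
  | A (n : ℕ)
  | D (n : ℕ)
  | E6
  | E7
  | E8

/-- The rank `N` of the underlying finite dimensional simple Lie algebra. -/
def AffineType.rank : AffineType → ℕ
  | .A n => n + 2
  | .D n => n + 4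
  | .E6 => 6
  | .E7 => 7
  | .E8 => 8

/-- The index set `I = {0, 1, …, N}`; `0` is the affine node. -/
abbrev Node (X : AffineType) : Type := Fin (X.rank + 1)

/-- The edges of the affine Dynkin diagram, each listed in one orientation. Type `A` is the oriented
cycle `0 → 1 → ⋯ → N → 0`; type `D` has the edges `0 – 2`, `1 – 2`, `2 – 3`, …, `(N-2) – (N-1)`,
`(N-2) – N`; in type `E_6` the three legs are `0 – 3 – 6`, `1 – 4 – 6`, `2 – 5 – 6`; in type `E_7` the
long chain is `0 – 2 – 3 – 4 – 5 – 6 – 1` with `7` attached to `4`; in type `E_8` the chain is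
`0 – 1 – ⋯ – 7` with `8` attached to `5`. -/
def AffineType.edge : AffineType → ℕ → ℕ → Prop
  | .A n, i, j => j = (i + 1) % (n + 3)
  | .D n, i, j => (i = 0 ∧ j = 2) ∨ (1 ≤ i ∧ j = i + 1 ∧ j ≤ n + 3) ∨ (i = n + 2 ∧ j = n + 4)
  | .E6, i, j => (i < 3 ∧ j = i + 3) ∨ (3 ≤ i ∧ i < 6 ∧ j = 6)
  | .E7, i, j => (i = 0 ∧ j = 2) ∨ (2 ≤ i ∧ j = i + 1 ∧ j ≤ 6) ∨ (i = 6 ∧ j = 1) ∨ (i = 4 ∧ j = 7)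
  | .E8, i, j => (j = i + 1 ∧ j ≤ 7) ∨ (i = 5 ∧ j = 8)

/-- The (co-)labels of the affine Dynkin diagram. -/
def AffineType.label : AffineType → ℕ → ℕ
  | .A _, _ => 1
  | .D n, i => if i = 0 ∨ i = 1 ∨ i = n + 3 ∨ i = n + 4 then 1 else 2
  | .E6, i => if i < 3 then 1 else if i < 6 then 2 else 3
  | .E7, i => [1, 1, 2, 3, 4, 3, 2, 2].getD i 0
  | .E8, i => [1, 2, 3, 4, 5, 6, 4, 2, 3].getD i 0

variable (X : AffineType)

instance (X : AffineType) (i j : ℕ) : Decidable (X.edge i j) :=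
  match X with
  | .A n => inferInstanceAs (Decidable (j = (i + 1) % (n + 3)))
  | .D n => inferInstanceAs (Decidable ((i = 0 ∧ j = 2) ∨ (1 ≤ i ∧ j = i + 1 ∧ j ≤ n + 3) ∨
      (i = n + 2 ∧ j = n + 4)))
  | .E6 => inferInstanceAs (Decidable ((i < 3 ∧ j = i + 3) ∨ (3 ≤ i ∧ i < 6 ∧ j = 6)))
  | .E7 => inferInstanceAs (Decidable ((i = 0 ∧ j = 2) ∨ (2 ≤ i ∧ j = i + 1 ∧ j ≤ 6) ∨
      (i = 6 ∧ j = 1) ∨ (i = 4 ∧ j = 7)))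
  | .E8 => inferInstanceAs (Decidable ((j = i + 1 ∧ j ≤ 7) ∨ (i = 5 ∧ j = 8)))

/-- The generalized Cartan matrix `a_{ij}`, which is its own symmetrization. -/
def cartan (i j : Node X) : ℤ :=
  if i = j then 2 else if X.edge i j ∨ X.edge j i then -1 else 0

/-- The labels `a_i` as a vector; `δ = ∑ a_i α_i`. -/
def label (i : Node X) : ℕ := X.label i

/-- The matrix `m_{ij} = δ_{i,j+1} - δ_{i+1,j}` (indices modulo `N + 1`) in type `A`, and `0` otherwise. -/
def mMat : (X : AffineType) → Node X → Node X → ℤ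
  | .A n, i, j =>
      (if (i : ℕ) = ((j : ℕ) + 1) % (n + 3) then 1 else 0)
        - (if (j : ℕ) = ((i : ℕ) + 1) % (n + 3) then 1 else 0)
  | _, _, _ => 0

/-! ### Weights and meromorphic functions -/

/-- `𝔥*`, a weight `λ` being recorded by the numbers `⟨λ, h_i⟩` (`i ∈ I`) and `⟨λ, d⟩`. -/
abbrev hStar : Type := (Node X → ℂ) × ℂ

/-- `H* = 𝔥* ⊕ H_P*`; an element of `H_P*` is recorded by its values on `P_j` (`j ∈ I`). -/
abbrev HStar : Type := hStar X × (Node X → ℂ)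

/-- The simple root `α_j`: `⟨α_j, h_i⟩ = a_{ij}` and `⟨α_j, d⟩ = δ_{j,0}`. -/
def simpleRoot (j : Node X) : hStar X := (fun i => (cartan X i j : ℂ), if j = 0 then 1 else 0)

/-- `Q_μ ∈ H_P*`: the linear map with `⟨Q_{α_i}, P_j⟩ = a_{ij}`, that is `⟨Q_μ, P_j⟩ = ⟨μ, h_j⟩`. -/
def Qof (μ : hStar X) : Node X → ℂ := μ.1

/-- The algebra of entire functions on a complex normed space. -/
def Entire (E : Type) [NormedAddCommGroup E] [NormedSpace ℂ E] : Subalgebra ℂ (E → ℂ) where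
  carrier := {f | ∀ x, AnalyticAt ℂ f x}
  mul_mem' := fun hf hg x => (hf x).mul (hg x)
  add_mem' := fun hf hg x => (hf x).add (hg x)
  algebraMap_mem' := fun _ _ => analyticAt_const

instance (E : Type) [NormedAddCommGroup E] [NormedSpace ℂ E] : IsDomain (Entire E) := by
  have : NoZeroDivisors (Entire E) := by
    refine ⟨fun {f g} h => ?_⟩
    by_contra hne
    push Not at hne
    obtain ⟨hf, hg⟩ := hne
    have hf' : ∃ x, f.1 x ≠ 0 := by
      by_contra hc
      push Not at hc
      exact hf (Subtype.ext (funext hc))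
    obtain ⟨x, hx⟩ := hf'
    have hgx : g.1 =ᶠ[nhds x] 0 := by
      filter_upwards [(f.2 x).continuousAt.eventually_ne hx] with y hy
      have hfg : f.1 y * g.1 y = 0 := congrFun (congrArg Subtype.val h) y
      exact (mul_eq_zero.mp hfg).resolve_left hy
    have hz : g.1 = 0 :=
      AnalyticOnNhd.eq_of_eventuallyEq (𝕜 := ℂ) (fun y _ => g.2 y) (fun _ _ => analyticAt_const) hgx
    exact hg (Subtype.ext hz)
  exact NoZeroDivisors.to_isDomain _

/-- The field of meromorphic functions on `H*`, a finite dimensional complex vector space: every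
meromorphic function there is a quotient of two entire functions. -/
abbrev Mero : Type := FractionRing (Entire (HStar X))

/-- Translation of entire functions, `(T_η f)(ξ) = f (ξ + η)`. -/
def translate {E : Type} [NormedAddCommGroup E] [NormedSpace ℂ E] (η : E) :
    Entire E ≃ₐ[ℂ] Entire E where
  toFun f := ⟨fun x => f.1 (x + η), fun x =>
    AnalyticAt.fun_comp (f := fun y : E => y + η) (f.2 (x + η)) (analyticAt_id.add analyticAt_const)⟩
  invFun f := ⟨fun x => f.1 (x - η), fun x =>
    AnalyticAt.fun_comp (f := fun y : E => y - η) (f.2 (x - η)) (analyticAt_id.sub analyticAt_const)⟩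
  left_inv f := by ext x; simp
  right_inv f := by ext x; simp
  map_mul' f g := rfl
  map_add' f g := rfl
  commutes' c := rfl

variable {X} in
/-- Translation of meromorphic functions, `(T_η f)(ξ) = f (ξ + η)`. -/
def shift (η : HStar X) : Mero X ≃ₐ[ℂ] Mero X :=
  IsFractionRing.algEquivOfAlgEquiv (translate η)

/-! ### Generating series -/

/-- The coefficient of `z^n` in `exp (∑_{m ≥ 1} a_m z^m)`. -/
def expCoeff {R : Type*} [Ring R] [Algebra ℂ R] (a : ℕ → R) (n : ℕ) : R :=
  ∑ k ∈ Finset.range (n + 1),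
    ((k.factorial : ℂ)⁻¹) • PowerSeries.coeff n ((PowerSeries.mk fun m => if m = 0 then 0 else a m) ^ k)

/-- The series `(a x; t)_∞ = ∏_{n ≥ 0} (1 - a t^n x)` in the variable `x`, for `|t| < 1`. -/
def qPoch (t a : ℂ) : PowerSeries ℂ :=
  PowerSeries.mk fun n => a ^ n * ∏ k ∈ Finset.range n, (-(t ^ k) / (1 - t ^ (k + 1)))

/-- `(a x; t)_∞ = (1 - a x) (a t x; t)_∞`; with constant term `1` this determines the series. -/
theorem qPoch_eq (t a : ℂ) (ht : ‖t‖ < 1) :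
    qPoch t a = (1 - PowerSeries.C a * PowerSeries.X) * qPoch t (a * t) := by
  ext n
  rw [sub_mul, one_mul, map_sub]
  cases n with
  | zero => simp [qPoch]
  | succ n =>
    rw [mul_assoc, PowerSeries.coeff_C_mul, PowerSeries.coeff_succ_X_mul]
    have h1 : 1 - t ^ (n + 1) ≠ 0 := by
      intro h
      have h2 : ‖t ^ (n + 1)‖ < 1 := by
        rw [norm_pow]; exact pow_lt_one₀ (norm_nonneg _) ht (by omega)
      rw [← sub_eq_zero.mp h] at h2
      simp at h2
    simp only [qPoch, PowerSeries.coeff_mk, Finset.prod_range_succ]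
    field_simp
    ring

/-- `g(z; s) = exp (- ∑_{m>0} (q^{bm} - q^{-bm}) (s z)^m / (m (1 - s^m)))`. -/
def gSeries (q s : ℂ) (b : ℤ) : PowerSeries ℂ :=
  PowerSeries.mk (expCoeff fun m : ℕ =>
    -((q ^ (b * m) - q ^ (-(b * m))) / (m * (1 - s ^ m)) * s ^ m))

/-- The `q`-integer `[n]`. -/
def qInt (q : ℂ) (n : ℤ) : ℂ := (q ^ n - q ^ (-n)) / (q - q⁻¹)

section Modes

variable {V : Type*} [AddCommGroup V] [Module ℂ V]

/-- For currents `A(z) = ∑ A_n z^{-n}`, `B(w) = ∑ B_n w^{-n}` and a power series `c`, the coefficient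
of `z^{-r} w^{-t}` in `c(w/z) A(z) B(w)`, applied to `v`. -/
def ord2 (c : PowerSeries ℂ) (A B : ℤ → Module.End ℂ V) (r t : ℤ) (v : V) : V :=
  ∑ᶠ s : ℕ, PowerSeries.coeff s c • A (r - s) (B (t + s) v)

/-- The coefficient of `z₁^{-r₁} z₂^{-r₂} z₃^{-r₃}` in
`c₁₂(z₂/z₁) c₁₃(z₃/z₁) c₂₃(z₃/z₂) A(z₁) B(z₂) C(z₃)`, applied to `v`. -/
def ord3 (c₁₂ c₁₃ c₂₃ : PowerSeries ℂ) (A B C : ℤ → Module.End ℂ V) (r₁ r₂ r₃ : ℤ) (v : V) : V :=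
  ∑ᶠ s : ℕ × ℕ × ℕ,
    (PowerSeries.coeff s.1 c₁₂ * PowerSeries.coeff s.2.1 c₁₃ * PowerSeries.coeff s.2.2 c₂₃) •
      A (r₁ - s.1 - s.2.1) (B (r₂ + s.1 - s.2.2) (C (r₃ + s.2.1 + s.2.2) v))

/-- The coefficient of `z₁^{-r₁} z₂^{-r₂} w^{-t}` in
`G(z₂/z₁) ∑_{r=0}^{2} (-1)^r [2 choose r] ∏_{s ≤ r} D(u⁻¹ w/z_s) ∏_{s > r} D(u z_s/w)
  A(z₁) ⋯ A(z_r) B(w) A(z_{r+1}) ⋯ A(z₂)`, applied to `v`; here `u = κ^{m_{ij}}`. -/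
def serreTerm (q u : ℂ) (G D : PowerSeries ℂ) (A B : ℤ → Module.End ℂ V) (r₁ r₂ t : ℤ) (v : V) : V :=
  ord3 (PowerSeries.rescale u D) (PowerSeries.rescale u D) G B A A t r₁ r₂ v
    - (q + q⁻¹) • ord3 (PowerSeries.rescale u⁻¹ D) G (PowerSeries.rescale u D) A B A r₁ t r₂ v
    + ord3 G (PowerSeries.rescale u⁻¹ D) (PowerSeries.rescale u⁻¹ D) A A B r₁ r₂ t v

/-- The Serre relation for `a_{ij} = -1`: the sum over the permutations of `(z₁, z₂)` vanishes. -/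
def SerreRelation (q u : ℂ) (G D : PowerSeries ℂ) (A B : ℤ → Module.End ℂ V) : Prop :=
  ∀ (r₁ r₂ t : ℤ) (v : V),
    serreTerm q u G D A B r₁ r₂ t v + serreTerm q u G D A B r₂ r₁ t v = 0

open Classical in
/-- The sum `v ↦ ∑ₙ Tₙ v` of a locally finite sequence of operators (each `v` is killed by all but
finitely many); `0` if the sequence is not locally finite. -/
def locSum (T : ℕ → Module.End ℂ V) : Module.End ℂ V :=
  if h : ∀ v, {n | T n v ≠ 0}.Finite then
    { toFun := fun v => ∑ᶠ n, T n v
      map_add' := fun v w => by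
        simp only [map_add]
        exact finsum_add_distrib (h v) (h w)
      map_smul' := fun c v => by
        simp only [map_smul, RingHom.id_apply]
        exact (smul_finsum c _).symm }
  else 0

/-- The coefficient of `z^{-s}` in `exp (∑_{m>0} a_m z^m) exp (∑_{m>0} b_m z^{-m})`. -/
def vertexMode (a b : ℕ → Module.End ℂ V) (s : ℤ) : Module.End ℂ V :=
  locSum fun n => expCoeff a n * (if 0 ≤ (n : ℤ) + s then expCoeff b ((n : ℤ) + s).toNat else 0)

end Modes

/-! ### Dynamical modules -/

section Modules

variable (V : Type*) [AddCommGroup V] [Module (Mero X) V] [Module ℂ V]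

/-- The operators by which currents `x^±_i(z) = ∑ x^±_{i,n} z^{-n}` (or the currents `Z^±_i(z)`), the
elements `K^±_i`, `q^d`, and the functions `g(h, P)` act on a vector space over the field of
meromorphic functions. The operator `ev g` is the action of an entire function through its values on
weights. -/
structure Currents where
  xp : Node X → ℤ → Module.End ℂ V
  xm : Node X → ℤ → Module.End ℂ V
  Kp : Node X → Module.End ℂ V
  Km : Node X → Module.End ℂ V
  qd : Module.End ℂ V
  ev : Entire (HStar X) →ₐ[ℂ] Module.End ℂ V

/-- The operators of a module over the elliptic quantum toroidal algebra: in addition the `α_{i,m}`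
(`m ≠ 0`) and `q^{c/2}`. -/
structure UCurrents extends Currents X V where
  al : Node X → ℤ → Module.End ℂ V
  qc : Module.End ℂ V

variable {X V}

/-- A vector of weight `ξ ∈ H*`: functions `g(h, P)` act on it by the number `g(ξ)`. -/
def Currents.IsWeight (D : Currents X V) (ξ : HStar X) (v : V) : Prop :=
  ∀ f : Entire (HStar X), D.ev f v = f.1 ξ • v

/-- The operator `T` has weight `η`, that is `g T = T (T_η g)`, both for the scalars `g` and
for the functions acting through weights. -/
def Currents.HasWeight (D : Currents X V) (η : HStar X) (T : Module.End ℂ V) : Prop :=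
  (∀ (g : Mero X) (v : V), g • T v = T (shift η g • v)) ∧
    ∀ g : Entire (HStar X), D.ev g * T = T * D.ev (translate η g)

/-- `∏_i K_i^{a_i}` (in the order of `I`). -/
def centralProd (K : Node X → Module.End ℂ V) : Module.End ℂ V :=
  (List.ofFn fun i => K i ^ label X i).prod

/-- The part of the relations common to modules over the elliptic quantum toroidal algebra and over its
`Z`-algebra: `H`-diagonalizability, the commutation relations with functions, with `q^d` and with
`K^±_i`, the level `(·, l)`, and the truncation which makes products of currents well defined. -/
structure Currents.IsDynamical (D : Currents X V) (q l : ℂ) : Prop where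
  diag : Submodule.span ℂ {v | ∃ ξ, D.IsWeight ξ v} = ⊤
  ev_weight : ∀ f, D.HasWeight 0 (D.ev f)
  xp_weight : ∀ j m, D.HasWeight (simpleRoot X j, -Qof X (simpleRoot X j)) (D.xp j m)
  xm_weight : ∀ j m, D.HasWeight (-simpleRoot X j, 0) (D.xm j m)
  Kp_weight : ∀ j, D.HasWeight (0, -Qof X (simpleRoot X j)) (D.Kp j)
  Km_weight : ∀ j, D.HasWeight (0, -Qof X (simpleRoot X j)) (D.Km j)
  qd_weight : D.HasWeight 0 D.qd
  Kp_bij : ∀ j, Function.Bijective (D.Kp j)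
  Km_bij : ∀ j, Function.Bijective (D.Km j)
  qd_bij : Function.Bijective D.qd
  qd_xp : ∀ j m, D.qd * D.xp j m = q ^ m • (D.xp j m * D.qd)
  qd_xm : ∀ j m, D.qd * D.xm j m = q ^ m • (D.xm j m * D.qd)
  qd_Kp : ∀ j, Commute D.qd (D.Kp j)
  qd_Km : ∀ j, Commute D.qd (D.Km j)
  Kp_Kp : ∀ i j, Commute (D.Kp i) (D.Kp j)
  Kp_Km : ∀ i j, Commute (D.Kp i) (D.Km j)
  Km_Km : ∀ i j, Commute (D.Km i) (D.Km j)
  Kp_xp : ∀ i j m, D.Kp i * D.xp j m = q ^ cartan X i j • (D.xp j m * D.Kp i)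
  Km_xp : ∀ i j m, D.Km i * D.xp j m = q ^ (-cartan X i j) • (D.xp j m * D.Km i)
  Kp_xm : ∀ i j m, D.Kp i * D.xm j m = q ^ (-cartan X i j) • (D.xm j m * D.Kp i)
  Km_xm : ∀ i j m, D.Km i * D.xm j m = q ^ cartan X i j • (D.xm j m * D.Km i)
  central_p : ∀ j m, Commute (centralProd D.Kp) (D.xp j m) ∧ Commute (centralProd D.Kp) (D.xm j m)
  central_m : ∀ j m, Commute (centralProd D.Km) (D.xp j m) ∧ Commute (centralProd D.Km) (D.xm j m)
  level : centralProd D.Kp = q ^ (-l) • 1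
  trunc : ∀ j v, ∃ M : ℤ, ∀ m ≥ M, D.xp j m v = 0 ∧ D.xm j m v = 0

/-- The prefactor `(q^{-b} x; q²)_∞ / (q² q^b x; q²)_∞` of the relations between currents
`Z^±` of equal sign (`k = 1`). -/
def zFactor (q : ℂ) (b : ℤ) : PowerSeries ℂ :=
  qPoch (q ^ 2) (q ^ (-b)) * (qPoch (q ^ 2) (q ^ 2 * q ^ b))⁻¹

/-- The prefactor `(q^b q x; q²)_∞ / (q^{-b} q x; q²)_∞` of the relation between `Z^+` and `Z^-`
(`k = 1`). -/
def zMixedFactor (q : ℂ) (b : ℤ) : PowerSeries ℂ :=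
  qPoch (q ^ 2) (q ^ b * q) * (qPoch (q ^ 2) (q ^ (-b) * q))⁻¹

/-- The series `(c q^{-b} x; q²)_∞ / (c q^b x; q²)_∞` of the Serre relations of the currents `Z^±`
(`k = 1`; `c = 1` for `Z^+` and `c = q²` for `Z^-`). -/
def zSerreFactor (q c : ℂ) (b : ℤ) : PowerSeries ℂ :=
  qPoch (q ^ 2) (q ^ (-b) * c) * (qPoch (q ^ 2) (q ^ b * c))⁻¹

/-- The operators `D` (with `D.xp`, `D.xm` in the role of the modes of `Z^±_i(z)`) form a module of
level `(1, l)` over the universal dynamical quantum `Z`-algebra at `k = 1`. Relations between formal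
series are stated coefficient by coefficient. -/
structure Currents.IsZModule (D : Currents X V) (q κ l : ℂ) : Prop extends D.IsDynamical q l where
  zz_p : ∀ i j r t v,
    ord2 (PowerSeries.rescale (κ ^ (-mMat X i j)) (zFactor q (cartan X i j)))
        (D.xp i) (D.xp j) (r + 1) t v =
      -κ ^ (-mMat X i j) • ord2 (PowerSeries.rescale (κ ^ mMat X i j) (zFactor q (cartan X i j)))
        (D.xp j) (D.xp i) (t + 1) r v
  zz_m : ∀ i j r t v,
    ord2 (PowerSeries.rescale (κ ^ (-mMat X i j)) (zFactor q (cartan X i j)))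
        (D.xm i) (D.xm j) (r + 1) t v =
      -κ ^ (-mMat X i j) • ord2 (PowerSeries.rescale (κ ^ mMat X i j) (zFactor q (cartan X i j)))
        (D.xm j) (D.xm i) (t + 1) r v
  zz_pm : ∀ i j r t v,
    ord2 (PowerSeries.rescale (κ ^ (-mMat X i j)) (zMixedFactor q (cartan X i j)))
        (D.xp i) (D.xm j) r t v -
      ord2 (PowerSeries.rescale (κ ^ mMat X i j) (zMixedFactor q (cartan X i j)))
        (D.xm j) (D.xp i) t r v =
      if i = j ∧ r + t = 0 then (q - q⁻¹)⁻¹ • (q ^ r • D.Kp i v - q ^ (-r) • D.Km i v) else 0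
  serre_p : ∀ i j, cartan X i j = -1 →
    SerreRelation q (κ ^ mMat X i j) (zSerreFactor q 1 2) (zSerreFactor q 1 (-1)) (D.xp i) (D.xp j)
  serre_m : ∀ i j, cartan X i j = -1 →
    SerreRelation q (κ ^ mMat X i j) (zSerreFactor q (q ^ 2) 2) (zSerreFactor q (q ^ 2) (-1))
      (D.xm i) (D.xm j)
  serre_p_zero : ∀ i j, cartan X i j = 0 → ∀ r t, Commute (D.xp i r) (D.xp j t)
  serre_m_zero : ∀ i j, cartan X i j = 0 → ∀ r t, Commute (D.xm i r) (D.xm j t)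

/-- The coefficient of `w^{-s}` in
`φ^+_i(q^{c/2} w) = K^+_i exp(-(q - q⁻¹) ∑ p^n α_{i,-n} w^n/(1-p^n)) exp((q - q⁻¹) ∑ α_{i,n} w^{-n}/(1-p^n))`. -/
def UCurrents.phiP (D : UCurrents X V) (q p : ℂ) (i : Node X) (s : ℤ) : Module.End ℂ V :=
  D.Kp i * vertexMode (fun n => (-(q - q⁻¹) * p ^ n / (1 - p ^ n)) • D.al i (-n))
    (fun n => ((q - q⁻¹) / (1 - p ^ n)) • D.al i n) s

/-- The coefficient of `w^{-s}` in
`φ^-_i(q^{-c/2} w) = K^-_i exp(-(q - q⁻¹) ∑ α_{i,-n} w^n/(1-p^n)) exp((q - q⁻¹) ∑ p^n α_{i,n} w^{-n}/(1-p^n))`. -/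
def UCurrents.phiM (D : UCurrents X V) (q p : ℂ) (i : Node X) (s : ℤ) : Module.End ℂ V :=
  D.Km i * vertexMode (fun n => (-(q - q⁻¹) / (1 - p ^ n)) • D.al i (-n))
    (fun n => ((q - q⁻¹) * p ^ n / (1 - p ^ n)) • D.al i n) s

/-- The operators `D` form a module of level `(1, l)` over the elliptic quantum toroidal algebra. Here
`q^{c/2}` acts as `q^{1/2}`, so that `q^c` is written as `q`, and `p^* = p q^{-2c}` as `p q^{-2}`. -/
structure UCurrents.IsUModule (D : UCurrents X V) (q κ p l : ℂ) : Prop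
    extends D.toCurrents.IsDynamical q l where
  qc_level : D.qc = q ^ (1 / 2 : ℂ) • 1
  al_weight : ∀ i m, D.HasWeight 0 (D.al i m)
  qd_al : ∀ i m, D.qd * D.al i m = q ^ m • (D.al i m * D.qd)
  Kp_al : ∀ i j m, Commute (D.Kp i) (D.al j m)
  Km_al : ∀ i j m, Commute (D.Km i) (D.al j m)
  /-- every vector is killed by all products of `α_{i,m}`, `m > 0`, of large total degree -/
  trunc_al : ∀ v, ∃ M : ℤ, ∀ L : List (Node X × ℤ), (∀ x ∈ L, 0 < x.2) → M ≤ (L.map Prod.snd).sum →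
    (L.map fun x => D.al x.1 x.2).prod v = 0
  al_al : ∀ (i j : Node X) (m n : ℤ), m ≠ 0 → n ≠ 0 →
    D.al i m * D.al j n - D.al j n * D.al i m =
      if m + n = 0 then
        (qInt q (cartan X i j * m) / m * ((q ^ m - q ^ (-m)) / (q - q⁻¹))
          * ((1 - p ^ m) / (1 - (p * q ^ (-2 : ℤ)) ^ m)) * κ ^ (-m * mMat X i j) * q ^ (-m)) • 1
      else 0
  al_xp : ∀ (i j : Node X) (m n : ℤ), m ≠ 0 →
    D.al i m * D.xp j n - D.xp j n * D.al i m =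
      (qInt q (cartan X i j * m) / m * ((1 - p ^ m) / (1 - (p * q ^ (-2 : ℤ)) ^ m))
        * q ^ (-m) * κ ^ (-m * mMat X i j)) • D.xp j (m + n)
  al_xm : ∀ (i j : Node X) (m n : ℤ), m ≠ 0 →
    D.al i m * D.xm j n - D.xm j n * D.al i m =
      -(qInt q (cartan X i j * m) / m * κ ^ (-m * mMat X i j)) • D.xm j (m + n)
  xp_xp : ∀ i j r t v,
    κ ^ mMat X i j • ord2 (PowerSeries.rescale (κ ^ (-mMat X i j))
          (gSeries q (p * q ^ (-2 : ℤ)) (cartan X i j))) (D.xp i) (D.xp j) (r + 1) t v -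
      q ^ cartan X i j • ord2 (PowerSeries.rescale (κ ^ (-mMat X i j))
          (gSeries q (p * q ^ (-2 : ℤ)) (cartan X i j))) (D.xp i) (D.xp j) r (t + 1) v =
    (κ ^ mMat X i j * q ^ cartan X i j) • ord2 (PowerSeries.rescale (κ ^ mMat X i j)
          (gSeries q (p * q ^ (-2 : ℤ)) (cartan X i j))) (D.xp j) (D.xp i) t (r + 1) v -
      ord2 (PowerSeries.rescale (κ ^ mMat X i j)
          (gSeries q (p * q ^ (-2 : ℤ)) (cartan X i j))) (D.xp j) (D.xp i) (t + 1) r v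
  xm_xm : ∀ i j r t v,
    κ ^ mMat X i j • ord2 (PowerSeries.rescale (κ ^ (-mMat X i j))
          (gSeries q p (cartan X i j))⁻¹) (D.xm i) (D.xm j) (r + 1) t v -
      q ^ (-cartan X i j) • ord2 (PowerSeries.rescale (κ ^ (-mMat X i j))
          (gSeries q p (cartan X i j))⁻¹) (D.xm i) (D.xm j) r (t + 1) v =
    (κ ^ mMat X i j * q ^ (-cartan X i j)) • ord2 (PowerSeries.rescale (κ ^ mMat X i j)
          (gSeries q p (cartan X i j))⁻¹) (D.xm j) (D.xm i) t (r + 1) v -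
      ord2 (PowerSeries.rescale (κ ^ mMat X i j)
          (gSeries q p (cartan X i j))⁻¹) (D.xm j) (D.xm i) (t + 1) r v
  xp_xm : ∀ (i j : Node X) (r t : ℤ),
    D.xp i r * D.xm j t - D.xm j t * D.xp i r =
      if i = j then
        (q - q⁻¹)⁻¹ • (q ^ r • D.phiP q p i (r + t) - q ^ (-r) • D.phiM q p i (r + t))
      else 0
  serre_p : ∀ i j, cartan X i j = -1 →
    SerreRelation q (κ ^ mMat X i j) (gSeries q (p * q ^ (-2 : ℤ)) 2)
      (gSeries q (p * q ^ (-2 : ℤ)) (-1)) (D.xp i) (D.xp j)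
  serre_m : ∀ i j, cartan X i j = -1 →
    SerreRelation q (κ ^ mMat X i j) (gSeries q p 2)⁻¹ (gSeries q p (-1))⁻¹ (D.xm i) (D.xm j)
  serre_p_zero : ∀ i j, cartan X i j = 0 → ∀ r t, Commute (D.xp i r) (D.xp j t)
  serre_m_zero : ∀ i j, cartan X i j = 0 → ∀ r t, Commute (D.xm i r) (D.xm j t)

/-- The grading conditions of the categories of modules: `q^d` is diagonalizable with eigenvalues
`q^ω`, and for every `ω` the eigenvalues `q^{ω+n}` do not occur for large `n`. -/
def Currents.IsTruncatedGraded (D : Currents X V) (q : ℂ) : Prop :=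
  Submodule.span ℂ {v | ∃ ω : ℂ, D.qd v = q ^ ω • v} = ⊤ ∧
    ∀ ω : ℂ, ∃ n₀ : ℕ, ∀ n > n₀, ∀ v, D.qd v = q ^ (ω + n) • v → v = 0

/-- A subspace stable under the currents, `K^±_i`, `q^d`, their inverses, and all functions. -/
structure Currents.Stable (D : Currents X V) (U : Submodule (Mero X) V) : Prop where
  xp : ∀ i m, ∀ v ∈ U, D.xp i m v ∈ U
  xm : ∀ i m, ∀ v ∈ U, D.xm i m v ∈ U
  Kp : ∀ i v, D.Kp i v ∈ U ↔ v ∈ U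
  Km : ∀ i v, D.Km i v ∈ U ↔ v ∈ U
  qd : ∀ v, D.qd v ∈ U ↔ v ∈ U
  ev : ∀ f, ∀ v ∈ U, D.ev f v ∈ U

/-- Submodules for the elliptic quantum toroidal algebra. -/
structure UCurrents.Stable (D : UCurrents X V) (U : Submodule (Mero X) V) : Prop
    extends D.toCurrents.Stable U where
  al : ∀ i m, m ≠ 0 → ∀ v ∈ U, D.al i m v ∈ U
  qc : ∀ v, D.qc v ∈ U ↔ v ∈ U

/-- Irreducibility as a `Z`-algebra module. -/
def Currents.Irreducible (D : Currents X V) : Prop :=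
  Nontrivial V ∧ ∀ U : Submodule (Mero X) V, D.Stable U → U = ⊥ ∨ U = ⊤

/-- Irreducibility as a module over the elliptic quantum toroidal algebra. -/
def UCurrents.Irreducible (D : UCurrents X V) : Prop :=
  Nontrivial V ∧ ∀ U : Submodule (Mero X) V, D.Stable U → U = ⊥ ∨ U = ⊤

/-- Equivalence of `Z`-algebra modules: a linear isomorphism intertwining all operators. -/
def Currents.Equivalent {V' : Type*} [AddCommGroup V'] [Module (Mero X) V'] [Module ℂ V']
    (D : Currents X V) (D' : Currents X V') : Prop :=
  ∃ φ : V ≃ₗ[Mero X] V', ∀ v,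
    (∀ i m, φ (D.xp i m v) = D'.xp i m (φ v)) ∧ (∀ i m, φ (D.xm i m v) = D'.xm i m (φ v)) ∧
    (∀ i, φ (D.Kp i v) = D'.Kp i (φ v)) ∧ (∀ i, φ (D.Km i v) = D'.Km i (φ v)) ∧
    φ (D.qd v) = D'.qd (φ v) ∧ ∀ f, φ (D.ev f v) = D'.ev f (φ v)

/-- `v` generates the module, has the weight `(λ, μ)`, that is, functions act on it by
`f(h, P) v = f(⟨λ - μ, h⟩, ⟨Q_μ, P⟩) v`, and is killed by `α_{i,n}` and `x^±_{i,n}` for `n > 0`, `i ∈ I`,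
and by `x^+_{i,0}` for `i ≠ 0`. -/
structure UCurrents.IsHorizontalHighestWeightVector (D : UCurrents X V) (lam mu : hStar X) (v : V) :
    Prop where
  ne_zero : v ≠ 0
  cyclic : ∀ U : Submodule (Mero X) V, D.Stable U → v ∈ U → U = ⊤
  weight : D.IsWeight (lam - mu, Qof X mu) v
  al_pos : ∀ i n, 0 < n → D.al i n v = 0
  xp_pos : ∀ i n, 0 < n → D.xp i n v = 0
  xm_pos : ∀ i n, 0 < n → D.xm i n v = 0
  xp_zero : ∀ i, i ≠ 0 → D.xp i 0 v = 0

/-- `v` is a highest weight vector of weight `(λ, μ)`: it generates the module, functions act on it by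
`f(h, P) v = f(⟨λ - μ, h⟩, ⟨Q_μ, P⟩) v`, and it is killed by `α_{i,n}` (`n > 0`), `x^+_{i,n}` (`n ≥ 0`) and
`x^-_{i,n}` (`n > 0`), for all `i ∈ I`. -/
structure UCurrents.IsHighestWeightVector (D : UCurrents X V) (lam mu : hStar X) (v : V) : Prop where
  ne_zero : v ≠ 0
  cyclic : ∀ U : Submodule (Mero X) V, D.Stable U → v ∈ U → U = ⊤
  weight : D.IsWeight (lam - mu, Qof X mu) v
  al : ∀ i n, 0 < n → D.al i n v = 0
  xp : ∀ i n, 0 ≤ n → D.xp i n v = 0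
  xm : ∀ i n, 0 < n → D.xm i n v = 0

end Modules

/-! ### The lattices -/

/-- The root lattice `𝒬 = ⨁ ℤ α_i`. -/
abbrev RootLattice : Type := Node X → ℤ

theorem label_zero : label X 0 = 1 := by
  cases X <;> simp [label, AffineType.label]

/-- Labels of the basis `e^{Q_μ} e^{Q_ν}` (`ν_0 = 0`) of `e^{Q_μ} ℂ[ℛ_Q]` with the central element
`e^{∑ a_j Q_j}` set equal to a number. -/
abbrev DynLattice : Type := {ν : Node X → ℤ // ν 0 = 0}

variable {X}

/-- Reduction of `e^{Q_γ} e^{Q_ν}`: with `Q_γ = γ_0 ∑ a_j Q_j + Q_{γ'}`, `γ'_0 = 0`, this is the label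
`γ' + ν`; the factor is `s ^ γ_0` if `e^{∑ a_j Q_j} = s`. -/
def dynMove (γ : Node X → ℤ) (ν : DynLattice X) : DynLattice X :=
  ⟨fun i => ν.1 i + γ i - γ 0 * label X i, by simp [ν.2, label_zero]⟩

/-- The constant `(-1)^{a_{ij}} κ^{-m_{ij}}` in `e^{α_i} e^{α_j} = (-1)^{a_{ij}} κ^{-m_{ij}} e^{α_j} e^{α_i}`. -/
def commConst (κ : ℂ) (i j : Node X) : ℂ := (-1) ^ cartan X i j * κ ^ (-mMat X i j)

/-- The cocycle of the twisted group algebra `ℂ[𝒬]`, which has the basis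
`e^β = (e^{α_0})^{β_0} (e^{α_1})^{β_1} ⋯ (e^{α_N})^{β_N}` and the product
`e^β e^γ = twist κ β γ • e^{β+γ}`. -/
def twist (κ : ℂ) (β γ : RootLattice X) : ℂ :=
  ∏ i, ∏ j, if j < i then commConst κ i j ^ (β i * γ j) else 1

theorem commConst_ne_zero {κ : ℂ} (hκ : κ ≠ 0) (i j : Node X) : commConst κ i j ≠ 0 :=
  mul_ne_zero (zpow_ne_zero _ (by norm_num)) (zpow_ne_zero _ hκ)

/-- The product of the twisted group algebra is associative (and `e^0 = 1`). -/
theorem twist_assoc {κ : ℂ} (hκ : κ ≠ 0) (β γ δ : RootLattice X) :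
    twist κ β γ * twist κ (β + γ) δ = twist κ γ δ * twist κ β (γ + δ) := by
  simp only [twist, ← Finset.prod_mul_distrib]
  refine Finset.prod_congr rfl fun i _ => Finset.prod_congr rfl fun j _ => ?_
  split_ifs
  · simp only [← zpow_add₀ (commConst_ne_zero hκ i j), Pi.add_apply]
    congr 1
    ring
  · simp

theorem cartan_symm (i j : Node X) : cartan X i j = cartan X j i := by
  simp only [cartan, or_comm, eq_comm (a := i)]

theorem mMat_antisymm (i j : Node X) : mMat X i j = -mMat X j i := by
  cases X <;> simp [mMat]

theorem commConst_inv {κ : ℂ} (hκ : κ ≠ 0) (i j : Node X) :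
    commConst κ j i = (commConst κ i j)⁻¹ := by
  have h1 : (-1 : ℂ) ^ cartan X i j * (-1) ^ cartan X i j = 1 := by
    rw [← mul_zpow]; norm_num
  refine eq_inv_of_mul_eq_one_left ?_
  simp only [commConst, cartan_symm j i, mMat_antisymm j i, neg_neg]
  rw [mul_mul_mul_comm, h1, ← zpow_add₀ hκ]
  simp

/-- The defining commutation relation `e^{α_i} e^{±α_j} = (-1)^{a_{ij}} κ^{∓m_{ij}} e^{±α_j} e^{α_i}`. -/
theorem twist_comm {κ : ℂ} (hκ : κ ≠ 0) (i j : Node X) :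
    twist κ (Pi.single i 1) (Pi.single j 1) =
        (-1) ^ cartan X i j * κ ^ (-mMat X i j) * twist κ (Pi.single j 1) (Pi.single i 1) ∧
      twist κ (Pi.single i 1) (Pi.single j (-1)) =
        (-1) ^ cartan X i j * κ ^ mMat X i j * twist κ (Pi.single j (-1)) (Pi.single i 1) := by
  have key : ∀ (i j : Node X) (a b : ℤ), twist κ (Pi.single i a) (Pi.single j b) =
      if j < i then commConst κ i j ^ (a * b) else 1 := by
    intro i j a b
    unfold twist
    rw [Finset.prod_eq_single i, Finset.prod_eq_single j]
    · simp
    · intro k _ hk; simp [Pi.single_eq_of_ne hk]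
    · simp
    · intro k _ hk; simp [Pi.single_eq_of_ne hk]
    · simp
  have hm1 : (-1 : ℂ) ^ cartan X i j = ((-1 : ℂ) ^ cartan X i j)⁻¹ := by
    refine eq_inv_of_mul_eq_one_left ?_
    rw [← mul_zpow]; norm_num
  have hc : (-1 : ℂ) ^ cartan X i j * κ ^ mMat X i j = (commConst κ i j)⁻¹ := by
    rw [commConst, mul_inv, ← hm1, zpow_neg, inv_inv]
  rw [hc, ← commConst]
  simp only [key]
  rcases lt_trichotomy i j with h | h | h
  · simp [h, h.not_gt, commConst_inv hκ i j, commConst_ne_zero hκ i j]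
  · subst h
    have : mMat X i i = 0 := by have := mMat_antisymm i i; omega
    simp [commConst, cartan, this]
  · simp [h, h.not_gt]

/-! ### The modules -/

/-- The basis vectors `e^β e^Λ ⊗ e^{Q_μ} e^{Q_ν}` are labelled by the pairs `(β, ν)`. -/
abbrev Idx (X : AffineType) : Type := RootLattice X × DynLattice X

/-- The integer `⟨Λ + β, h_i⟩`, where `Λ` is given by the integers `⟨Λ, h_i⟩`. -/
def hval (lam : Node X → ℤ) (β : RootLattice X) (i : Node X) : ℤ :=
  lam i + ∑ j, cartan X i j * β j

/-- The integer `(β, β)/2 + (Λ, β) = ((Λ + β, Λ + β) - (Λ, Λ))/2`; `q^d` acts on `e^β e^Λ` by its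
negative. -/
def energy (lam : Node X → ℤ) (β : RootLattice X) : ℤ :=
  ∑ i, lam i * β i + (∑ i, ∑ j, β i * cartan X i j * β j) / 2

/-- The weight `(Λ + β, Q_{μ+ν})` of `e^β e^Λ ⊗ e^{Q_μ} e^{Q_ν}`, where `⟨Λ, d⟩ = 0`. -/
def weightOf (lam : Node X → ℤ) (μ : hStar X) (x : Idx X) : HStar X :=
  ((fun i => (lam i : ℂ), 0) + ∑ j, (x.1 j : ℂ) • simpleRoot X j,
    Qof X (μ + ∑ j, (x.2.1 j : ℂ) • simpleRoot X j))

/-- The number by which `e^{∑ a_j Q_j}` acts; with `h_j` acting by `⟨Λ + β, h_j⟩` it makes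
`∏ (K^+_j)^{a_j} = ∏ (q^{h_j} e^{-Q_j})^{a_j}` act by `q^{-l}`. -/
def dynConst (q l : ℂ) (lam : Node X → ℤ) : ℂ := q ^ l * q ^ (∑ i, (label X i : ℤ) * lam i)

/-- The operator on `⨁_x M` mapping the summand `x` to the summand `f x` by `T x`. -/
def blockOp {ι M : Type*} [AddCommGroup M] [Module ℂ M] (f : ι → ι) (T : ι → M →ₗ[ℂ] M) :
    Module.End ℂ (ι →₀ M) :=
  Finsupp.lsum ℂ fun x => (Finsupp.lsingle (f x)).comp (T x)

/-- Functions acting through their values at the weights of the basis vectors. -/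
def evHom (M : Type*) [AddCommGroup M] [Module ℂ M] (lam : Node X → ℤ) (μ : hStar X) :
    Entire (HStar X) →ₐ[ℂ] Module.End ℂ (Idx X →₀ M) :=
  AlgHom.ofLinearMap
    { toFun := fun f => blockOp id fun x => f.1 (weightOf lam μ x) • LinearMap.id
      map_add' := fun f g => by
        refine Finsupp.lhom_ext fun x m => ?_
        simp [blockOp, add_smul]
      map_smul' := fun c f => by
        refine Finsupp.lhom_ext fun x m => ?_
        simp [blockOp, mul_smul] }
    (by refine Finsupp.lhom_ext fun x m => ?_
        simp [blockOp])
    (by intro f g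
        refine Finsupp.lhom_ext fun x m => ?_
        simp [blockOp, mul_smul])

/-- The lattice part of the currents, with coefficients in a space `M` on which translations `τ η` of
functions act: on `⨁_{(β,ν)} M · e^β e^Λ ⊗ e^{Q_μ} e^{Q_ν}`, and for vertex operators
`Tp j s`, `Tm j s` on `M` (the coefficients of `z^{-s}`), the modes of
`Tp_j(z) e^{α_j} z^{h_j+1} ⊗ e^{-Q_j}` and `Tm_j(z) e^{-α_j} z^{-h_j+1}`, the operators
`K^±_j = q^{±h_j} ⊗ e^{-Q_j}`, and `q^d`, which acts on `M` by `dM`. -/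
def latticeCurrents {M : Type*} [AddCommGroup M] [Module ℂ M] (q κ l : ℂ) (lam : Node X → ℤ)
    (μ : hStar X) (τ : HStar X → M →ₗ[ℂ] M) (Tp Tm : Node X → ℤ → M →ₗ[ℂ] M) (dM : M →ₗ[ℂ] M)
    [Module (Mero X) M] : Currents X (Idx X →₀ M) where
  xp j n := blockOp (fun x => (x.1 + Pi.single j 1, dynMove (-Pi.single j 1) x.2)) fun x =>
    (twist κ (Pi.single j 1) x.1 * dynConst q l lam ^ (-Pi.single (M := fun _ => ℤ) j 1 0)) •
      (Tp j (n + hval lam x.1 j + 1) ∘ₗ τ (-(simpleRoot X j, -Qof X (simpleRoot X j))))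
  xm j n := blockOp (fun x => (x.1 + Pi.single j (-1), x.2)) fun x =>
    twist κ (Pi.single j (-1)) x.1 •
      (Tm j (n - hval lam x.1 j + 1) ∘ₗ τ (-(-simpleRoot X j, 0)))
  Kp j := blockOp (fun x => (x.1, dynMove (-Pi.single j 1) x.2)) fun x =>
    (q ^ hval lam x.1 j * dynConst q l lam ^ (-Pi.single (M := fun _ => ℤ) j 1 0)) •
      τ (-(0, -Qof X (simpleRoot X j)))
  Km j := blockOp (fun x => (x.1, dynMove (-Pi.single j 1) x.2)) fun x =>
    (q ^ (-hval lam x.1 j) * dynConst q l lam ^ (-Pi.single (M := fun _ => ℤ) j 1 0)) •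
      τ (-(0, -Qof X (simpleRoot X j)))
  qd := blockOp id fun x => q ^ (-energy lam x.1) • dM
  ev := evHom M lam μ

/-- The space `𝓦(Λ, μ) = 𝓕 ⊗ e^Λ ℂ[𝒬] ⊗ e^{Q_μ} ℂ[ℛ_Q]` over the field `𝓕` of meromorphic functions. -/
abbrev WSpace (X : AffineType) : Type := Idx X →₀ Mero X

/-- `𝓦(Λ, μ)` with `Z^+_j(z) = e^{α_j} z^{h_j+1} ⊗ e^{-Q_j}`, `Z^-_j(z) = e^{-α_j} z^{-h_j+1}` and
`K^±_j = q^{±h_j} ⊗ e^{-Q_j}`. -/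
def WModule (q κ l : ℂ) (lam : Node X → ℤ) (μ : hStar X) : Currents X (WSpace X) :=
  latticeCurrents q κ l lam μ (fun η => (shift η).toLinearMap)
    (fun _ s => if s = 0 then LinearMap.id else 0) (fun _ s => if s = 0 then LinearMap.id else 0)
    LinearMap.id

/-- The Fock space, polynomials in `α_{i,-m}` (`i ∈ I`, `m ≥ 1`), with coefficients in `𝓕`. -/
abbrev Fock (X : AffineType) : Type := MvPolynomial (Node X × ℕ+) (Mero X)

/-- The action of `α_{i,m}` on the Fock space of level one: for `m > 0`, `α_{i,-m}` acts by
multiplication and `α_{i,m}` acts by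
`∑_j ([a_{ij} m] [m] / m) ((1 - p^m) / (1 - p^{*m})) q^{-m} κ^{-m m_{ij}} ∂/∂α_{j,-m}`. -/
def fockAl (q κ p : ℂ) (i : Node X) (m : ℤ) : Module.End ℂ (Fock X) :=
  if hm : 0 < m then
    ∑ j, (qInt q (cartan X i j * m) * qInt q m / m * ((1 - p ^ m) / (1 - (p * q ^ (-2 : ℤ)) ^ m))
        * q ^ (-m) * κ ^ (-m * mMat X i j)) •
      (MvPolynomial.pderiv (R := Mero X) (j, ⟨m.toNat, by omega⟩)).toLinearMap.restrictScalars ℂ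
  else if hm' : m < 0 then
    LinearMap.mulLeft ℂ (MvPolynomial.X (i, ⟨(-m).toNat, by omega⟩))
  else 0

/-- `α'_{i,m} = ((1 - p^{*m}) / (1 - p^m)) q^m α_{i,m}`. -/
def fockAl' (q κ p : ℂ) (i : Node X) (m : ℤ) : Module.End ℂ (Fock X) :=
  ((1 - (p * q ^ (-2 : ℤ)) ^ m) / (1 - p ^ m) * q ^ m) • fockAl q κ p i m

/-- `q^d` on the Fock space, multiplying `α_{i,-m}` by `q^{-m}`. -/
def fockDeg (q : ℂ) : Module.End ℂ (Fock X) :=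
  ((MvPolynomial.aeval fun x : Node X × ℕ+ =>
    (q ^ (-(x.2 : ℤ))) • (MvPolynomial.X x : Fock X)) : Fock X →ₐ[Mero X] Fock X).toLinearMap.restrictScalars ℂ

/-- The space `Ind 𝓦(Λ, μ)`, Fock space tensored with `𝓦(Λ, μ)`. -/
abbrev IndSpace (X : AffineType) : Type := Idx X →₀ Fock X

/-- The operators of the elliptic quantum toroidal algebra on `Ind 𝓦(Λ, μ)`:
`x^+_j(z) = exp(∑ α_{j,-m} z^m/[m]) exp(-∑ α_{j,m} z^{-m}/[m]) e^{α_j} e^{-Q_j} z^{h_j+1}` and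
`x^-_j(z) = exp(-∑ α'_{j,-m} z^m/[m]) exp(∑ α'_{j,m} z^{-m}/[m]) e^{-α_j} z^{-h_j+1}`. -/
def IndModule (q κ p l : ℂ) (lam : Node X → ℤ) (μ : hStar X) : UCurrents X (IndSpace X) where
  toCurrents := latticeCurrents q κ l lam μ
    (fun η => (MvPolynomial.mapAlgHom (shift η).toAlgHom).toLinearMap)
    (fun j s => vertexMode (fun m => (qInt q m)⁻¹ • fockAl q κ p j (-m))
      (fun m => -(qInt q m)⁻¹ • fockAl q κ p j m) s)
    (fun j s => vertexMode (fun m => -(qInt q m)⁻¹ • fockAl' q κ p j (-m))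
      (fun m => (qInt q m)⁻¹ • fockAl' q κ p j m) s)
    (fockDeg q)
  al i m := blockOp id fun _ => fockAl q κ p i m
  qc := q ^ (1 / 2 : ℂ) • 1

variable (X) in
/-- The weight `Λ̄_a + ε Λ_0`, by its values on the `h_i`, where `Λ_i` are the fundamental weights and
`Λ̄_a = Λ_a - Λ_0` for `a` with label one. For `ε = 1` this is `Λ_a`. -/
def vacuumWeight (ε : ℤ) (a : Node X) : Node X → ℤ :=
  Pi.single a 1 - Pi.single 0 1 + ε • Pi.single 0 1

variable (X) in
/-- A weight of `𝔥` with vanishing value on `d`, from its values on the `h_i`. -/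
def toWeight (lam : Node X → ℤ) : hStar X := (fun i => (lam i : ℂ), 0)

/-- Genericity of the parameters: `0 < |q| < 1`, `0 < |p| < 1`, `|p^*| = |p q^{-2}| < 1`, `κ ≠ 0`, and
`q`, `κ` are multiplicatively independent. -/
structure GenericParams (q κ p : ℂ) : Prop where
  q_ne : q ≠ 0
  q_lt : ‖q‖ < 1
  p_ne : p ≠ 0
  p_lt : ‖p‖ < 1
  pstar_lt : ‖p * q ^ (-2 : ℤ)‖ < 1
  κ_ne : κ ≠ 0
  indep : ∀ a b : ℤ, q ^ a * κ ^ b = 1 → a = 0 ∧ b = 0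

end EllToroidal

end

set_option linter.unusedSectionVars false

/-! Relations. Every current is a bosonic vertex operator times a lattice operator. By Wick's
theorem a product A(z)B(w) is a power series in w/z, the contraction, times a normally ordered
product, and normally ordered products do not depend on the order of their factors
(`vertexMode_mul`, `vertexMode_mul_mul`, `normal2_swap`). Reordering the lattice factors costs a
constant, from the cocycle, and a shift of the exponents of z and w by the pairing e of the two
lattice vectors. Hence a quadratic or Serre relation depends only on the product of its structure
function with the contraction, and this product turns out to be elementary. With ρ = q^{±1} it is,
for equal signs, (1 - ρ^{-e}x) times (1 - ρ²x)(1 - x), 1/(1 - ρx) or 1 for e = 2, -1, 0, without the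
linear factor in the Serre relations. For opposite signs it is 1/((1 - qx)(1 - q⁻¹x)), 1 - x or 1,
up to rescaling x by powers of κ. In the Z-algebra there are no bosons, the contractions are 1, and
the infinite products telescope to these series. In the elliptic algebra the nome cancels between g
and the Heisenberg contraction (`gSeries_mul_contr_plus`, `gSeries_mul_contr_minus`). So both
algebras reduce to three identities about an arbitrary array of coefficients: `formal_exchange`,
`formal_serre`, and `formal_delta`. The last one says that the two expansions of 1/((1 - qx)(1 -
q⁻¹x)) differ by delta functions; at z = q^{±1}w the product of the two vertex operators collapses
to the exponentials in φ^±.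

Irreducibility. The kernel of the affine Cartan matrix is spanned by the labels, so distinct basis
vectors have distinct weights (`weightOf_injective`), and entire functions cut out the components of
any vector of a submodule (`single_mem_of_ev`). The operators K and suitable modes of the currents
move a component with vacuum coefficient to any other position (`eq_top_of_single_mem`). It remains
to treat one coefficient space. For W it is the field of meromorphic functions itself. For Ind W it
is the Fock space, which is irreducible because the pairing of α_{i,m} with α_{j,-m} is
nondegenerate (`heisenberg_nondegenerate`): in type A since going around the cycle multiplies by a
monomial in q and κ that is not 1, otherwise since the eigenvalues of the diagram are real of
modulus at most 2, while q^m + q^{-m}, if real, has modulus greater than 2.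

Inequivalence. An equivalence preserves weights, so the two vacuum weights differ by an element of
the root lattice; characters of weights modulo roots separate the nodes of label one
(`eq_of_single_sub_single`).

Highest weights and grading. On the vacuum the factor z^{±h+1} shifts mode numbers by ±⟨Λ, h_i⟩ + 1,
and positive modes of a vertex operator kill the Fock vacuum. The exponents of q^d are minus the
energy minus the Fock degree. At ε = 0 the linear part of the energy vanishes on δ, so the positive
semidefinite quadratic part dominates it and the energy is bounded below (`energy_bound`). At ε = 1
the energy is unbounded along multiples of δ, which is why the grading is asserted only for ε = 0.
-/

noncomputable section

namespace EllToroidal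

/-! ### Formal exponentials of commuting exponents and their reordering -/

section FormalExp

variable {R : Type*} [Ring R] [Algebra ℂ R]

/-- The Euler derivation `x d/dx` of formal power series. -/
def euler (f : PowerSeries R) : PowerSeries R :=
  PowerSeries.mk fun n => (n : ℂ) • PowerSeries.coeff n f

theorem euler_mul (f g : PowerSeries R) : euler (f * g) = euler f * g + f * euler g := by
  ext n
  simp only [euler, PowerSeries.coeff_mk, map_add, PowerSeries.coeff_mul, Finset.smul_sum,
    ← Finset.sum_add_distrib]
  refine Finset.sum_congr rfl fun x hx => ?_
  rw [← Finset.HasAntidiagonal.mem_antidiagonal.mp hx]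
  push_cast
  rw [smul_mul_assoc, mul_smul_comm, add_smul]

/-- The exponent of a formal exponential, a series without constant term. -/
def gen (a : ℕ → R) : PowerSeries R := PowerSeries.mk fun m => if m = 0 then 0 else a m

/-- Without a constant term the k-th power starts in degree k. Hence the finite sum in `expCoeff`
may be lengthened at will, which is how degree n is compared for consecutive powers. -/
theorem coeff_gen_pow_of_lt (a : ℕ → R) (k : ℕ) :
    ∀ n < k, PowerSeries.coeff n (gen a ^ k) = 0 := by
  induction k with
  | zero => intro n h; omega
  | succ k ih =>
    intro n hn
    rw [pow_succ', PowerSeries.coeff_mul]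
    refine Finset.sum_eq_zero fun x hx => ?_
    have := Finset.HasAntidiagonal.mem_antidiagonal.mp hx
    by_cases h0 : x.1 = 0
    · simp [gen, h0]
    · rw [ih x.2 (by omega), mul_zero]

theorem expCoeff_eq_sum (a : ℕ → R) {n K : ℕ} (h : n < K) : expCoeff a n =
    ∑ k ∈ Finset.range K, ((k.factorial : ℂ)⁻¹) • PowerSeries.coeff n (gen a ^ k) := by
  unfold expCoeff
  refine Finset.sum_subset (by intro x; simp; omega) fun k _ hk => ?_
  have := coeff_gen_pow_of_lt a k n (by simpa using hk)
  rw [gen] at this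
  rw [this, smul_zero]

@[simp] theorem expCoeff_zero (a : ℕ → R) : expCoeff a 0 = 1 := by
  simp [expCoeff]

theorem commute_gen {a b : ℕ → R} (h : ∀ m n, Commute (a m) (b n)) : Commute (gen a) (gen b) := by
  ext n
  rw [PowerSeries.coeff_mul, PowerSeries.coeff_mul, ← Finset.Nat.sum_antidiagonal_swap]
  refine Finset.sum_congr rfl fun x _ => ?_
  simp only [gen, PowerSeries.coeff_mk, Prod.fst_swap, Prod.snd_swap]
  split_ifs <;> simp [(h x.2 x.1).eq]

theorem euler_gen (a : ℕ → R) : euler (gen a) = gen fun m => (m : ℂ) • a m := by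
  ext n
  simp only [euler, gen, PowerSeries.coeff_mk]
  split_ifs <;> simp

/-- In a noncommutative ring the power rule needs the series to commute with its own derivative,
which follows from commutation of all the exponents. -/
theorem euler_gen_pow {a : ℕ → R} (h : ∀ m n, Commute (a m) (a n)) (k : ℕ) :
    euler (gen a ^ (k + 1)) = ((k : ℂ) + 1) • (euler (gen a) * gen a ^ k) := by
  induction k with
  | zero => simp
  | succ k ih =>
    have hc : Commute (gen a) (euler (gen a)) := by
      rw [euler_gen]; exact commute_gen fun m n => (h m n).smul_right _
    rw [pow_succ', euler_mul, ih, mul_smul_comm, ← mul_assoc, hc.eq, mul_assoc, ← pow_succ']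
    push_cast
    rw [add_smul ((k : ℂ) + 1), one_smul, add_comm]

/-- The differential equation of the exponential, coefficientwise. -/
theorem expCoeff_rec {a : ℕ → R} (h : ∀ m n, Commute (a m) (a n)) (n : ℕ) :
    (n : ℂ) • expCoeff a n =
      ∑ x ∈ Finset.HasAntidiagonal.antidiagonal n, (x.1 : ℂ) • (a x.1 * expCoeff a x.2) := by
  have h1 : ∀ k : ℕ, (n : ℂ) • (((k + 1).factorial : ℂ)⁻¹ • PowerSeries.coeff n (gen a ^ (k + 1)))
      = ∑ x ∈ Finset.HasAntidiagonal.antidiagonal n,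
        (x.1 : ℂ) • (a x.1 * (((k.factorial : ℂ)⁻¹) • PowerSeries.coeff x.2 (gen a ^ k))) := by
    intro k
    have h2 := congrArg (PowerSeries.coeff n) (euler_gen_pow h k)
    rw [euler, PowerSeries.coeff_mk] at h2
    rw [smul_comm, h2, PowerSeries.coeff_smul, PowerSeries.coeff_mul, smul_smul, Finset.smul_sum]
    have hk : (k : ℂ) + 1 ≠ 0 := by exact_mod_cast Nat.succ_ne_zero k
    have h3 : ((k + 1).factorial : ℂ)⁻¹ * ((k : ℂ) + 1) = (k.factorial : ℂ)⁻¹ := by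
      rw [Nat.factorial_succ]; push_cast; field_simp
    rw [h3]
    refine Finset.sum_congr rfl fun x _ => ?_
    rw [euler_gen]
    by_cases hx : x.1 = 0
    · simp [gen, hx]
    · simp only [gen, PowerSeries.coeff_mk, if_neg hx]
      rw [mul_smul_comm, smul_mul_assoc, smul_comm]
  rw [expCoeff_eq_sum a (show n < n + 1 + 1 by omega), Finset.sum_range_succ', smul_add,
    Finset.smul_sum, Finset.sum_congr rfl fun k _ => h1 k, Finset.sum_comm]
  have h4 : (n : ℂ) • (((Nat.factorial 0 : ℂ)⁻¹) • PowerSeries.coeff n (gen a ^ 0)) = 0 := by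
    cases n <;> simp [PowerSeries.coeff_one]
  rw [h4, add_zero]
  refine Finset.sum_congr rfl fun x hx => ?_
  rw [← Finset.smul_sum, ← Finset.mul_sum, ← expCoeff_eq_sum]
  have := Finset.HasAntidiagonal.mem_antidiagonal.mp hx
  omega

/-- Over ℂ the differential equation determines the coefficient of degree n from the lower ones,
because n is invertible. Scaling and addition of exponents are proved by checking this recursion. -/
theorem expCoeff_unique {a : ℕ → R} (h : ∀ m n, Commute (a m) (a n)) {e : ℕ → R} (h0 : e 0 = 1)
    (he : ∀ n : ℕ, (n : ℂ) • e n = ∑ x ∈ Finset.HasAntidiagonal.antidiagonal n, (x.1 : ℂ) • (a x.1 * e x.2)) (n : ℕ) :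
    e n = expCoeff a n := by
  induction n using Nat.strong_induction_on with
  | _ n ih =>
    rcases Nat.eq_zero_or_pos n with rfl | hn
    · rw [h0, expCoeff_zero]
    · have hn' : (n : ℂ) ≠ 0 := by exact_mod_cast hn.ne'
      refine smul_right_injective R hn' ?_
      change (n : ℂ) • e n = (n : ℂ) • _
      rw [he, expCoeff_rec h]
      refine Finset.sum_congr rfl fun x hx => ?_
      by_cases hx0 : x.1 = 0
      · simp [hx0]
      · rw [ih x.2 (by have := Finset.HasAntidiagonal.mem_antidiagonal.mp hx; omega)]

theorem expCoeff_congr {a b : ℕ → R} (h : ∀ m, 0 < m → a m = b m) (n : ℕ) :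
    expCoeff a n = expCoeff b n := by
  unfold expCoeff
  have : (fun m => if m = 0 then 0 else a m) = fun m => if m = 0 then 0 else b m := by
    funext m
    split_ifs with hm
    · rfl
    · exact h m (by omega)
  rw [this]

theorem expCoeff_map {S : Type*} [Ring S] [Algebra ℂ S] (φ : R →ₐ[ℂ] S) (a : ℕ → R) (n : ℕ) :
    expCoeff (fun m => φ (a m)) n = φ (expCoeff a n) := by
  unfold expCoeff
  rw [map_sum]
  refine Finset.sum_congr rfl fun k _ => ?_
  rw [map_smul]
  congr 1
  have : (PowerSeries.mk fun m => if m = 0 then 0 else φ (a m)) =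
      PowerSeries.map (φ : R →+* S) (PowerSeries.mk fun m => if m = 0 then 0 else a m) := by
    ext m
    simp only [PowerSeries.coeff_mk, PowerSeries.coeff_map]
    split_ifs <;> simp
  rw [this, ← map_pow, PowerSeries.coeff_map]
  rfl

@[simp] theorem expCoeff_of_zero (n : ℕ) : expCoeff (fun _ => (0 : R)) n = if n = 0 then 1 else 0 := by
  refine (expCoeff_unique (a := fun _ => (0 : R)) (e := fun n => if n = 0 then 1 else 0)
    (fun m n => Commute.refl _) ?_ (fun n => ?_) n).symm
  · simp
  · simp only [zero_mul, smul_zero, Finset.sum_const_zero]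
    split_ifs with h <;> simp [h]

/-- With `b = a` and `D` a degree operator this is the homogeneity of the exponential; with `s = 1`
it is plain commutation. -/
theorem semiconj_expCoeff {a b : ℕ → R} (h : ∀ m n, Commute (a m) (a n)) (D : R) (s : ℂ)
    (hD : ∀ m, 0 < m → D * a m = s ^ m • (b m * D)) (hb : ∀ m n, Commute (b m) (b n)) (n : ℕ) :
    D * expCoeff a n = s ^ n • (expCoeff b n * D) := by
  induction n using Nat.strong_induction_on with
  | _ n ih =>
    rcases Nat.eq_zero_or_pos n with rfl | hn
    · simp
    · have hn' : (n : ℂ) ≠ 0 := by exact_mod_cast hn.ne'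
      refine smul_right_injective R hn' ?_
      change (n : ℂ) • (D * _) = (n : ℂ) • _
      rw [← mul_smul_comm, smul_comm, ← smul_mul_assoc, expCoeff_rec h, expCoeff_rec hb,
        Finset.mul_sum, Finset.sum_mul, Finset.smul_sum]
      refine Finset.sum_congr rfl fun x hx => ?_
      have hx' := Finset.HasAntidiagonal.mem_antidiagonal.mp hx
      rcases Nat.eq_zero_or_pos x.1 with hx0 | hx0
      · simp [hx0]
      · rw [mul_smul_comm, ← mul_assoc, hD _ hx0, smul_mul_assoc, mul_assoc, ih x.2 (by omega),
          mul_smul_comm, smul_smul, smul_smul, mul_assoc, ← pow_add, hx', smul_mul_assoc, mul_assoc,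
          smul_smul, mul_comm]

theorem commute_expCoeff {a : ℕ → R} (h : ∀ m n, Commute (a m) (a n)) {D : R}
    (hD : ∀ m, 0 < m → Commute D (a m)) (n : ℕ) : Commute D (expCoeff a n) := by
  have := semiconj_expCoeff h D 1 (fun m hm => by simpa using (hD m hm).eq) h n
  simpa [Commute, SemiconjBy] using this

theorem expCoeff_commute {a b : ℕ → R} (ha : ∀ m n, Commute (a m) (a n))
    (hb : ∀ m n, Commute (b m) (b n)) (hab : ∀ m n, Commute (a m) (b n)) (k l : ℕ) :
    Commute (expCoeff a k) (expCoeff b l) :=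
  commute_expCoeff hb (fun n _ => (commute_expCoeff ha (fun m _ => (hab m n).symm) k).symm) l

theorem expCoeff_scale {a : ℕ → R} (h : ∀ m n, Commute (a m) (a n)) (s : ℂ) (n : ℕ) :
    expCoeff (fun m => s ^ m • a m) n = s ^ n • expCoeff a n := by
  refine (expCoeff_unique (e := fun n => s ^ n • expCoeff a n)
    (fun m n => ((h m n).smul_left _).smul_right _) (by simp) (fun n => ?_) n).symm
  rw [smul_comm, expCoeff_rec h, Finset.smul_sum]
  refine Finset.sum_congr rfl fun x hx => ?_
  rw [← Finset.HasAntidiagonal.mem_antidiagonal.mp hx, smul_mul_smul_comm, ← pow_add, smul_comm]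

/-- The product of the two exponentials satisfies the differential equation for the sum of the
exponents, by the Leibniz rule; commutation is used to bring the derivative of the second exponent
to the far left. -/
theorem expCoeff_add {a b : ℕ → R} (ha : ∀ m n, Commute (a m) (a n))
    (hb : ∀ m n, Commute (b m) (b n)) (hab : ∀ m n, Commute (a m) (b n)) (n : ℕ) :
    expCoeff (fun m => a m + b m) n =
      ∑ x ∈ Finset.HasAntidiagonal.antidiagonal n, expCoeff a x.1 * expCoeff b x.2 := by
  refine (expCoeff_unique (e := fun n => ∑ x ∈ Finset.HasAntidiagonal.antidiagonal n,
    expCoeff a x.1 * expCoeff b x.2) (fun m n => ?_) (by simp) (fun n => ?_) n).symm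
  · exact ((ha m n).add_right (hab m n)).add_left ((hab n m).symm.add_right (hb m n))
  · have key := congrArg (PowerSeries.coeff n)
      (euler_mul (PowerSeries.mk (expCoeff a)) (PowerSeries.mk (expCoeff b)))
    have ea : euler (PowerSeries.mk (expCoeff a)) =
        PowerSeries.mk (fun m => (m : ℂ) • a m) * PowerSeries.mk (expCoeff a) := by
      ext m
      simp [euler, expCoeff_rec ha, PowerSeries.coeff_mul]
    have eb : euler (PowerSeries.mk (expCoeff b)) =
        PowerSeries.mk (fun m => (m : ℂ) • b m) * PowerSeries.mk (expCoeff b) := by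
      ext m
      simp [euler, expCoeff_rec hb, PowerSeries.coeff_mul]
    have hc : PowerSeries.mk (expCoeff a) * PowerSeries.mk (fun m => (m : ℂ) • b m) =
        PowerSeries.mk (fun m => (m : ℂ) • b m) * PowerSeries.mk (expCoeff a) := by
      ext m
      rw [PowerSeries.coeff_mul, PowerSeries.coeff_mul, ← Finset.Nat.sum_antidiagonal_swap]
      refine Finset.sum_congr rfl fun x _ => ?_
      simp only [PowerSeries.coeff_mk, Prod.fst_swap, Prod.snd_swap]
      exact ((commute_expCoeff ha (fun m _ => (hab m _).symm) _).symm.smul_right _).eq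
    rw [ea, eb, ← mul_assoc (PowerSeries.mk (expCoeff a)), hc, mul_assoc, mul_assoc, ← add_mul] at key
    rw [euler, PowerSeries.coeff_mk, PowerSeries.coeff_mul] at key
    simp only [PowerSeries.coeff_mk] at key
    rw [key, PowerSeries.coeff_mul]
    refine Finset.sum_congr rfl fun x _ => ?_
    simp only [map_add, PowerSeries.coeff_mk, PowerSeries.coeff_mul, ← smul_add, smul_mul_assoc]

/-- The coefficients of a formal exponential, extended by zero to negative degrees. -/
def expZ (a : ℕ → R) (k : ℤ) : R := if 0 ≤ k then expCoeff a k.toNat else 0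

@[simp] theorem expZ_natCast (a : ℕ → R) (n : ℕ) : expZ a n = expCoeff a n := by simp [expZ]

theorem expZ_of_neg (a : ℕ → R) {k : ℤ} (h : k < 0) : expZ a k = 0 := by simp [expZ, h]

/-- Commuting a formal exponential with an operator having a scalar commutator with one exponent. -/
theorem comm_expCoeff {a : ℕ → R} (ha : ∀ m n, Commute (a m) (a n)) {D : R} {k : ℕ} (hk : 0 < k)
    {c : ℂ} (hD : ∀ m, 0 < m → D * a m = a m * D + if m = k then c • 1 else 0) (n : ℕ) :
    D * expCoeff a n = expCoeff a n * D + c • expZ a ((n : ℤ) - k) := by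
  induction n using Nat.strong_induction_on with
  | _ n ih =>
    rcases Nat.eq_zero_or_pos n with rfl | hn
    · simp [expZ_of_neg, hk]
    · have hn' : (n : ℂ) ≠ 0 := by exact_mod_cast hn.ne'
      refine smul_right_injective R hn' ?_
      change (n : ℂ) • (D * _) = (n : ℂ) • _
      rw [smul_add, ← mul_smul_comm, ← smul_mul_assoc, expCoeff_rec ha, Finset.mul_sum,
        Finset.sum_mul]
      have e1 : ∀ x ∈ Finset.HasAntidiagonal.antidiagonal n, D * (x.1 : ℂ) • (a x.1 * expCoeff a x.2) =
          (x.1 : ℂ) • (a x.1 * expCoeff a x.2) * D + (x.1 : ℂ) • (c • (a x.1 * expZ a (x.2 - k)))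
            + if x.1 = k then ((x.1 : ℂ) * c) • expCoeff a x.2 else 0 := by
        intro x hx
        have hx' := Finset.HasAntidiagonal.mem_antidiagonal.mp hx
        rcases Nat.eq_zero_or_pos x.1 with hx0 | hx0
        · simp [hx0]
        · rw [mul_smul_comm, ← mul_assoc, hD _ hx0, add_mul, mul_assoc, ih x.2 (by omega), mul_add,
            smul_add, smul_add, smul_mul_assoc, mul_smul_comm, mul_assoc]
          congr 1
          split_ifs <;> simp [mul_smul]
      rw [Finset.sum_congr rfl e1, Finset.sum_add_distrib, Finset.sum_add_distrib, add_assoc]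
      congr 1
      -- For n = k + d the induction hypothesis produces the recursion for degree d, hence a factor
      -- d, and the scalar commutator contributes a factor k. Together they give n, which cancels.
      -- For n < k every correction term has negative degree and vanishes.
      by_cases hkn : k ≤ n
      · obtain ⟨d, rfl⟩ := Nat.exists_eq_add_of_le hkn
        have e2 : ∑ x ∈ Finset.HasAntidiagonal.antidiagonal (k + d),
            (x.1 : ℂ) • (c • (a x.1 * expZ a ((x.2 : ℤ) - k))) =
            ∑ x ∈ Finset.HasAntidiagonal.antidiagonal d, (x.1 : ℂ) • (c • (a x.1 * expCoeff a x.2)) := by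
          symm
          refine Finset.sum_of_injOn (fun x => (x.1, x.2 + k)) ?_ ?_ ?_ ?_
          · intro x _ y _ h
            simp only [Prod.mk.injEq] at h
            ext <;> omega
          · intro x hx
            simp only [Finset.mem_coe, Finset.HasAntidiagonal.mem_antidiagonal] at hx ⊢
            omega
          · intro x hx hx2
            rw [expZ_of_neg]
            · simp
            · by_contra hc
              apply hx2
              rw [Finset.HasAntidiagonal.mem_antidiagonal] at hx
              refine ⟨(x.1, x.2 - k), ?_, ?_⟩
              · simp only [Finset.mem_coe, Finset.HasAntidiagonal.mem_antidiagonal]; omega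
              · ext <;> simp; omega
          · intro x _
            simp
        have e3 : ∑ x ∈ Finset.HasAntidiagonal.antidiagonal (k + d),
            (if x.1 = k then ((x.1 : ℂ) * c) • expCoeff a x.2 else 0) =
              ((k : ℂ) * c) • expCoeff a d := by
          rw [Finset.sum_eq_single (k, d)]
          · simp
          · intro x hx hne
            rw [if_neg]
            intro h
            apply hne
            have := Finset.HasAntidiagonal.mem_antidiagonal.mp hx
            ext <;> simp <;> omega
          · simp
        rw [e2, e3]
        have e4 : ((k + d : ℕ) : ℤ) - k = d := by push_cast; ring
        rw [e4, expZ_natCast]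
        simp_rw [smul_comm _ c, ← Finset.smul_sum]
        rw [← expCoeff_rec ha, smul_smul, smul_smul, ← add_smul]
        congr 1
        push_cast
        ring
      · rw [expZ_of_neg a (by omega), smul_zero, smul_zero, Finset.sum_eq_zero, Finset.sum_eq_zero,
          add_zero]
        · intro x hx
          have := Finset.HasAntidiagonal.mem_antidiagonal.mp hx
          rw [if_neg (by omega)]
        · intro x hx
          have := Finset.HasAntidiagonal.mem_antidiagonal.mp hx
          rw [expZ_of_neg _ (by omega)]
          simp

theorem comm_expZ {a : ℕ → R} (ha : ∀ m n, Commute (a m) (a n)) {D : R} {k : ℕ} (hk : 0 < k)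
    {c : ℂ} (hD : ∀ m, 0 < m → D * a m = a m * D + if m = k then c • 1 else 0) (n : ℤ) :
    D * expZ a n = expZ a n * D + c • expZ a (n - k) := by
  rcases lt_or_ge n 0 with h | h
  · rw [expZ_of_neg _ h, expZ_of_neg _ (by omega)]
    simp
  · lift n to ℕ using h
    rw [expZ_natCast, comm_expCoeff ha hk hD]

/-- Reordering of two formal exponentials whose exponents have scalar commutators. -/
theorem expCoeff_reorder {a b : ℕ → R} (ha : ∀ m n, Commute (a m) (a n))
    (hb : ∀ m n, Commute (b m) (b n)) {c : ℕ → ℂ}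
    (hba : ∀ m n, 0 < m → 0 < n → b m * a n = a n * b m + if n = m then c m • 1 else 0)
    (r : ℕ) : ∀ k : ℤ, expCoeff b r * expZ a k =
      ∑ x ∈ Finset.HasAntidiagonal.antidiagonal r, expCoeff c x.1 • (expZ a (k - x.1) * expCoeff b x.2) := by
  induction r using Nat.strong_induction_on with
  | _ r ih =>
    intro k
    rcases Nat.eq_zero_or_pos r with rfl | hr
    · simp
    have hr' : (r : ℂ) ≠ 0 := by exact_mod_cast hr.ne'
    refine smul_right_injective R hr' ?_
    change (r : ℂ) • (_ * _) = (r : ℂ) • _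
    rw [← smul_mul_assoc, expCoeff_rec hb, Finset.sum_mul]
    have e1 : ∀ x ∈ Finset.HasAntidiagonal.antidiagonal r, (x.1 : ℂ) • (b x.1 * expCoeff b x.2) * expZ a k =
        ∑ y ∈ Finset.HasAntidiagonal.antidiagonal x.2, ((x.1 : ℂ) • expCoeff c y.1 •
            (expZ a (k - y.1) * (b x.1 * expCoeff b y.2)) +
          ((x.1 : ℂ) * (c x.1 * expCoeff c y.1)) • (expZ a (k - (x.1 + y.1 : ℕ)) * expCoeff b y.2)) := by
      intro x hx
      have hx' := Finset.HasAntidiagonal.mem_antidiagonal.mp hx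
      rcases Nat.eq_zero_or_pos x.1 with hx0 | hx0
      · simp [hx0]
      · rw [smul_mul_assoc, mul_assoc, ih x.2 (by omega), Finset.mul_sum, Finset.smul_sum]
        refine Finset.sum_congr rfl fun y _ => ?_
        rw [mul_smul_comm, ← mul_assoc, comm_expZ ha hx0 (fun m hm => hba _ _ hx0 hm), add_mul,
          smul_add, smul_add, mul_assoc, smul_mul_assoc, smul_smul, smul_smul (x.1 : ℂ)]
        congr 1
        rw [smul_smul, Nat.cast_add, sub_sub, add_comm (y.1 : ℤ)]
        congr 1
        ring
    rw [Finset.sum_congr rfl e1]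
    simp_rw [Finset.sum_add_distrib]
    rw [Finset.sum_sigma', Finset.sum_sigma']
    -- The double sums are regrouped so that one is the recursion of exp b and the other that of exp
    -- c. They carry the weights `x.2` and `x.1`, which add up to r.
    have e2 : ∑ x ∈ (Finset.HasAntidiagonal.antidiagonal r).sigma fun a => Finset.HasAntidiagonal.antidiagonal a.2,
        (x.1.1 : ℂ) • expCoeff c x.2.1 • (expZ a (k - x.2.1) * (b x.1.1 * expCoeff b x.2.2)) =
        ∑ x ∈ Finset.HasAntidiagonal.antidiagonal r,
          (x.2 : ℂ) • expCoeff c x.1 • (expZ a (k - x.1) * expCoeff b x.2) := by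
      have : ∀ x ∈ Finset.HasAntidiagonal.antidiagonal r,
          (x.2 : ℂ) • expCoeff c x.1 • (expZ a (k - x.1) * expCoeff b x.2) =
          ∑ y ∈ Finset.HasAntidiagonal.antidiagonal x.2, (y.1 : ℂ) • expCoeff c x.1 •
            (expZ a (k - x.1) * (b y.1 * expCoeff b y.2)) := by
        intro x _
        rw [smul_comm, ← mul_smul_comm, expCoeff_rec hb, Finset.mul_sum, Finset.smul_sum]
        refine Finset.sum_congr rfl fun y _ => ?_
        rw [mul_smul_comm, smul_comm]
      rw [Finset.sum_congr rfl this, Finset.sum_sigma']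
      refine Finset.sum_bij' (fun x _ => ⟨(x.2.1, x.1.1 + x.2.2), (x.1.1, x.2.2)⟩)
        (fun x _ => ⟨(x.2.1, x.1.1 + x.2.2), (x.1.1, x.2.2)⟩) ?_ ?_ ?_ ?_ ?_
      · rintro ⟨⟨x1, x2⟩, ⟨y1, y2⟩⟩ hx
        simp at hx ⊢
        omega
      · rintro ⟨⟨x1, x2⟩, ⟨y1, y2⟩⟩ hx
        simp at hx ⊢
        omega
      · rintro ⟨⟨x1, x2⟩, ⟨y1, y2⟩⟩ hx
        simp only [Finset.mem_sigma, Finset.HasAntidiagonal.mem_antidiagonal] at hx ⊢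
        obtain ⟨h1, h2⟩ := hx
        subst h2; rfl
      · rintro ⟨⟨x1, x2⟩, ⟨y1, y2⟩⟩ hx
        simp only [Finset.mem_sigma, Finset.HasAntidiagonal.mem_antidiagonal] at hx ⊢
        obtain ⟨h1, h2⟩ := hx
        subst h2; rfl
      · rintro ⟨⟨x1, x2⟩, ⟨y1, y2⟩⟩ hx
        rfl
    have e3 : ∑ x ∈ (Finset.HasAntidiagonal.antidiagonal r).sigma fun a => Finset.HasAntidiagonal.antidiagonal a.2,
        ((x.1.1 : ℂ) * (c x.1.1 * expCoeff c x.2.1)) •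
          (expZ a (k - (x.1.1 + x.2.1 : ℕ)) * expCoeff b x.2.2) =
        ∑ x ∈ Finset.HasAntidiagonal.antidiagonal r,
          (x.1 : ℂ) • expCoeff c x.1 • (expZ a (k - x.1) * expCoeff b x.2) := by
      have : ∀ x ∈ Finset.HasAntidiagonal.antidiagonal r,
          (x.1 : ℂ) • expCoeff c x.1 • (expZ a (k - x.1) * expCoeff b x.2) =
          ∑ y ∈ Finset.HasAntidiagonal.antidiagonal x.1, ((y.1 : ℂ) * (c y.1 * expCoeff c y.2)) •
            (expZ a (k - (y.1 + y.2 : ℕ)) * expCoeff b x.2) := by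
        intro x _
        rw [smul_smul, ← smul_eq_mul (x.1 : ℂ), expCoeff_rec (fun m n => Commute.all _ _),
          Finset.sum_smul]
        refine Finset.sum_congr rfl fun y hy => ?_
        rw [Finset.HasAntidiagonal.mem_antidiagonal.mp hy, smul_eq_mul]
      rw [Finset.sum_congr rfl this, Finset.sum_sigma']
      refine Finset.sum_bij' (fun x _ => ⟨(x.1.1 + x.2.1, x.2.2), (x.1.1, x.2.1)⟩)
        (fun x _ => ⟨(x.2.1, x.2.2 + x.1.2), (x.2.2, x.1.2)⟩) ?_ ?_ ?_ ?_ ?_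
      · rintro ⟨⟨x1, x2⟩, ⟨y1, y2⟩⟩ hx
        simp at hx ⊢
        omega
      · rintro ⟨⟨x1, x2⟩, ⟨y1, y2⟩⟩ hx
        simp at hx ⊢
        omega
      · rintro ⟨⟨x1, x2⟩, ⟨y1, y2⟩⟩ hx
        simp only [Finset.mem_sigma, Finset.HasAntidiagonal.mem_antidiagonal] at hx ⊢
        obtain ⟨h1, h2⟩ := hx
        subst h2; rfl
      · rintro ⟨⟨x1, x2⟩, ⟨y1, y2⟩⟩ hx
        simp only [Finset.mem_sigma, Finset.HasAntidiagonal.mem_antidiagonal] at hx ⊢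
        obtain ⟨h1, h2⟩ := hx
        subst h2; rfl
      · rintro ⟨⟨x1, x2⟩, ⟨y1, y2⟩⟩ hx
        rfl
    rw [e2, e3, ← Finset.sum_add_distrib, Finset.smul_sum]
    refine Finset.sum_congr rfl fun x hx => ?_
    rw [← add_smul, ← Finset.HasAntidiagonal.mem_antidiagonal.mp hx]
    push_cast
    rw [add_comm]

end FormalExp

/-! ### Locally finite sums with power series coefficients -/

section LocallyFinite

variable {M : Type*} [AddCommGroup M] [Module ℂ M]

theorem finite_support_of_bound {g : ℕ → M} {K : ℕ} (h : ∀ n, K ≤ n → g n = 0) :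
    (Function.support g).Finite :=
  (Finset.range K).finite_toSet.subset fun n hn => by
    by_contra hc
    exact hn (h n (by simpa using hc))

theorem finsum_eq_range {g : ℕ → M} {K : ℕ} (h : ∀ n, K ≤ n → g n = 0) :
    ∑ᶠ n, g n = ∑ n ∈ Finset.range K, g n :=
  finsum_eq_sum_of_support_subset _ fun n hn => by
    by_contra hc
    exact hn (h n (by simpa using hc))

theorem finsum_swap {g : ℕ → ℕ → M} (K : ℕ) (h : ∀ i j, K ≤ i ∨ K ≤ j → g i j = 0) :
    ∑ᶠ i, ∑ᶠ j, g i j = ∑ᶠ j, ∑ᶠ i, g i j := by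
  have h1 : ∀ i, ∑ᶠ j, g i j = ∑ j ∈ Finset.range K, g i j := fun i =>
    finsum_eq_range fun j hj => h i j (Or.inr hj)
  have h2 : ∀ j, ∑ᶠ i, g i j = ∑ i ∈ Finset.range K, g i j := fun j =>
    finsum_eq_range fun i hi => h i j (Or.inl hi)
  simp only [h1, h2]
  rw [finsum_eq_range (K := K), finsum_eq_range (K := K), Finset.sum_comm]
  · exact fun j hj => Finset.sum_eq_zero fun i _ => h i j (Or.inr hj)
  · exact fun i hi => Finset.sum_eq_zero fun j _ => h i j (Or.inl hi)

theorem map_finsum_of_bound {N : Type*} [AddCommGroup N] [Module ℂ N] (T : M →ₗ[ℂ] N) {g : ℕ → M}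
    {K : ℕ} (h : ∀ n, K ≤ n → g n = 0) : T (∑ᶠ n, g n) = ∑ᶠ n, T (g n) := by
  rw [finsum_eq_range h, map_sum, finsum_eq_range]
  intro n hn
  rw [h n hn, map_zero]

theorem finsum_tail {g : ℕ → M} (j : ℕ) (h : ∀ n < j, g n = 0) {K : ℕ}
    (hK : ∀ n, K ≤ n → g n = 0) : ∑ᶠ n, g n = ∑ᶠ n, g (n + j) := by
  rw [finsum_eq_range (K := j + K) fun n hn => hK n (by omega),
    finsum_eq_range (K := K) fun n hn => hK _ (by omega), Finset.sum_range_add,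
    Finset.sum_eq_zero fun n hn => h n (by simpa using hn), zero_add]
  simp only [add_comm]

/-- `∑ₙ φₙ gₙ` for a power series `φ` and an eventually vanishing sequence `g`. -/
def lsum (φ : PowerSeries ℂ) (g : ℕ → M) : M := ∑ᶠ n, PowerSeries.coeff n φ • g n

theorem lsum_eq_range (φ : PowerSeries ℂ) {g : ℕ → M} {K : ℕ} (h : ∀ n, K ≤ n → g n = 0) :
    lsum φ g = ∑ n ∈ Finset.range K, PowerSeries.coeff n φ • g n :=
  finsum_eq_range fun n hn => by rw [h n hn, smul_zero]

theorem lsum_eq_zero (φ : PowerSeries ℂ) {g : ℕ → M} (h : ∀ n, g n = 0) : lsum φ g = 0 := by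
  simp [lsum, h]

theorem map_lsum {N : Type*} [AddCommGroup N] [Module ℂ N] (T : M →ₗ[ℂ] N) (φ : PowerSeries ℂ)
    {g : ℕ → M} {K : ℕ} (h : ∀ n, K ≤ n → g n = 0) : T (lsum φ g) = lsum φ fun n => T (g n) := by
  rw [lsum, map_finsum_of_bound T (K := K) fun n hn => by rw [h n hn, smul_zero], lsum]
  simp

theorem lsum_swap (φ ψ : PowerSeries ℂ) {g : ℕ → ℕ → M} (K : ℕ)
    (h : ∀ i j, K ≤ i ∨ K ≤ j → g i j = 0) :
    lsum φ (fun i => lsum ψ fun j => g i j) = lsum ψ fun j => lsum φ fun i => g i j := by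
  have h1 : ∀ i, lsum ψ (fun j => g i j) = ∑ j ∈ Finset.range K, PowerSeries.coeff j ψ • g i j :=
    fun i => lsum_eq_range ψ fun j hj => h i j (Or.inr hj)
  have h2 : ∀ j, lsum φ (fun i => g i j) = ∑ i ∈ Finset.range K, PowerSeries.coeff i φ • g i j :=
    fun j => lsum_eq_range φ fun i hi => h i j (Or.inl hi)
  simp only [h1, h2]
  rw [lsum_eq_range φ (K := K), lsum_eq_range ψ (K := K)]
  · simp only [Finset.smul_sum]
    rw [Finset.sum_comm]
    simp only [smul_comm (PowerSeries.coeff _ φ)]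
  · exact fun j hj => Finset.sum_eq_zero fun i _ => by rw [h i j (Or.inr hj), smul_zero]
  · exact fun i hi => Finset.sum_eq_zero fun j _ => by rw [h i j (Or.inl hi), smul_zero]

/-- Cauchy product. This is the device by which a structure function and a contraction merge into a
single series. -/
theorem lsum_mul (φ ψ : PowerSeries ℂ) {g : ℕ → M} {K : ℕ} (h : ∀ n, K ≤ n → g n = 0) :
    lsum φ (fun n => lsum ψ fun m => g (n + m)) = lsum (φ * ψ) g := by
  have h1 : ∀ n, lsum ψ (fun m => g (n + m)) =
      ∑ m ∈ Finset.range K, PowerSeries.coeff m ψ • g (n + m) :=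
    fun n => lsum_eq_range ψ fun m hm => h _ (by omega)
  simp only [h1]
  rw [lsum_eq_range φ (K := K), lsum_eq_range (φ * ψ) h]
  · simp only [PowerSeries.coeff_mul, Finset.smul_sum, Finset.sum_smul, smul_smul]
    rw [Finset.sum_sigma', Finset.sum_sigma']
    have : ∑ x ∈ (Finset.range K).sigma fun n => Finset.HasAntidiagonal.antidiagonal n,
        (PowerSeries.coeff x.2.1 φ * PowerSeries.coeff x.2.2 ψ) • g x.1 =
        ∑ x ∈ (Finset.range K ×ˢ Finset.range K).filter fun x => x.1 + x.2 < K,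
          (PowerSeries.coeff x.1 φ * PowerSeries.coeff x.2 ψ) • g (x.1 + x.2) := by
      refine Finset.sum_bij' (fun x _ => x.2) (fun x _ => ⟨x.1 + x.2, x⟩) ?_ ?_ ?_ ?_ ?_
      · rintro ⟨n, a, b⟩ hx
        simp at hx ⊢
        omega
      · rintro ⟨a, b⟩ hx
        simp at hx ⊢
        omega
      · rintro ⟨n, a, b⟩ hx
        simp at hx ⊢
        exact hx.2
      · rintro ⟨a, b⟩ hx
        rfl
      · rintro ⟨n, a, b⟩ hx
        simp at hx
        rw [hx.2]
    rw [this, Finset.sum_filter, ← Finset.sum_sigma' _ _ fun n m =>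
      (PowerSeries.coeff n φ * PowerSeries.coeff m ψ) • g (n + m), ← Finset.sum_product']
    refine Finset.sum_congr rfl fun x _ => ?_
    split_ifs with hx
    · rfl
    · rw [h _ (by omega), smul_zero]
  · exact fun n hn => Finset.sum_eq_zero fun m _ => by rw [h _ (by omega), smul_zero]

/-- The action of a creation series on the coefficients of a formal series. -/
def wrap (e : ℕ → Module.End ℂ M) (G : ℤ → M) (k : ℤ) : M := ∑ᶠ n : ℕ, e n (G (k + n))

theorem wrap_eq_zero (e : ℕ → Module.End ℂ M) {G : ℤ → M} {k : ℤ} (h : ∀ n, k ≤ n → G n = 0) :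
    wrap e G k = 0 := by
  simp [wrap, h]

/-- Creation series in two different variables commute; the bound on `H` makes both iterated sums
finite, so that they may be exchanged. -/
theorem wrap_comm {e f : ℕ → Module.End ℂ M} (hc : ∀ m n, Commute (e m) (f n)) {H : ℤ → ℤ → M}
    {D : ℤ} (hH : ∀ k l, D ≤ k ∨ D ≤ l → H k l = 0) (k l : ℤ) :
    wrap e (fun k => wrap f (fun l => H k l) l) k = wrap f (fun l => wrap e (fun k => H k l) k) l := by
  unfold wrap
  have h1 : ∀ n : ℕ, e n (∑ᶠ m : ℕ, f m (H (k + n) (l + m))) =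
      ∑ᶠ m : ℕ, e n (f m (H (k + n) (l + m))) := fun n =>
    map_finsum_of_bound _ (K := (D - l).toNat) fun m hm => by rw [hH _ _ (by omega), map_zero]
  have h2 : ∀ m : ℕ, f m (∑ᶠ n : ℕ, e n (H (k + n) (l + m))) =
      ∑ᶠ n : ℕ, f m (e n (H (k + n) (l + m))) := fun m =>
    map_finsum_of_bound _ (K := (D - k).toNat) fun n hn => by rw [hH _ _ (by omega), map_zero]
  simp only [h1, h2]
  rw [finsum_swap ((D - l).toNat + (D - k).toNat) fun i j hij => by
    rw [hH _ _ (by omega), map_zero, map_zero]]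
  refine finsum_congr fun m => finsum_congr fun n => ?_
  exact LinearMap.congr_fun (hc n m).eq _

theorem wrap_lsum (e : ℕ → Module.End ℂ M) (φ : PowerSeries ℂ) {G : ℤ → ℕ → M} (k : ℤ) (K : ℕ)
    (h : ∀ (n j : ℕ), K ≤ n ∨ K ≤ j → G (k + n) j = 0) :
    wrap e (fun k => lsum φ (G k)) k = lsum φ fun j => wrap e (fun k => G k j) k := by
  unfold wrap
  have h1 : ∀ n : ℕ, e n (lsum φ (G (k + n))) = ∑ᶠ j, PowerSeries.coeff j φ • e n (G (k + n) j) :=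
    fun n => map_lsum _ φ (K := K) fun j hj => h n j (Or.inr hj)
  simp only [h1]
  rw [finsum_swap K fun i j hij => by rw [h i j hij, map_zero, smul_zero]]
  refine finsum_congr fun j => ?_
  exact (smul_finsum _ _).symm

end LocallyFinite

/-! ### Vertex operators, contractions and normal ordering -/

section VertexSystems

variable {J M : Type*} [AddCommGroup M] [Module ℂ M]

/-- Families of commuting creation operators `a A m` and commuting annihilation operators `b A m` with
scalar commutators `[b A m, a B n] = δ_{m,n} c A B m`, such that annihilation is locally nilpotent. -/
structure IsVertexSystem (a b : J → ℕ → Module.End ℂ M) (c : J → J → ℕ → ℂ) : Prop where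
  aa : ∀ A B m n, Commute (a A m) (a B n)
  bb : ∀ A B m n, Commute (b A m) (b B n)
  ba : ∀ A B m n, 0 < m → 0 < n →
    b A m * a B n = a B n * b A m + if n = m then c A B m • (1 : Module.End ℂ M) else 0
  nil : ∀ v, ∃ D : ℕ, ∀ A r, D ≤ r → expCoeff (b A) r v = 0

variable {a b : J → ℕ → Module.End ℂ M} {c : J → J → ℕ → ℂ} (S : IsVertexSystem a b c)
include S

theorem IsVertexSystem.expZ_nil (v : M) : ∃ D : ℤ, 0 ≤ D ∧ ∀ A k, D ≤ k → expZ (b A) k v = 0 := by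
  obtain ⟨D, hD⟩ := S.nil v
  refine ⟨D, by omega, fun A k hk => ?_⟩
  lift k to ℕ using by omega
  rw [expZ_natCast]
  exact hD A k (by omega)

/-- Local nilpotence of annihilation makes the sequence of operators locally finite, so `locSum`
takes its genuine value and not the default 0. -/
theorem IsVertexSystem.vertexMode_apply (A : J) (s : ℤ) (v : M) :
    vertexMode (a A) (b A) s v = wrap (expCoeff (a A)) (fun k => expZ (b A) k v) s := by
  have h : ∀ v, {n : ℕ | (expCoeff (a A) n * expZ (b A) (n + s)) v ≠ 0}.Finite := by
    intro v
    obtain ⟨D, hD0, hD⟩ := S.expZ_nil v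
    refine finite_support_of_bound (K := (D - s).toNat) fun n hn => ?_
    rw [Module.End.mul_apply, hD A _ (by omega), map_zero]
  have h' : vertexMode (a A) (b A) s = locSum fun n : ℕ => expCoeff (a A) n * expZ (b A) (n + s) := rfl
  rw [h', locSum, dif_pos h]
  change ∑ᶠ n : ℕ, expCoeff (a A) n (expZ (b A) (n + s) v) = _
  simp only [wrap, add_comm]

/-- The contraction of two vertex operators. -/
def contr (c : J → J → ℕ → ℂ) (A B : J) : PowerSeries ℂ := PowerSeries.mk (expCoeff (c A B))

theorem IsVertexSystem.expZ_comm (A B : J) (k l : ℤ) : Commute (expZ (b A) k) (expZ (b B) l) := by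
  unfold expZ
  split_ifs
  · exact expCoeff_commute (S.bb A A) (S.bb B B) (S.bb A B) _ _
  · simp
  · simp
  · simp

/-- Pointwise form of `expCoeff_reorder`. Since `expZ` vanishes in negative degrees, the finite sum
over j ≤ k can be written as a full `lsum`. -/
theorem IsVertexSystem.expZ_reorder (A B : J) (k n : ℤ) (w : M) :
    expZ (b A) k (expZ (a B) n w) =
      lsum (contr c A B) fun j => expZ (a B) (n - j) (expZ (b A) (k - j) w) := by
  rcases lt_or_ge k 0 with hk | hk
  · rw [expZ_of_neg _ hk, lsum_eq_zero]
    · rfl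
    · intro j
      rw [expZ_of_neg (b A) (by omega)]
      simp
  · lift k to ℕ using hk
    rw [expZ_natCast, ← Module.End.mul_apply, expCoeff_reorder (S.aa B B) (S.bb A A)
      (fun m n hm hn => S.ba A B m n hm hn), lsum_eq_range (K := k + 1), LinearMap.sum_apply,
      Finset.Nat.sum_antidiagonal_eq_sum_range_succ_mk]
    · refine Finset.sum_congr rfl fun j hj => ?_
      have : (k : ℤ) - j = (k - j : ℕ) := by
        have := Finset.mem_range.mp hj
        omega
      rw [this, expZ_natCast, contr, PowerSeries.coeff_mk]
      rfl
    · intro j hj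
      rw [expZ_of_neg (b A) (by omega)]
      simp

/-- Wick's theorem in one step: moving an annihilation series through a creation series produces the
contraction, which lowers the degree in the first variable and raises it in the second. -/
theorem IsVertexSystem.expZ_wrap (A B : J) {G : ℤ → M} {D : ℤ} (hG : ∀ k, D ≤ k → G k = 0)
    (k l : ℤ) : expZ (b A) k (wrap (expCoeff (a B)) G l) =
      lsum (contr c A B) fun j =>
        wrap (expCoeff (a B)) (fun l => expZ (b A) (k - j) (G l)) (l + j) := by
  have h1 : ∀ n : ℕ, expZ (b A) k (expCoeff (a B) n (G (l + n))) =
      lsum (contr c A B) fun j => expZ (a B) (n - j) (expZ (b A) (k - j) (G (l + n))) := by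
    intro n
    rw [← expZ_natCast, S.expZ_reorder]
  have hz : ∀ n j : ℕ, (D - l).toNat + (k + 1).toNat ≤ n ∨ (D - l).toNat + (k + 1).toNat ≤ j →
      expZ (a B) (n - j) (expZ (b A) (k - j) (G (l + n))) = 0 := by
    intro n j h
    rcases h with h | h
    · rw [hG _ (by omega), map_zero, map_zero]
    · rw [expZ_of_neg (b A) (by omega), LinearMap.zero_apply, map_zero]
  unfold wrap
  rw [map_finsum_of_bound _ (K := (D - l).toNat) fun n hn => by rw [hG _ (by omega), map_zero]]
  simp only [h1]
  unfold lsum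
  rw [finsum_swap ((D - l).toNat + (k + 1).toNat) fun n j h => by simp only [hz n j h, smul_zero]]
  refine finsum_congr fun j => ?_
  rw [← smul_finsum]
  congr 1
  beta_reduce
  -- The terms n < j contain a creation coefficient of negative degree. Dropping them and replacing
  -- n by n + j turns the index l into l + j.
  rw [finsum_tail j (K := (D - l).toNat)]
  · refine finsum_congr fun n => ?_
    have e1 : (((n + j : ℕ) : ℤ) - j) = n := by push_cast; ring
    have e2 : l + ((n + j : ℕ) : ℤ) = l + j + n := by push_cast; ring
    rw [e1, e2, expZ_natCast]
  · intro n hn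
    rw [expZ_of_neg (a B) (by omega), LinearMap.zero_apply]
  · intro n hn
    rw [hG _ (by omega), map_zero, map_zero]

omit S in
/-- The coefficients of the normally ordered product of two vertex operators, applied to a vector. -/
def normal2 (a b : J → ℕ → Module.End ℂ M) (A B : J) (v : M) (k l : ℤ) : M :=
  wrap (expCoeff (a A)) (fun k => wrap (expCoeff (a B))
    (fun l => expZ (b A) k (expZ (b B) l v)) l) k

omit S in
/-- The coefficients of the normally ordered product of three vertex operators. -/
def normal3 (a b : J → ℕ → Module.End ℂ M) (A B C : J) (v : M) (k l m : ℤ) : M :=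
  wrap (expCoeff (a A)) (fun k => wrap (expCoeff (a B)) (fun l => wrap (expCoeff (a C))
    (fun m => expZ (b A) k (expZ (b B) l (expZ (b C) m v))) m) l) k

/-- Annihilation series commute, so whichever index is large, its factor can be applied to the
vector first. -/
theorem IsVertexSystem.expZ2_nil (v : M) : ∃ D : ℤ, 0 ≤ D ∧ ∀ A B k l, D ≤ k ∨ D ≤ l →
    expZ (b A) k (expZ (b B) l v) = 0 := by
  obtain ⟨D, hD0, hD⟩ := S.expZ_nil v
  refine ⟨D, hD0, fun A B k l h => ?_⟩
  rcases h with h | h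
  · rw [← Module.End.mul_apply, (S.expZ_comm A B k l).eq, Module.End.mul_apply, hD A k h, map_zero]
  · rw [hD B l h, map_zero]

theorem IsVertexSystem.expZ3_nil (v : M) : ∃ D : ℤ, 0 ≤ D ∧ ∀ A B C k l m, D ≤ k ∨ D ≤ l ∨ D ≤ m →
    expZ (b A) k (expZ (b B) l (expZ (b C) m v)) = 0 := by
  obtain ⟨D, hD0, hD⟩ := S.expZ2_nil v
  refine ⟨D, hD0, fun A B C k l m h => ?_⟩
  rcases h with h | h
  · rw [← Module.End.mul_apply, (S.expZ_comm A B k l).eq, Module.End.mul_apply,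
      hD A C k m (Or.inl h), map_zero]
  · rw [hD B C l m h, map_zero]

theorem IsVertexSystem.normal2_bound (A B : J) (v : M) :
    ∃ D : ℤ, ∀ k l, D ≤ k ∨ D ≤ l → normal2 a b A B v k l = 0 := by
  obtain ⟨D, hD0, hD⟩ := S.expZ2_nil v
  refine ⟨D, fun k l h => ?_⟩
  unfold normal2
  rcases h with h | h
  · exact wrap_eq_zero _ fun k' hk' => wrap_eq_zero _ fun l' _ => hD _ _ _ _ (by omega)
  · exact wrap_eq_zero _ fun k' _ => wrap_eq_zero _ fun l' hl' => hD _ _ _ _ (by omega)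

theorem IsVertexSystem.normal3_bound (A B C : J) (v : M) :
    ∃ D : ℤ, ∀ k l m, D ≤ k ∨ D ≤ l ∨ D ≤ m → normal3 a b A B C v k l m = 0 := by
  obtain ⟨D, hD0, hD⟩ := S.expZ3_nil v
  refine ⟨D, fun k l m h => ?_⟩
  unfold normal3
  rcases h with h | h | h
  · exact wrap_eq_zero _ fun k' hk' => wrap_eq_zero _ fun l' _ => wrap_eq_zero _ fun m' _ =>
      hD _ _ _ _ _ _ (by omega)
  · exact wrap_eq_zero _ fun k' _ => wrap_eq_zero _ fun l' hl' => wrap_eq_zero _ fun m' _ =>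
      hD _ _ _ _ _ _ (by omega)
  · exact wrap_eq_zero _ fun k' _ => wrap_eq_zero _ fun l' _ => wrap_eq_zero _ fun m' hm' =>
      hD _ _ _ _ _ _ (by omega)

theorem IsVertexSystem.expCoeff_a_comm (A B : J) (k l : ℕ) :
    Commute (expCoeff (a A) k) (expCoeff (a B) l) :=
  expCoeff_commute (S.aa A A) (S.aa B B) (S.aa A B) k l

/-- All creation parts stand to the left and all annihilation parts to the right, and each group
commutes. This symmetry is what makes the two sides of an exchange relation comparable. -/
theorem IsVertexSystem.normal2_swap (A B : J) (v : M) (k l : ℤ) :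
    normal2 a b A B v k l = normal2 a b B A v l k := by
  obtain ⟨D, hD0, hD⟩ := S.expZ2_nil v
  unfold normal2
  rw [wrap_comm (S.expCoeff_a_comm A B) (D := D) fun k l h => hD _ _ _ _ h]
  congr 1
  funext l
  congr 1
  funext k
  exact LinearMap.congr_fun (S.expZ_comm A B k l).eq v

theorem IsVertexSystem.normal3_swap_left (A B C : J) (v : M) (k l m : ℤ) :
    normal3 a b A B C v k l m = normal3 a b B A C v l k m := by
  obtain ⟨D, hD0, hD⟩ := S.expZ3_nil v
  unfold normal3
  rw [wrap_comm (S.expCoeff_a_comm A B) (D := D) fun k l h => wrap_eq_zero _ fun m' _ =>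
    hD _ _ _ _ _ _ (by omega)]
  congr 1
  funext l
  congr 1
  funext k
  congr 1
  funext m
  exact LinearMap.congr_fun (S.expZ_comm A B k l).eq _

theorem IsVertexSystem.normal3_swap_right (A B C : J) (v : M) (k l m : ℤ) :
    normal3 a b A B C v k l m = normal3 a b A C B v k m l := by
  obtain ⟨D, hD0, hD⟩ := S.expZ3_nil v
  unfold normal3
  congr 1
  funext k
  rw [wrap_comm (S.expCoeff_a_comm B C) (D := D) fun l m h => hD _ _ _ _ _ _ (by omega)]
  congr 1
  funext m
  congr 1
  funext l
  congr 1
  exact LinearMap.congr_fun (S.expZ_comm B C l m).eq v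

/-- The identity A(z)B(w) = c(w/z) :A(z)B(w):, read off at z^{-k} w^{-l}. -/
theorem IsVertexSystem.vertexMode_mul (A B : J) (k l : ℤ) (v : M) :
    vertexMode (a A) (b A) k (vertexMode (a B) (b B) l v) =
      lsum (contr c A B) fun j => normal2 a b A B v (k - j) (l + j) := by
  obtain ⟨D, hD0, hD⟩ := S.expZ2_nil v
  obtain ⟨D', hD0', hD'⟩ := S.expZ_nil v
  rw [S.vertexMode_apply A, S.vertexMode_apply B]
  have h1 : ∀ k, expZ (b A) k (wrap (expCoeff (a B)) (fun k => expZ (b B) k v) l) =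
      lsum (contr c A B) fun j =>
        wrap (expCoeff (a B)) (fun l => expZ (b A) (k - j) (expZ (b B) l v)) (l + j) := fun k =>
    S.expZ_wrap A B (D := D') (fun k hk => hD' B k hk) k l
  simp only [h1]
  rw [wrap_lsum _ _ k ((D - l).toNat + (D - k).toNat)]
  · congr 1
    funext j
    simp only [normal2, wrap]
    refine finsum_congr fun n => ?_
    rw [show k + (n : ℤ) - j = k - j + n by ring]
  · intro n j h
    exact wrap_eq_zero _ fun l' hl' => hD _ _ _ _ (by omega)

theorem IsVertexSystem.vertexMode_normal2 (A B C : J) (k l m : ℤ) (v : M) :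
    vertexMode (a A) (b A) k (normal2 a b B C v l m) =
      lsum (contr c A B) fun i => lsum (contr c A C) fun j =>
        normal3 a b A B C v (k - i - j) (l + i) (m + j) := by
  obtain ⟨D, hD0, hD⟩ := S.expZ3_nil v
  obtain ⟨D', hD0', hD'⟩ := S.expZ2_nil v
  rw [S.vertexMode_apply A, normal2]
  have h1 : ∀ k, expZ (b A) k (wrap (expCoeff (a B)) (fun l => wrap (expCoeff (a C))
      (fun m => expZ (b B) l (expZ (b C) m v)) m) l) =
      lsum (contr c A B) fun i => lsum (contr c A C) fun j =>
        wrap (expCoeff (a B)) (fun l => wrap (expCoeff (a C)) (fun m =>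
          expZ (b A) (k - i - j) (expZ (b B) l (expZ (b C) m v))) (m + j)) (l + i) := by
    intro k
    rw [S.expZ_wrap A B (D := D') fun l hl => wrap_eq_zero _ fun m' _ => hD' _ _ _ _ (by omega)]
    congr 1
    funext i
    rw [← wrap_lsum _ _ _ ((D - m).toNat + (D' - (l + i)).toNat)]
    · congr 1
      funext l
      rw [S.expZ_wrap A C (D := D') fun m hm => hD' _ _ _ _ (by omega)]
    · intro n j h
      exact wrap_eq_zero _ fun m' hm' => by
        rcases h with h | h
        · rw [hD' _ _ _ _ (Or.inl (by omega)), map_zero]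
        · exact hD _ _ _ _ _ _ (by omega)
  simp only [h1]
  have hz : ∀ (n i j : ℕ), (D - k).toNat + (D - l).toNat + (D - m).toNat ≤ n ∨
      (D - l).toNat ≤ i ∨ (D - m).toNat ≤ j → wrap (expCoeff (a B)) (fun l => wrap (expCoeff (a C))
        (fun m => expZ (b A) (k + n - i - j) (expZ (b B) l (expZ (b C) m v))) (m + j)) (l + i) = 0 := by
    intro n i j h
    exact wrap_eq_zero _ fun l' hl' => wrap_eq_zero _ fun m' hm' => hD _ _ _ _ _ _ (by omega)
  rw [wrap_lsum _ _ k ((D - k).toNat + (D - l).toNat + (D - m).toNat)]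
  · congr 1
    funext i
    rw [wrap_lsum _ _ k ((D - k).toNat + (D - l).toNat + (D - m).toNat)]
    · congr 1
      funext j
      simp only [normal3, wrap]
      refine finsum_congr fun n => ?_
      rw [show k + (n : ℤ) - i - j = k - i - j + n by ring]
    · intro n j h
      exact hz n i j (by omega)
  · intro n i h
    exact lsum_eq_zero _ fun j => hz n i j (by omega)

/-- Three factors give the product of the three pairwise contractions; the indices h, i, j belong to
the pairs (B, C), (A, B) and (A, C). -/
theorem IsVertexSystem.vertexMode_mul_mul (A B C : J) (k l m : ℤ) (v : M) :
    vertexMode (a A) (b A) k (vertexMode (a B) (b B) l (vertexMode (a C) (b C) m v)) =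
      lsum (contr c B C) fun h => lsum (contr c A B) fun i => lsum (contr c A C) fun j =>
        normal3 a b A B C v (k - i - j) (l - h + i) (m + h + j) := by
  obtain ⟨D, hD⟩ := S.normal2_bound B C v
  rw [S.vertexMode_mul B C, map_lsum _ _ (K := (D - m).toNat) fun h hh => hD _ _ (by omega)]
  congr 1
  funext h
  rw [S.vertexMode_normal2]

theorem IsVertexSystem.vertexMode_trunc (A : J) (v : M) :
    ∃ D : ℤ, ∀ s, D ≤ s → vertexMode (a A) (b A) s v = 0 := by
  obtain ⟨D, hD0, hD⟩ := S.expZ_nil v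
  refine ⟨D, fun s hs => ?_⟩
  rw [S.vertexMode_apply]
  exact wrap_eq_zero _ fun k hk => hD A k (by omega)

end VertexSystems

/-! ### The Serre identity for symmetric coefficients -/

section FormalIdentities

variable {M : Type*} [AddCommGroup M] [Module ℂ M]

theorem finsum_nat_eq_zero_add {g : ℕ → M} {K : ℕ} (h : ∀ n, K ≤ n → g n = 0) :
    ∑ᶠ n, g n = g 0 + ∑ᶠ n, g (n + 1) := by
  rw [finsum_eq_range (K := K + 1) fun n hn => h n (by omega), Finset.sum_range_succ',
    finsum_eq_range (K := K) fun n hn => h _ (by omega), add_comm]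

/-- Multiplying a geometric expansion by its linear denominator leaves only the first term. The
recurrences in `formal_serre` are all instances of this. -/
theorem finsum_sub_smul_shift {g f : ℕ → M} {r : ℂ} {x : M} {K : ℕ} (h : ∀ n, K ≤ n → g n = 0)
    (h0 : g 0 = x) (hs : ∀ n, g (n + 1) = r • f n) : ∑ᶠ n, g n - r • ∑ᶠ n, f n = x := by
  rw [finsum_nat_eq_zero_add h, h0, smul_finsum]
  simp only [hs, add_sub_cancel_right]

/-- Iterated `lsum` in three variables. -/
def lsum3 (φ ψ χ : PowerSeries ℂ) (g : ℕ → ℕ → ℕ → M) : M :=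
  lsum φ fun h => lsum ψ fun i => lsum χ fun j => g h i j

theorem lsum3_mul (φ ψ χ φ' ψ' χ' : PowerSeries ℂ) {g : ℕ → ℕ → ℕ → M} {K : ℕ}
    (hg : ∀ h i j, K ≤ h ∨ K ≤ i ∨ K ≤ j → g h i j = 0) :
    lsum3 φ ψ χ (fun h i j => lsum3 φ' ψ' χ' fun h' i' j' => g (h + h') (i + i') (j + j')) =
      lsum3 (φ * φ') (ψ * ψ') (χ * χ') g := by
  unfold lsum3
  rw [← lsum_mul φ φ' (K := K) fun h hh => lsum_eq_zero _ fun i => lsum_eq_zero _ fun j =>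
    hg _ _ _ (by omega)]
  congr 1
  funext h
  have e1 : ∀ i, (lsum χ fun j => lsum φ' fun h' => lsum ψ' fun i' => lsum χ' fun j' =>
      g (h + h') (i + i') (j + j')) = lsum φ' fun h' => lsum ψ' fun i' => lsum χ fun j =>
        lsum χ' fun j' => g (h + h') (i + i') (j + j') := by
    intro i
    rw [lsum_swap _ _ K fun j h' hj => lsum_eq_zero _ fun i' => lsum_eq_zero _ fun j' =>
      hg _ _ _ (by omega)]
    congr 1
    funext h'
    rw [lsum_swap _ _ K fun j i' hj => lsum_eq_zero _ fun j' => hg _ _ _ (by omega)]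
  simp only [e1]
  rw [lsum_swap _ _ K fun i h' hi => lsum_eq_zero _ fun i' => lsum_eq_zero _ fun j =>
    lsum_eq_zero _ fun j' => hg _ _ _ (by omega)]
  congr 1
  funext h'
  rw [← lsum_mul ψ ψ' (K := K) fun i hi => lsum_eq_zero _ fun j => hg _ _ _ (by omega)]
  congr 1
  funext i
  congr 1
  funext i'
  rw [← lsum_mul χ χ' (K := K) fun j hj => hg _ _ _ (by omega)]

theorem finsum_triple_eq_lsum3 (φ ψ χ : PowerSeries ℂ) {g : ℕ → ℕ → ℕ → M} {K : ℕ}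
    (hg : ∀ h i j, K ≤ h ∨ K ≤ i ∨ K ≤ j → g h i j = 0) :
    ∑ᶠ s : ℕ × ℕ × ℕ, (PowerSeries.coeff s.1 φ * PowerSeries.coeff s.2.1 ψ *
      PowerSeries.coeff s.2.2 χ) • g s.1 s.2.1 s.2.2 = lsum3 φ ψ χ g := by
  have hfin : (Function.support fun s : ℕ × ℕ × ℕ => (PowerSeries.coeff s.1 φ *
      PowerSeries.coeff s.2.1 ψ * PowerSeries.coeff s.2.2 χ) • g s.1 s.2.1 s.2.2).Finite := by
    refine ((Finset.range K) ×ˢ (Finset.range K) ×ˢ (Finset.range K)).finite_toSet.subset ?_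
    intro s hs
    by_contra hc
    refine hs ?_
    simp only [Finset.coe_product, Set.mem_prod, Finset.mem_coe, Finset.mem_range] at hc
    change _ • g s.1 s.2.1 s.2.2 = 0
    rw [hg _ _ _ (by omega), smul_zero]
  rw [finsum_curry _ hfin]
  unfold lsum3 lsum
  refine finsum_congr fun h => ?_
  rw [finsum_curry, smul_finsum]
  · refine finsum_congr fun i => ?_
    rw [smul_finsum, smul_finsum]
    refine finsum_congr fun j => ?_
    rw [smul_smul, smul_smul]
  · refine ((Finset.range K) ×ˢ (Finset.range K)).finite_toSet.subset ?_
    intro s hs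
    by_contra hc
    refine hs ?_
    simp only [Finset.coe_product, Set.mem_prod, Finset.mem_coe, Finset.mem_range] at hc
    change _ • g h s.1 s.2 = 0
    rw [hg _ _ _ (by omega), smul_zero]

/-- The geometric series `∑ ρⁿ xⁿ`. -/
def geom (ρ : ℂ) : PowerSeries ℂ := PowerSeries.mk fun n => ρ ^ n

/-- The quadratic factor `(1 - ρ² x) (1 - x)`. -/
def quad (ρ : ℂ) : PowerSeries ℂ :=
  (1 - PowerSeries.C (ρ ^ 2) * PowerSeries.X) * (1 - PowerSeries.X)

theorem lsum_one (g : ℕ → M) : lsum 1 g = g 0 := by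
  unfold lsum
  rw [finsum_eq_single _ 0]
  · simp
  · intro n hn
    simp [PowerSeries.coeff_one, hn]

theorem lsum_one_sub (r : ℂ) (g : ℕ → M) :
    lsum (1 - PowerSeries.C r * PowerSeries.X) g = g 0 - r • g 1 := by
  unfold lsum
  rw [finsum_eq_sum_of_support_subset (s := Finset.range 2)]
  · simp [Finset.sum_range_succ, PowerSeries.coeff_one, PowerSeries.coeff_X, sub_eq_add_neg]
  · intro n hn
    by_contra hc
    apply hn
    have h2 : 2 ≤ n := not_lt.mp fun h => hc (by simpa using h)
    simp [PowerSeries.coeff_one, PowerSeries.coeff_X, show n ≠ 0 by omega, show n ≠ 1 by omega]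

theorem lsum_quad (ρ : ℂ) (g : ℕ → M) :
    lsum (quad ρ) g = g 0 - (1 + ρ ^ 2) • g 1 + ρ ^ 2 • g 2 := by
  have hq : quad ρ = PowerSeries.mk fun n => if n = 0 then 1 else if n = 1 then -(1 + ρ ^ 2) else
      if n = 2 then ρ ^ 2 else 0 := by
    have : quad ρ = 1 - PowerSeries.C (1 + ρ ^ 2) * PowerSeries.X +
        PowerSeries.C (ρ ^ 2) * PowerSeries.X ^ 2 := by
      rw [quad, map_add, map_one]; ring
    rw [this]
    ext n
    simp only [map_add, map_sub, PowerSeries.coeff_C_mul, PowerSeries.coeff_one,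
      PowerSeries.coeff_X_pow, PowerSeries.coeff_mk]
    rcases n with _ | _ | _ | n <;> simp [← map_pow]
  rw [hq]
  unfold lsum
  rw [finsum_eq_sum_of_support_subset (s := Finset.range 3)]
  · simp [Finset.sum_range_succ]
    module
  · intro n hn
    by_contra hc
    apply hn
    have h2 : 3 ≤ n := not_lt.mp fun h => hc (by simpa using h)
    simp [show n ≠ 0 by omega, show n ≠ 1 by omega, show n ≠ 2 by omega]

theorem lsum_rescale_geom (u ρ : ℂ) (g : ℕ → M) :
    lsum (PowerSeries.rescale u (geom ρ)) g = ∑ᶠ n, (ρ * u) ^ n • g n := by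
  simp only [lsum, geom, PowerSeries.coeff_rescale, PowerSeries.coeff_mk, mul_pow, mul_comm]

theorem double_finsum_sub_smul {c d r : ℂ} {f g : ℕ → ℕ → M} (K : ℕ)
    (hf : ∀ i j, K ≤ i ∨ K ≤ j → f i j = 0) (hg : ∀ i j, K ≤ i ∨ K ≤ j → g i j = 0) :
    ∑ᶠ i : ℕ, c ^ i • ∑ᶠ j : ℕ, d ^ j • (f i j - r • g i j) =
      ∑ᶠ i : ℕ, ∑ᶠ j : ℕ, (c ^ i * d ^ j) • f i j -
        r • ∑ᶠ i : ℕ, ∑ᶠ j : ℕ, (c ^ i * d ^ j) • g i j := by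
  have h1 : ∀ i, ∑ᶠ j : ℕ, d ^ j • (f i j - r • g i j) =
      ∑ j ∈ Finset.range K, d ^ j • (f i j - r • g i j) := fun i =>
    finsum_eq_range fun j hj => by rw [hf _ _ (Or.inr hj), hg _ _ (Or.inr hj)]; simp
  have h2 : ∀ i, ∑ᶠ j : ℕ, (c ^ i * d ^ j) • f i j =
      ∑ j ∈ Finset.range K, (c ^ i * d ^ j) • f i j := fun i =>
    finsum_eq_range fun j hj => by rw [hf _ _ (Or.inr hj)]; simp
  have h3 : ∀ i, ∑ᶠ j : ℕ, (c ^ i * d ^ j) • g i j =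
      ∑ j ∈ Finset.range K, (c ^ i * d ^ j) • g i j := fun i =>
    finsum_eq_range fun j hj => by rw [hg _ _ (Or.inr hj)]; simp
  simp only [h1, h2, h3]
  rw [finsum_eq_range (K := K), finsum_eq_range (K := K), finsum_eq_range (K := K)]
  · simp only [Finset.smul_sum, ← Finset.sum_sub_distrib]
    refine Finset.sum_congr rfl fun i _ => Finset.sum_congr rfl fun j _ => ?_
    module
  · exact fun i hi => Finset.sum_eq_zero fun j _ => by rw [hg _ _ (Or.inl hi)]; simp
  · exact fun i hi => Finset.sum_eq_zero fun j _ => by rw [hf _ _ (Or.inl hi)]; simp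
  · exact fun i hi => by
      rw [Finset.sum_eq_zero fun j _ => by rw [hf _ _ (Or.inl hi), hg _ _ (Or.inl hi)]; simp]; simp

/-- The Serre identity for coefficients `N` of a normally ordered product symmetric in the first two
variables. -/
theorem formal_serre {N : ℤ → ℤ → ℤ → M} {D : ℤ}
    (hN : ∀ k l m, D ≤ k ∨ D ≤ l ∨ D ≤ m → N k l m = 0) (hsymm : ∀ k l m, N k l m = N l k m)
    {ρ u : ℂ} (hρ : ρ ≠ 0) (hu : u ≠ 0) (Θ : ℤ → ℤ → ℤ → M)
    (hΘ : ∀ k l m, Θ k l m =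
      lsum3 (PowerSeries.rescale u (geom ρ)) (PowerSeries.rescale u (geom ρ)) (quad ρ)
          (fun h i j => N (k + 2 + h - j) (l + i + j) (m - 2 - h - i)) +
      ((ρ + ρ⁻¹) * u⁻¹) •
        lsum3 (PowerSeries.rescale u⁻¹ (geom ρ)) (PowerSeries.rescale u (geom ρ)) (quad ρ)
          (fun h i j => N (k + 1 - h - j) (l + i + j) (m - 1 + h - i)) +
      (u⁻¹ ^ 2) •
        lsum3 (PowerSeries.rescale u⁻¹ (geom ρ)) (PowerSeries.rescale u⁻¹ (geom ρ)) (quad ρ)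
          (fun h i j => N (k + 1 - h - j) (l - 1 - i + j) (m + h + i))) (k l m : ℤ) :
    Θ k l m + Θ l k m = 0 := by
  -- In terms of generating functions N is N(z₁, z₂, w), symmetric in z₁ and z₂, and L stands for
  -- (z₁ - z₂)N, which is antisymmetric. The factor z₁ - z₂ comes from z₁² times `quad` at z₂/z₁,
  -- which is (z₁ - ρ²z₂)(z₁ - z₂).
  set L : ℤ → ℤ → ℤ → M := fun k l m => N (k + 1) l m - N k (l + 1) m with hL
  have hLb : ∀ k l m, D ≤ k ∨ D ≤ l ∨ D ≤ m → L k l m = 0 := by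
    intro k l m h
    rw [hL]
    beta_reduce
    rw [hN _ _ _ (by omega), hN _ _ _ (by omega), sub_zero]
  have hLs : ∀ k l m, L k l m = -L l k m := by
    intro k l m
    simp only [hL]
    rw [hsymm (l + 1), hsymm l, neg_sub]
  have hquad : ∀ k l m, N (k + 2) l m - (1 + ρ ^ 2) • N (k + 1) (l + 1) m + ρ ^ 2 • N k (l + 2) m =
      L (k + 1) l m - ρ ^ 2 • L k (l + 1) m := by
    intro k l m
    simp only [hL, add_assoc, one_add_one_eq_two]
    module
  -- A, P, B are L divided by (w - ρu z₁)(w - ρu z₂), by (z₁ - ρu⁻¹w)(w - ρu z₂) and by (z₁ -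
  -- ρu⁻¹w)(z₂ - ρu⁻¹w) respectively, each expanded as the corresponding position of B(w) in the
  -- product dictates. Likewise x is L/(w - ρu z₂) and y is L/(z₁ - ρu⁻¹w).
  set A : ℤ → ℤ → ℤ → M := fun k l m =>
    ∑ᶠ n : ℕ, ∑ᶠ j : ℕ, (ρ * u) ^ (n + j) • L (k + n) (l + j) (m - n - j - 2) with hA
  set P : ℤ → ℤ → ℤ → M := fun k l m =>
    ∑ᶠ n : ℕ, ∑ᶠ j : ℕ, ((ρ * u⁻¹) ^ n * (ρ * u) ^ j) • L (k - n - 1) (l + j) (m + n - j - 1) with hP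
  set B : ℤ → ℤ → ℤ → M := fun k l m =>
    ∑ᶠ n : ℕ, ∑ᶠ j : ℕ, (ρ * u⁻¹) ^ (n + j) • L (k - n - 1) (l - j - 1) (m + n + j) with hB
  set x : ℤ → ℤ → ℤ → M := fun k l m => ∑ᶠ j : ℕ, (ρ * u) ^ j • L k (l + j) (m - j - 1) with hx
  set y : ℤ → ℤ → ℤ → M := fun k l m => ∑ᶠ n : ℕ, (ρ * u⁻¹) ^ n • L (k - n - 1) l (m + n) with hy
  have hAs : ∀ k l m, A k l m = -A l k m := by
    intro k l m
    simp only [hA]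
    rw [finsum_swap ((D - k).toNat + (D - l).toNat) fun n j h => by
      rw [hLb _ _ _ (by omega), smul_zero], ← finsum_neg_distrib]
    refine finsum_congr fun j => ?_
    rw [← finsum_neg_distrib]
    refine finsum_congr fun n => ?_
    rw [hLs, smul_neg, add_comm n j, sub_right_comm m]
  have hBs : ∀ k l m, B k l m = -B l k m := by
    intro k l m
    simp only [hB]
    rw [finsum_swap (D - m).toNat fun n j h => by
      rw [hLb _ _ _ (by omega), smul_zero], ← finsum_neg_distrib]
    refine finsum_congr fun j => ?_
    rw [← finsum_neg_distrib]
    refine finsum_congr fun n => ?_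
    rw [hLs, smul_neg, add_comm n j, add_right_comm]
  -- The recurrences clear one denominator at a time: (w - ρu z₁)A = x, (z₁ - ρu⁻¹w)P = x, (w - ρu
  -- z₂)P = y and (z₂ - ρu⁻¹w)B = y.
  have R1 : ∀ k l m, A k l (m + 1) - (ρ * u) • A (k + 1) l m = x k l m := by
    intro k l m
    refine finsum_sub_smul_shift (K := (D - k).toNat) (fun n hn => ?_) ?_ (fun n => ?_)
    · simp only [hLb (k + n) _ _ (Or.inl (by omega)), smul_zero, finsum_zero]
    · simp only [hx]
      refine finsum_congr fun j => ?_
      rw [zero_add, Nat.cast_zero, add_zero, sub_zero, show m + 1 - j - 2 = m - j - 1 by ring]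
    · rw [smul_finsum]
      refine finsum_congr fun j => ?_
      rw [smul_smul, ← pow_succ', add_right_comm n 1 j]
      congr 2 <;> push_cast <;> ring
  have R3 : ∀ k l m, P (k + 1) l m - (ρ * u⁻¹) • P k l (m + 1) = x k l m := by
    intro k l m
    refine finsum_sub_smul_shift (K := (D - m).toNat + (D - l).toNat + 1) (fun n hn => ?_) ?_
      (fun n => ?_)
    · rw [← finsum_zero (α := ℕ)]
      refine finsum_congr fun j => ?_
      rw [hLb _ _ _ (by omega), smul_zero]
    · simp only [hx]
      refine finsum_congr fun j => ?_
      rw [pow_zero, one_mul, Nat.cast_zero, add_zero, sub_zero, add_sub_cancel_right]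
    · rw [smul_finsum]
      refine finsum_congr fun j => ?_
      rw [smul_smul, pow_succ', mul_assoc]
      congr 2 <;> push_cast <;> ring
  have R4 : ∀ k l m, P k l (m + 1) - (ρ * u) • P k (l + 1) m = y k l m := by
    intro k l m
    have hPs : ∀ k l m, P k l m = ∑ᶠ j : ℕ, ∑ᶠ n : ℕ, ((ρ * u⁻¹) ^ n * (ρ * u) ^ j) •
        L (k - n - 1) (l + j) (m + n - j - 1) := by
      intro k l m
      simp only [hP]
      exact finsum_swap ((D - m).toNat + (D - l).toNat + (D - l).toNat + 1) fun n j h => by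
        rw [hLb _ _ _ (by omega), smul_zero]
    rw [hPs, hPs]
    refine finsum_sub_smul_shift (K := (D - l).toNat) (fun j hj => ?_) ?_ (fun j => ?_)
    · rw [← finsum_zero (α := ℕ)]
      refine finsum_congr fun n => ?_
      rw [hLb _ _ _ (by omega), smul_zero]
    · simp only [hy]
      refine finsum_congr fun n => ?_
      rw [pow_zero, mul_one, Nat.cast_zero, add_zero, sub_zero,
        show m + 1 + (n : ℤ) - 1 = m + n by ring]
    · rw [smul_finsum]
      refine finsum_congr fun n => ?_
      rw [smul_smul, pow_succ', mul_left_comm]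
      congr 2 <;> push_cast <;> ring
  have R8 : ∀ k l m, B k (l + 1) m - (ρ * u⁻¹) • B k l (m + 1) = y k l m := by
    intro k l m
    have hBs' : ∀ k l m, B k l m = ∑ᶠ j : ℕ, ∑ᶠ n : ℕ, (ρ * u⁻¹) ^ (n + j) •
        L (k - n - 1) (l - j - 1) (m + n + j) := by
      intro k l m
      simp only [hB]
      exact finsum_swap (D - m).toNat fun n j h => by
        rw [hLb _ _ _ (by omega), smul_zero]
    rw [hBs', hBs']
    refine finsum_sub_smul_shift (K := (D - m).toNat) (fun j hj => ?_) ?_ (fun j => ?_)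
    · rw [← finsum_zero (α := ℕ)]
      refine finsum_congr fun n => ?_
      rw [hLb _ _ _ (by omega), smul_zero]
    · simp only [hy]
      refine finsum_congr fun n => ?_
      rw [add_zero, Nat.cast_zero, add_zero, sub_zero, add_sub_cancel_right]
    · rw [smul_finsum]
      refine finsum_congr fun n => ?_
      rw [smul_smul, ← pow_succ', add_assoc n j 1]
      congr 2 <;> push_cast <;> ring
  -- In generating functions Θ is z₁ - ρ²z₂ times A + (ρ + ρ⁻¹)u⁻¹P + u⁻²B.
  have T : ∀ k l m, Θ k l m = (A (k + 1) l m - ρ ^ 2 • A k (l + 1) m) +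
      ((ρ + ρ⁻¹) * u⁻¹) • (P (k + 1) l m - ρ ^ 2 • P k (l + 1) m) +
      (u⁻¹ ^ 2) • (B (k + 1) l m - ρ ^ 2 • B k (l + 1) m) := by
    intro k l m
    have cN : ∀ {a a' b b' c c' : ℤ}, a = a' → b = b' → c = c' → N a b c = N a' b' c' := by
      rintro _ _ _ _ _ _ rfl rfl rfl; rfl
    have cL : ∀ {a a' b b' c c' : ℤ}, a = a' → b = b' → c = c' → L a b c = L a' b' c' := by
      rintro _ _ _ _ _ _ rfl rfl rfl; rfl
    have key : ∀ (k l m : ℤ) {a b c x y : M}, a = N (k + 2) l m → b = N (k + 1) (l + 1) m →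
        c = N k (l + 2) m → x = L (k + 1) l m → y = L k (l + 1) m →
        a - (1 + ρ ^ 2) • b + ρ ^ 2 • c = x - ρ ^ 2 • y := by
      rintro k l m _ _ _ _ _ rfl rfl rfl rfl rfl
      exact hquad k l m
    have e1 : ∀ k l m, lsum3 (PowerSeries.rescale u (geom ρ)) (PowerSeries.rescale u (geom ρ))
        (quad ρ) (fun h i j => N (k + 2 + h - j) (l + i + j) (m - 2 - h - i)) =
        A (k + 1) l m - ρ ^ 2 • A k (l + 1) m := by
      intro k l m
      simp only [lsum3, lsum_rescale_geom, lsum_quad, hA, pow_add]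
      rw [← double_finsum_sub_smul ((D - k).toNat + (D - l).toNat)]
      · refine finsum_congr fun h => ?_
        congr 1
        refine finsum_congr fun i => ?_
        congr 1
        exact key (k + h) (l + i) (m - 2 - h - i) (cN (by push_cast; ring) (by push_cast; ring) (by ring))
          (cN (by push_cast; ring) (by push_cast; ring) (by ring))
          (cN (by push_cast; ring) (by push_cast; ring) (by ring))
          (cL (by ring) (by ring) (by ring)) (cL (by ring) (by ring) (by ring))
      · exact fun h i hi => hLb _ _ _ (by omega)
      · exact fun h i hi => hLb _ _ _ (by omega)
    have e2 : ∀ k l m, lsum3 (PowerSeries.rescale u⁻¹ (geom ρ)) (PowerSeries.rescale u (geom ρ))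
        (quad ρ) (fun h i j => N (k + 1 - h - j) (l + i + j) (m - 1 + h - i)) =
        P (k + 1) l m - ρ ^ 2 • P k (l + 1) m := by
      intro k l m
      simp only [lsum3, lsum_rescale_geom, lsum_quad, hP]
      rw [← double_finsum_sub_smul ((D - m).toNat + (D - l).toNat + (D - l).toNat + 1)]
      · refine finsum_congr fun h => ?_
        congr 1
        refine finsum_congr fun i => ?_
        congr 1
        exact key (k - h - 1) (l + i) (m - 1 + h - i) (cN (by push_cast; ring) (by push_cast; ring) (by ring))
          (cN (by push_cast; ring) (by push_cast; ring) (by ring))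
          (cN (by push_cast; ring) (by push_cast; ring) (by ring))
          (cL (by ring) (by ring) (by ring)) (cL (by ring) (by ring) (by ring))
      · exact fun h i hi => hLb _ _ _ (by omega)
      · exact fun h i hi => hLb _ _ _ (by omega)
    have e3 : ∀ k l m, lsum3 (PowerSeries.rescale u⁻¹ (geom ρ)) (PowerSeries.rescale u⁻¹ (geom ρ))
        (quad ρ) (fun h i j => N (k + 1 - h - j) (l - 1 - i + j) (m + h + i)) =
        B (k + 1) l m - ρ ^ 2 • B k (l + 1) m := by
      intro k l m
      simp only [lsum3, lsum_rescale_geom, lsum_quad, hB, pow_add]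
      rw [← double_finsum_sub_smul (D - m).toNat]
      · refine finsum_congr fun h => ?_
        congr 1
        refine finsum_congr fun i => ?_
        congr 1
        exact key (k - h - 1) (l - 1 - i) (m + h + i) (cN (by push_cast; ring) (by push_cast; ring) (by ring))
          (cN (by push_cast; ring) (by push_cast; ring) (by ring))
          (cN (by push_cast; ring) (by push_cast; ring) (by ring))
          (cL (by ring) (by ring) (by ring)) (cL (by ring) (by ring) (by ring))
      · exact fun h i hi => hLb _ _ _ (by omega)
      · exact fun h i hi => hLb _ _ _ (by omega)
    rw [hΘ, e1, e2, e3]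
  have a1 := R1 k l m
  have a2 := R1 l k m
  have p1 := R3 k l m
  have p2 := R4 k l m
  have p3 := R3 l k m
  have p4 := R4 l k m
  have b1 := R8 k l m
  have b2 := R8 l k m
  rw [hAs l k, hAs (l + 1) k] at a2
  rw [hBs l (k + 1), hBs l k] at b2
  rw [T, T, hAs (l + 1) k, hAs l (k + 1), hBs (l + 1) k, hBs l (k + 1)]
  -- Let x', y' be x, y with z₁ and z₂ exchanged. By antisymmetry of A and B, the symmetrized A- and
  -- B-terms are (1 + ρ²)(z₁ - z₂)A and (1 + ρ²)u⁻²(z₁ - z₂)B, that is, -(1 + ρ²)(ρu)⁻¹(x + x') and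
  -- -(1 + ρ²)u⁻²(y + y'). The P-term is computed from z₁ - ρ²z₂ = (z₁ - ρu⁻¹w) + ρu⁻¹(w - ρu z₂),
  -- which gives x + ρu⁻¹y. With the coefficient (ρ + ρ⁻¹)u⁻¹ everything cancels.
  linear_combination (norm := skip) (-(1 + ρ ^ 2) * (ρ * u)⁻¹) • a1 +
    (-(1 + ρ ^ 2) * (ρ * u)⁻¹) • a2 + ((ρ + ρ⁻¹) * u⁻¹) • (p1 + (ρ * u⁻¹) • p2) +
    ((ρ + ρ⁻¹) * u⁻¹) • (p3 + (ρ * u⁻¹) • p4) - ((1 + ρ ^ 2) * u⁻¹ ^ 2) • b1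
    - ((1 + ρ ^ 2) * u⁻¹ ^ 2) • b2
  match_scalars <;> field_simp <;> ring

end FormalIdentities

/-! ### Delta functions and specialization at proportional arguments -/

section Specialization

variable {M : Type*} [AddCommGroup M] [Module ℂ M]

theorem finsum_comm_of_finite {α β : Type*} {g : α → β → M} {s : Set α} {t : Set β}
    (hs : s.Finite) (ht : t.Finite) (h : ∀ i j, ¬(i ∈ s ∧ j ∈ t) → g i j = 0) :
    ∑ᶠ i, ∑ᶠ j, g i j = ∑ᶠ j, ∑ᶠ i, g i j := by
  have h1 : ∀ i, ∑ᶠ j, g i j = ∑ j ∈ ht.toFinset, g i j := fun i =>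
    finsum_eq_sum_of_support_subset _ fun j hj => by
      by_contra hc
      exact hj (h i j fun h' => hc (by simpa using h'.2))
  have h2 : ∀ j, ∑ᶠ i, g i j = ∑ i ∈ hs.toFinset, g i j := fun j =>
    finsum_eq_sum_of_support_subset _ fun i hi => by
      by_contra hc
      exact hi (h i j fun h' => hc (by simpa using h'.1))
  simp only [h1, h2]
  rw [finsum_eq_sum_of_support_subset (s := hs.toFinset),
    finsum_eq_sum_of_support_subset (s := ht.toFinset), Finset.sum_comm]
  · intro j hj
    by_contra hc
    exact hj (Finset.sum_eq_zero fun i _ => h i j fun h' => hc (by simpa using h'.2))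
  · intro i hi
    by_contra hc
    exact hi (Finset.sum_eq_zero fun j _ => h i j fun h' => hc (by simpa using h'.1))

theorem finsum_antidiagonal {g : ℕ → ℕ → M} {K : ℕ} (h : ∀ i j, K ≤ i ∨ K ≤ j → g i j = 0) :
    ∑ᶠ n, ∑ x ∈ Finset.HasAntidiagonal.antidiagonal n, g x.1 x.2 = ∑ᶠ i, ∑ᶠ j, g i j := by
  have h1 : ∀ i, ∑ᶠ j, g i j = ∑ j ∈ Finset.range K, g i j := fun i =>
    finsum_eq_range fun j hj => h i j (Or.inr hj)
  simp only [h1]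
  rw [finsum_eq_range (K := 2 * K), finsum_eq_range (K := K), Finset.sum_sigma',
    ← Finset.sum_product']
  · symm
    refine Finset.sum_of_injOn (fun x => ⟨x.1 + x.2, x⟩) ?_ ?_ ?_ ?_
    · intro x _ y _ hxy
      simp at hxy
      exact hxy.2
    · intro x hx
      simp at hx ⊢
      omega
    · rintro ⟨n, i, j⟩ hx hx2
      apply h
      change K ≤ i ∨ K ≤ j
      by_contra hc
      apply hx2
      simp at hx
      refine ⟨(i, j), ?_, ?_⟩
      · simp; omega
      · simp; omega
    · intro x _
      rfl
  · exact fun i hi => Finset.sum_eq_zero fun j _ => h i j (Or.inl hi)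
  · intro n hn
    refine Finset.sum_eq_zero fun x hx => h _ _ ?_
    have := Finset.HasAntidiagonal.mem_antidiagonal.mp hx
    omega

theorem finsum_int_split {G : ℤ → M} (c : ℤ) {L : ℕ} (h : ∀ k, k < c - L ∨ c + L ≤ k → G k = 0) :
    ∑ᶠ k, G k = ∑ n ∈ Finset.range L, G (c - 1 - n) + ∑ n ∈ Finset.range L, G (c + n) := by
  rw [finsum_eq_sum_of_support_subset (s := Finset.Ico (c - L) (c + L))]
  · rw [← Finset.sum_range_reflect (fun n : ℕ => G (c - 1 - n))]
    have : ∑ k ∈ Finset.Ico (c - L) (c + L), G k = ∑ n ∈ Finset.range (L + L), G (c - L + n) := by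
      symm
      refine Finset.sum_bij' (fun n _ => c - L + n) (fun k _ => (k - (c - L)).toNat) ?_ ?_ ?_ ?_ ?_
      · intro n hn; simp at hn ⊢; omega
      · intro n hn; simp at hn ⊢; omega
      · intro n hn; simp at hn ⊢
      · intro n hn; simp at hn ⊢; omega
      · intro n hn; rfl
    rw [this, Finset.sum_range_add]
    congr 1
    · refine Finset.sum_congr rfl fun n hn => ?_
      have := Finset.mem_range.mp hn
      congr 1
      omega
    · refine Finset.sum_congr rfl fun n hn => ?_
      congr 1
      push_cast
      ring
  · intro k hk
    by_contra hc
    refine hk (h k ?_)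
    simp at hc
    omega

/-- The series with coefficients the `q`-integers `[n + 1]`. -/
def qIntSeries (q : ℂ) : PowerSeries ℂ := PowerSeries.mk fun n => qInt q (n + 1)

/-- The difference of the two expansions of `1 / ((1 - q x) (1 - q⁻¹ x))` is a combination of delta
functions. -/
theorem formal_delta {N : ℤ → ℤ → M} {D : ℤ} (hN : ∀ k l, D ≤ k ∨ D ≤ l → N k l = 0) {q : ℂ}
    (hq : q ≠ 0) (R T : ℤ) :
    lsum (qIntSeries q) (fun n => N (R - 2 - n) (T + n)) -
        lsum (qIntSeries q) (fun n => N (R + n) (T - 2 - n)) =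
      (q - q⁻¹)⁻¹ • (q ^ (R - 1) • ∑ᶠ k : ℤ, q ^ (-k) • N k (R + T - 2 - k) -
        q ^ (-(R - 1)) • ∑ᶠ k : ℤ, q⁻¹ ^ (-k) • N k (R + T - 2 - k)) := by
  set L : ℕ := (D - T).toNat + (D - R).toNat + 1 with hL
  have hz : ∀ k, k < R - (L + 1 : ℕ) ∨ R + (L + 1 : ℕ) ≤ k → N k (R + T - 2 - k) = 0 := by
    intro k hk
    push_cast at hk
    exact hN _ _ (by omega)
  rw [lsum_eq_range (K := L) _ fun n hn => hN _ _ (by omega),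
    lsum_eq_range (K := L + 1) _ fun n hn => hN _ _ (by omega),
    finsum_int_split R (L := L + 1) fun k hk => by rw [hz k hk, smul_zero],
    finsum_int_split R (L := L + 1) fun k hk => by rw [hz k hk, smul_zero]]
  have e1 : ∀ n : ℕ, R - 1 - (n + 1 : ℕ) = R - 2 - n := fun n => by push_cast; ring
  simp only [Finset.sum_range_succ' _ L, e1]
  rw [← Finset.sum_range_succ' (fun n : ℕ => q ^ (-(R + (n : ℤ))) • N (R + n) (R + T - 2 - (R + n))),
    ← Finset.sum_range_succ' (fun n : ℕ => q⁻¹ ^ (-(R + (n : ℤ))) • N (R + n) (R + T - 2 - (R + n))),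
    ← Finset.sum_range_succ' (fun n : ℕ => PowerSeries.coeff n (qIntSeries q) •
      N (R + n) (T - 2 - n))]
  have e2 : ∀ n : ℕ, R + T - 2 - (R - 2 - n) = T + n := fun n => by ring
  have e3 : ∀ n : ℕ, R + T - 2 - (R + n) = T - 2 - n := fun n => by ring
  simp only [e2, e3]
  -- The index k = R - 1 would carry the q-integer [0], so it is absent on the left; on the right
  -- the contributions of the two delta functions agree there and cancel. Indices below and above it
  -- carry [n + 1] and -[n + 1], which is the content of `e5` and `e6`.
  have e4 : q ^ (R - 1) • (q ^ (-(R - 1 - ((0 : ℕ) : ℤ)))) • N (R - 1 - (0 : ℕ))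
      (R + T - 2 - (R - 1 - (0 : ℕ))) = q ^ (-(R - 1)) • (q⁻¹ ^ (-(R - 1 - ((0 : ℕ) : ℤ)))) •
        N (R - 1 - (0 : ℕ)) (R + T - 2 - (R - 1 - (0 : ℕ))) := by
    rw [smul_smul, smul_smul, inv_zpow', ← zpow_add₀ hq, ← zpow_add₀ hq]
    congr 2
    simp
  have e5 : ∀ n : ℕ, PowerSeries.coeff n (qIntSeries q) • N (R - 2 - n) (T + n) =
      (q - q⁻¹)⁻¹ • (q ^ (R - 1) • q ^ (-(R - 2 - (n : ℤ))) • N (R - 2 - n) (T + n) -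
        q ^ (-(R - 1)) • q⁻¹ ^ (-(R - 2 - (n : ℤ))) • N (R - 2 - n) (T + n)) := by
    intro n
    rw [smul_smul, smul_smul, inv_zpow', ← zpow_add₀ hq, ← zpow_add₀ hq, ← sub_smul, smul_smul,
      qIntSeries, PowerSeries.coeff_mk, qInt, div_eq_inv_mul]
    congr 3
    · congr 1; ring
    · congr 1; ring
  have e6 : ∀ n : ℕ, PowerSeries.coeff n (qIntSeries q) • N (R + n) (T - 2 - n) =
      -((q - q⁻¹)⁻¹ • (q ^ (R - 1) • q ^ (-(R + (n : ℤ))) • N (R + n) (T - 2 - n) -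
        q ^ (-(R - 1)) • q⁻¹ ^ (-(R + (n : ℤ))) • N (R + n) (T - 2 - n))) := by
    intro n
    rw [smul_smul, smul_smul, inv_zpow', ← zpow_add₀ hq, ← zpow_add₀ hq, ← sub_smul, smul_smul,
      qIntSeries, PowerSeries.coeff_mk, qInt, div_eq_inv_mul, ← neg_smul, ← mul_neg, neg_sub]
    congr 3
    · congr 1; ring
    · congr 1; ring
  rw [Finset.sum_congr rfl fun n _ => e5 n, Finset.sum_congr rfl fun n _ => e6 n,
    Finset.sum_neg_distrib, sub_neg_eq_add, ← Finset.smul_sum, ← Finset.smul_sum, ← smul_add]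
  congr 1
  rw [Finset.sum_sub_distrib, Finset.sum_sub_distrib, ← Finset.smul_sum, ← Finset.smul_sum,
    ← Finset.smul_sum, ← Finset.smul_sum, smul_add, smul_add, smul_add, smul_add, e4]
  abel

variable {J : Type*} {a b : J → ℕ → Module.End ℂ M} {c : J → J → ℕ → ℂ}

/-- Annihilation half of the specialization z = s w: a coefficient of z^{-r} becomes s^{-r} times
one of w^{-r}, and the exponents add. -/
theorem IsVertexSystem.expZ_scale_add (S : IsVertexSystem a b c) (A B : J) (s : ℂ) (m : ℤ) (v : M) :
    expZ (fun m => s⁻¹ ^ m • b A m + b B m) m v =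
      ∑ᶠ r : ℤ, s ^ (-r) • expZ (b A) r (expZ (b B) (m - r) v) := by
  have hs : ∀ r : ℤ, r ∉ Finset.Icc 0 m →
      s ^ (-r) • expZ (b A) r (expZ (b B) (m - r) v) = 0 := by
    intro r hr
    simp only [Finset.mem_Icc, not_and_or, not_le] at hr
    rcases hr with hr | hr
    · rw [expZ_of_neg _ hr, LinearMap.zero_apply, smul_zero]
    · rw [expZ_of_neg (b B) (by omega), LinearMap.zero_apply, map_zero, smul_zero]
  rw [finsum_eq_sum_of_support_subset (s := Finset.Icc 0 m) _ fun r hr => by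
    by_contra hc
    exact hr (hs r hc)]
  rcases lt_or_ge m 0 with hm | hm
  · rw [expZ_of_neg _ hm, Finset.Icc_eq_empty (by omega)]
    rfl
  · lift m to ℕ using hm
    rw [expZ_natCast, expCoeff_add (a := fun m => s⁻¹ ^ m • b A m) (b := b B)
      (fun m n => ((S.bb A A m n).smul_left _).smul_right _) (S.bb B B)
      (fun m n => (S.bb A B m n).smul_left _), LinearMap.sum_apply]
    refine Finset.sum_bij' (fun x _ => (x.1 : ℤ)) (fun r _ => (r.toNat, m - r.toNat)) ?_ ?_ ?_ ?_ ?_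
    · intro x hx
      have := Finset.HasAntidiagonal.mem_antidiagonal.mp hx
      simp; omega
    · intro r hr
      simp at hr ⊢; omega
    · rintro ⟨x, y⟩ hx
      have := Finset.HasAntidiagonal.mem_antidiagonal.mp hx
      simp at this ⊢; omega
    · intro r hr
      simp at hr ⊢; omega
    · rintro ⟨x, y⟩ hx
      have := Finset.HasAntidiagonal.mem_antidiagonal.mp hx
      rw [expCoeff_scale (S.bb A A), zpow_neg, zpow_natCast, inv_pow,
        show (m : ℤ) - x = y by simp at this; omega]
      simp

/-- A normally ordered product of two vertex operators at proportional arguments `z = s w` is again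
of exponential form. -/
theorem IsVertexSystem.vertexMode_scale_add (S : IsVertexSystem a b c) (A B : J) {s : ℂ} (hs : s ≠ 0)
    (K : ℤ) (v : M) :
    vertexMode (fun m => s ^ m • a A m + a B m) (fun m => s⁻¹ ^ m • b A m + b B m) K v =
      ∑ᶠ k : ℤ, s ^ (-k) • normal2 a b A B v k (K - k) := by
  set b' : ℕ → Module.End ℂ M := fun m => s⁻¹ ^ m • b A m + b B m with hb'
  set a' : ℕ → Module.End ℂ M := fun m => s ^ m • a A m + a B m with ha'
  have hnil : ∀ v, ∃ D : ℤ, ∀ m, D ≤ m → expZ b' m v = 0 := by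
    intro v
    obtain ⟨D, hD0, hD⟩ := S.expZ2_nil v
    refine ⟨2 * D, fun m hm => ?_⟩
    rw [S.expZ_scale_add]
    refine (finsum_congr fun r => ?_).trans finsum_zero
    rw [hD _ _ _ _ (by omega), smul_zero]
  have h : ∀ v, {n : ℕ | (expCoeff a' n * expZ b' (n + K)) v ≠ 0}.Finite := by
    intro v
    obtain ⟨D, hD⟩ := hnil v
    refine finite_support_of_bound (K := (D - K).toNat) fun n hn => ?_
    rw [Module.End.mul_apply, hD _ (by omega), map_zero]
  have h' : vertexMode a' b' K = locSum fun n : ℕ => expCoeff a' n * expZ b' (n + K) := rfl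
  rw [h', locSum, dif_pos h]
  change ∑ᶠ n : ℕ, expCoeff a' n (expZ b' (n + K) v) = _
  obtain ⟨D, hD0, hD⟩ := S.expZ2_nil v
  have hneg : ∀ k l : ℤ, k < 0 ∨ l < 0 → expZ (b A) k (expZ (b B) l v) = 0 := by
    intro k l hkl
    rcases hkl with hk | hl
    · rw [expZ_of_neg _ hk, LinearMap.zero_apply]
    · rw [expZ_of_neg (b B) hl, LinearMap.zero_apply, map_zero]
  set H : ℤ → ℤ → M := fun k l => expZ (b A) k (expZ (b B) l v) with hH
  have hHz : ∀ k l, k < 0 ∨ l < 0 ∨ D ≤ k ∨ D ≤ l → H k l = 0 := by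
    intro k l hkl
    by_cases hc : k < 0 ∨ l < 0
    · exact hneg _ _ hc
    · exact hD _ _ _ _ (by tauto)
  -- the left side as a triple sum
  set Φ : ℕ → ℕ → ℤ → M := fun x y k =>
    s ^ (-k) • expCoeff (a A) x (expCoeff (a B) y (H (k + x) (K - k + y))) with hΦ
  have hΦz : ∀ x y k, ¬(x ∈ Set.Iio (2 * D - K).toNat ∧ k ∈ Set.Icc (K - D) D) → Φ x y k = 0 := by
    intro x y k hxk
    simp only [Set.mem_Iio, Set.mem_Icc] at hxk
    simp only [hΦ]
    rw [hHz _ _ (by omega)]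
    simp
  have hΦy : ∀ x y k, ¬(y ∈ Set.Iio (2 * D - K).toNat ∧ k ∈ Set.Icc (K - D) D) → Φ x y k = 0 := by
    intro x y k hxk
    simp only [Set.mem_Iio, Set.mem_Icc] at hxk
    simp only [hΦ]
    rw [hHz _ _ (by omega)]
    simp
  have hfin : (Set.Icc (K - D) D).Finite := Set.finite_Icc _ _
  have hfin' : (Set.Iio (2 * D - K).toNat).Finite := Set.finite_Iio _
  have hR : ∑ᶠ k : ℤ, s ^ (-k) • normal2 a b A B v k (K - k) = ∑ᶠ x, ∑ᶠ y, ∑ᶠ k, Φ x y k := by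
    have e1 : ∀ k : ℤ, s ^ (-k) • normal2 a b A B v k (K - k) = ∑ᶠ x, ∑ᶠ y, Φ x y k := by
      intro k
      simp only [normal2, wrap]
      rw [smul_finsum]
      refine finsum_congr fun x => ?_
      rw [map_finsum_of_bound _ (K := (D - (K - k)).toNat) fun n hn => by
        rw [hD _ _ _ _ (Or.inr (by omega)), map_zero], smul_finsum]
    simp only [e1]
    rw [finsum_comm_of_finite (s := Set.Icc (K - D) D) (t := Set.Iio (2 * D - K).toNat) hfin hfin'
      fun k x hkx => (finsum_congr fun y => hΦz x y k (by tauto)).trans finsum_zero]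
    refine finsum_congr fun x => ?_
    exact finsum_comm_of_finite hfin hfin' fun k y hky => hΦy x y k (by tauto)
  rw [hR, ← finsum_antidiagonal (K := (2 * D - K).toNat)]
  · refine finsum_congr fun n => ?_
    rw [expCoeff_add (a := fun m => s ^ m • a A m) (b := a B)
      (fun m n => ((S.aa A A m n).smul_left _).smul_right _) (S.aa B B)
      (fun m n => (S.aa A B m n).smul_left _), LinearMap.sum_apply]
    refine Finset.sum_congr rfl fun x hx => ?_
    have hx' := Finset.HasAntidiagonal.mem_antidiagonal.mp hx
    rw [S.expZ_scale_add, Module.End.mul_apply, expCoeff_scale (S.aa A A), LinearMap.smul_apply]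
    -- Shifting k by `x.1` matches the annihilation degree with the argument of `H` in `Φ`; the
    -- factor s^{x.1} from scaling the creation part compensates the resulting change in s^{-k}.
    rw [← finsum_comp_equiv (Equiv.addRight (x.1 : ℤ))]
    have hfs : (Function.support fun k : ℤ => s ^ (-(k + (x.1 : ℤ))) •
        H (k + x.1) (n + K - (k + x.1))).Finite := by
      refine (Set.finite_Icc (-(x.1 : ℤ)) D).subset fun k hk => ?_
      by_contra hc
      refine hk ?_
      simp only [Set.mem_Icc] at hc
      beta_reduce
      rw [hHz _ _ (by omega), smul_zero]
    have hmap : ∀ T : Module.End ℂ M, T (∑ᶠ k : ℤ, s ^ (-(k + (x.1 : ℤ))) •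
        H (k + x.1) (n + K - (k + x.1))) = ∑ᶠ k : ℤ, s ^ (-(k + (x.1 : ℤ))) •
        T (H (k + x.1) (n + K - (k + x.1))) := by
      intro T
      rw [← LinearMap.toAddMonoidHom_coe, AddMonoidHom.map_finsum _ hfs]
      simp
    have := hmap (expCoeff (a A) x.1 * expCoeff (a B) x.2)
    rw [Module.End.mul_apply] at this
    refine (congrArg (s ^ x.1 • ·) this).trans ?_
    rw [smul_finsum]
    refine finsum_congr fun k => ?_
    simp only [hΦ]
    rw [smul_smul, ← zpow_natCast, ← zpow_add₀ hs, Module.End.mul_apply]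
    have e2 : (x.1 : ℤ) + -(k + x.1) = -k := by ring
    have e3 : (n : ℤ) + K - (k + x.1) = K - k + x.2 := by rw [← hx']; push_cast; ring
    rw [e2, e3]
  · intro x y hxy
    refine (finsum_congr fun k => ?_).trans finsum_zero
    rcases hxy with hh | hh
    · exact hΦz x y k (by simp only [Set.mem_Iio]; omega)
    · exact hΦy x y k (by simp only [Set.mem_Iio]; omega)

end Specialization

/-! ### Truncation and linearity of ordered products -/

section Linearity

variable {V : Type*} [AddCommGroup V] [Module ℂ V]

/-- Every vector is killed by all modes of large degree. -/
def LocTrunc (B : ℤ → Module.End ℂ V) : Prop := ∀ v, ∃ D : ℤ, ∀ t, D ≤ t → B t v = 0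

theorem ord2_eq_lsum (φ : PowerSeries ℂ) (A B : ℤ → Module.End ℂ V) (r t : ℤ) (v : V) :
    ord2 φ A B r t v = lsum φ fun s => A (r - s) (B (t + s) v) := rfl

theorem LocTrunc.ord2_bound {B : ℤ → Module.End ℂ V} (hB : LocTrunc B) (A : ℤ → Module.End ℂ V)
    (r t : ℤ) (v : V) : ∃ K : ℕ, ∀ s : ℕ, K ≤ s → A (r - s) (B (t + s) v) = 0 := by
  obtain ⟨D, hD⟩ := hB v
  exact ⟨(D - t).toNat, fun s hs => by rw [hD _ (by omega), map_zero]⟩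

/-- Local truncation makes the defining sum finite uniformly on any two vectors, hence linear.
Relations then need checking only on vectors supported at one basis index. -/
theorem LocTrunc.exists_linear_ord2 {B : ℤ → Module.End ℂ V} (hB : LocTrunc B)
    (φ : PowerSeries ℂ) (A : ℤ → Module.End ℂ V) (r t : ℤ) :
    ∃ L : Module.End ℂ V, ∀ v, ord2 φ A B r t v = L v := by
  refine ⟨{ toFun := ord2 φ A B r t, map_add' := fun v w => ?_, map_smul' := fun c v => ?_ },
    fun v => rfl⟩
  · obtain ⟨K, hK⟩ := hB.ord2_bound A r t v
    obtain ⟨K', hK'⟩ := hB.ord2_bound A r t w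
    simp only [ord2_eq_lsum]
    rw [lsum_eq_range φ (K := K + K') fun s hs => hK s (by omega),
      lsum_eq_range φ (K := K + K') fun s hs => hK' s (by omega),
      lsum_eq_range φ (K := K + K') fun s hs => by
        rw [map_add, map_add, hK s (by omega), hK' s (by omega), add_zero]]
    simp only [map_add, smul_add, Finset.sum_add_distrib]
  · simp only [ord2, map_smul, RingHom.id_apply, smul_finsum]
    refine finsum_congr fun s => ?_
    rw [smul_comm]

theorem LocTrunc.ord3_bound {B C : ℤ → Module.End ℂ V} (hB : LocTrunc B) (hC : LocTrunc C)
    (A : ℤ → Module.End ℂ V) (k l m : ℤ) (v : V) : ∃ K : ℕ, ∀ h i j : ℕ, K ≤ h ∨ K ≤ i ∨ K ≤ j →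
      A (k - h - i) (B (l + h - j) (C (m + i + j) v)) = 0 := by
  obtain ⟨D, hD⟩ := hC v
  have : ∀ w, ∃ E : ℕ, ∀ t : ℤ, E ≤ t → B t w = 0 := fun w => by
    obtain ⟨E, hE⟩ := hB w
    exact ⟨E.toNat, fun t ht => hE t (by omega)⟩
  choose E hE using this
  set n := (D - m).toNat with hn
  -- For i + j < n only the finitely many vectors C_{m+s} v with s < n occur; the sum of their
  -- truncation degrees is a uniform bound for B. For i + j ≥ n already C kills v.
  set F := ∑ s ∈ Finset.range n, E (C (m + s) v) with hF
  refine ⟨n + F + n + (-l).toNat, fun h i j hij => ?_⟩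
  by_cases hlt : n ≤ i + j
  · rw [hD _ (by omega), map_zero, map_zero]
  · have h1 : E (C (m + (i + j : ℕ)) v) ≤ F :=
      Finset.single_le_sum (f := fun s : ℕ => E (C (m + s) v)) (fun _ _ => Nat.zero_le _)
        (Finset.mem_range.mpr (by omega))
    rw [show m + (i : ℤ) + j = m + (i + j : ℕ) by push_cast; ring, hE _ _ (by omega), map_zero]

theorem LocTrunc.ord3_eq_lsum3 {B C : ℤ → Module.End ℂ V} (hB : LocTrunc B) (hC : LocTrunc C)
    (φ ψ χ : PowerSeries ℂ) (A : ℤ → Module.End ℂ V) (k l m : ℤ) (v : V) :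
    ord3 φ ψ χ A B C k l m v =
      lsum3 φ ψ χ fun h i j => A (k - h - i) (B (l + h - j) (C (m + i + j) v)) := by
  obtain ⟨K, hK⟩ := hB.ord3_bound hC A k l m v
  exact finsum_triple_eq_lsum3 φ ψ χ hK

theorem LocTrunc.exists_linear_ord3 {B C : ℤ → Module.End ℂ V} (hB : LocTrunc B) (hC : LocTrunc C)
    (φ ψ χ : PowerSeries ℂ) (A : ℤ → Module.End ℂ V) (k l m : ℤ) :
    ∃ L : Module.End ℂ V, ∀ v, ord3 φ ψ χ A B C k l m v = L v := by
  have key : ∀ v, ∃ K : ℕ, ∀ K', K ≤ K' → ord3 φ ψ χ A B C k l m v =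
      ∑ h ∈ Finset.range K', PowerSeries.coeff h φ • ∑ i ∈ Finset.range K', PowerSeries.coeff i ψ •
        ∑ j ∈ Finset.range K', PowerSeries.coeff j χ •
          A (k - h - i) (B (l + h - j) (C (m + i + j) v)) := by
    intro v
    obtain ⟨K, hK⟩ := hB.ord3_bound hC A k l m v
    refine ⟨K, fun K' hK' => ?_⟩
    rw [hB.ord3_eq_lsum3 hC]
    unfold lsum3
    rw [lsum_eq_range φ (K := K') fun h hh => lsum_eq_zero _ fun i => lsum_eq_zero _ fun j =>
      hK _ _ _ (by omega)]
    refine Finset.sum_congr rfl fun h _ => ?_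
    rw [lsum_eq_range ψ (K := K') fun i hi => lsum_eq_zero _ fun j => hK _ _ _ (by omega)]
    congr 1
    refine Finset.sum_congr rfl fun i _ => ?_
    rw [lsum_eq_range χ (K := K') fun j hj => hK _ _ _ (by omega)]
  refine ⟨{ toFun := ord3 φ ψ χ A B C k l m, map_add' := fun v w => ?_,
            map_smul' := fun c v => ?_ }, fun v => rfl⟩
  · obtain ⟨K, hK⟩ := key v
    obtain ⟨K', hK'⟩ := key w
    obtain ⟨K'', hK''⟩ := key (v + w)
    rw [hK (K + K' + K'') (by omega), hK' (K + K' + K'') (by omega), hK'' (K + K' + K'') (by omega)]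
    simp only [map_add, smul_add, Finset.sum_add_distrib]
  · simp only [ord3, map_smul, RingHom.id_apply, smul_finsum]
    refine finsum_congr fun s => ?_
    rw [smul_comm]

/-- A linear factor in w/z can be split off as a difference of two shifted modes. This converts a
relation with a power series prefactor into one with a linear prefactor. -/
theorem LocTrunc.ord2_one_sub {B : ℤ → Module.End ℂ V} (hB : LocTrunc B) (φ : PowerSeries ℂ) (c : ℂ)
    (A : ℤ → Module.End ℂ V) (r t : ℤ) (v : V) :
    ord2 ((1 - PowerSeries.C c * PowerSeries.X) * φ) A B r t v =
      ord2 φ A B r t v - c • ord2 φ A B (r - 1) (t + 1) v := by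
  obtain ⟨K, hK⟩ := hB.ord2_bound A r t v
  simp only [ord2_eq_lsum]
  rw [← lsum_mul _ φ hK, lsum_one_sub]
  congr 2
  · funext n
    rw [zero_add]
  · congr 1
    funext n
    congr 2
    · push_cast; ring
    · congr 1
      push_cast; ring

end Linearity

theorem map_lsum3 {V W : Type*} [AddCommGroup V] [Module ℂ V] [AddCommGroup W] [Module ℂ W]
    (T : V →ₗ[ℂ] W) (φ ψ χ : PowerSeries ℂ) {G : ℕ → ℕ → ℕ → V} {K : ℕ}
    (hG : ∀ h i j, K ≤ h ∨ K ≤ i ∨ K ≤ j → G h i j = 0) :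
    T (lsum3 φ ψ χ G) = lsum3 φ ψ χ fun h i j => T (G h i j) := by
  unfold lsum3
  rw [map_lsum T _ (K := K) fun h hh => lsum_eq_zero _ fun i => lsum_eq_zero _ fun j =>
    hG _ _ _ (by omega)]
  congr 1
  funext h
  rw [map_lsum T _ (K := K) fun i hi => lsum_eq_zero _ fun j => hG _ _ _ (by omega)]
  congr 1
  funext i
  rw [map_lsum T _ (K := K) fun j hj => hG _ _ _ (by omega)]

/-! ### Modes of lattice vertex operators -/

section LatticeModes

variable {J ι M : Type*} [AddCommGroup M] [Module ℂ M]

theorem blockOp_single (f : ι → ι) (T : ι → M →ₗ[ℂ] M) (x : ι) (m : M) :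
    blockOp f T (Finsupp.single x m) = Finsupp.single (f x) (T x m) := by
  simp [blockOp]

/-- The data of the current `T(z) e^γ z^{h+1}` on `⨁_x M`: the vertex operator `T` (a label), the
permutation of the summands, a constant, the eigenvalue of `h`, and an operator on `M`. -/
structure Cur (J ι M : Type*) [AddCommGroup M] [Module ℂ M] where
  idx : J
  move : ι → ι
  coef : ι → ℂ
  height : ι → ℤ
  tr : M →ₗ[ℂ] M

variable (a b : J → ℕ → Module.End ℂ M)

/-- The modes of a current. -/
def Cur.mode (A : Cur J ι M) (n : ℤ) : Module.End ℂ (ι →₀ M) :=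
  blockOp A.move fun x =>
    A.coef x • (vertexMode (a A.idx) (b A.idx) (n + A.height x + 1) ∘ₗ A.tr)

theorem Cur.mode_single (A : Cur J ι M) (n : ℤ) (x : ι) (m : M) :
    A.mode a b n (Finsupp.single x m) = Finsupp.single (A.move x)
      (A.coef x • vertexMode (a A.idx) (b A.idx) (n + A.height x + 1) (A.tr m)) := by
  rw [Cur.mode, blockOp_single]
  rfl

/-- The translation part of a current commutes with all vertex operators. -/
def Cur.Compat (A : Cur J ι M) : Prop :=
  ∀ j s m, A.tr (vertexMode (a j) (b j) s m) = vertexMode (a j) (b j) s (A.tr m)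

/-- Two currents with `e^γ e^γ' = ω e^γ' e^γ` and `(γ, γ') = e`. -/
structure Cur.Pair (A B : Cur J ι M) (e : ℤ) (ω : ℂ) : Prop where
  move : ∀ x, A.move (B.move x) = B.move (A.move x)
  left : ∀ x, A.height (B.move x) = A.height x + e
  right : ∀ x, B.height (A.move x) = B.height x + e
  coef : ∀ x, A.coef (B.move x) * B.coef x = ω * (B.coef (A.move x) * A.coef x)
  tr : ∀ m, A.tr (B.tr m) = B.tr (A.tr m)

variable {a b} {c : J → J → ℕ → ℂ} (S : IsVertexSystem a b c)
include S

theorem IsVertexSystem.mode_trunc (A : Cur J ι M) : LocTrunc (A.mode a b) := by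
  intro v
  induction v using Finsupp.induction_linear with
  | zero => exact ⟨0, fun t _ => map_zero _⟩
  | add v w hv hw =>
    obtain ⟨D, hD⟩ := hv
    obtain ⟨D', hD'⟩ := hw
    exact ⟨max D D', fun t ht => by
      rw [map_add, hD t (by omega), hD' t (by omega), add_zero]⟩
  | single x m =>
    obtain ⟨D, hD⟩ := S.vertexMode_trunc A.idx (A.tr m)
    exact ⟨D - A.height x - 1, fun t ht => by
      rw [A.mode_single, hD _ (by omega), smul_zero, Finsupp.single_zero]⟩

/-- The structure function enters only multiplied by the contraction. Everything else is a position,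
a constant and coefficients of one normally ordered product with indices shifted by the heights. -/
theorem IsVertexSystem.ord2_mode_single (φ : PowerSeries ℂ) (A B : Cur J ι M) (hA : A.Compat a b)
    (r t : ℤ) (x : ι) (m : M) :
    ord2 φ (A.mode a b) (B.mode a b) r t (Finsupp.single x m) =
      Finsupp.single (A.move (B.move x)) ((A.coef (B.move x) * B.coef x) •
        lsum (φ * contr c A.idx B.idx) fun n => normal2 a b A.idx B.idx (A.tr (B.tr m))
          (r + A.height (B.move x) + 1 - n) (t + B.height x + 1 + n)) := by
  obtain ⟨D, hD⟩ := S.vertexMode_trunc B.idx (A.tr (B.tr m))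
  obtain ⟨D', hD'⟩ := S.normal2_bound A.idx B.idx (A.tr (B.tr m))
  rw [ord2_eq_lsum, ← lsum_mul φ _ (K := (D' - (t + B.height x + 1)).toNat)
    fun n hn => hD' _ _ (by omega)]
  have h1 : ∀ n : ℕ, A.mode a b (r - n) (B.mode a b (t + n) (Finsupp.single x m)) =
      (Finsupp.lsingle (A.move (B.move x)) ∘ₗ ((A.coef (B.move x) * B.coef x) •
        (LinearMap.id : M →ₗ[ℂ] M))) (lsum (contr c A.idx B.idx) fun j =>
          normal2 a b A.idx B.idx (A.tr (B.tr m))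
            (r + A.height (B.move x) + 1 - (n + j : ℕ)) (t + B.height x + 1 + (n + j : ℕ))) := by
    intro n
    rw [B.mode_single, A.mode_single, map_smul, map_smul, smul_smul, hA,
      S.vertexMode_mul A.idx B.idx]
    simp only [LinearMap.comp_apply, LinearMap.smul_apply, LinearMap.id_apply,
      Finsupp.lsingle_apply]
    congr 3
    funext j
    congr 1
    · push_cast; ring
    · push_cast; ring
  simp only [h1]
  rw [← map_lsum _ φ (K := (D' - (t + B.height x + 1)).toNat)]
  · simp
  · intro n hn
    exact lsum_eq_zero _ fun j => hD' _ _ (by push_cast; omega)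

theorem IsVertexSystem.ord3_mode_single (φ ψ χ : PowerSeries ℂ) (A B C : Cur J ι M)
    (hA : A.Compat a b) (hB : B.Compat a b) (k l m : ℤ) (x : ι) (v : M) :
    ord3 φ ψ χ (A.mode a b) (B.mode a b) (C.mode a b) k l m (Finsupp.single x v) =
      Finsupp.single (A.move (B.move (C.move x)))
        ((A.coef (B.move (C.move x)) * B.coef (C.move x) * C.coef x) •
          lsum3 (φ * contr c A.idx B.idx) (ψ * contr c A.idx C.idx) (χ * contr c B.idx C.idx)
            fun h i j => normal3 a b A.idx B.idx C.idx (A.tr (B.tr (C.tr v)))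
              (k + A.height (B.move (C.move x)) + 1 - h - i) (l + B.height (C.move x) + 1 + h - j)
              (m + C.height x + 1 + i + j)) := by
  obtain ⟨D, hD⟩ := S.normal3_bound A.idx B.idx C.idx (A.tr (B.tr (C.tr v)))
  set k' := k + A.height (B.move (C.move x)) + 1 with hk'
  set l' := l + B.height (C.move x) + 1 with hl'
  set m' := m + C.height x + 1 with hm'
  set w := A.tr (B.tr (C.tr v)) with hw
  set g : ℕ → ℕ → ℕ → M := fun h i j =>
    normal3 a b A.idx B.idx C.idx w (k' - h - i) (l' + h - j) (m' + i + j) with hg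
  set K := (D - m').toNat + (D - l').toNat with hK
  have hgz : ∀ h i j, K ≤ h ∨ K ≤ i ∨ K ≤ j → g h i j = 0 := by
    intro h i j hij
    simp only [hg]
    exact hD _ _ _ (by omega)
  rw [(S.mode_trunc B).ord3_eq_lsum3 (S.mode_trunc C), ← lsum3_mul _ _ _ _ _ _ hgz]
  set T : M →ₗ[ℂ] (ι →₀ M) := Finsupp.lsingle (A.move (B.move (C.move x))) ∘ₗ
    ((A.coef (B.move (C.move x)) * B.coef (C.move x) * C.coef x) • (LinearMap.id : M →ₗ[ℂ] M))
    with hT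
  have h1 : ∀ h i j : ℕ, A.mode a b (k - h - i) (B.mode a b (l + h - j)
      (C.mode a b (m + i + j) (Finsupp.single x v))) =
      T (lsum3 (contr c A.idx B.idx) (contr c A.idx C.idx) (contr c B.idx C.idx) fun h' i' j' =>
        g (h + h') (i + i') (j + j')) := by
    intro h i j
    rw [C.mode_single, B.mode_single, A.mode_single]
    simp only [map_smul]
    rw [hB, hA, hA, S.vertexMode_mul_mul]
    simp only [hT, LinearMap.comp_apply, LinearMap.smul_apply, LinearMap.id_apply,
      Finsupp.lsingle_apply, smul_smul, ← hw, ← mul_assoc]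
    congr 2
    -- `vertexMode_mul_mul` sums over the pairs (B, C), (A, B), (A, C) in this order, whereas `ord3`
    -- has (A, B), (A, C), (B, C); two exchanges of sums bring them into line.
    unfold lsum3
    rw [lsum_swap _ _ K]
    · congr 1
      funext h'
      rw [lsum_swap _ _ K]
      · congr 1
        funext i'
        congr 1
        funext j'
        simp only [hg, hk', hl', hm']
        congr 1 <;> push_cast <;> ring
      · intro j' i' hij
        exact hD _ _ _ (by omega)
    · intro j' h' hij
      exact lsum_eq_zero _ fun i' => hD _ _ _ (by omega)
  simp only [h1]
  have h2 : ∀ h i j, K ≤ h ∨ K ≤ i ∨ K ≤ j → lsum3 (contr c A.idx B.idx) (contr c A.idx C.idx)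
      (contr c B.idx C.idx) (fun h' i' j' => g (h + h') (i + i') (j + j')) = 0 := by
    intro h i j hij
    exact lsum_eq_zero _ fun h' => lsum_eq_zero _ fun i' => lsum_eq_zero _ fun j' =>
      hgz _ _ _ (by omega)
  exact (map_lsum3 T _ _ _ h2).symm

end LatticeModes

/-! ### Exchange, mixed and Serre relations for abstract currents -/

section Relations

variable {J ι M : Type*} [AddCommGroup M] [Module ℂ M]
variable {a b : J → ℕ → Module.End ℂ M} {c : J → J → ℕ → ℂ}

/-- The series `exp (∑ (q^{em} - q^{-em}) ρ'^m x^m / (m (1 - q^{2m})))`-type factors, in closed form, for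
`e = 2, -1, 0`. -/
def serreSeries (ρ : ℂ) (e : ℤ) : PowerSeries ℂ :=
  if e = 2 then quad ρ else if e = -1 then geom ρ else 1

/-- The prefactor `(1 - ρ^{-e} x)` times `serreSeries ρ e`. -/
def exchangeSeries (ρ : ℂ) (e : ℤ) : PowerSeries ℂ :=
  (1 - PowerSeries.C (ρ ^ (-e)) * PowerSeries.X) * serreSeries ρ e

/-- The cubic (1 - ρ⁻²x)(1 - ρ²x)(1 - x) has coefficients 1, -c, c, -1. This antipalindromic shape
is what produces the sign in the exchange relation. -/
theorem lsum_exchange_two {ρ : ℂ} (hρ : ρ ≠ 0) (g : ℕ → M) :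
    lsum (exchangeSeries ρ 2) g = g 0 - (1 + ρ ^ 2 + (ρ ^ 2)⁻¹) • g 1 +
      (1 + ρ ^ 2 + (ρ ^ 2)⁻¹) • g 2 - g 3 := by
  have h : exchangeSeries ρ 2 = (1 - PowerSeries.C (ρ ^ 2)⁻¹ * PowerSeries.X) * quad ρ := by
    have : ρ ^ (-2 : ℤ) = (ρ ^ 2)⁻¹ := by rw [zpow_neg]; norm_cast
    simp [exchangeSeries, serreSeries, this]
  -- `lsum_mul` needs an eventually vanishing sequence; a cubic sees only the first four terms, so
  -- the rest may be cut off.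
  have h2 : lsum (exchangeSeries ρ 2) g =
      lsum (exchangeSeries ρ 2) (fun n => if n ≤ 3 then g n else 0) := by
    have h3 : exchangeSeries ρ 2 = 1 - PowerSeries.C (1 + ρ ^ 2 + (ρ ^ 2)⁻¹) * PowerSeries.X +
        PowerSeries.C (1 + ρ ^ 2 + (ρ ^ 2)⁻¹) * PowerSeries.X ^ 2 -
          PowerSeries.C 1 * PowerSeries.X ^ 3 := by
      have hC : PowerSeries.C (ρ ^ 2)⁻¹ * PowerSeries.C (ρ ^ 2) = (1 : PowerSeries ℂ) := by
        rw [← map_mul, inv_mul_cancel₀ (pow_ne_zero 2 hρ), map_one]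
      rw [h, quad]
      simp only [map_add, map_one]
      linear_combination (PowerSeries.X ^ 2 - PowerSeries.X ^ 3) * hC
    unfold lsum
    refine finsum_congr fun n => ?_
    beta_reduce
    split_ifs with hn
    · rfl
    · rw [h3, map_sub, map_add, map_sub, PowerSeries.coeff_C_mul, PowerSeries.coeff_C_mul,
        PowerSeries.coeff_C_mul]
      simp [PowerSeries.coeff_one, PowerSeries.coeff_X, PowerSeries.coeff_X_pow,
        show n ≠ 0 by omega, show n ≠ 1 by omega, show n ≠ 2 by omega, show n ≠ 3 by omega]
  rw [h2, h, ← lsum_mul _ _ (K := 4) (g := fun n => if n ≤ 3 then g n else 0)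
    (fun n hn => if_neg (by omega)), lsum_one_sub, lsum_quad, lsum_quad]
  norm_num
  have h0 : ρ ^ 2 ≠ 0 := pow_ne_zero 2 hρ
  match_scalars <;> field_simp <;> ring

/-- The linear prefactor is exactly the denominator of the geometric series. -/
theorem exchangeSeries_neg_one (ρ : ℂ) : exchangeSeries ρ (-1) = 1 := by
  have h : geom ρ * (1 - PowerSeries.C ρ * PowerSeries.X) = 1 := by
    ext n
    rw [mul_sub, mul_one, map_sub, ← mul_assoc, mul_comm (geom ρ), mul_assoc, PowerSeries.coeff_C_mul]
    cases n with
    | zero => simp [geom]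
    | succ n =>
      rw [PowerSeries.coeff_succ_mul_X]
      simp [geom, PowerSeries.coeff_one, pow_succ, mul_comm]
  rw [mul_comm] at h
  simpa [exchangeSeries, serreSeries] using h

theorem exchangeSeries_zero (ρ : ℂ) :
    exchangeSeries ρ 0 = 1 - PowerSeries.C 1 * PowerSeries.X := by
  simp [exchangeSeries, serreSeries]

/-- The exchange relation for the normally ordered product of two currents of equal sign. -/
theorem formal_exchange {ρ u : ℂ} (hρ : ρ ≠ 0) {e : ℤ} (he : e = 2 ∨ e = -1 ∨ e = 0)
    (hu : e ≠ -1 → u = 1) (N : ℤ → ℤ → M) (R T : ℤ) :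
    ((-1) ^ e * u⁻¹) • lsum (PowerSeries.rescale u⁻¹ (exchangeSeries ρ e))
        (fun n => N (R + 1 + e - n) (T + n)) =
      -u⁻¹ • lsum (PowerSeries.rescale u (exchangeSeries ρ e))
        (fun n => N (R + n) (T + 1 + e - n)) := by
  -- For e = 2 and e = 0 the polynomial changes sign when its coefficients are reversed, which
  -- exchanges the two sides; for e = -1 the series is 1 and only the constant (-1)^e u⁻¹ remains.
  rcases he with rfl | rfl | rfl
  · rw [hu (by norm_num)]
    simp only [inv_one, PowerSeries.rescale_one, RingHom.id_apply, lsum_exchange_two hρ]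
    push_cast
    ring_nf
    module
  · simp only [exchangeSeries_neg_one, map_one, lsum_one]
    push_cast
    ring_nf
  · rw [hu (by norm_num)]
    simp only [inv_one, PowerSeries.rescale_one, RingHom.id_apply, exchangeSeries_zero,
      lsum_one_sub]
    push_cast
    ring_nf
    module

variable (S : IsVertexSystem a b c)
include S

/-- Passing one lattice vector through the other shifts the height by e and multiplies by ω. After
normal ordering both sides involve the same coefficients, so the scalar identity `hN` for an
arbitrary array suffices. -/
theorem IsVertexSystem.ord2_exchange_single {A B : Cur J ι M} (hA : A.Compat a b)
    (hB : B.Compat a b) {e : ℤ} {ω d : ℂ} (P : A.Pair B e ω) {φ φ' : PowerSeries ℂ}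
    (hN : ∀ (N : ℤ → ℤ → M) (R T : ℤ),
      ω • lsum (φ * contr c A.idx B.idx) (fun n => N (R + 1 + e - n) (T + n)) =
        d • lsum (φ' * contr c B.idx A.idx) (fun n => N (R + n) (T + 1 + e - n)))
    (r t : ℤ) (x : ι) (m : M) :
    ord2 φ (A.mode a b) (B.mode a b) (r + 1) t (Finsupp.single x m) =
      d • ord2 φ' (B.mode a b) (A.mode a b) (t + 1) r (Finsupp.single x m) := by
  rw [S.ord2_mode_single φ A B hA, S.ord2_mode_single φ' B A hB, P.move, P.left, P.right, P.coef,
    P.tr, Finsupp.smul_single]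
  congr 1
  have h := hN (normal2 a b A.idx B.idx (B.tr (A.tr m))) (r + A.height x + 1) (t + B.height x + 1)
  rw [mul_comm, mul_smul, smul_comm d]
  congr 1
  convert h using 3
  · funext n; congr 1; ring
  · funext n
    rw [S.normal2_swap]; congr 1; ring

/-- The exchange relation for two currents with `e^γ e^γ' = (-1)^e u⁻¹ e^γ' e^γ`. -/
theorem IsVertexSystem.ord2_exchange {A B : Cur J ι M} (hA : A.Compat a b)
    (hB : B.Compat a b) {e : ℤ} {u : ℂ} (P : A.Pair B e ((-1) ^ e * u⁻¹))
    (he : e = 2 ∨ e = -1 ∨ e = 0) (hu : e ≠ -1 → u = 1) {ρ : ℂ} (hρ : ρ ≠ 0)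
    {φ φ' : PowerSeries ℂ}
    (hφ : φ * contr c A.idx B.idx = PowerSeries.rescale u⁻¹ (exchangeSeries ρ e))
    (hφ' : φ' * contr c B.idx A.idx = PowerSeries.rescale u (exchangeSeries ρ e))
    (r t : ℤ) (v : ι →₀ M) :
    ord2 φ (A.mode a b) (B.mode a b) (r + 1) t v =
      -u⁻¹ • ord2 φ' (B.mode a b) (A.mode a b) (t + 1) r v := by
  obtain ⟨L, hL⟩ := (S.mode_trunc B).exists_linear_ord2 φ (A.mode a b) (r + 1) t
  obtain ⟨L', hL'⟩ := (S.mode_trunc A).exists_linear_ord2 φ' (B.mode a b) (t + 1) r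
  have : L = -u⁻¹ • L' := by
    refine Finsupp.lhom_ext fun x m => ?_
    rw [LinearMap.smul_apply, ← hL, ← hL']
    refine S.ord2_exchange_single hA hB P (fun N R T => ?_) r t x m
    rw [hφ, hφ']
    exact formal_exchange hρ he hu N R T
  rw [hL, hL', this, LinearMap.smul_apply]

/-- The same relation with a linear prefactor instead of a power series. -/
theorem IsVertexSystem.ord2_exchange_linear {A B : Cur J ι M} (hA : A.Compat a b)
    (hB : B.Compat a b) {e : ℤ} {u : ℂ} (hu0 : u ≠ 0) (P : A.Pair B e ((-1) ^ e * u⁻¹))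
    (he : e = 2 ∨ e = -1 ∨ e = 0) (hu : e ≠ -1 → u = 1) {ρ : ℂ} (hρ : ρ ≠ 0)
    {φ φ' : PowerSeries ℂ}
    (hφ : φ * contr c A.idx B.idx = PowerSeries.rescale u⁻¹ (serreSeries ρ e))
    (hφ' : φ' * contr c B.idx A.idx = PowerSeries.rescale u (serreSeries ρ e))
    (r t : ℤ) (v : ι →₀ M) :
    u • ord2 φ (A.mode a b) (B.mode a b) (r + 1) t v -
        ρ ^ (-e) • ord2 φ (A.mode a b) (B.mode a b) r (t + 1) v =
      (u * ρ ^ (-e)) • ord2 φ' (B.mode a b) (A.mode a b) t (r + 1) v -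
        ord2 φ' (B.mode a b) (A.mode a b) (t + 1) r v := by
  have key : ∀ s : ℂ, PowerSeries.rescale s (exchangeSeries ρ e) =
      (1 - PowerSeries.C (ρ ^ (-e) * s) * PowerSeries.X) *
        PowerSeries.rescale s (serreSeries ρ e) := by
    intro s
    rw [exchangeSeries, map_mul, map_sub, map_one, map_mul, PowerSeries.rescale_X, map_mul,
      mul_assoc]
    congr 3
    ext n; simp [PowerSeries.coeff_rescale, PowerSeries.coeff_C]
    split_ifs with h <;> simp [h]
  -- The linear factors are absorbed into the structure functions, completing `serreSeries` to
  -- `exchangeSeries`, and are split off again afterwards.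
  have h := S.ord2_exchange hA hB P he hu hρ
    (φ := (1 - PowerSeries.C (ρ ^ (-e) * u⁻¹) * PowerSeries.X) * φ)
    (φ' := (1 - PowerSeries.C (ρ ^ (-e) * u) * PowerSeries.X) * φ')
    (by rw [mul_assoc, hφ, key]) (by rw [mul_assoc, hφ', key]) r t v
  rw [(S.mode_trunc B).ord2_one_sub, (S.mode_trunc A).ord2_one_sub] at h
  simp only [add_sub_cancel_right] at h
  linear_combination (norm := skip) u • h
  match_scalars <;> field_simp <;> ring

theorem IsVertexSystem.mixed_single {A B : Cur J ι M} (hA : A.Compat a b)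
    (hB : B.Compat a b) {e : ℤ} {ω : ℂ} (P : A.Pair B e ω) (φ φ' : PowerSeries ℂ)
    (r t : ℤ) (x : ι) (m : M) :
    ord2 φ (A.mode a b) (B.mode a b) r t (Finsupp.single x m) -
        ord2 φ' (B.mode a b) (A.mode a b) t r (Finsupp.single x m) =
      Finsupp.single (A.move (B.move x)) ((B.coef (A.move x) * A.coef x) •
        (ω • lsum (φ * contr c A.idx B.idx) (fun n => normal2 a b A.idx B.idx (A.tr (B.tr m))
            (r + A.height x + 1 + e - n) (t + B.height x + 1 + n)) -
          lsum (φ' * contr c B.idx A.idx) (fun n => normal2 a b A.idx B.idx (A.tr (B.tr m))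
            (r + A.height x + 1 + n) (t + B.height x + 1 + e - n)))) := by
  rw [S.ord2_mode_single φ A B hA, S.ord2_mode_single φ' B A hB, ← P.move, P.left, P.right, P.coef,
    ← P.tr, ← Finsupp.single_sub, smul_sub, smul_smul, mul_comm ω]
  congr 3
  · congr 1; funext n; congr 1; ring
  · congr 1
    funext n
    rw [S.normal2_swap]; congr 1; ring

/-- Currents of opposite sign at distinct nodes. -/
theorem IsVertexSystem.mixed_eq_zero {A B : Cur J ι M} (hA : A.Compat a b)
    (hB : B.Compat a b) {e : ℤ} {u : ℂ} (hu0 : u ≠ 0) (P : A.Pair B e ((-1) ^ e * u))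
    (he : e = 1 ∨ e = 0) (hu : e ≠ 1 → u = 1) {φ φ' : PowerSeries ℂ}
    (hφ : φ * contr c A.idx B.idx = if e = 1 then 1 - PowerSeries.C u⁻¹ * PowerSeries.X else 1)
    (hφ' : φ' * contr c B.idx A.idx = if e = 1 then 1 - PowerSeries.C u * PowerSeries.X else 1)
    (r t : ℤ) (v : ι →₀ M) :
    ord2 φ (A.mode a b) (B.mode a b) r t v - ord2 φ' (B.mode a b) (A.mode a b) t r v = 0 := by
  obtain ⟨L, hL⟩ := (S.mode_trunc B).exists_linear_ord2 φ (A.mode a b) r t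
  obtain ⟨L', hL'⟩ := (S.mode_trunc A).exists_linear_ord2 φ' (B.mode a b) t r
  have : L = L' := by
    refine Finsupp.lhom_ext fun x m => ?_
    rw [← hL, ← hL', ← sub_eq_zero, S.mixed_single hA hB P, hφ, hφ']
    convert Finsupp.single_zero _
    rcases he with rfl | rfl
    · simp only [if_true, lsum_one_sub]
      push_cast
      ring_nf
      match_scalars <;> field_simp <;> ring
    · rw [hu (by norm_num)]
      simp [lsum_one]
  rw [hL, hL', this, sub_self]

/-- Currents of opposite sign at the same node. -/
theorem IsVertexSystem.mixed_delta {A B : Cur J ι M} (hA : A.Compat a b)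
    (hB : B.Compat a b) (P : A.Pair B (-2) 1) {φ φ' : PowerSeries ℂ} {q : ℂ} (hq : q ≠ 0)
    (hφ : φ * contr c A.idx B.idx = qIntSeries q) (hφ' : φ' * contr c B.idx A.idx = qIntSeries q)
    (r t : ℤ) (x : ι) (hx : B.height x = -A.height x) (m : M) :
    ord2 φ (A.mode a b) (B.mode a b) r t (Finsupp.single x m) -
        ord2 φ' (B.mode a b) (A.mode a b) t r (Finsupp.single x m) =
      Finsupp.single (A.move (B.move x)) ((B.coef (A.move x) * A.coef x) • (q - q⁻¹)⁻¹ •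
        (q ^ (r + A.height x) • vertexMode (fun m => q ^ m • a A.idx m + a B.idx m)
            (fun m => q⁻¹ ^ m • b A.idx m + b B.idx m) (r + t) (A.tr (B.tr m)) -
          q ^ (-(r + A.height x)) • vertexMode (fun m => q⁻¹ ^ m • a A.idx m + a B.idx m)
            (fun m => q ^ m • b A.idx m + b B.idx m) (r + t) (A.tr (B.tr m)))) := by
  rw [S.mixed_single hA hB P, one_smul, hφ, hφ']
  obtain ⟨D, hD⟩ := S.normal2_bound A.idx B.idx (A.tr (B.tr m))
  have h := formal_delta hD hq (r + A.height x + 1) (t + B.height x + 1)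
  have h1 := S.vertexMode_scale_add A.idx B.idx hq (r + t) (A.tr (B.tr m))
  have h2 := S.vertexMode_scale_add A.idx B.idx (inv_ne_zero hq) (r + t) (A.tr (B.tr m))
  rw [inv_inv] at h2
  rw [h1, h2]
  -- Opposite heights cancel, so after specialization the mode number is r + t, and the height
  -- survives only in the powers of q, where it becomes the eigenvalue of K^±.
  rw [show r + A.height x + 1 + (t + B.height x + 1) - 2 = r + t by rw [hx]; ring,
    add_sub_cancel_right] at h
  rw [← h]
  rfl

theorem IsVertexSystem.mode_commute {A B : Cur J ι M} (hA : A.Compat a b)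
    (hB : B.Compat a b) (P : A.Pair B 0 1) (hc : contr c A.idx B.idx = 1)
    (hc' : contr c B.idx A.idx = 1) (r t : ℤ) : Commute (A.mode a b r) (B.mode a b t) := by
  have one : ∀ (A B : ℤ → Module.End ℂ (ι →₀ M)) (r t : ℤ) v, ord2 1 A B r t v = A r (B t v) := by
    intro A B r t v
    rw [ord2_eq_lsum, lsum_one]; simp
  refine LinearMap.ext fun v => ?_
  have h := S.mixed_eq_zero hA hB (e := 0) (u := 1) one_ne_zero (by simpa using P) (Or.inr rfl)
    (fun _ => rfl) (φ := 1) (φ' := 1) (by simp [hc]) (by simp [hc']) r t v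
  rw [one, one, sub_eq_zero] at h
  exact h

/-- All three positions of B lead to one normally ordered product AAB, and each transposition of A
and B costs -u⁻¹; what remains is `formal_serre`. Only q + q⁻¹ enters, so that ρ may be q or q⁻¹, as
the two signs of currents require. -/
theorem IsVertexSystem.serre_single {A B : Cur J ι M} (hA : A.Compat a b)
    (hB : B.Compat a b) {u ρ q : ℂ} (hu : u ≠ 0) (hρ : ρ ≠ 0) (hq : q + q⁻¹ = ρ + ρ⁻¹)
    (P : A.Pair A 2 1) (P' : A.Pair B (-1) (-u⁻¹)) {G D : PowerSeries ℂ}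
    (hG : G * contr c A.idx A.idx = quad ρ)
    (hAB : PowerSeries.rescale u⁻¹ D * contr c A.idx B.idx = PowerSeries.rescale u⁻¹ (geom ρ))
    (hBA : PowerSeries.rescale u D * contr c B.idx A.idx = PowerSeries.rescale u (geom ρ))
    (r₁ r₂ t : ℤ) (x : ι) (v : M) :
    serreTerm q u G D (A.mode a b) (B.mode a b) r₁ r₂ t (Finsupp.single x v) +
      serreTerm q u G D (A.mode a b) (B.mode a b) r₂ r₁ t (Finsupp.single x v) = 0 := by
  set w := A.tr (A.tr (B.tr v)) with hw
  set N : ℤ → ℤ → ℤ → M := normal3 a b A.idx A.idx B.idx w with hN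
  obtain ⟨E, hE⟩ := S.normal3_bound A.idx A.idx B.idx w
  set Θ : ℤ → ℤ → ℤ → M := fun k l m =>
      lsum3 (PowerSeries.rescale u (geom ρ)) (PowerSeries.rescale u (geom ρ)) (quad ρ)
          (fun h i j => N (k + 2 + h - j) (l + i + j) (m - 2 - h - i)) +
      ((ρ + ρ⁻¹) * u⁻¹) •
        lsum3 (PowerSeries.rescale u⁻¹ (geom ρ)) (PowerSeries.rescale u (geom ρ)) (quad ρ)
          (fun h i j => N (k + 1 - h - j) (l + i + j) (m - 1 + h - i)) +
      (u⁻¹ ^ 2) •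
        lsum3 (PowerSeries.rescale u⁻¹ (geom ρ)) (PowerSeries.rescale u⁻¹ (geom ρ)) (quad ρ)
          (fun h i j => N (k + 1 - h - j) (l - 1 - i + j) (m + h + i)) with hΘ
  have key : ∀ r₁ r₂, serreTerm q u G D (A.mode a b) (B.mode a b) r₁ r₂ t (Finsupp.single x v) =
      Finsupp.single (B.move (A.move (A.move x)))
        ((B.coef (A.move (A.move x)) * A.coef (A.move x) * A.coef x) •
          Θ (r₁ + A.height x + 1) (r₂ + A.height x + 1) (t + B.height x + 1)) := by
    intro r₁ r₂
    -- The constants of the orderings ABA and AAB relative to BAA are -u⁻¹ and u⁻². The first one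
    -- turns the coefficient -[2] of the Serre sum into +(ρ + ρ⁻¹)u⁻¹.
    have c1 : A.coef (B.move (A.move x)) * B.coef (A.move x) * A.coef x =
        -u⁻¹ * (B.coef (A.move (A.move x)) * A.coef (A.move x) * A.coef x) := by
      rw [P'.coef]; ring
    have c2 : A.coef (A.move (B.move x)) * A.coef (B.move x) * B.coef x =
        u⁻¹ ^ 2 * (B.coef (A.move (A.move x)) * A.coef (A.move x) * A.coef x) := by
      rw [mul_assoc, P'.coef, P'.move]
      linear_combination -u⁻¹ * c1
    rw [serreTerm, S.ord3_mode_single _ _ _ B A A hB hA, S.ord3_mode_single _ _ _ A B A hA hB,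
      S.ord3_mode_single _ _ _ A A B hA hA, hG, hAB, hBA, c1, c2]
    simp only [← P'.tr, P'.move, P'.left, P'.right, P.left, ← hw]
    rw [Finsupp.smul_single, ← Finsupp.single_sub, ← Finsupp.single_add, hΘ]
    congr 1
    set k := r₁ + A.height x + 1 with hk
    set l := r₂ + A.height x + 1 with hl
    set m := t + B.height x + 1 with hm
    have t0 : (lsum3 (PowerSeries.rescale u (geom ρ)) (PowerSeries.rescale u (geom ρ)) (quad ρ)
          fun h i j => normal3 a b B.idx A.idx A.idx w (t + (B.height x + -1 + -1) + 1 - h - i)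
            (r₁ + (A.height x + 2) + 1 + h - j) (r₂ + A.height x + 1 + i + j)) =
        lsum3 (PowerSeries.rescale u (geom ρ)) (PowerSeries.rescale u (geom ρ)) (quad ρ)
          (fun h i j => N (k + 2 + h - j) (l + i + j) (m - 2 - h - i)) := by
      congr 1
      funext h i j
      rw [S.normal3_swap_left, S.normal3_swap_right, hN]
      congr 1 <;> ring
    have t1 : (lsum3 (PowerSeries.rescale u⁻¹ (geom ρ)) (quad ρ) (PowerSeries.rescale u (geom ρ))
          fun h i j => normal3 a b A.idx B.idx A.idx w (r₁ + (A.height x + 2 + -1) + 1 - h - i)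
            (t + (B.height x + -1) + 1 + h - j) (r₂ + A.height x + 1 + i + j)) =
        lsum3 (PowerSeries.rescale u⁻¹ (geom ρ)) (PowerSeries.rescale u (geom ρ)) (quad ρ)
          (fun h i j => N (k + 1 - h - j) (l + i + j) (m - 1 + h - i)) := by
      unfold lsum3
      congr 1
      funext h
      rw [lsum_swap _ _ (E - l).toNat]
      · congr 1
        funext i
        congr 1
        funext j
        beta_reduce
        rw [S.normal3_swap_right, hN]
        congr 1 <;> ring
      · intro i j hij
        beta_reduce
        rw [S.normal3_swap_right]
        exact hE _ _ _ (by omega)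
    have t2 : (lsum3 (quad ρ) (PowerSeries.rescale u⁻¹ (geom ρ)) (PowerSeries.rescale u⁻¹ (geom ρ))
          fun h i j => normal3 a b A.idx A.idx B.idx w (r₁ + (A.height x + 2 + -1) + 1 - h - i)
            (r₂ + (A.height x + -1) + 1 + h - j) (m + i + j)) =
        lsum3 (PowerSeries.rescale u⁻¹ (geom ρ)) (PowerSeries.rescale u⁻¹ (geom ρ)) (quad ρ)
          (fun h i j => N (k + 1 - h - j) (l - 1 - i + j) (m + h + i)) := by
      unfold lsum3
      rw [lsum_swap _ _ ((E - m).toNat + (E - l + 1).toNat + (E - m).toNat)]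
      · congr 1
        funext h
        rw [lsum_swap _ _ ((E - m).toNat + (E - l + 1).toNat + (E - m).toNat)]
        · congr 1
          funext i
          congr 1
          funext j
          beta_reduce
          rw [hN]
          congr 1 <;> ring
        · intro i j hij
          exact hE _ _ _ (by omega)
      · intro i j hij
        refine lsum_eq_zero _ fun n => ?_
        exact hE _ _ _ (by omega)
    rw [t0, t1, t2, hq]
    beta_reduce
    module
  rw [key, key, ← Finsupp.single_add, ← smul_add, formal_serre hE
    (fun k l m => S.normal3_swap_left _ _ _ _ _ _ _) hρ hu Θ (fun _ _ _ => rfl), smul_zero,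
    Finsupp.single_zero]

theorem IsVertexSystem.serreRelation {A B : Cur J ι M} (hA : A.Compat a b)
    (hB : B.Compat a b) {u ρ q : ℂ} (hu : u ≠ 0) (hρ : ρ ≠ 0) (hq : q + q⁻¹ = ρ + ρ⁻¹)
    (P : A.Pair A 2 1) (P' : A.Pair B (-1) (-u⁻¹)) {G D : PowerSeries ℂ}
    (hG : G * contr c A.idx A.idx = quad ρ)
    (hAB : PowerSeries.rescale u⁻¹ D * contr c A.idx B.idx = PowerSeries.rescale u⁻¹ (geom ρ))
    (hBA : PowerSeries.rescale u D * contr c B.idx A.idx = PowerSeries.rescale u (geom ρ)) :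
    SerreRelation q u G D (A.mode a b) (B.mode a b) := by
  have key : ∀ r₁ r₂ t, ∃ L : Module.End ℂ (ι →₀ M), ∀ v,
      serreTerm q u G D (A.mode a b) (B.mode a b) r₁ r₂ t v = L v := by
    intro r₁ r₂ t
    have hA' := S.mode_trunc A
    have hB' := S.mode_trunc B
    obtain ⟨L₀, h₀⟩ := hA'.exists_linear_ord3 hA' (PowerSeries.rescale u D)
      (PowerSeries.rescale u D) G (B.mode a b) t r₁ r₂
    obtain ⟨L₁, h₁⟩ := hB'.exists_linear_ord3 hA' (PowerSeries.rescale u⁻¹ D) G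
      (PowerSeries.rescale u D) (A.mode a b) r₁ t r₂
    obtain ⟨L₂, h₂⟩ := hA'.exists_linear_ord3 hB' G (PowerSeries.rescale u⁻¹ D)
      (PowerSeries.rescale u⁻¹ D) (A.mode a b) r₁ r₂ t
    exact ⟨L₀ - (q + q⁻¹) • L₁ + L₂, fun v => by simp [serreTerm, h₀, h₁, h₂]⟩
  intro r₁ r₂ t v
  obtain ⟨L, hL⟩ := key r₁ r₂ t
  obtain ⟨L', hL'⟩ := key r₂ r₁ t
  have : L + L' = 0 := by
    refine Finsupp.lhom_ext fun x m => ?_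
    rw [LinearMap.add_apply, ← hL, ← hL']
    exact S.serre_single hA hB hu hρ hq P P' hG hAB hBA r₁ r₂ t x m
  rw [hL, hL', ← LinearMap.add_apply, this, LinearMap.zero_apply]

end Relations

/-! ### Affine Cartan matrices type by type -/

theorem cartan_self {X : AffineType} (i : Node X) : cartan X i i = 2 := by simp [cartan]

theorem cartan_cases {X : AffineType} (i j : Node X) :
    (i = j ∧ cartan X i j = 2) ∨ (i ≠ j ∧ cartan X i j = -1) ∨ (i ≠ j ∧ cartan X i j = 0) := by
  unfold cartan
  split_ifs <;> simp_all

theorem succ_mod_eq {n k : ℕ} (hk : k < n + 3) :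
    (k + 1) % (n + 3) = if k = n + 2 then 0 else k + 1 := by
  split_ifs with h
  · subst h; simp
  · exact Nat.mod_eq_of_lt (by omega)

theorem cartan_A (n : ℕ) (i j : Node (.A n)) : cartan (.A n) i j =
    if (i : ℕ) = j then 2 else if (j : ℕ) = (if (i : ℕ) = n + 2 then 0 else (i : ℕ) + 1) ∨
      (i : ℕ) = (if (j : ℕ) = n + 2 then 0 else (j : ℕ) + 1) then -1 else 0 := by
  rw [← succ_mod_eq i.isLt, ← succ_mod_eq j.isLt]
  simp only [cartan, AffineType.edge, Fin.ext_iff]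
  congr

theorem mMat_A (n : ℕ) (i j : Node (.A n)) : mMat (.A n) i j =
    (if (i : ℕ) = (if (j : ℕ) = n + 2 then 0 else (j : ℕ) + 1) then 1 else 0) -
      (if (j : ℕ) = (if (i : ℕ) = n + 2 then 0 else (i : ℕ) + 1) then 1 else 0) := by
  rw [← succ_mod_eq i.isLt, ← succ_mod_eq j.isLt]
  rfl

theorem val_add_one_A {n : ℕ} (i : Node (.A n)) :
    ((i + 1 : Node (.A n)) : ℕ) = if (i : ℕ) = n + 2 then 0 else (i : ℕ) + 1 := by
  rw [← succ_mod_eq i.isLt]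
  change Fin.val ((i : Fin (n + 2 + 1)) + 1) = _
  rw [Fin.val_add]
  rfl

theorem val_sub_one_A {n : ℕ} (i : Node (.A n)) :
    ((i - 1 : Node (.A n)) : ℕ) = if (i : ℕ) = 0 then n + 2 else (i : ℕ) - 1 := by
  have hi : (i : ℕ) < n + 3 := i.isLt
  change Fin.val ((i : Fin (n + 2 + 1)) - 1) = _
  rw [Fin.val_sub]
  change (n + 3 - 1 + (i : ℕ)) % (n + 3) = _
  split_ifs with h
  · rw [h]; exact Nat.mod_eq_of_lt (by omega)
  · rw [show n + 3 - 1 + (i : ℕ) = (i - 1 : ℕ) + (n + 3) by omega, Nat.add_mod_right]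
    exact Nat.mod_eq_of_lt (by omega)

theorem mMat_eq_zero {X : AffineType} {i j : Node X} (h : cartan X i j ≠ -1) : mMat X i j = 0 := by
  cases X with
  | A n =>
    have hi : (i : ℕ) < n + 3 := i.isLt
    have hj : (j : ℕ) < n + 3 := j.isLt
    rw [cartan_A] at h
    rw [mMat_A]
    generalize (i : ℕ) = i at *
    generalize (j : ℕ) = j at *
    grind
  | _ => rfl

theorem sum_fin_ite {R : Type*} [AddCommMonoid R] {m : ℕ} (f : ℕ → R) {k : ℕ} (hk : k < m) :
    ∑ j : Fin m, (if (j : ℕ) = k then f j else 0) = f k := by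
  rw [Finset.sum_eq_single ⟨k, hk⟩]
  · simp
  · intro j _ hj
    exact if_neg fun h => hj (Fin.ext h)
  · simp

/-- The cycle has n + 3 ≥ 3 nodes, so i, i + 1 and i - 1 are distinct and carry all nonzero entries
of row i. -/
theorem cartan_A_sum {R : Type*} [AddCommMonoid R] (n : ℕ) (i : Node (.A n))
    (G : Node (.A n) → R) (hG : ∀ j, cartan (.A n) i j = 0 → G j = 0) :
    ∑ j, G j = G i + G (i + 1) + G (i - 1) := by
  have hi : (i : ℕ) < n + 3 := i.isLt
  have h1 := val_add_one_A i
  have h2 := val_sub_one_A i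
  have n1 : i ≠ i + 1 := by rw [ne_eq, Fin.ext_iff, h1]; split_ifs <;> omega
  have n2 : i ≠ i - 1 := by rw [ne_eq, Fin.ext_iff, h2]; split_ifs <;> omega
  have n3 : i + 1 ≠ i - 1 := by rw [ne_eq, Fin.ext_iff, h1, h2]; split_ifs <;> omega
  rw [← Finset.sum_subset (Finset.subset_univ {i, i + 1, i - 1}), Finset.sum_insert,
    Finset.sum_pair n3, add_assoc]
  · simp [n1, n2]
  · intro j _ hj
    apply hG
    have hj' : (j : ℕ) < n + 3 := j.isLt
    simp only [Finset.mem_insert, Finset.mem_singleton, not_or, Fin.ext_iff, h1, h2] at hj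
    rw [cartan_A]
    generalize (i : ℕ) = i at *
    generalize (j : ℕ) = j at *
    grind

theorem cartan_add_one_A {n : ℕ} (i : Node (.A n)) :
    cartan (.A n) i (i + 1) = -1 ∧ mMat (.A n) i (i + 1) = -1 := by
  have hi : (i : ℕ) < n + 3 := i.isLt
  rw [cartan_A, mMat_A, val_add_one_A]
  generalize (i : ℕ) = i at *
  grind

theorem cartan_sub_one_A {n : ℕ} (i : Node (.A n)) :
    cartan (.A n) i (i - 1) = -1 ∧ mMat (.A n) i (i - 1) = 1 := by
  have h := cartan_add_one_A (i - 1)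
  rw [sub_add_cancel] at h
  rw [cartan_symm, mMat_antisymm, h.1, h.2]
  simp

theorem cartan_D (n : ℕ) (i j : Node (.D n)) : cartan (.D n) i j =
    if (i : ℕ) = j then 2 else if (((i : ℕ) = 0 ∧ (j : ℕ) = 2) ∨
      (1 ≤ (i : ℕ) ∧ (j : ℕ) = i + 1 ∧ (j : ℕ) ≤ n + 3) ∨ ((i : ℕ) = n + 2 ∧ (j : ℕ) = n + 4)) ∨
      (((j : ℕ) = 0 ∧ (i : ℕ) = 2) ∨
      (1 ≤ (j : ℕ) ∧ (i : ℕ) = j + 1 ∧ (i : ℕ) ≤ n + 3) ∨ ((j : ℕ) = n + 2 ∧ (i : ℕ) = n + 4))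
      then -1 else 0 := by
  simp only [cartan, AffineType.edge, Fin.ext_iff]
  congr

/-- The function lives on ℕ so that neighbours can be written arithmetically; each conditional is
one kind of edge seen from one of its ends. -/
theorem cartan_D_sum (n : ℕ) (i : Node (.D n)) (f : ℕ → ℤ) :
    ∑ j : Node (.D n), cartan (.D n) i j * f j = 2 * f i - (if (i : ℕ) = 0 then f 2 else 0)
      - (if 1 ≤ (i : ℕ) ∧ (i : ℕ) ≤ n + 2 then f (i + 1) else 0)
      - (if (i : ℕ) = n + 2 then f (n + 4) else 0) - (if (i : ℕ) = 2 then f 0 else 0)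
      - (if 2 ≤ (i : ℕ) ∧ (i : ℕ) ≤ n + 3 then f (i - 1) else 0)
      - (if (i : ℕ) = n + 4 then f (n + 2) else 0) := by
  have hi := i.isLt
  simp only [AffineType.rank] at hi
  have key : ∀ j : Node (.D n), cartan (.D n) i j * f j =
      2 * (if (j : ℕ) = i then f j else 0)
      - (if (i : ℕ) = 0 then (if (j : ℕ) = 2 then f j else 0) else 0)
      - (if 1 ≤ (i : ℕ) ∧ (i : ℕ) ≤ n + 2 then (if (j : ℕ) = i + 1 then f j else 0) else 0)
      - (if (i : ℕ) = n + 2 then (if (j : ℕ) = n + 4 then f j else 0) else 0)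
      - (if (i : ℕ) = 2 then (if (j : ℕ) = 0 then f j else 0) else 0)
      - (if 2 ≤ (i : ℕ) ∧ (i : ℕ) ≤ n + 3 then (if (j : ℕ) = i - 1 then f j else 0) else 0)
      - (if (i : ℕ) = n + 4 then (if (j : ℕ) = n + 2 then f j else 0) else 0) := by
    intro j
    have hj := j.isLt
    simp only [AffineType.rank] at hj
    rw [cartan_D]
    generalize (i : ℕ) = i at *
    generalize (j : ℕ) = j at *
    generalize f j = x
    simp only [ite_mul, neg_mul, one_mul, zero_mul]
    grind (splits := 30)
  simp only [key, Finset.sum_sub_distrib, ← Finset.mul_sum]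
  have hN : (AffineType.D n).rank + 1 = n + 5 := rfl
  have ite_sum : ∀ (p : Prop) [Decidable p] (k : ℕ), (p → k < n + 5) →
      ∑ j : Node (.D n), (if p then (if (j : ℕ) = k then f j else 0) else 0) =
        if p then f k else 0 := by
    intro p _ k hk
    split_ifs with hp
    · exact sum_fin_ite f (hk hp)
    · simp
  rw [sum_fin_ite f i.isLt]
  rw [ite_sum ((i : ℕ) = 0) 2 (by omega), ite_sum (1 ≤ (i : ℕ) ∧ (i : ℕ) ≤ n + 2) (i + 1) (by omega),
    ite_sum ((i : ℕ) = n + 2) (n + 4) (by omega), ite_sum ((i : ℕ) = 2) 0 (by omega),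
    ite_sum (2 ≤ (i : ℕ) ∧ (i : ℕ) ≤ n + 3) (i - 1) (by omega),
    ite_sum ((i : ℕ) = n + 4) (n + 2) (by omega)]

theorem cartan_label (X : AffineType) (i : Node X) : ∑ j, cartan X i j * label X j = 0 := by
  cases X with
  | A n =>
    rw [cartan_A_sum n i _ fun j hj => by rw [hj, zero_mul], cartan_self, (cartan_add_one_A i).1,
      (cartan_sub_one_A i).1]
    simp [label, AffineType.label]
  | D n =>
    have := cartan_D_sum n i fun k => ((AffineType.D n).label k : ℤ)
    simp only [label]
    rw [this]
    have hi := i.isLt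
    simp only [AffineType.rank] at hi
    simp only [AffineType.label]
    generalize (i : ℕ) = i at *
    grind
  | E6 => revert i; decide
  | E7 => revert i; decide
  | E8 => revert i; decide

/-- Connectedness of the diagram, as an induction starting at the affine node. -/
theorem node_induction {X : AffineType} {P : Node X → Prop} (h0 : P 0)
    (hs : ∀ i j, P i → cartan X i j = -1 → P j) (i : Node X) : P i := by
  cases X with
  | A n =>
    have key : ∀ k (hk : k < n + 3), P ⟨k, hk⟩ := by
      intro k
      induction k with
      | zero => exact fun _ => h0
      | succ k ih =>
        intro hk
        refine hs ⟨k, by change k < n + 3; omega⟩ _ (ih (by omega)) ?_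
        rw [cartan_A, if_neg (by simp), if_pos]
        left
        rw [if_neg]
        change ¬ (k = n + 2)
        omega
    exact key i i.isLt
  | D n =>
    have e : ∀ (i j : Node (.D n)), i ≠ j → (AffineType.D n).edge i j →
        cartan (.D n) i j = -1 ∧ cartan (.D n) j i = -1 := by
      intro i j h h'
      rw [cartan_symm j i]
      simp [cartan, h, h']
    have h2 : P ⟨2, by simp [AffineType.rank]⟩ :=
      hs 0 _ h0 (e _ _ (by simp [Fin.ext_iff]) (by simp [AffineType.edge])).1
    have h1 : P ⟨1, by simp [AffineType.rank]⟩ :=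
      hs _ _ h2 (e _ _ (by simp [Fin.ext_iff]) (by simp [AffineType.edge])).2
    have key : ∀ k (hk : k + 2 ≤ n + 3), P ⟨k + 2, by simp only [AffineType.rank]; omega⟩ := by
      intro k
      induction k with
      | zero => exact fun _ => h2
      | succ k ih =>
        intro hk
        refine hs _ _ (ih (by omega)) (e _ _ (by simp [Fin.ext_iff]) (Or.inr (Or.inl
          ⟨(by omega : 1 ≤ k + 2), (by omega : k + 1 + 2 = k + 2 + 1), (by omega : k + 1 + 2 ≤ n + 3)⟩))).1
    have hN : P ⟨n + 4, by simp only [AffineType.rank]; omega⟩ :=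
      hs _ _ (key n (by omega)) (e _ _ (by simp [Fin.ext_iff]) (by simp [AffineType.edge])).1
    obtain ⟨i, hi⟩ := i
    simp only [AffineType.rank] at hi
    rcases Nat.lt_or_ge i 2 with h | h
    · interval_cases i
      · exact h0
      · exact h1
    · obtain ⟨k, rfl⟩ := Nat.exists_eq_add_of_le' h
      rcases Nat.lt_or_ge k (n + 2) with h' | h'
      · exact key k (by omega)
      · obtain rfl : k = n + 2 := by omega
        exact hN
  | E6 =>
    have h3 : P 3 := hs 0 _ h0 (by decide)
    have h6 : P 6 := hs 3 _ h3 (by decide)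
    have h4 : P 4 := hs 6 _ h6 (by decide)
    have h5 : P 5 := hs 6 _ h6 (by decide)
    have h1 : P 1 := hs 4 _ h4 (by decide)
    have h2 : P 2 := hs 5 _ h5 (by decide)
    change Fin 7 at i
    fin_cases i <;> assumption
  | E7 =>
    have h2 : P 2 := hs 0 _ h0 (by decide)
    have h3 : P 3 := hs 2 _ h2 (by decide)
    have h4 : P 4 := hs 3 _ h3 (by decide)
    have h5 : P 5 := hs 4 _ h4 (by decide)
    have h6 : P 6 := hs 5 _ h5 (by decide)
    have h1 : P 1 := hs 6 _ h6 (by decide)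
    have h7 : P 7 := hs 4 _ h4 (by decide)
    change Fin 8 at i
    fin_cases i <;> assumption
  | E8 =>
    have h1 : P 1 := hs 0 _ h0 (by decide)
    have h2 : P 2 := hs 1 _ h1 (by decide)
    have h3 : P 3 := hs 2 _ h2 (by decide)
    have h4 : P 4 := hs 3 _ h3 (by decide)
    have h5 : P 5 := hs 4 _ h4 (by decide)
    have h6 : P 6 := hs 5 _ h5 (by decide)
    have h7 : P 7 := hs 6 _ h6 (by decide)
    have h8 : P 8 := hs 5 _ h5 (by decide)
    change Fin 9 at i
    fin_cases i <;> assumption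

/-- Level one nodes in the same class modulo the root lattice coincide. -/
theorem eq_of_single_sub_single {X : AffineType} {a b : Node X} (ha : label X a = 1)
    (hb : label X b = 1) {β : Node X → ℤ}
    (h : ∀ i, (Pi.single a 1 : Node X → ℤ) i - (Pi.single b 1 : Node X → ℤ) i =
      ∑ j, cartan X i j * β j) : a = b := by
  -- A vector χ that the Cartan matrix kills modulo m is a character of weights modulo the root
  -- lattice; it is evaluated on Λ_a - Λ_b, with symmetry of the matrix used to transfer it to χ.
  have key : ∀ (m : ℤ) (χ : Node X → ℤ), (∀ i, m ∣ ∑ j, cartan X i j * χ j) → m ∣ χ a - χ b := by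
    intro m χ hχ
    have h1 : χ a - χ b = ∑ i, χ i * ((Pi.single a 1 : Node X → ℤ) i - (Pi.single b 1 : Node X → ℤ) i) := by
      simp [mul_sub, Finset.sum_sub_distrib, Pi.single_apply]
    rw [h1]
    simp only [h, Finset.mul_sum]
    rw [Finset.sum_comm]
    refine Finset.dvd_sum fun j _ => ?_
    have h2 : ∑ i, χ i * (cartan X i j * β j) = (∑ i, cartan X j i * χ i) * β j := by
      rw [Finset.sum_mul]
      refine Finset.sum_congr rfl fun i _ => ?_
      rw [cartan_symm j i]; ring
    rw [h2]
    exact (hχ j).mul_right _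
  cases X with
  | A n =>
    -- The position on the cycle is a character modulo its length: second differences vanish except
    -- at the two ends, where they are ±(n + 3).
    have h1 := key (n + 3) (fun i => (i : ℕ)) fun i => by
      have hi : (i : ℕ) < n + 3 := i.isLt
      rw [cartan_A_sum n i _ fun j hj => by rw [hj, zero_mul], cartan_self,
        (cartan_add_one_A i).1, (cartan_sub_one_A i).1, val_add_one_A, val_sub_one_A]
      generalize (i : ℕ) = i at *
      rcases Nat.eq_zero_or_pos i with h0 | h0
      · rw [if_pos h0, if_neg (by omega), h0]; exact ⟨-1, by push_cast; ring⟩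
      · rw [if_neg (by omega : ¬ i = 0)]
        split_ifs with h2
        · exact ⟨1, by rw [h2]; push_cast [show 1 ≤ n + 2 by omega]; ring⟩
        · exact ⟨0, by push_cast [show 1 ≤ i by omega]; ring⟩
    have ha' : (a : ℕ) < n + 3 := a.isLt
    have hb' : (b : ℕ) < n + 3 := b.isLt
    obtain ⟨k, hk⟩ := h1
    rw [Fin.ext_iff]
    have : k = 0 := by
      by_contra hc
      rcases lt_or_gt_of_ne hc with hc | hc
      · nlinarith
      · nlinarith
    rw [this] at hk
    omega
  | D n =>
    -- The first character separates the nodes {0, 1} from the two spinor nodes. The second one,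
    -- modulo 4, depends on the parity of n, reflecting that the class group is ℤ/2 × ℤ/2 or ℤ/4;
    -- together they distinguish the four nodes of label one.
    have h1 := key 2 (fun i => if (i : ℕ) = n + 3 ∨ (i : ℕ) = n + 4 then 1 else 0) fun i => by
      have hi : (i : ℕ) < n + 5 := i.isLt
      rw [cartan_D_sum n i fun i => if i = n + 3 ∨ i = n + 4 then 1 else 0]
      generalize (i : ℕ) = i at *
      grind
    have h2 := key 4 (fun i => if (i : ℕ) = 0 then 0 else if (i : ℕ) ≤ n + 2 then
        (if (i : ℕ) % 2 = 1 then 2 else 0) else if (i : ℕ) = n + 3 then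
          (if n % 2 = 0 then 2 else 1) else (if n % 2 = 0 then 0 else 3)) fun i => by
      have hi : (i : ℕ) < n + 5 := i.isLt
      rw [cartan_D_sum n i fun i => if (i : ℕ) = 0 then 0 else if (i : ℕ) ≤ n + 2 then
        (if (i : ℕ) % 2 = 1 then 2 else 0) else if (i : ℕ) = n + 3 then
          (if n % 2 = 0 then 2 else 1) else (if n % 2 = 0 then 0 else 3)]
      generalize (i : ℕ) = i at *
      have e1 : i = 0 ∨ i = 1 ∨ i = 2 ∨ (3 ≤ i ∧ i ≤ n + 1) ∨ (3 ≤ i ∧ i = n + 2) ∨ i = n + 3 ∨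
        i = n + 4 := by omega
      have e2 : n % 2 = 0 ∨ n % 2 = 1 := by omega
      rcases e1 with rfl | rfl | rfl | e1 | e1 | rfl | rfl <;> rcases e2 with e2 | e2
      all_goals grind (splits := 30)
    simp only [label, AffineType.label] at ha hb
    have ha' : (a : ℕ) < n + 5 := a.isLt
    have hb' : (b : ℕ) < n + 5 := b.isLt
    rw [Fin.ext_iff]
    clear key h
    generalize (a : ℕ) = a at *
    generalize (b : ℕ) = b at *
    grind
  | E6 =>
    -- This character modulo 3 takes the values 0, 1, 2 on the three nodes of label one.
    have h1 := key 3 ![0, 1, 2, 0, 2, 1, 0] (by decide)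
    have h2 : ∀ a b : Node .E6, label .E6 a = 1 → label .E6 b = 1 → (3 : ℤ) ∣
        (![0, 1, 2, 0, 2, 1, 0] : Fin 7 → ℤ) a - (![0, 1, 2, 0, 2, 1, 0] : Fin 7 → ℤ) b → a = b := by decide
    exact h2 a b ha hb h1
  | E7 =>
    have h1 := key 2 ![0, 1, 0, 0, 0, 1, 0, 1] (by decide)
    have h2 : ∀ a b : Node .E7, label .E7 a = 1 → label .E7 b = 1 → (2 : ℤ) ∣
        (![0, 1, 0, 0, 0, 1, 0, 1] : Fin 8 → ℤ) a - (![0, 1, 0, 0, 0, 1, 0, 1] : Fin 8 → ℤ) b → a = b := by decide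
    exact h2 a b ha hb h1
  | E8 =>
    have h2 : ∀ a b : Node .E8, label .E8 a = 1 → label .E8 b = 1 → a = b := by decide
    exact h2 a b ha hb

/-! ### Semidefiniteness of the affine form and the energy bound -/

theorem label_pos {X : AffineType} (i : Node X) : 0 < label X i := by
  cases X with
  | A n => exact Nat.one_pos
  | D n => simp only [label, AffineType.label]; split_ifs <;> norm_num
  | E6 => revert i; decide
  | E7 => revert i; decide
  | E8 => revert i; decide

/-- The Dirichlet form of the affine diagram. -/
def dirichlet {X : AffineType} (x : Node X → ℝ) : ℝ :=
  ∑ i, ∑ j, -(cartan X i j : ℝ) * label X i * label X j * (x i - x j) ^ 2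

/-- Writing β_i = a_i x_i and expanding the squared differences, the terms with x_i² and x_j² vanish
because the labels lie in the kernel of the Cartan matrix. The quadratic form thus becomes a sum of
squares over edges. -/
theorem dirichlet_eq {X : AffineType} (β x : Node X → ℝ) (h : ∀ i, β i = label X i * x i) :
    dirichlet x = 2 * ∑ i, ∑ j, β i * cartan X i j * β j := by
  have hl : ∀ i : Node X, ∑ j, (cartan X i j : ℝ) * label X j = 0 := fun i => by
    exact_mod_cast cartan_label X i
  have h1 : ∑ i, ∑ j, (cartan X i j : ℝ) * label X i * label X j * x i ^ 2 = 0 := by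
    refine Finset.sum_eq_zero fun i _ => ?_
    have : ∀ j, (cartan X i j : ℝ) * label X i * label X j * x i ^ 2 =
        (label X i * x i ^ 2) * (cartan X i j * label X j) := fun j => by ring
    simp only [this, ← Finset.mul_sum, hl, mul_zero]
  have h2 : ∑ i, ∑ j, (cartan X i j : ℝ) * label X i * label X j * x j ^ 2 = 0 := by
    rw [Finset.sum_comm, ← h1]
    refine Finset.sum_congr rfl fun i _ => Finset.sum_congr rfl fun j _ => ?_
    rw [cartan_symm j i]; ring
  have h3 : dirichlet x = 2 * ∑ i, ∑ j, β i * cartan X i j * β j -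
      ∑ i, ∑ j, (cartan X i j : ℝ) * label X i * label X j * x i ^ 2 -
      ∑ i, ∑ j, (cartan X i j : ℝ) * label X i * label X j * x j ^ 2 := by
    rw [dirichlet, Finset.mul_sum, ← Finset.sum_sub_distrib, ← Finset.sum_sub_distrib]
    refine Finset.sum_congr rfl fun i _ => ?_
    rw [Finset.mul_sum, ← Finset.sum_sub_distrib, ← Finset.sum_sub_distrib]
    refine Finset.sum_congr rfl fun j _ => ?_
    rw [h, h]; ring
  rw [h3, h1, h2, sub_zero, sub_zero]

theorem dirichlet_term_nonneg {X : AffineType} (x : Node X → ℝ) (i j : Node X) :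
    0 ≤ -(cartan X i j : ℝ) * label X i * label X j * (x i - x j) ^ 2 := by
  rcases cartan_cases i j with ⟨rfl, -⟩ | ⟨-, h⟩ | ⟨-, h⟩
  · simp
  · rw [h]; push_cast; rw [neg_neg, one_mul]; positivity
  · simp [h]

theorem dirichlet_nonneg {X : AffineType} (x : Node X → ℝ) : 0 ≤ dirichlet x :=
  Finset.sum_nonneg fun i _ => Finset.sum_nonneg fun j _ => dirichlet_term_nonneg x i j

/-- Poincaré inequality on the affine diagram. -/
theorem sq_sub_le_dirichlet {X : AffineType} (i : Node X) :
    ∃ C : ℝ, 0 ≤ C ∧ ∀ x : Node X → ℝ, (x i - x 0) ^ 2 ≤ C * dirichlet x := by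
  induction i using node_induction with
  | h0 => exact ⟨0, le_rfl, fun x => by simp⟩
  | hs i j ih hij =>
    obtain ⟨C, hC, h⟩ := ih
    -- From (s - t)² ≤ 2s² + 2t², with s = x_i - x_0 bounded by C times the form and t = x_i - x_j
    -- bounded by the form itself, since the edge occurs in it with weight at least 1.
    refine ⟨2 * C + 2, by positivity, fun x => ?_⟩
    have h1 := h x
    have h2 : (x i - x j) ^ 2 ≤ dirichlet x := by
      have h3 := (Finset.single_le_sum (fun j _ => dirichlet_term_nonneg x i j)
        (Finset.mem_univ j)).trans (Finset.single_le_sum (fun i _ =>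
          Finset.sum_nonneg fun j _ => dirichlet_term_nonneg x i j) (Finset.mem_univ i))
      refine le_trans ?_ h3
      have hi : (1 : ℝ) ≤ label X i := by exact_mod_cast label_pos i
      have hj : (1 : ℝ) ≤ label X j := by exact_mod_cast label_pos j
      rw [hij]; push_cast; rw [neg_neg, one_mul]
      exact le_mul_of_one_le_left (sq_nonneg _) (by nlinarith)
    nlinarith [sq_nonneg ((x i - x 0) + (x i - x j))]

/-- The Dirichlet form of β_i/a_i vanishes, so by the Poincaré inequality this function is constant,
equal to its value 0 at the affine node. -/
theorem eq_zero_of_cartan_eq_zero {X : AffineType} {β : Node X → ℤ} (h0 : β 0 = 0)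
    (h : ∀ i, ∑ j, cartan X i j * β j = 0) : β = 0 := by
  set x : Node X → ℝ := fun i => β i / label X i with hx
  have hl : ∀ i : Node X, (label X i : ℝ) ≠ 0 := fun i => by exact_mod_cast (label_pos i).ne'
  have hd : dirichlet x = 0 := by
    rw [dirichlet_eq (fun i => (β i : ℝ)) x fun i => by rw [hx]; field_simp [hl i]]
    have : ∀ i, ∑ j, (β i : ℝ) * cartan X i j * β j = 0 := fun i => by
      have := h i
      simp only [mul_assoc, ← Finset.mul_sum]
      norm_cast
      rw [this]; simp
    simp [this]
  funext i
  obtain ⟨C, hC, hb⟩ := sq_sub_le_dirichlet i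
  have h1 := hb x
  rw [hd, mul_zero] at h1
  have h2 : x i - x 0 = 0 := by nlinarith [sq_nonneg (x i - x 0)]
  simp only [hx, h0, Int.cast_zero, zero_div, sub_zero, div_eq_zero_iff, hl i, or_false] at h2
  exact_mod_cast h2

/-- Splitting the symmetric matrix into a triangular half with 1 on the diagonal and its transpose
shows evenness, so the integer division in `energy` is exact. -/
theorem even_quadratic {X : AffineType} (β : Node X → ℤ) :
    ∃ s, ∑ i, ∑ j, β i * cartan X i j * β j = 2 * s := by
  set T : Node X → Node X → ℤ := fun i j => if j < i then cartan X i j else if i = j then 1 else 0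
    with hT
  have h1 : ∀ i j, cartan X i j = T i j + T j i := by
    intro i j
    rcases lt_trichotomy i j with h | h | h
    · simp [hT, h, h.not_gt, h.ne, cartan_symm i j]
    · subst h; simp [hT, cartan_self]
    · simp [hT, h, h.not_gt, h.ne]
  refine ⟨∑ i, ∑ j, β i * T i j * β j, ?_⟩
  rw [two_mul]
  nth_rw 3 [Finset.sum_comm]
  rw [← Finset.sum_add_distrib]
  refine Finset.sum_congr rfl fun i _ => ?_
  rw [← Finset.sum_add_distrib]
  refine Finset.sum_congr rfl fun j _ => ?_
  rw [h1]; ring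

theorem two_mul_energy {X : AffineType} (lam : Node X → ℤ) (β : RootLattice X) :
    2 * energy lam β = 2 * ∑ i, lam i * β i + ∑ i, ∑ j, β i * cartan X i j * β j := by
  obtain ⟨s, hs⟩ := even_quadratic β
  rw [energy, hs, Int.mul_ediv_cancel_left _ two_ne_zero]
  ring

/-- With x_i = β_i/a_i and t = x_a - x_0 one has 4E = 4t + D, where D is the Dirichlet form; a and 0
having label one, t is the linear term. Since t² ≤ K D by the Poincaré inequality, completing the
square gives E ≥ -K. -/
theorem energy_bound {X : AffineType} (a : Node X) (ha : label X a = 1) :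
    ∃ C : ℤ, ∀ β, -C ≤ energy (Pi.single a 1 - Pi.single 0 1) β := by
  obtain ⟨C, hC, hb⟩ := sq_sub_le_dirichlet a
  obtain ⟨K, hK⟩ := exists_nat_ge C
  refine ⟨K, fun β => ?_⟩
  have hl : ∀ i : Node X, (label X i : ℝ) ≠ 0 := fun i => by exact_mod_cast (label_pos i).ne'
  set x : Node X → ℝ := fun i => β i / label X i with hx
  have h1 := hb x
  have h2 := dirichlet_eq (fun i => (β i : ℝ)) x fun i => by rw [hx]; field_simp [hl i]
  have h3 := two_mul_energy (Pi.single a 1 - Pi.single 0 1) β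
  have h4 : ∑ i, (Pi.single a 1 - Pi.single 0 1 : Node X → ℤ) i * β i = β a - β 0 := by
    simp [sub_mul, Finset.sum_sub_distrib, Pi.single_apply]
  rw [h4] at h3
  have h5 : x a - x 0 = β a - β 0 := by simp [hx, ha, label_zero]
  have h6 : 4 * (energy (Pi.single a 1 - Pi.single 0 1) β : ℝ) =
      4 * (x a - x 0) + dirichlet x := by
    rw [h2, h5]
    have : (2 * energy (Pi.single a 1 - Pi.single 0 1) β : ℝ) = 2 * (β a - β 0) +
      ∑ i, ∑ j, (β i : ℝ) * cartan X i j * β j := by exact_mod_cast h3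
    linarith
  have h7 := dirichlet_nonneg x
  have h8 : -(K : ℝ) ≤ energy (Pi.single a 1 - Pi.single 0 1) β := by
    rcases le_or_gt 0 (x a - x 0) with h | h
    · nlinarith
    · have : (x a - x 0) ^ 2 ≤ K * dirichlet x := h1.trans (mul_le_mul_of_nonneg_right hK h7)
      rcases K.eq_zero_or_pos with hK0 | hK0
      · subst hK0; norm_num at this; nlinarith [sq_nonneg (x a - x 0)]
      · have hK' : (0 : ℝ) < K := by exact_mod_cast hK0
        by_contra hc
        push Not at hc
        nlinarith [sq_nonneg (x a - x 0 + 2 * K)]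
  exact_mod_cast h8

/-! ### Nondegeneracy of the Heisenberg pairing -/

section Heisenberg

/-- Going once around the cycle multiplies g by c^{n+3}. -/
theorem eq_zero_of_rotation {n : ℕ} {g : Node (.A n) → ℂ} {c : ℂ} (hc : c ^ (n + 3) ≠ 1)
    (h : ∀ i, g (i + 1) = c * g i) : g = 0 := by
  have h0 : ∀ k : ℕ, ∀ i : Node (.A n), g (i + k • (1 : Node (.A n))) = c ^ k * g i := by
    intro k
    induction k with
    | zero => intro i; simp
    | succ k ih => intro i; rw [succ_nsmul, ← add_assoc, h, ih, pow_succ]; ring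
  funext i
  have h1 := h0 (n + 3) i
  have h2 : (n + 3) • (1 : Node (.A n)) = 0 := by
    have := card_nsmul_eq_zero (x := (1 : Node (.A n)))
    rwa [Fintype.card_fin] at this
  rw [h2, add_zero] at h1
  have h3 : (c ^ (n + 3) - 1) * g i = 0 := by linear_combination -h1
  exact (mul_eq_zero.mp h3).resolve_left (sub_ne_zero.mpr hc)

/-- Reality gives (z̄ - z)(z z̄ - 1) = 0, and |z| < 1 leaves only z real; then |z + z⁻¹| = |z| +
|z|⁻¹ > 2. -/
theorem norm_add_inv_gt {z : ℂ} (h0 : z ≠ 0) (h1 : ‖z‖ < 1)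
    (hr : (starRingEnd ℂ) (z + z⁻¹) = z + z⁻¹) : 2 < ‖z + z⁻¹‖ := by
  have hz' : (starRingEnd ℂ) z ≠ 0 := by simpa using h0
  have hn : 0 < ‖z‖ := norm_pos_iff.mpr h0
  have hzz : z * (starRingEnd ℂ) z = (‖z‖ ^ 2 : ℝ) := by
    rw [Complex.mul_conj, Complex.normSq_eq_norm_sq]
  have h2 : z * (starRingEnd ℂ) z ≠ 1 := by
    rw [hzz]
    intro h
    have : ‖z‖ ^ 2 = 1 := by exact_mod_cast h
    nlinarith
  have h3 : (starRingEnd ℂ) z = z := by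
    rw [map_add, map_inv₀] at hr
    field_simp at hr
    have : ((starRingEnd ℂ) z - z) * (z * (starRingEnd ℂ) z - 1) = 0 := by linear_combination hr
    exact sub_eq_zero.mp ((mul_eq_zero.mp this).resolve_right (sub_ne_zero.mpr h2))
  have h4 : z * (z + z⁻¹) = ((‖z‖ ^ 2 + 1 : ℝ) : ℂ) := by
    rw [mul_add, mul_inv_cancel₀ h0]
    rw [h3] at hzz
    rw [hzz]; push_cast; ring
  have h5 : ‖z‖ * ‖z + z⁻¹‖ = ‖z‖ ^ 2 + 1 := by
    rw [← norm_mul, h4, Complex.norm_real, Real.norm_eq_abs, abs_of_pos (by positivity)]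
  by_contra hc
  push Not at hc
  nlinarith [sq_nonneg (‖z‖ - 1)]

/-- The adjacency matrix is nonnegative and symmetric, with the labels as positive eigenvector for
the eigenvalue 2. Summing absolute values against the labels bounds t as in Perron's argument, and
symmetry makes t real. -/
theorem norm_le_two_of_eigen {X : AffineType} {f : Node X → ℂ} (hf : f ≠ 0) {t : ℂ}
    (h : ∀ i, ∑ j, (2 * (if i = j then 1 else 0) - cartan X i j : ℂ) * f j = t * f i) :
    ‖t‖ ≤ 2 ∧ (starRingEnd ℂ) t = t := by
  set N : Node X → Node X → ℝ := fun i j => 2 * (if i = j then 1 else 0) - cartan X i j with hN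
  have hNn : ∀ i j, 0 ≤ N i j := by
    intro i j
    rcases cartan_cases i j with ⟨rfl, h⟩ | ⟨h', h⟩ | ⟨h', h⟩ <;> simp_all
  have hNs : ∀ i j, N i j = N j i := fun i j => by simp [hN, cartan_symm i j, eq_comm (a := i)]
  have h' : ∀ i, ∑ j, (N i j : ℂ) * f j = t * f i := fun i => by
    rw [← h i]
    refine Finset.sum_congr rfl fun j _ => ?_
    simp only [hN]; push_cast
    split_ifs <;> simp
  obtain ⟨k, hk⟩ := Function.ne_iff.mp hf
  have hk' : 0 < ‖f k‖ := norm_pos_iff.mpr hk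
  constructor
  · have hl : ∀ j, ∑ i, (label X i : ℝ) * N i j = 2 * label X j := by
      intro j
      have h1 : ∑ i, (cartan X j i : ℝ) * label X i = 0 := by exact_mod_cast cartan_label X j
      have h2 : ∀ i, (label X i : ℝ) * N i j =
          2 * (if i = j then (label X i : ℝ) else 0) - cartan X j i * label X i := by
        intro i
        simp only [hN, cartan_symm i j]
        split_ifs <;> ring
      simp [h2, Finset.sum_sub_distrib, h1]
    have h1 : ∑ i, (label X i : ℝ) * (‖t‖ * ‖f i‖) ≤ ∑ i, (label X i : ℝ) * ∑ j, N i j * ‖f j‖ := by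
      refine Finset.sum_le_sum fun i _ => mul_le_mul_of_nonneg_left ?_ (Nat.cast_nonneg _)
      rw [← norm_mul, ← h']
      refine (norm_sum_le _ _).trans_eq (Finset.sum_congr rfl fun j _ => ?_)
      rw [norm_mul, Complex.norm_real, Real.norm_eq_abs, abs_of_nonneg (hNn i j)]
    have h2 : ∑ i, (label X i : ℝ) * ∑ j, N i j * ‖f j‖ = 2 * ∑ j, (label X j : ℝ) * ‖f j‖ := by
      simp only [Finset.mul_sum]
      rw [Finset.sum_comm]
      refine Finset.sum_congr rfl fun j _ => ?_
      simp only [← mul_assoc, ← Finset.sum_mul, hl]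
    have h3 : ∑ i, (label X i : ℝ) * (‖t‖ * ‖f i‖) = ‖t‖ * ∑ j, (label X j : ℝ) * ‖f j‖ := by
      rw [Finset.mul_sum]
      exact Finset.sum_congr rfl fun _ _ => by ring
    rw [h2, h3] at h1
    refine le_of_mul_le_mul_right h1 ?_
    refine Finset.sum_pos' (fun i _ => by positivity) ⟨k, Finset.mem_univ _, ?_⟩
    have : (0 : ℝ) < label X k := by exact_mod_cast label_pos k
    positivity
  · have h1 : t * ∑ i, (starRingEnd ℂ) (f i) * f i =
        ∑ i, ∑ j, (N i j : ℂ) * ((starRingEnd ℂ) (f i) * f j) := by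
      rw [Finset.mul_sum]
      refine Finset.sum_congr rfl fun i _ => ?_
      rw [mul_left_comm, ← h', Finset.mul_sum]
      exact Finset.sum_congr rfl fun _ _ => by ring
    have hS : (starRingEnd ℂ) (∑ i, (starRingEnd ℂ) (f i) * f i) =
        ∑ i, (starRingEnd ℂ) (f i) * f i := by
      simp [map_sum, mul_comm]
    have h2 : (starRingEnd ℂ) (t * ∑ i, (starRingEnd ℂ) (f i) * f i) =
        t * ∑ i, (starRingEnd ℂ) (f i) * f i := by
      rw [h1]
      simp only [map_sum, map_mul, Complex.conj_conj, Complex.conj_ofReal]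
      rw [Finset.sum_comm]
      refine Finset.sum_congr rfl fun i _ => Finset.sum_congr rfl fun j _ => ?_
      rw [hNs]; ring
    rw [map_mul, hS] at h2
    refine mul_right_cancel₀ ?_ h2
    have h3 : ∑ i, (starRingEnd ℂ) (f i) * f i = ((∑ i, ‖f i‖ ^ 2 : ℝ) : ℂ) := by
      push_cast
      exact Finset.sum_congr rfl fun i _ => Complex.conj_mul' (f i)
    rw [h3]
    norm_cast
    refine (Finset.sum_pos' (fun i _ => by positivity) ⟨k, Finset.mem_univ _, by positivity⟩).ne'

theorem qInt_two_mul {q : ℂ} (hq : q ≠ 0) (m : ℤ) :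
    qInt q (2 * m) = qInt q m * (q ^ m + (q ^ m)⁻¹) := by
  simp only [qInt, two_mul, neg_add, zpow_add₀ hq, zpow_neg]
  have := zpow_ne_zero m hq
  ring

theorem qInt_neg (q : ℂ) (m : ℤ) : qInt q (-m) = -qInt q m := by
  simp only [qInt, neg_neg]; ring

theorem GenericParams.norm_pow_lt {q κ p : ℂ} (hg : GenericParams q κ p) {m : ℤ} (hm : 0 < m) :
    ‖q ^ m‖ < 1 := by
  lift m to ℕ using hm.le
  rw [zpow_natCast, norm_pow]
  exact pow_lt_one₀ (norm_nonneg _) hg.q_lt (by omega)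

theorem GenericParams.sub_inv_ne {q κ p : ℂ} (hg : GenericParams q κ p) : q - q⁻¹ ≠ 0 := by
  intro h
  have h1 : q * q = 1 := by
    rw [sub_eq_zero] at h
    nth_rw 2 [h]
    exact mul_inv_cancel₀ hg.q_ne
  have := hg.indep 2 0 (by rw [zpow_two]; simpa using h1)
  omega

theorem GenericParams.qInt_ne {q κ p : ℂ} (hg : GenericParams q κ p) {m : ℤ} (hm : m ≠ 0) :
    qInt q m ≠ 0 := by
  refine div_ne_zero ?_ hg.sub_inv_ne
  intro h
  have := hg.indep (2 * m) 0 (by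
    rw [zpow_neg, sub_eq_zero] at h
    rw [two_mul, zpow_add₀ hg.q_ne]
    nth_rw 2 [h]
    simp [mul_inv_cancel₀ (zpow_ne_zero m hg.q_ne)])
  omega

/-- The matrix `([a_{ij} m] κ^{-m m_{ij}})` is nondegenerate. -/
theorem heisenberg_nondegenerate {X : AffineType} {q κ p : ℂ} (hg : GenericParams q κ p) {m : ℤ}
    (hm : 0 < m) {f : Node X → ℂ}
    (h : ∀ i, ∑ j, qInt q (cartan X i j * m) * κ ^ (-m * mMat X i j) * f j = 0) : f = 0 := by
  have hq := hg.qInt_ne hm.ne'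
  have hz : q ^ m ≠ 0 := zpow_ne_zero m hg.q_ne
  -- Without κ the matrix is [m] times q^m + q^{-m} minus the adjacency matrix, so a null vector is
  -- an eigenvector of the diagram for q^m + q^{-m}.
  have generic : (∀ i j : Node X, mMat X i j = 0) → f = 0 := by
    intro hmm
    by_contra hf
    obtain ⟨h1, h2⟩ := norm_le_two_of_eigen hf (t := q ^ m + (q ^ m)⁻¹) fun i => by
      have h3 := h i
      have h4 : ∀ j, qInt q (cartan X i j * m) * κ ^ (-m * mMat X i j) * f j = qInt q m *
          ((q ^ m + (q ^ m)⁻¹) * (if i = j then f j else 0) -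
            (2 * (if i = j then 1 else 0) - cartan X i j : ℂ) * f j) := by
        intro j
        rw [hmm, mul_zero, zpow_zero]
        rcases cartan_cases i j with ⟨rfl, h⟩ | ⟨h', h⟩ | ⟨h', h⟩
        · rw [h, qInt_two_mul hg.q_ne]; simp; ring
        · rw [h, neg_one_mul, qInt_neg]; simp [h']
        · rw [h]; simp [h', qInt]
      simp only [h4, ← Finset.mul_sum, mul_eq_zero, hq, false_or, Finset.sum_sub_distrib] at h3
      rw [sub_eq_zero] at h3
      rw [← h3]
      simp
    exact absurd h1 (norm_add_inv_gt hz (hg.norm_pow_lt hm) h2).not_ge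
  cases X with
  | A n =>
    have hK : κ ^ m ≠ 0 := zpow_ne_zero m hg.κ_ne
    have row : ∀ i : Node (.A n), (q ^ m + (q ^ m)⁻¹) * f i = κ ^ m * f (i + 1) +
        (κ ^ m)⁻¹ * f (i - 1) := by
      intro i
      have h1 := h i
      rw [cartan_A_sum n i _ fun j hj => by rw [hj]; simp [qInt], cartan_self,
        (cartan_add_one_A i).1, (cartan_sub_one_A i).1, (cartan_add_one_A i).2,
        (cartan_sub_one_A i).2, mMat_eq_zero (i := i) (j := i) (by rw [cartan_self]; decide),
        qInt_two_mul hg.q_ne, neg_one_mul, qInt_neg] at h1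
      simp only [mul_zero, zpow_zero, mul_one, mul_neg, neg_neg, zpow_neg] at h1
      refine mul_left_cancel₀ hq ?_
      linear_combination h1
    have npow : ∀ s : ℤ, s ≠ 0 → ∀ c : ℂ, c = q ^ (-m) * κ ^ s ∨ c = q ^ m * κ ^ s →
        c ^ (n + 3) ≠ 1 := by
      rintro s hs c (rfl | rfl) hc
      · rw [mul_pow, ← zpow_natCast, ← zpow_natCast, ← zpow_mul, ← zpow_mul] at hc
        have := (hg.indep _ _ hc).2
        rcases mul_eq_zero.mp this with h | h
        · exact hs h
        · omega
      · rw [mul_pow, ← zpow_natCast, ← zpow_natCast, ← zpow_mul, ← zpow_mul] at hc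
        have := (hg.indep _ _ hc).2
        rcases mul_eq_zero.mp this with h | h
        · exact hs h
        · omega
    -- With S the rotation twisted by κ^m, the equation reads (S + S⁻¹ - q^m - q^{-m})f = 0 and
    -- factors through S - q^m and S - q^{-m}. Each factor is injective, since its monodromy around
    -- the cycle is a nontrivial monomial in q and κ.
    have h1 : (fun i => κ ^ m * f (i + 1) - q ^ m * f i) = 0 := by
      refine eq_zero_of_rotation (npow (-m) (by omega) (q ^ (-m) * κ ^ (-m)) (Or.inl rfl)) fun i => ?_
      have h2 := row (i + 1)
      rw [add_sub_cancel_right] at h2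
      simp only [zpow_neg]
      have e1 : (κ ^ m)⁻¹ * κ ^ m = 1 := inv_mul_cancel₀ hK
      have e2 : (q ^ m)⁻¹ * q ^ m = 1 := inv_mul_cancel₀ hz
      linear_combination -h2 - (q ^ m)⁻¹ * f (i + 1) * e1 + (κ ^ m)⁻¹ * f i * e2
    refine eq_zero_of_rotation (npow (-m) (by omega) (q ^ m * κ ^ (-m)) (Or.inr rfl)) fun i => ?_
    have h2 := congrFun h1 i
    simp only [Pi.zero_apply] at h2
    rw [zpow_neg]
    have e1 : (κ ^ m)⁻¹ * κ ^ m = 1 := inv_mul_cancel₀ hK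
    linear_combination (κ ^ m)⁻¹ * h2 - f (i + 1) * e1
  | _ => exact generic fun _ _ => rfl

end Heisenberg

/-! ### Weights and energies of the basis vectors -/

theorem hval_add {X : AffineType} (lam : Node X → ℤ) (β γ : RootLattice X) (i : Node X) :
    hval lam (β + γ) i = hval lam β i + ∑ j, cartan X i j * γ j := by
  simp only [hval, Pi.add_apply, mul_add, Finset.sum_add_distrib]
  ring

theorem hval_add_single {X : AffineType} (lam : Node X → ℤ) (β : RootLattice X) (i j : Node X)
    (s : ℤ) : hval lam (β + Pi.single j s) i = hval lam β i + cartan X i j * s := by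
  rw [hval_add, Finset.sum_eq_single j]
  · simp
  · intro k _ hk; simp [Pi.single_eq_of_ne hk]
  · simp

/-- Polarization of the quadratic form. For s = ±1 the increment is ±h + 1, which is the exponent in
z^{±h+1}; this makes the modes homogeneous for q^d. -/
theorem energy_add_single {X : AffineType} (lam : Node X → ℤ) (β : RootLattice X) (j : Node X)
    (s : ℤ) : energy lam (β + Pi.single j s) = energy lam β + s * hval lam β j + s ^ 2 := by
  have h1 := two_mul_energy lam (β + Pi.single j s)
  have h2 := two_mul_energy lam β
  have h3 : ∑ i, lam i * (β + Pi.single j s : Node X → ℤ) i = ∑ i, lam i * β i + lam j * s := by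
    simp [mul_add, Finset.sum_add_distrib, Pi.single_apply]
  have h4 : ∑ i, ∑ k, (β + Pi.single j s : Node X → ℤ) i * cartan X i k *
      (β + Pi.single j s : Node X → ℤ) k = ∑ i, ∑ k, β i * cartan X i k * β k +
        2 * s * (∑ k, cartan X j k * β k) + 2 * s ^ 2 := by
    have e1 : ∀ i k, (β + Pi.single j s : Node X → ℤ) i * cartan X i k *
        (β + Pi.single j s : Node X → ℤ) k = β i * cartan X i k * β k +
          (if i = j then s * (cartan X j k * β k) else 0) +
          (if k = j then s * (cartan X j i * β i) else 0) +
          (if i = j then (if k = j then s ^ 2 * 2 else 0) else 0) := by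
      intro i k
      simp only [Pi.add_apply, Pi.single_apply]
      split_ifs with h h' h'
      · subst h; subst h'; simp [cartan_self]; ring
      · subst h; simp; ring
      · subst h'; simp [cartan_symm k i]; ring
      · simp
    simp only [e1, Finset.sum_add_distrib, ← Finset.mul_sum, Finset.sum_ite_eq',
      Finset.mem_univ, if_true]
    rw [Finset.sum_comm (f := fun i k => if i = j then s * (cartan X j k * β k) else 0),
      Finset.sum_comm (f := fun i k => if i = j then (if k = j then s ^ 2 * 2 else 0) else 0)]
    simp only [Finset.sum_ite_eq', Finset.mem_univ, if_true, ← Finset.mul_sum]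
    ring
  have h5 : hval lam β j = lam j + ∑ k, cartan X j k * β k := rfl
  rw [h3, h4] at h1
  rw [h5]
  linarith

theorem dynMove_zero {X : AffineType} (ν : DynLattice X) : dynMove 0 ν = ν := by
  ext i; simp [dynMove]

theorem dynMove_dynMove {X : AffineType} (γ γ' : Node X → ℤ) (ν : DynLattice X) :
    dynMove γ (dynMove γ' ν) = dynMove (γ + γ') ν := by
  ext i; simp [dynMove]; ring

theorem dynMove_comm {X : AffineType} (γ γ' : Node X → ℤ) (ν : DynLattice X) :
    dynMove γ (dynMove γ' ν) = dynMove γ' (dynMove γ ν) := by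
  rw [dynMove_dynMove, dynMove_dynMove, add_comm]

theorem dynMove_label {X : AffineType} (ν : DynLattice X) (s : ℤ) :
    dynMove (fun i => s * label X i) ν = ν := by
  ext i; simp [dynMove, label_zero]

/-- The element `Q_γ = ∑ γ_j Q_j`. -/
def dynWeight {X : AffineType} (γ : Node X → ℤ) : Node X → ℂ :=
  fun i => ∑ j, (cartan X i j : ℂ) * γ j

theorem dynWeight_add {X : AffineType} (γ γ' : Node X → ℤ) :
    dynWeight (γ + γ') = dynWeight γ + dynWeight γ' := by
  funext i; simp [dynWeight, mul_add, Finset.sum_add_distrib]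

theorem dynWeight_single {X : AffineType} (j : Node X) :
    dynWeight (Pi.single j 1) = Qof X (simpleRoot X j) := by
  funext i; simp [dynWeight, Qof, simpleRoot, Pi.single_apply]

theorem dynWeight_label {X : AffineType} : dynWeight (fun i => (label X i : ℤ)) = 0 := by
  funext i
  simp only [dynWeight, Pi.zero_apply]
  exact_mod_cast cartan_label X i

theorem dynWeight_neg {X : AffineType} (γ : Node X → ℤ) : dynWeight (-γ) = -dynWeight γ := by
  funext i; simp [dynWeight]

theorem weightOf_snd {X : AffineType} (lam : Node X → ℤ) (μ : hStar X) (x : Idx X) :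
    (weightOf lam μ x).2 = Qof X μ + dynWeight x.2.1 := by
  funext i
  simp only [weightOf, Qof, dynWeight, simpleRoot, Prod.fst_add, Prod.fst_sum, Prod.smul_fst,
    Pi.add_apply, Finset.sum_apply, Pi.smul_apply, smul_eq_mul, add_right_inj]
  exact Finset.sum_congr rfl fun j _ => mul_comm _ _

theorem weightOf_fst_fst {X : AffineType} (lam : Node X → ℤ) (μ : hStar X) (x : Idx X)
    (i : Node X) : (weightOf lam μ x).1.1 i = hval lam x.1 i := by
  simp only [weightOf, hval, simpleRoot, Prod.fst_add, Prod.fst_sum, Prod.smul_fst,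
    Pi.add_apply, Finset.sum_apply, Pi.smul_apply, smul_eq_mul]
  push_cast
  congr 1
  exact Finset.sum_congr rfl fun j _ => mul_comm _ _

theorem weightOf_fst_snd {X : AffineType} (lam : Node X → ℤ) (μ : hStar X) (x : Idx X) :
    (weightOf lam μ x).1.2 = x.1 0 := by
  simp [weightOf, simpleRoot, Prod.snd_sum]

/-- Reduction to ν_0 = 0 subtracts a multiple of the label vector, whose weight is zero. -/
theorem weightOf_move_dyn {X : AffineType} (lam : Node X → ℤ) (μ : hStar X) (β : RootLattice X)
    (ν : DynLattice X) (γ : Node X → ℤ) : weightOf lam μ (β, dynMove γ ν) =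
      weightOf lam μ (β, ν) + (0, dynWeight γ) := by
  refine Prod.ext (by simp [weightOf]) ?_
  rw [weightOf_snd, Prod.snd_add, weightOf_snd, add_assoc]
  congr 1
  have h : (dynMove γ ν).1 = ν.1 + γ + -(fun i => γ 0 * (label X i : ℤ)) := by
    funext i; simp [dynMove, sub_eq_add_neg]
  have h2 : dynWeight (fun i => γ 0 * (label X i : ℤ)) = 0 := by
    funext i
    simp only [dynWeight, Pi.zero_apply]
    have : ∑ j, cartan X i j * (γ 0 * label X j) = 0 := by
      have h3 : ∀ j, cartan X i j * (γ 0 * label X j) = γ 0 * (cartan X i j * label X j) :=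
        fun j => by ring
      simp only [h3, ← Finset.mul_sum, cartan_label, mul_zero]
    exact_mod_cast this
  rw [h, dynWeight_add, dynWeight_neg, h2, dynWeight_add]
  simp

theorem weightOf_move_root {X : AffineType} (lam : Node X → ℤ) (μ : hStar X) (β : RootLattice X)
    (ν : DynLattice X) (j : Node X) (s : ℤ) : weightOf lam μ (β + Pi.single j s, ν) =
      weightOf lam μ (β, ν) + ((s : ℂ) • simpleRoot X j, 0) := by
  refine Prod.ext ?_ (by simp [weightOf])
  simp only [weightOf, Prod.fst_add, Pi.add_apply, Int.cast_add, add_smul, Finset.sum_add_distrib]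
  rw [← add_assoc]
  congr 1
  rw [Finset.sum_eq_single j]
  · simp
  · intro k _ hk; simp [Pi.single_eq_of_ne hk]
  · simp

/-- Distinct basis vectors have distinct weights. -/
theorem weightOf_injective {X : AffineType} (lam : Node X → ℤ) (μ : hStar X) :
    Function.Injective (weightOf lam μ) := by
  rintro ⟨β, ν⟩ ⟨β', ν'⟩ h
  -- The value on d recovers the coefficient at the affine node, and the values on the h_i recover β
  -- up to the kernel of the Cartan matrix. For ν the normalization ν_0 = 0 plays the role of d.
  have h1 : β - β' = 0 := by
    refine eq_zero_of_cartan_eq_zero ?_ fun i => ?_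
    · have := congrArg (fun ξ => ξ.1.2) h
      simp only [weightOf_fst_snd] at this
      have h2 : β 0 = β' 0 := by exact_mod_cast this
      simp [h2]
    · have := congrArg (fun ξ => ξ.1.1 i) h
      simp only [weightOf_fst_fst] at this
      have h2 : hval lam β i = hval lam β' i := by exact_mod_cast this
      simp only [hval, add_right_inj] at h2
      simp [mul_sub, Finset.sum_sub_distrib, h2]
  have h2 : ν.1 - ν'.1 = 0 := by
    refine eq_zero_of_cartan_eq_zero (by simp [ν.2, ν'.2]) fun i => ?_
    have := congrArg (fun ξ => ξ.2) h
    simp only [weightOf_snd, add_right_inj] at this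
    have h3 := congrFun this i
    simp only [dynWeight] at h3
    have h4 : ∑ j, cartan X i j * ν.1 j = ∑ j, cartan X i j * ν'.1 j := by exact_mod_cast h3
    simp [mul_sub, Finset.sum_sub_distrib, h4]
  exact Prod.ext (sub_eq_zero.mp h1) (Subtype.ext (sub_eq_zero.mp h2))

/-! ### The cocycle and translations of functions -/

section Twist

theorem twist_single {X : AffineType} (κ : ℂ) (i j : Node X) (a b : ℤ) :
    twist κ (Pi.single i a) (Pi.single j b) = if j < i then commConst κ i j ^ (a * b) else 1 := by
  unfold twist
  rw [Finset.prod_eq_single i, Finset.prod_eq_single j]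
  · simp
  · intro k _ hk; simp [Pi.single_eq_of_ne hk]
  · simp
  · intro k _ hk; simp [Pi.single_eq_of_ne hk]
  · simp

theorem twist_ne_zero {X : AffineType} {κ : ℂ} (hκ : κ ≠ 0) (β γ : RootLattice X) :
    twist κ β γ ≠ 0 := by
  unfold twist
  refine Finset.prod_ne_zero_iff.mpr fun i _ => Finset.prod_ne_zero_iff.mpr fun j _ => ?_
  split_ifs
  · exact zpow_ne_zero _ (commConst_ne_zero hκ i j)
  · exact one_ne_zero

theorem commConst_self {X : AffineType} (κ : ℂ) (i : Node X) : commConst κ i i = 1 := by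
  rw [commConst, cartan_self, mMat_eq_zero (by rw [cartan_self]; decide)]
  norm_num

theorem twist_single_comm {X : AffineType} {κ : ℂ} (hκ : κ ≠ 0) (i j : Node X) (a b : ℤ) :
    twist κ (Pi.single i a) (Pi.single j b) =
      commConst κ i j ^ (a * b) * twist κ (Pi.single j b) (Pi.single i a) := by
  rw [twist_single, twist_single]
  rcases lt_trichotomy i j with h | rfl | h
  · rw [if_neg h.not_gt, if_pos h, commConst_inv hκ i j, inv_zpow, mul_comm b a,
      mul_inv_cancel₀ (zpow_ne_zero _ (commConst_ne_zero hκ i j))]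
  · simp [commConst_self]
  · rw [if_pos h, if_neg h.not_gt, mul_one]

/-- The cocycle identity is applied to both bracketings of e^{aα_i} e^{bα_j} e^β, which leaves only
the commutation constant of the first two factors. -/
theorem twist_exchange {X : AffineType} {κ : ℂ} (hκ : κ ≠ 0) (i j : Node X) (a b : ℤ)
    (β : RootLattice X) :
    twist κ (Pi.single i a) (β + Pi.single j b) * twist κ (Pi.single j b) β =
      commConst κ i j ^ (a * b) *
        (twist κ (Pi.single j b) (β + Pi.single i a) * twist κ (Pi.single i a) β) := by
  have h1 := twist_assoc hκ (Pi.single i a) (Pi.single j b) β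
  have h2 := twist_assoc hκ (Pi.single j b) (Pi.single i a) β
  rw [add_comm β, mul_comm, ← h1, twist_single_comm hκ, add_comm β, mul_comm (twist κ _ (_ + β)),
    ← h2, add_comm (Pi.single i a : RootLattice X)]
  ring

end Twist

theorem translate_translate {E : Type} [NormedAddCommGroup E] [NormedSpace ℂ E] (η η' : E)
    (f : Entire E) : translate η (translate η' f) = translate (η + η') f := by
  ext x
  change f.1 (x + η + η') = f.1 (x + (η + η'))
  rw [add_assoc]

theorem shift_shift {X : AffineType} (η η' : HStar X) (g : Mero X) :
    shift η (shift η' g) = shift (η + η') g := by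
  have h : ((shift η : Mero X ≃ₐ[ℂ] Mero X).toRingEquiv.toRingHom.comp
      (shift η' : Mero X ≃ₐ[ℂ] Mero X).toRingEquiv.toRingHom) =
      (shift (η + η') : Mero X ≃ₐ[ℂ] Mero X).toRingEquiv.toRingHom := by
    refine IsFractionRing.ringHom_ext (A := Entire (HStar X)) fun f => ?_
    change shift η (shift η' (algebraMap _ _ f)) = shift (η + η') (algebraMap _ _ f)
    simp only [shift, IsFractionRing.algEquivOfAlgEquiv_algebraMap, translate_translate]
  exact RingHom.congr_fun h g

theorem shift_zero {X : AffineType} (g : Mero X) : shift (0 : HStar X) g = g := by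
  refine (shift (0 : HStar X)).injective ?_
  rw [shift_shift, add_zero]

/-! ### Relations with functions, K^± and q^d -/

section Lattice

variable {X : AffineType} {M : Type*} [AddCommGroup M] [Module ℂ M] [Module (Mero X) M]

/-- Compatibility of translations, vertex operators and the grading on the coefficient space of
`latticeCurrents`. -/
structure LatticeData (q : ℂ) (τ : HStar X → M →ₗ[ℂ] M) (Tp Tm : Node X → ℤ → M →ₗ[ℂ] M)
    (dM : M →ₗ[ℂ] M) : Prop where
  τ_zero : τ 0 = LinearMap.id
  τ_add : ∀ η η' m, τ (η + η') m = τ η (τ η' m)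
  τ_smul : ∀ η (g : Mero X) m, τ η (g • m) = shift η g • τ η m
  τ_Tp : ∀ η j s m, τ η (Tp j s m) = Tp j s (τ η m)
  τ_Tm : ∀ η j s m, τ η (Tm j s m) = Tm j s (τ η m)
  τ_dM : ∀ η m, τ η (dM m) = dM (τ η m)
  Tp_smul : ∀ j s (g : Mero X) m, Tp j s (g • m) = g • Tp j s m
  Tm_smul : ∀ j s (g : Mero X) m, Tm j s (g • m) = g • Tm j s m
  dM_smul : ∀ (g : Mero X) m, dM (g • m) = g • dM m
  dM_Tp : ∀ j s m, dM (Tp j s m) = q ^ s • Tp j s (dM m)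
  dM_Tm : ∀ j s m, dM (Tm j s m) = q ^ s • Tm j s (dM m)
  dM_bij : Function.Bijective dM
  trunc : ∀ j m, ∃ D : ℤ, ∀ s, D ≤ s → Tp j s m = 0 ∧ Tm j s m = 0

variable (q κ l : ℂ) (lam : Node X → ℤ) (μ : hStar X) (τ : HStar X → M →ₗ[ℂ] M)
  (Tp Tm : Node X → ℤ → M →ₗ[ℂ] M) (dM : M →ₗ[ℂ] M)

theorem latticeCurrents_xp (j : Node X) (n : ℤ) (β : RootLattice X) (ν : DynLattice X) (m : M) :
    (latticeCurrents q κ l lam μ τ Tp Tm dM).xp j n (Finsupp.single (β, ν) m) =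
      Finsupp.single (β + Pi.single j 1, dynMove (-Pi.single j 1) ν)
        ((twist κ (Pi.single j 1) β * dynConst q l lam ^ (-Pi.single (M := fun _ => ℤ) j 1 0)) •
          Tp j (n + hval lam β j + 1) (τ (-(simpleRoot X j, -Qof X (simpleRoot X j))) m)) :=
  blockOp_single _ _ _ _

theorem latticeCurrents_xm (j : Node X) (n : ℤ) (β : RootLattice X) (ν : DynLattice X) (m : M) :
    (latticeCurrents q κ l lam μ τ Tp Tm dM).xm j n (Finsupp.single (β, ν) m) =
      Finsupp.single (β + Pi.single j (-1), ν) (twist κ (Pi.single j (-1)) β •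
          Tm j (n - hval lam β j + 1) (τ (-(-simpleRoot X j, 0)) m)) :=
  blockOp_single _ _ _ _

theorem latticeCurrents_qd (x : Idx X) (m : M) :
    (latticeCurrents q κ l lam μ τ Tp Tm dM).qd (Finsupp.single x m) =
      Finsupp.single x (q ^ (-energy lam x.1) • dM m) :=
  blockOp_single _ _ _ _

theorem latticeCurrents_ev (f : Entire (HStar X)) (x : Idx X) (m : M) :
    (latticeCurrents q κ l lam μ τ Tp Tm dM).ev f (Finsupp.single x m) =
      Finsupp.single x (f.1 (weightOf lam μ x) • m) :=
  blockOp_single _ _ _ _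

/-- The operator `∏ (K^±_j)^{γ_j}`, `s = ±1`. -/
def latticeK (s : ℤ) (γ : Node X → ℤ) : Module.End ℂ (Idx X →₀ M) :=
  blockOp (fun x => (x.1, dynMove (-γ) x.2)) fun x =>
    (q ^ (s * ∑ i, γ i * hval lam x.1 i) * dynConst q l lam ^ (-γ 0)) • τ (-(0, -dynWeight γ))

theorem latticeK_apply (s : ℤ) (γ : Node X → ℤ) (β : RootLattice X) (ν : DynLattice X) (m : M) :
    latticeK q l lam τ s γ (Finsupp.single (β, ν) m) = Finsupp.single (β, dynMove (-γ) ν)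
      ((q ^ (s * ∑ i, γ i * hval lam β i) * dynConst q l lam ^ (-γ 0)) •
        τ (-(0, -dynWeight γ)) m) :=
  blockOp_single _ _ _ _

theorem sum_single_hval (β : RootLattice X) (j : Node X) :
    ∑ i, (Pi.single j 1 : Node X → ℤ) i * hval lam β i = hval lam β j := by
  simp [Pi.single_apply]

theorem latticeCurrents_Kp (j : Node X) :
    (latticeCurrents q κ l lam μ τ Tp Tm dM).Kp j = latticeK q l lam τ 1 (Pi.single j 1) := by
  refine Finsupp.lhom_ext fun x m => ?_
  rw [latticeK_apply, sum_single_hval, one_mul, dynWeight_single]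
  exact blockOp_single _ _ _ _

theorem latticeCurrents_Km (j : Node X) :
    (latticeCurrents q κ l lam μ τ Tp Tm dM).Km j = latticeK q l lam τ (-1) (Pi.single j 1) := by
  refine Finsupp.lhom_ext fun x m => ?_
  rw [latticeK_apply, sum_single_hval, neg_one_mul, dynWeight_single]
  exact blockOp_single _ _ _ _

theorem dynConst_ne_zero {q : ℂ} (hq : q ≠ 0) (l : ℂ) (lam : Node X → ℤ) :
    dynConst q l lam ≠ 0 :=
  mul_ne_zero (by rw [Complex.cpow_def_of_ne_zero hq]; exact Complex.exp_ne_zero _)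
    (zpow_ne_zero _ hq)

variable {q κ lam μ τ Tp Tm dM}
-- The two halves of the weight condition separate: the coefficient operators account for scalars in
-- the field, and the motion of basis indices for functions evaluated at weights.
theorem hasWeight_blockOp [IsScalarTower ℂ (Mero X) M] {η : HStar X} {f : Idx X → Idx X}
    {T : Idx X → M →ₗ[ℂ] M} (h1 : ∀ x (g : Mero X) m, T x (shift η g • m) = g • T x m)
    (h2 : ∀ x, weightOf lam μ (f x) = weightOf lam μ x + η) :
    (latticeCurrents q κ l lam μ τ Tp Tm dM).HasWeight η (blockOp f T) := by
  refine ⟨fun g v => ?_, fun g => Finsupp.lhom_ext fun x m => ?_⟩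
  · induction v using Finsupp.induction_linear with
    | zero => simp
    | add v w hv hw => rw [map_add, smul_add, smul_add, map_add, hv, hw]
    | single x m => rw [blockOp_single, Finsupp.smul_single, Finsupp.smul_single, blockOp_single, h1]
  · rw [Module.End.mul_apply, Module.End.mul_apply, blockOp_single, latticeCurrents_ev,
      latticeCurrents_ev, blockOp_single, h2, map_smul]
    rfl

variable (L : LatticeData q τ Tp Tm dM)
include L

/-- The products of the K_j form a representation of ℤ^I, which gives inverses and reduces the
central product to a single operator. -/
theorem LatticeData.latticeK_add (hq : q ≠ 0) (s : ℤ) (γ γ' : Node X → ℤ) :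
    latticeK q l lam τ s (γ + γ') = latticeK q l lam τ s γ * latticeK q l lam τ s γ' := by
  refine Finsupp.lhom_ext fun x m => ?_
  rw [Module.End.mul_apply, latticeK_apply, latticeK_apply, latticeK_apply, dynMove_dynMove,
    neg_add, map_smul, smul_smul, ← L.τ_add]
  congr 1
  congr 1
  · simp only [Pi.add_apply, add_mul, Finset.sum_add_distrib, mul_add, neg_add, zpow_add₀ hq,
      zpow_add₀ (dynConst_ne_zero hq l lam)]
    ring
  · congr 2
    rw [dynWeight_add]
    ext <;> simp [add_comm]

theorem LatticeData.latticeK_zero (s : ℤ) : latticeK q l lam τ s 0 = 1 := by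
  refine Finsupp.lhom_ext fun x m => ?_
  have : (-(0, -dynWeight (0 : Node X → ℤ)) : HStar X) = 0 := by
    refine Prod.ext (by simp) ?_
    funext i; simp [dynWeight]
  rw [latticeK_apply, neg_zero, dynMove_zero, this, L.τ_zero]
  simp

theorem LatticeData.latticeK_bij (hq : q ≠ 0) (s : ℤ) (γ : Node X → ℤ) :
    Function.Bijective (latticeK q l lam τ s γ) := by
  have h : ∀ γ v, latticeK q l lam τ s γ (latticeK q l lam τ s (-γ) v) = v := fun γ v => by
    rw [← Module.End.mul_apply, ← L.latticeK_add l hq, add_neg_cancel, L.latticeK_zero]; rfl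
  exact Function.bijective_iff_has_inverse.mpr ⟨latticeK q l lam τ s (-γ),
    fun v => by simpa using h (-γ) v, h γ⟩

theorem LatticeData.latticeK_commute (s s' : ℤ) (γ γ' : Node X → ℤ) :
    Commute (latticeK q l lam τ s γ) (latticeK q l lam τ s' γ') := by
  refine Finsupp.lhom_ext fun x m => ?_
  rw [Module.End.mul_apply, Module.End.mul_apply, latticeK_apply, latticeK_apply, latticeK_apply,
    latticeK_apply, dynMove_comm, map_smul, map_smul, smul_smul, smul_smul, ← L.τ_add, ← L.τ_add,
    mul_comm, add_comm (-(0, -dynWeight γ') : HStar X)]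

/-- For γ equal to the labels nothing moves: the Q-weight is zero, the dynamical index returns to
itself, and ∑ a_i⟨Λ + β, h_i⟩ does not depend on β. The inverse of the constant e^{∑ a_j Q_j}
remains and fixes the level. -/
theorem LatticeData.centralProd_latticeK (hq : q ≠ 0) (s : ℤ) :
    centralProd (fun j => latticeK q l lam τ s (Pi.single j 1)) =
      (q ^ (s * ∑ i, (label X i : ℤ) * lam i) * (dynConst q l lam)⁻¹) •
        (1 : Module.End ℂ (Idx X →₀ M)) := by
  let φ : Multiplicative (Node X → ℤ) →* Module.End ℂ (Idx X →₀ M) :=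
    { toFun := fun γ => latticeK q l lam τ s γ.toAdd
      map_one' := L.latticeK_zero l s
      map_mul' := fun γ γ' => L.latticeK_add l hq s _ _ }
  have h1 : centralProd (fun j => latticeK q l lam τ s (Pi.single j 1)) =
      latticeK q l lam τ s (fun i => (label X i : ℤ)) := by
    have h2 : (List.ofFn fun i => latticeK q l lam τ s (Pi.single i 1) ^ label X i) =
        List.map φ (List.ofFn fun i => Multiplicative.ofAdd (Pi.single i 1 : Node X → ℤ) ^ label X i) := by
      rw [List.map_ofFn]
      congr 1
      funext i
      exact (map_pow φ _ _).symm
    rw [centralProd, h2, ← map_list_prod, List.prod_ofFn]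
    change latticeK q l lam τ s (Multiplicative.toAdd (∏ i, _)) = _
    congr 1
    rw [toAdd_prod]
    funext k
    simp [Finset.sum_apply, Pi.single_apply]
  rw [h1]
  refine Finsupp.lhom_ext fun x m => ?_
  obtain ⟨β, ν⟩ := x
  have h3 : ∑ i, (label X i : ℤ) * hval lam β i = ∑ i, (label X i : ℤ) * lam i := by
    simp only [hval, mul_add, Finset.sum_add_distrib, Finset.mul_sum]
    rw [add_eq_left, Finset.sum_comm]
    refine Finset.sum_eq_zero fun j _ => ?_
    have : ∀ i, (label X i : ℤ) * (cartan X i j * β j) = (cartan X j i * label X i) * β j :=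
      fun i => by rw [cartan_symm]; ring
    simp only [this, ← Finset.sum_mul, cartan_label, zero_mul]
  have h4 : dynMove (-fun i => (label X i : ℤ)) ν = ν := by
    have e : (-fun i => (label X i : ℤ)) = fun i => -1 * (label X i : ℤ) := by funext i; simp
    rw [e]
    exact dynMove_label ν (-1)
  rw [latticeK_apply, h3, dynWeight_label, h4]
  simp only [neg_zero, label_zero, Prod.mk_zero_zero, L.τ_zero, LinearMap.id_apply, Nat.cast_one,
    zpow_neg_one, LinearMap.smul_apply, Module.End.one_apply, Finsupp.smul_single]

theorem LatticeData.latticeK_xp (hq : q ≠ 0) (s : ℤ) (i j : Node X) (n : ℤ) :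
    latticeK q l lam τ s (Pi.single i 1) * (latticeCurrents q κ l lam μ τ Tp Tm dM).xp j n =
      q ^ (s * cartan X i j) • ((latticeCurrents q κ l lam μ τ Tp Tm dM).xp j n *
        latticeK q l lam τ s (Pi.single i 1)) := by
  refine Finsupp.lhom_ext fun x m => ?_
  obtain ⟨β, ν⟩ := x
  rw [LinearMap.smul_apply, Module.End.mul_apply, Module.End.mul_apply, latticeK_apply,
    latticeCurrents_xp, latticeK_apply, latticeCurrents_xp, dynMove_comm, Finsupp.smul_single,
    sum_single_hval, sum_single_hval, hval_add_single, mul_one, mul_add, zpow_add₀ hq, map_smul,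
    map_smul, map_smul, smul_smul, smul_smul, smul_smul, L.τ_Tp, ← L.τ_add, ← L.τ_add,
    add_comm (-(simpleRoot X j, _) : HStar X)]
  congr 2
  ring

theorem LatticeData.latticeK_xm (hq : q ≠ 0) (s : ℤ) (i j : Node X) (n : ℤ) :
    latticeK q l lam τ s (Pi.single i 1) * (latticeCurrents q κ l lam μ τ Tp Tm dM).xm j n =
      q ^ (-(s * cartan X i j)) • ((latticeCurrents q κ l lam μ τ Tp Tm dM).xm j n *
        latticeK q l lam τ s (Pi.single i 1)) := by
  refine Finsupp.lhom_ext fun x m => ?_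
  obtain ⟨β, ν⟩ := x
  rw [LinearMap.smul_apply, Module.End.mul_apply, Module.End.mul_apply, latticeK_apply,
    latticeCurrents_xm, latticeK_apply, latticeCurrents_xm, Finsupp.smul_single,
    sum_single_hval, sum_single_hval, hval_add_single, mul_neg_one, mul_add, zpow_add₀ hq, map_smul,
    map_smul, map_smul, smul_smul, smul_smul, smul_smul, L.τ_Tm, ← L.τ_add, ← L.τ_add,
    add_comm (-(-simpleRoot X j, _) : HStar X), mul_neg]
  congr 2
  ring

theorem LatticeData.qd_xp (hq : q ≠ 0) (j : Node X) (n : ℤ) :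
    (latticeCurrents q κ l lam μ τ Tp Tm dM).qd * (latticeCurrents q κ l lam μ τ Tp Tm dM).xp j n =
      q ^ n • ((latticeCurrents q κ l lam μ τ Tp Tm dM).xp j n *
        (latticeCurrents q κ l lam μ τ Tp Tm dM).qd) := by
  refine Finsupp.lhom_ext fun x m => ?_
  obtain ⟨β, ν⟩ := x
  rw [LinearMap.smul_apply, Module.End.mul_apply, Module.End.mul_apply, latticeCurrents_qd,
    latticeCurrents_xp, latticeCurrents_qd, latticeCurrents_xp, Finsupp.smul_single,
    energy_add_single, map_smul, map_smul, map_smul, smul_smul, smul_smul, smul_smul, L.τ_dM,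
    L.dM_Tp, smul_smul]
  congr 2
  have : -(energy lam β + 1 * hval lam β j + 1 ^ 2) = n + -energy lam β - (n + hval lam β j + 1) := by
    ring
  rw [this, zpow_sub₀ hq, zpow_add₀ hq]
  field_simp [zpow_ne_zero (n + hval lam β j + 1) hq]

theorem LatticeData.qd_xm (hq : q ≠ 0) (j : Node X) (n : ℤ) :
    (latticeCurrents q κ l lam μ τ Tp Tm dM).qd * (latticeCurrents q κ l lam μ τ Tp Tm dM).xm j n =
      q ^ n • ((latticeCurrents q κ l lam μ τ Tp Tm dM).xm j n *
        (latticeCurrents q κ l lam μ τ Tp Tm dM).qd) := by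
  refine Finsupp.lhom_ext fun x m => ?_
  obtain ⟨β, ν⟩ := x
  rw [LinearMap.smul_apply, Module.End.mul_apply, Module.End.mul_apply, latticeCurrents_qd,
    latticeCurrents_xm, latticeCurrents_qd, latticeCurrents_xm, Finsupp.smul_single,
    energy_add_single, map_smul, map_smul, map_smul, smul_smul, smul_smul, smul_smul, L.τ_dM,
    L.dM_Tm, smul_smul]
  congr 2
  have : -(energy lam β + -1 * hval lam β j + (-1) ^ 2) =
      n + -energy lam β - (n - hval lam β j + 1) := by ring
  rw [this, zpow_sub₀ hq, zpow_add₀ hq]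
  field_simp [zpow_ne_zero (n - hval lam β j + 1) hq]

theorem LatticeData.latticeK_qd (s : ℤ) (γ : Node X → ℤ) :
    Commute (latticeCurrents q κ l lam μ τ Tp Tm dM).qd (latticeK q l lam τ s γ) := by
  refine Finsupp.lhom_ext fun x m => ?_
  obtain ⟨β, ν⟩ := x
  rw [Module.End.mul_apply, Module.End.mul_apply, latticeCurrents_qd,
    latticeK_apply, latticeCurrents_qd, latticeK_apply, map_smul, map_smul, smul_smul, smul_smul,
    L.τ_dM, mul_comm]

theorem LatticeData.qd_bij (hq : q ≠ 0) :
    Function.Bijective (latticeCurrents q κ l lam μ τ Tp Tm dM).qd := by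
  set e := LinearEquiv.ofBijective dM L.dM_bij with he
  set T : Module.End ℂ (Idx X →₀ M) := blockOp id fun x => q ^ energy lam x.1 • e.symm.toLinearMap
    with hT
  have h1 : T * (latticeCurrents q κ l lam μ τ Tp Tm dM).qd = 1 := by
    refine Finsupp.lhom_ext fun x m => ?_
    rw [Module.End.mul_apply, latticeCurrents_qd, hT, blockOp_single, LinearMap.smul_apply,
      map_smul, smul_smul, ← zpow_add₀ hq, add_neg_cancel, zpow_zero, one_smul]
    have : e.symm (dM m) = m := e.symm_apply_apply m
    exact congrArg _ this
  have h2 : (latticeCurrents q κ l lam μ τ Tp Tm dM).qd * T = 1 := by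
    refine Finsupp.lhom_ext fun x m => ?_
    rw [Module.End.mul_apply, hT, blockOp_single, latticeCurrents_qd, LinearMap.smul_apply,
      map_smul, smul_smul, ← zpow_add₀ hq, id, neg_add_cancel, zpow_zero, one_smul]
    have : dM (e.symm m) = m := e.apply_symm_apply m
    exact congrArg _ this
  exact Function.bijective_iff_has_inverse.mpr ⟨T, fun v => LinearMap.congr_fun h1 v,
    fun v => LinearMap.congr_fun h2 v⟩

theorem LatticeData.isDynamical [IsScalarTower ℂ (Mero X) M] (hq : q ≠ 0) :
    (latticeCurrents q κ l lam μ τ Tp Tm dM).IsDynamical q l := by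
  -- An operator of weight η translates coefficients by -η, so that it turns the scalar T_η g back
  -- into g.
  have hτ : ∀ η (g : Mero X) m, τ (-η) (shift η g • m) = g • τ (-η) m := fun η g m => by
    rw [L.τ_smul, shift_shift, neg_add_cancel, shift_zero]
  have hK : ∀ s j, (latticeCurrents q κ l lam μ τ Tp Tm dM).HasWeight
      (0, -Qof X (simpleRoot X j)) (latticeK q l lam τ s (Pi.single j 1)) := by
    intro s j
    refine hasWeight_blockOp l (fun x g m => ?_) fun x => ?_
    · rw [← dynWeight_single, LinearMap.smul_apply, LinearMap.smul_apply, hτ, smul_comm]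
    · rw [weightOf_move_dyn, dynWeight_neg, dynWeight_single]
  have hcentral : ∀ s, ∃ c : ℂ, centralProd (fun j => latticeK q l lam τ s (Pi.single j 1)) =
      c • 1 := fun s => ⟨_, L.centralProd_latticeK l hq s⟩
  have hKp : (latticeCurrents q κ l lam μ τ Tp Tm dM).Kp =
    fun j => latticeK q l lam τ 1 (Pi.single j 1) := funext fun j => latticeCurrents_Kp ..
  have hKm : (latticeCurrents q κ l lam μ τ Tp Tm dM).Km =
    fun j => latticeK q l lam τ (-1) (Pi.single j 1) := funext fun j => latticeCurrents_Km ..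
  have hsc : ∀ (c : ℂ) (T : Module.End ℂ (Idx X →₀ M)), Commute (c • 1) T := fun c T => by
    rw [Commute, SemiconjBy, smul_mul_assoc, mul_smul_comm, one_mul, mul_one]
  refine
    { diag := ?_, ev_weight := ?_, xp_weight := ?_, xm_weight := ?_, Kp_weight := ?_,
      Km_weight := ?_, qd_weight := ?_, Kp_bij := ?_, Km_bij := ?_, qd_bij := L.qd_bij l hq,
      qd_xp := L.qd_xp l hq, qd_xm := L.qd_xm l hq, qd_Kp := ?_, qd_Km := ?_, Kp_Kp := ?_,
      Kp_Km := ?_, Km_Km := ?_, Kp_xp := ?_, Km_xp := ?_, Kp_xm := ?_, Km_xm := ?_,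
      central_p := ?_, central_m := ?_, level := ?_, trunc := ?_ }
  · rw [eq_top_iff]
    rintro v -
    induction v using Finsupp.induction_linear with
    | zero => exact zero_mem _
    | add v w hv hw => exact add_mem hv hw
    | single x m =>
      refine Submodule.subset_span ⟨weightOf lam μ x, fun f => ?_⟩
      rw [latticeCurrents_ev, Finsupp.smul_single]
  · intro f
    refine hasWeight_blockOp l (fun x g m => ?_) fun x => (add_zero _).symm
    rw [shift_zero, LinearMap.smul_apply, LinearMap.smul_apply, smul_comm]
    rfl
  · intro j m
    refine hasWeight_blockOp l (fun x g m => ?_) fun x => ?_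
    · rw [LinearMap.smul_apply, LinearMap.smul_apply, LinearMap.comp_apply, LinearMap.comp_apply,
        hτ, L.Tp_smul, smul_comm]
    · rw [weightOf_move_root, weightOf_move_dyn, dynWeight_neg, dynWeight_single, add_assoc]
      simp
  · intro j m
    refine hasWeight_blockOp l (fun x g m => ?_) fun x => ?_
    · rw [LinearMap.smul_apply, LinearMap.smul_apply, LinearMap.comp_apply, LinearMap.comp_apply,
        hτ, L.Tm_smul, smul_comm]
    · rw [weightOf_move_root]
      simp
  · intro j; rw [hKp]; exact hK 1 j
  · intro j; rw [hKm]; exact hK (-1) j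
  · refine hasWeight_blockOp l (fun x g m => ?_) fun x => (add_zero _).symm
    rw [shift_zero, LinearMap.smul_apply, LinearMap.smul_apply, L.dM_smul, smul_comm]
  · intro j; rw [hKp]; exact L.latticeK_bij l hq _ _
  · intro j; rw [hKm]; exact L.latticeK_bij l hq _ _
  · intro j; rw [hKp]; exact L.latticeK_qd l _ _
  · intro j; rw [hKm]; exact L.latticeK_qd l _ _
  · intro i j; rw [hKp]; exact L.latticeK_commute l _ _ _ _
  · intro i j; rw [hKp, hKm]; exact L.latticeK_commute l _ _ _ _
  · intro i j; rw [hKm]; exact L.latticeK_commute l _ _ _ _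
  · intro i j m; rw [hKp]; simpa using L.latticeK_xp l hq 1 i j m
  · intro i j m; rw [hKm]; simpa using L.latticeK_xp l hq (-1) i j m
  · intro i j m; rw [hKp]; simpa using L.latticeK_xm l hq 1 i j m
  · intro i j m; rw [hKm]; simpa using L.latticeK_xm l hq (-1) i j m
  · intro j m
    rw [hKp]
    obtain ⟨c, hc⟩ := hcentral 1
    rw [hc]
    exact ⟨hsc _ _, hsc _ _⟩
  · intro j m
    rw [hKm]
    obtain ⟨c, hc⟩ := hcentral (-1)
    rw [hc]
    exact ⟨hsc _ _, hsc _ _⟩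
  · rw [hKp, L.centralProd_latticeK l hq, one_mul, dynConst, mul_inv, mul_left_comm,
      mul_inv_cancel₀ (zpow_ne_zero _ hq), mul_one, Complex.cpow_neg]
  · intro j v
    induction v using Finsupp.induction_linear with
    | zero => exact ⟨0, fun m _ => by simp⟩
    | add v w hv hw =>
      obtain ⟨D, hD⟩ := hv
      obtain ⟨D', hD'⟩ := hw
      refine ⟨max D D', fun m hm => ?_⟩
      rw [map_add, map_add, (hD m (by omega)).1, (hD m (by omega)).2, (hD' m (by omega)).1,
        (hD' m (by omega)).2, add_zero]
      exact ⟨rfl, rfl⟩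
    | single x m =>
      obtain ⟨β, ν⟩ := x
      obtain ⟨D, hD⟩ := L.trunc j (τ (-(simpleRoot X j, -Qof X (simpleRoot X j))) m)
      obtain ⟨D', hD'⟩ := L.trunc j (τ (-(-simpleRoot X j, 0)) m)
      refine ⟨max (D - hval lam β j) (D' + hval lam β j), fun n hn => ?_⟩
      rw [latticeCurrents_xp, latticeCurrents_xm, (hD _ (by omega)).1, (hD' _ (by omega)).2,
        smul_zero, smul_zero, Finsupp.single_zero, Finsupp.single_zero]
      exact ⟨rfl, rfl⟩

end Lattice

/-! ### The lattice currents and their commutation data -/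

section LatticeCur

variable {X : AffineType} {M : Type*} [AddCommGroup M] [Module ℂ M] [Module (Mero X) M]
variable (q κ l : ℂ) (lam : Node X → ℤ) (τ : HStar X → M →ₗ[ℂ] M)

/-- The data of the currents `x^+_j(z)`. -/
def curP (j : Node X) : Cur (Node X × Bool) (Idx X) M where
  idx := (j, true)
  move x := (x.1 + Pi.single j 1, dynMove (-Pi.single j 1) x.2)
  coef x := twist κ (Pi.single j 1) x.1 * dynConst q l lam ^ (-Pi.single (M := fun _ => ℤ) j 1 0)
  height x := hval lam x.1 j
  tr := τ (-(simpleRoot X j, -Qof X (simpleRoot X j)))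

/-- The data of the currents `x^-_j(z)`. -/
def curM (j : Node X) : Cur (Node X × Bool) (Idx X) M where
  idx := (j, false)
  move x := (x.1 + Pi.single j (-1), x.2)
  coef x := twist κ (Pi.single j (-1)) x.1
  height x := -hval lam x.1 j
  tr := τ (-(-simpleRoot X j, 0))

theorem curP_mode (μ : hStar X) (dM : M →ₗ[ℂ] M)
    (a b : Node X × Bool → ℕ → Module.End ℂ M) (Tm : Node X → ℤ → M →ₗ[ℂ] M) (j : Node X) :
    (curP q κ l lam τ j).mode a b = (latticeCurrents q κ l lam μ τ
      (fun j s => vertexMode (a (j, true)) (b (j, true)) s) Tm dM).xp j := rfl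

theorem curM_mode (μ : hStar X) (dM : M →ₗ[ℂ] M)
    (a b : Node X × Bool → ℕ → Module.End ℂ M) (Tp : Node X → ℤ → M →ₗ[ℂ] M) (j : Node X) :
    (curM κ lam τ j).mode a b = (latticeCurrents q κ l lam μ τ Tp
      (fun j s => vertexMode (a (j, false)) (b (j, false)) s) dM).xm j := by
  funext n
  refine Finsupp.lhom_ext fun x m => ?_
  rw [latticeCurrents_xm, sub_eq_add_neg]
  exact Cur.mode_single _ _ _ _ _ _

variable {q κ l lam τ}
variable (hκ : κ ≠ 0) (hτ : ∀ η η' m, τ (η + η') m = τ η (τ η' m))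
include hκ hτ

theorem curP_pair (i j : Node X) : (curP q κ l lam τ i).Pair (curP q κ l lam τ j) (cartan X i j)
    ((-1) ^ cartan X i j * (κ ^ mMat X i j)⁻¹) where
  move x := by simp only [curP]; rw [dynMove_comm, add_right_comm]
  left x := by simp only [curP]; rw [hval_add_single, mul_one]
  right x := by simp only [curP]; rw [hval_add_single, mul_one, cartan_symm]
  coef x := by
    have h := twist_exchange hκ i j 1 1 x.1
    simp only [curP]
    rw [mul_one, zpow_one, commConst, zpow_neg] at h
    linear_combination (dynConst q l lam ^ (-Pi.single (M := fun _ => ℤ) i 1 0) *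
      dynConst q l lam ^ (-Pi.single (M := fun _ => ℤ) j 1 0)) * h
  tr m := by simp only [curP]; rw [← hτ, ← hτ, add_comm]

theorem curM_pair (i j : Node X) : (curM κ lam τ i).Pair (curM κ lam τ j) (cartan X i j)
    ((-1) ^ cartan X i j * (κ ^ mMat X i j)⁻¹) where
  move x := by simp only [curM]; rw [add_right_comm]
  left x := by simp only [curM]; rw [hval_add_single]; ring
  right x := by simp only [curM]; rw [hval_add_single, cartan_symm]; ring
  coef x := by
    have h := twist_exchange hκ i j (-1) (-1) x.1
    simp only [curM]
    rw [neg_one_mul, neg_neg, zpow_one, commConst, zpow_neg] at h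
    exact h
  tr m := by simp only [curM]; rw [← hτ, ← hτ, add_comm]

theorem curP_curM_pair (i j : Node X) : (curP q κ l lam τ i).Pair (curM κ lam τ j) (-cartan X i j)
    ((-1) ^ (-cartan X i j) * κ ^ mMat X i j) where
  move x := by simp only [curM, curP]; rw [add_right_comm]
  left x := by simp only [curM, curP]; rw [hval_add_single]; ring
  right x := by simp only [curM, curP]; rw [hval_add_single, cartan_symm]; ring
  coef x := by
    have h := twist_exchange hκ i j 1 (-1) x.1
    simp only [curM, curP]
    rw [one_mul, zpow_neg_one, commConst, mul_inv, ← zpow_neg, ← zpow_neg, neg_neg] at h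
    linear_combination dynConst q l lam ^ (-Pi.single (M := fun _ => ℤ) i 1 0) * h
  tr m := by simp only [curM, curP]; rw [← hτ, ← hτ, add_comm]

/-- The elements e^{-α_j} and e^{α_j} multiply to 1 without a constant, because the cocycle involves
only pairs of distinct indices. -/
theorem twist_neg_single (j : Node X) (β : RootLattice X) :
    twist κ (Pi.single j (-1)) (β + Pi.single j 1) * twist κ (Pi.single j 1) β = 1 := by
  have h := twist_assoc hκ (Pi.single j (-1)) (Pi.single j 1) β
  have h0 : (Pi.single j (-1) + Pi.single j 1 : RootLattice X) = 0 := by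
    rw [← Pi.single_add]; simp
  have h1 : twist κ (0 : RootLattice X) β = 1 := by simp [twist]
  rw [twist_single, if_neg (lt_irrefl j), h0, h1, one_mul] at h
  rw [add_comm β, mul_comm, ← h]

/-- The commutator of `x^+_i` and `x^-_i`, expressed by `K^±_i` and vertex operators. -/
theorem curP_curM_delta {a b : Node X × Bool → ℕ → Module.End ℂ M}
    {c : Node X × Bool → Node X × Bool → ℕ → ℂ} (S : IsVertexSystem a b c) (hq : q ≠ 0)
    (hP : ∀ j, (curP q κ l lam τ j).Compat a b) (hM : ∀ j, (curM κ lam τ j).Compat a b)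
    {φ φ' : PowerSeries ℂ} (i : Node X) (hφ : φ * contr c (i, true) (i, false) = qIntSeries q)
    (hφ' : φ' * contr c (i, false) (i, true) = qIntSeries q) {Vp Vm : ℤ → Module.End ℂ M}
    (hVp : ∀ s, vertexMode (fun m => q ^ m • a (i, true) m + a (i, false) m)
      (fun m => q⁻¹ ^ m • b (i, true) m + b (i, false) m) s = Vp s)
    (hVm : ∀ s, vertexMode (fun m => q⁻¹ ^ m • a (i, true) m + a (i, false) m)
      (fun m => q ^ m • b (i, true) m + b (i, false) m) s = Vm s)
    (hτp : ∀ η s m, τ η (Vp s m) = Vp s (τ η m)) (hτm : ∀ η s m, τ η (Vm s m) = Vm s (τ η m))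
    (r t : ℤ) (v : Idx X →₀ M) :
    ord2 φ ((curP q κ l lam τ i).mode a b) ((curM κ lam τ i).mode a b) r t v -
        ord2 φ' ((curM κ lam τ i).mode a b) ((curP q κ l lam τ i).mode a b) t r v =
      (q - q⁻¹)⁻¹ • (q ^ r • (latticeK q l lam τ 1 (Pi.single i 1) *
          blockOp id fun _ => Vp (r + t) : Module.End ℂ (Idx X →₀ M)) v -
        q ^ (-r) • (latticeK q l lam τ (-1) (Pi.single i 1) * blockOp id fun _ => Vm (r + t) :
          Module.End ℂ (Idx X →₀ M)) v) := by
  obtain ⟨L, hL⟩ := (S.mode_trunc (curM κ lam τ i)).exists_linear_ord2 φ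
    ((curP q κ l lam τ i).mode a b) r t
  obtain ⟨L', hL'⟩ := (S.mode_trunc (curP q κ l lam τ i)).exists_linear_ord2 φ'
    ((curM κ lam τ i).mode a b) t r
  have : L - L' = (q - q⁻¹)⁻¹ • (q ^ r • (latticeK q l lam τ 1 (Pi.single i 1) *
          blockOp id fun _ => Vp (r + t)) -
        q ^ (-r) • (latticeK q l lam τ (-1) (Pi.single i 1) * blockOp id fun _ => Vm (r + t))) := by
    refine Finsupp.lhom_ext fun x m => ?_
    obtain ⟨β, ν⟩ := x
    have P := curP_curM_pair (q := q) (l := l) (lam := lam) hκ hτ i i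
    have h0 : mMat X i i = 0 := mMat_eq_zero (by rw [cartan_self]; decide)
    -- At equal nodes e = -2 and the commutation constant is (-1)^{-2} κ^0 = 1, which is the form
    -- required by `mixed_delta`.
    rw [cartan_self, h0, zpow_zero, mul_one, show (-1 : ℂ) ^ (-2 : ℤ) = 1 by norm_num] at P
    have hc := twist_neg_single hκ hτ i β
    simp only [LinearMap.sub_apply, LinearMap.smul_apply, Module.End.mul_apply, ← hL, ← hL']
    rw [S.mixed_delta (hP i) (hM i) P hq hφ hφ' r t (β, ν) rfl m]
    simp only [blockOp_single, id, latticeK_apply, sum_single_hval, dynWeight_single]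
    have e1 : β + Pi.single i (-1) + Pi.single i 1 = β := by
      rw [add_assoc, ← Pi.single_add]; simp
    -- The weights of x^+_i and x^-_i add up to the weight of K^±_i, so the composed translations
    -- agree with that of K^±_i.
    have e2 : (curP q κ l lam τ i).tr ((curM κ lam τ i).tr m) =
        τ (-(0, -Qof X (simpleRoot X i))) m := by
      simp only [curP, curM]
      rw [← hτ]
      congr 2
      ext <;> simp
    have e3 : (curM κ lam τ i).coef ((curP q κ l lam τ i).move (β, ν)) *
        (curP q κ l lam τ i).coef (β, ν) =
          dynConst q l lam ^ (-Pi.single (M := fun _ => ℤ) i 1 0) := by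
      simp only [curP, curM]
      rw [← mul_assoc, hc, one_mul]
    have e4 : (curP q κ l lam τ i).move ((curM κ lam τ i).move (β, ν)) =
        (β, dynMove (-Pi.single i 1) ν) := by simp only [curP, curM, e1]
    have e5 : (curP q κ l lam τ i).height (β, ν) = hval lam β i := rfl
    have e6 : (curP q κ l lam τ i).idx = (i, true) := rfl
    have e7 : (curM κ lam τ i).idx = (i, false) := rfl
    rw [e2, e3, e4, e5, e6, e7, hVp, hVm, hτp, hτm, Finsupp.smul_single, Finsupp.smul_single,
      ← Finsupp.single_sub, Finsupp.smul_single]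
    congr 1
    rw [one_mul, neg_one_mul, neg_add, zpow_add₀ hq, zpow_add₀ hq]
    module
  rw [hL, hL', ← LinearMap.sub_apply, this]
  rfl

end LatticeCur

/-! ### Structure series of the Z-algebra in closed form -/

section Series

open PowerSeries in
theorem geom_mul (ρ : ℂ) : geom ρ * (1 - C ρ * X) = 1 := by
  ext n
  rw [mul_sub, mul_one, map_sub, ← mul_assoc, mul_comm (geom ρ), mul_assoc, coeff_C_mul]
  cases n with
  | zero => simp [geom]
  | succ n =>
    rw [coeff_succ_mul_X]
    simp [geom, coeff_one, pow_succ, mul_comm]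

open PowerSeries in
theorem qIntSeries_mul {q : ℂ} (hq : q ≠ 0) (hq' : q - q⁻¹ ≠ 0) :
    qIntSeries q * ((1 - C q⁻¹ * X) * (1 - C q * X)) = 1 := by
  have h : ((1 - C q⁻¹ * X) * (1 - C q * X) : PowerSeries ℂ) = 1 - C (q + q⁻¹) * X + X ^ 2 := by
    have hC : C q⁻¹ * C q = (1 : PowerSeries ℂ) := by rw [← map_mul, inv_mul_cancel₀ hq, map_one]
    rw [map_add]
    linear_combination X ^ 2 * hC
  rw [h, mul_comm, add_mul, sub_mul, one_mul, mul_assoc]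
  ext n
  rw [map_add, map_sub, coeff_C_mul]
  match n with
  | 0 => simp [qIntSeries, qInt, coeff_X_pow_mul', div_self hq']
  | 1 =>
    simp only [qIntSeries, qInt, coeff_X_pow_mul', coeff_mk, coeff_one]
    rw [show (1 : ℕ) = 0 + 1 from rfl, coeff_succ_X_mul]
    simp only [coeff_mk]
    norm_num
    have : q ^ 2 - 1 ≠ 0 := by
      intro h0; apply hq'; field_simp; rw [mul_zero]; exact h0
    field_simp
    rw [mul_zero]
    ring
  | n + 2 =>
    rw [coeff_succ_X_mul, coeff_X_pow_mul']
    simp only [qIntSeries, qInt, coeff_mk, coeff_one]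
    simp
    simp only [zpow_add₀ hq, zpow_neg, zpow_ofNat]
    field_simp
    ring

theorem qPoch_div {t a a' : ℂ} {F : PowerSeries ℂ} (h : qPoch t a = F * qPoch t a') :
    qPoch t a * (qPoch t a')⁻¹ = F := by
  rw [h, mul_assoc, PowerSeries.mul_inv_cancel, mul_one]
  simp [qPoch]

theorem norm_sq_lt {q : ℂ} (hq : ‖q‖ < 1) : ‖q ^ 2‖ < 1 := by
  rw [norm_pow]; exact pow_lt_one₀ (norm_nonneg _) hq two_ne_zero

/-- The arguments of numerator and denominator differ by q^6, 1 or q² for b = 2, -1, 0, integral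
powers of the base q², so all but three, none or one of the factors cancel. -/
theorem zFactor_eq {q : ℂ} (hq : q ≠ 0) (hq1 : ‖q‖ < 1) {b : ℤ} (hb : b = 2 ∨ b = -1 ∨ b = 0) :
    zFactor q b = exchangeSeries q b := by
  have ht := norm_sq_lt hq1
  rcases hb with rfl | rfl | rfl
  · refine qPoch_div ?_
    rw [qPoch_eq _ _ ht, qPoch_eq _ (q ^ (-2 : ℤ) * q ^ 2) ht,
      qPoch_eq _ (q ^ (-2 : ℤ) * q ^ 2 * q ^ 2) ht, exchangeSeries, serreSeries, if_pos rfl, quad]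
    have e : q ^ (-2 : ℤ) * q ^ 2 = 1 := by
      rw [zpow_neg]; norm_cast; exact inv_mul_cancel₀ (pow_ne_zero 2 hq)
    rw [e, one_mul, map_one, show q ^ (2 : ℤ) = q ^ 2 by norm_cast]
    ring
  · rw [exchangeSeries_neg_one]
    refine qPoch_div ?_
    rw [one_mul]
    congr 1
    rw [neg_neg, zpow_one, zpow_neg_one]
    field_simp
  · rw [exchangeSeries_zero]
    refine qPoch_div ?_
    rw [qPoch_eq _ _ ht]
    simp

theorem zMixedFactor_eq {q : ℂ} (hq : q ≠ 0) (hq1 : ‖q‖ < 1) (hq' : q - q⁻¹ ≠ 0) {b : ℤ}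
    (hb : b = 2 ∨ b = -1 ∨ b = 0) :
    zMixedFactor q b = if b = 2 then qIntSeries q else
      if b = -1 then 1 - PowerSeries.C 1 * PowerSeries.X else 1 := by
  have ht := norm_sq_lt hq1
  rcases hb with rfl | rfl | rfl
  · rw [if_pos rfl]
    refine qPoch_div ?_
    rw [qPoch_eq _ (q ^ (-2 : ℤ) * q) ht, qPoch_eq _ (q ^ (-2 : ℤ) * q * q ^ 2) ht]
    have e : q ^ (-2 : ℤ) * q = q⁻¹ := by
      rw [zpow_neg]; norm_cast; field_simp
    have e2 : q⁻¹ * q ^ 2 = q := by field_simp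
    rw [e, e2, ← mul_assoc, ← mul_assoc, mul_assoc (qIntSeries q), qIntSeries_mul hq hq', one_mul]
    congr 1
    norm_cast; ring
  · rw [if_neg (by norm_num), if_pos rfl]
    refine qPoch_div ?_
    have e : q ^ (-1 : ℤ) * q = 1 := by rw [zpow_neg_one]; exact inv_mul_cancel₀ hq
    rw [qPoch_eq _ _ ht, e]
    congr 2
    norm_num; ring
  · rw [if_neg (by norm_num), if_neg (by norm_num)]
    refine qPoch_div ?_
    rw [neg_zero, one_mul]

/-- The constants c = 1 and c = q² correspond to ρ = q⁻¹ for Z^+ and ρ = q for Z^-; apart from this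
choice both signs are treated alike. -/
theorem zSerreFactor_eq {q : ℂ} (hq : q ≠ 0) (hq1 : ‖q‖ < 1) :
    zSerreFactor q 1 2 = quad q⁻¹ ∧ zSerreFactor q 1 (-1) = geom q⁻¹ ∧
      zSerreFactor q (q ^ 2) 2 = quad q ∧ zSerreFactor q (q ^ 2) (-1) = geom q := by
  have ht := norm_sq_lt hq1
  have z1 : q ^ (-2 : ℤ) = (q ^ 2)⁻¹ := by rw [zpow_neg]; norm_cast
  have z2 : q ^ (2 : ℤ) = q ^ 2 := by norm_cast
  have z3 : q ^ (- -1 : ℤ) = q := by simp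
  have h2 : q ^ 2 ≠ 0 := pow_ne_zero 2 hq
  refine ⟨qPoch_div ?_, qPoch_div ?_, qPoch_div ?_, qPoch_div ?_⟩
  · rw [z1, z2, qPoch_eq _ _ ht, qPoch_eq _ ((q ^ 2)⁻¹ * 1 * q ^ 2) ht, mul_one,
      inv_mul_cancel₀ h2, quad, inv_pow, map_one]
    simp only [one_mul, mul_one, mul_assoc]
  · rw [z3, zpow_neg_one]
    simp only [mul_one]
    rw [qPoch_eq _ q⁻¹ ht, ← mul_assoc, geom_mul, one_mul]
    congr 1; field_simp
  · rw [z1, z2, qPoch_eq _ _ ht, qPoch_eq _ ((q ^ 2)⁻¹ * q ^ 2 * q ^ 2) ht,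
      inv_mul_cancel₀ h2, quad, map_one]
    simp only [one_mul]
    ring
  · rw [z3, zpow_neg_one, qPoch_eq _ (q⁻¹ * q ^ 2) ht, ← mul_assoc]
    have e : q⁻¹ * q ^ 2 = q := by field_simp
    rw [e, geom_mul, one_mul]

end Series

/-! ### The vertex system without bosons -/

section Trivial

variable {J M : Type*} [AddCommGroup M] [Module ℂ M]

theorem isVertexSystem_zero :
    IsVertexSystem (0 : J → ℕ → Module.End ℂ M) 0 (0 : J → J → ℕ → ℂ) where
  aa _ _ _ _ := by simp
  bb _ _ _ _ := by simp
  ba _ _ _ _ _ _ := by simp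
  nil v := ⟨1, fun A r hr => by
    have h := expCoeff_of_zero (R := Module.End ℂ M) r
    rw [if_neg (by omega)] at h
    exact (LinearMap.congr_fun h v)⟩

theorem contr_zero (A B : J) : contr (0 : J → J → ℕ → ℂ) A B = 1 := by
  ext n
  rw [contr, PowerSeries.coeff_mk, PowerSeries.coeff_one]
  exact expCoeff_of_zero n

/-- With zero exponents a vertex operator is the identity concentrated in degree 0. The currents Z^±
therefore fall under the general theory, with all contractions equal to 1. -/
theorem vertexMode_zero (s : ℤ) :
    vertexMode (0 : ℕ → Module.End ℂ M) 0 s = if s = 0 then LinearMap.id else 0 := by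
  have S := isVertexSystem_zero (J := Unit) (M := M)
  have e : ∀ n, expCoeff (0 : ℕ → Module.End ℂ M) n = if n = 0 then 1 else 0 :=
    fun n => expCoeff_of_zero n
  refine LinearMap.ext fun v => ?_
  have h := S.vertexMode_apply () s v
  simp only [Pi.zero_apply] at h
  rw [h, wrap, finsum_eq_single _ 0 fun n hn => by rw [e, if_neg hn, LinearMap.zero_apply]]
  rw [e, if_pos rfl, Module.End.one_apply]
  rcases lt_trichotomy s 0 with hs | rfl | hs
  · rw [if_neg hs.ne, expZ_of_neg _ (by simpa using hs)]
  · rw [if_pos rfl]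
    rw [zero_add, expZ_natCast, e, if_pos rfl]; rfl
  · obtain ⟨n, rfl⟩ := Int.eq_ofNat_of_zero_le hs.le
    rw [if_neg hs.ne', Nat.cast_zero, add_zero, expZ_natCast, e, if_neg (by omega)]

end Trivial

/-! ### The lattice space as a module over the Z-algebra -/

section LatticeModule

variable {X : AffineType} {q κ p l : ℂ} {lam : Node X → ℤ} {μ : hStar X}

theorem latticeData_W (q : ℂ) : LatticeData (X := X) (M := Mero X) q
    (fun η => (shift η).toLinearMap)
    (fun _ s => if s = 0 then LinearMap.id else 0) (fun _ s => if s = 0 then LinearMap.id else 0)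
    LinearMap.id where
  τ_zero := LinearMap.ext fun m => shift_zero m
  τ_add η η' m := (shift_shift η η' m).symm
  τ_smul η g m := map_mul (shift η) g m
  τ_Tp η j s m := by split_ifs <;> simp
  τ_Tm η j s m := by split_ifs <;> simp
  τ_dM η m := rfl
  Tp_smul j s g m := by split_ifs <;> simp
  Tm_smul j s g m := by split_ifs <;> simp
  dM_smul g m := rfl
  dM_Tp j s m := by split_ifs with h <;> simp [h]
  dM_Tm j s m := by split_ifs with h <;> simp [h]
  dM_bij := Function.bijective_id
  trunc j m := ⟨1, fun s hs => by rw [if_neg (by omega)]; simp⟩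

theorem rescale_one_sub (u : ℂ) : PowerSeries.rescale u
    (1 - PowerSeries.C (1 : ℂ) * PowerSeries.X) = 1 - PowerSeries.C u * PowerSeries.X := by
  rw [map_one, one_mul, map_sub, map_one, PowerSeries.rescale_X]

theorem cartan_mem (i j : Node X) : cartan X i j = 2 ∨ cartan X i j = -1 ∨ cartan X i j = 0 := by
  rcases cartan_cases i j with h | h | h
  · exact Or.inl h.2
  · exact Or.inr (Or.inl h.2)
  · exact Or.inr (Or.inr h.2)

theorem LatticeData.isZModule {M : Type*} [AddCommGroup M] [Module ℂ M] [Module (Mero X) M]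
    [IsScalarTower ℂ (Mero X) M] {τ : HStar X → M →ₗ[ℂ] M} {dM : M →ₗ[ℂ] M}
    (L : LatticeData q τ (fun _ s => if s = 0 then LinearMap.id else 0)
      (fun _ s => if s = 0 then LinearMap.id else 0) dM) (hg : GenericParams q κ p) :
    (latticeCurrents q κ l lam μ τ (fun _ s => if s = 0 then LinearMap.id else 0)
      (fun _ s => if s = 0 then LinearMap.id else 0) dM).IsZModule q κ l := by
  set D := latticeCurrents q κ l lam μ τ (fun _ s => if s = 0 then LinearMap.id else 0)
      (fun _ s => if s = 0 then LinearMap.id else 0) dM with hD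
  set a : Node X × Bool → ℕ → Module.End ℂ M := 0 with ha
  have hT : ∀ e : Bool, (fun (j : Node X) (s : ℤ) => if s = 0 then (LinearMap.id : M →ₗ[ℂ] M) else 0) =
      fun j s => vertexMode (a (j, e)) (a (j, e)) s := by
    intro e; funext j s; exact (vertexMode_zero s).symm
  have S : IsVertexSystem a a (0 : Node X × Bool → Node X × Bool → ℕ → ℂ) := isVertexSystem_zero
  have hqt := hg.sub_inv_ne
  have τadd : ∀ η η' (m : M), τ (η + η') m = τ η (τ η' m) := L.τ_add
  have hxp : ∀ j, D.xp j = (curP q κ l lam τ j).mode a a := by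
    intro j
    rw [hD, hT true]; exact (curP_mode q κ l lam τ μ _ a a _ j).symm
  have hxm : ∀ j, D.xm j = (curM κ lam τ j).mode a a := by
    intro j
    rw [hD, hT false]; exact (curM_mode q κ l lam τ μ _ a a _ j).symm
  have hKp : ∀ j, D.Kp j = latticeK q l lam τ 1 (Pi.single j 1) :=
    fun j => latticeCurrents_Kp ..
  have hKm : ∀ j, D.Km j = latticeK q l lam τ (-1) (Pi.single j 1) :=
    fun j => latticeCurrents_Km ..
  have compat : ∀ A : Cur (Node X × Bool) (Idx X) M, A.Compat a a := by
    intro A j s m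
    change _ = vertexMode 0 0 s _
    rw [show vertexMode (a j) (a j) s = vertexMode 0 0 s from rfl, vertexMode_zero]
    split_ifs <;> simp
  have hu : ∀ i j, cartan X i j ≠ -1 → κ ^ mMat X i j = 1 := fun i j h => by
    rw [mMat_eq_zero h, zpow_zero]
  have hu0 : ∀ i j : Node X, κ ^ mMat X i j ≠ 0 := fun i j => zpow_ne_zero _ hg.κ_ne
  have hq := hg.q_ne
  have hS := zSerreFactor_eq hq hg.q_lt
  -- As contractions are trivial, the structure functions alone must equal the elementary series,
  -- which is what `zFactor_eq`, `zMixedFactor_eq` and `zSerreFactor_eq` supply.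
  have cz := contr_zero (J := Node X × Bool)
  have one : ∀ (A B : ℤ → Module.End ℂ (Idx X →₀ M)) (r t : ℤ) v, ord2 1 A B r t v = A r (B t v) := by
    intro A B r t v
    rw [ord2_eq_lsum, lsum_one]; simp
  refine { toIsDynamical := L.isDynamical l hq, zz_p := ?_, zz_m := ?_, zz_pm := ?_, serre_p := ?_,
           serre_m := ?_, serre_p_zero := ?_, serre_m_zero := ?_ }
  · intro i j r t v
    rw [hxp, hxp, zFactor_eq hq hg.q_lt (cartan_mem i j), zpow_neg]
    exact S.ord2_exchange (compat _) (compat _) (curP_pair hg.κ_ne τadd i j) (cartan_mem i j)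
      (hu i j) hq (by rw [cz, mul_one]) (by rw [cz, mul_one]) r t v
  · intro i j r t v
    rw [hxm, hxm, zFactor_eq hq hg.q_lt (cartan_mem i j), zpow_neg]
    exact S.ord2_exchange (compat _) (compat _) (curM_pair hg.κ_ne τadd i j) (cartan_mem i j)
      (hu i j) hq (by rw [cz, mul_one]) (by rw [cz, mul_one]) r t v
  · intro i j r t v
    rw [hxp, hxm, zMixedFactor_eq hq hg.q_lt hqt (cartan_mem i j)]
    rcases cartan_cases i j with ⟨rfl, h⟩ | ⟨h', h⟩ | ⟨h', h⟩
    · have hm : mMat X i i = 0 := mMat_eq_zero (by rw [h]; decide)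
      rw [if_pos h, hm, neg_zero, zpow_zero, PowerSeries.rescale_one]
      rw [curP_curM_delta hg.κ_ne τadd S hq (fun j => compat _) (fun j => compat _) i
        (Vp := fun s => if s = 0 then LinearMap.id else 0)
        (Vm := fun s => if s = 0 then LinearMap.id else 0)
        (by rw [cz, mul_one]; rfl) (by rw [cz, mul_one]; rfl) ?_ ?_ ?_ ?_, hKp, hKm]
      · have e0 : (blockOp id fun _ => (0 : M →ₗ[ℂ] M) :
            Module.End ℂ (Idx X →₀ M)) = 0 :=
          Finsupp.lhom_ext fun x m => by rw [blockOp_single]; simp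
        have e1 : (blockOp id fun _ => (LinearMap.id : M →ₗ[ℂ] M) :
            Module.End ℂ (Idx X →₀ M)) = 1 :=
          Finsupp.lhom_ext fun x m => by rw [blockOp_single]; simp
        by_cases hrt : r + t = 0
        · simp only [hrt, if_true, e1, mul_one, and_self]
        · simp only [hrt, if_false, e0, mul_zero, and_false, LinearMap.zero_apply, smul_zero,
            sub_self]
      · intro s
        rw [← vertexMode_zero]; congr 1 <;> funext m <;> simp [ha]
      · intro s
        rw [← vertexMode_zero]; congr 1 <;> funext m <;> simp [ha]
      · intro η s m; split_ifs <;> simp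
      · intro η s m; split_ifs <;> simp
    · rw [h, if_neg (by decide), if_pos rfl, if_neg (fun hc => h' hc.1), zpow_neg]
      have P := curP_curM_pair (q := q) (l := l) (lam := lam) hg.κ_ne τadd i j
      rw [h] at P
      refine S.mixed_eq_zero (compat _) (compat _) (hu0 i j) P (Or.inl rfl)
        (fun hc => absurd rfl hc) ?_ ?_ r t v
      · rw [cz, mul_one, rescale_one_sub]; rfl
      · rw [cz, mul_one, rescale_one_sub]; rfl
    · rw [h, if_neg (by decide), if_neg (by decide), if_neg (fun hc => h' hc.1), zpow_neg]
      have P := curP_curM_pair (q := q) (l := l) (lam := lam) hg.κ_ne τadd i j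
      rw [h] at P
      refine S.mixed_eq_zero (compat _) (compat _) (hu0 i j) P (Or.inr rfl)
        (fun _ => hu i j (by rw [h]; decide)) ?_ ?_ r t v
      · rw [cz, mul_one, map_one]; rfl
      · rw [cz, mul_one, map_one]; rfl
  · intro i j hij
    rw [hxp, hxp, hS.1, hS.2.1]
    have P := curP_pair (q := q) (l := l) (lam := lam) hg.κ_ne τadd i i
    have P' := curP_pair (q := q) (l := l) (lam := lam) hg.κ_ne τadd i j
    rw [cartan_self, hu i i (by rw [cartan_self]; decide)] at P
    rw [hij] at P'
    refine S.serreRelation (compat _) (compat _) (hu0 i j) (inv_ne_zero hq)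
      (by rw [inv_inv, add_comm]) (by simpa using P) (by simpa using P') ?_ ?_ ?_ <;>
    rw [cz, mul_one]
  · intro i j hij
    rw [hxm, hxm, hS.2.2.1, hS.2.2.2]
    have P := curM_pair (lam := lam) hg.κ_ne τadd i i
    have P' := curM_pair (lam := lam) hg.κ_ne τadd i j
    rw [cartan_self, hu i i (by rw [cartan_self]; decide)] at P
    rw [hij] at P'
    refine S.serreRelation (compat _) (compat _) (hu0 i j) hq rfl
      (by simpa using P) (by simpa using P') ?_ ?_ ?_ <;>
    rw [cz, mul_one]
  · intro i j hij r t
    rw [hxp, hxp]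
    have P := curP_pair (q := q) (l := l) (lam := lam) hg.κ_ne τadd i j
    rw [hij, hu i j (by rw [hij]; decide)] at P
    exact S.mode_commute (compat _) (compat _) (by simpa using P) (cz _ _) (cz _ _) r t
  · intro i j hij r t
    rw [hxm, hxm]
    have P := curM_pair (lam := lam) hg.κ_ne τadd i j
    rw [hij, hu i j (by rw [hij]; decide)] at P
    exact S.mode_commute (compat _) (compat _) (by simpa using P) (cz _ _) (cz _ _) r t

set_option maxHeartbeats 1000000 in
theorem WModule_isZModule (hg : GenericParams q κ p) : (WModule q κ l lam μ).IsZModule q κ l := by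
  unfold WModule
  have L := latticeData_W (X := X) q
  apply L.isZModule hg

end LatticeModule

/-! ### Scalar exponentials and logarithms of linear factors -/

section ScalarSeries

open PowerSeries

/-- The power series `exp (∑_{m>0} f_m x^m)`. -/
def expSeries (f : ℕ → ℂ) : PowerSeries ℂ := PowerSeries.mk (expCoeff f)

theorem expSeries_congr {f g : ℕ → ℂ} (h : ∀ m, 0 < m → f m = g m) : expSeries f = expSeries g := by
  ext n
  rw [expSeries, expSeries, coeff_mk, coeff_mk, expCoeff_congr h]

theorem expSeries_add (f g : ℕ → ℂ) :
    expSeries (fun m => f m + g m) = expSeries f * expSeries g := by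
  ext n
  rw [expSeries, coeff_mk, coeff_mul, expCoeff_add (fun _ _ => Commute.all _ _)
    (fun _ _ => Commute.all _ _) fun _ _ => Commute.all _ _]
  simp [expSeries]

theorem expSeries_zero : expSeries (fun _ => 0) = 1 := by
  ext n
  rw [expSeries, coeff_mk, expCoeff_of_zero, coeff_one]

theorem expSeries_ne_zero (f : ℕ → ℂ) : constantCoeff (expSeries f) ≠ 0 := by
  rw [← coeff_zero_eq_constantCoeff_apply, expSeries, coeff_mk, expCoeff_zero]
  exact one_ne_zero

theorem expSeries_neg (f : ℕ → ℂ) : (expSeries f)⁻¹ = expSeries fun m => -f m := by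
  refine (PowerSeries.inv_eq_iff_mul_eq_one (expSeries_ne_zero f)).mpr ?_
  rw [← expSeries_add]
  simpa using expSeries_zero

theorem rescale_expSeries (u : ℂ) (f : ℕ → ℂ) :
    rescale u (expSeries f) = expSeries fun m => u ^ m * f m := by
  ext n
  rw [coeff_rescale, expSeries, coeff_mk, expSeries, coeff_mk]
  exact (expCoeff_scale (fun _ _ => Commute.all _ _) u n).symm

theorem expSeries_geom (ρ : ℂ) : expSeries (fun m => ρ ^ m / m) = geom ρ := by
  ext n
  rw [expSeries, coeff_mk, geom, coeff_mk]
  refine (expCoeff_unique (fun _ _ => Commute.all _ _) (pow_zero ρ) (fun n => ?_) n).symm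
  have h : ∀ x ∈ Finset.HasAntidiagonal.antidiagonal n,
      (x.1 : ℂ) • (ρ ^ x.1 / x.1 * ρ ^ x.2) = if x.1 = 0 then 0 else ρ ^ n := by
    intro x hx
    rw [← Finset.HasAntidiagonal.mem_antidiagonal.mp hx]
    split_ifs with h0
    · simp [h0]
    · have : (x.1 : ℂ) ≠ 0 := Nat.cast_ne_zero.mpr h0
      rw [smul_eq_mul, pow_add]
      field_simp
  rw [Finset.sum_congr rfl h, Finset.Nat.sum_antidiagonal_eq_sum_range_succ_mk,
    Finset.sum_range_succ']
  simp

theorem expSeries_linear (ρ : ℂ) : expSeries (fun m => -(ρ ^ m / m)) = 1 - C ρ * X := by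
  rw [← expSeries_neg, expSeries_geom]
  refine (PowerSeries.inv_eq_iff_mul_eq_one ?_).mpr ?_
  · simp [geom, ← coeff_zero_eq_constantCoeff_apply]
  · rw [mul_comm, geom_mul]

theorem expSeries_quad (ρ : ℂ) :
    expSeries (fun m => -((ρ ^ 2) ^ m / m) + -(1 ^ m / m)) = quad ρ := by
  rw [expSeries_add, expSeries_linear, expSeries_linear, quad, map_one, one_mul]

theorem expSeries_qInt {q : ℂ} (hq : q ≠ 0) (hq' : q - q⁻¹ ≠ 0) :
    expSeries (fun m => q⁻¹ ^ m / m + q ^ m / m) = qIntSeries q := by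
  have h := qIntSeries_mul hq hq'
  have h1 := geom_mul q
  have h2 := geom_mul q⁻¹
  rw [expSeries_add, expSeries_geom, expSeries_geom]
  linear_combination (-(geom q * geom q⁻¹)) * h +
    qIntSeries q * (1 - C q * X) * geom q * h2 + qIntSeries q * h1

theorem gSeries_eq (q s : ℂ) (b : ℤ) : gSeries q s b = expSeries fun m : ℕ =>
    -((q ^ (b * m) - q ^ (-(b * m))) / (m * (1 - s ^ m)) * s ^ m) := rfl

/-- The denominator 1 - ρ^{2m} divides the numerator: for e = 2 the quotient is -(ρ^{2m} + 1)/m and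
for e = -1 it is ρ^m/m. These are the coefficients of logarithms of linear factors or of their
inverses. -/
theorem expSeries_serre {ρ : ℂ} (h1 : ∀ m : ℕ, 0 < m → 1 - (ρ ^ m) ^ 2 ≠ 0) (h0 : ρ ≠ 0) {e : ℤ}
    (he : e = 2 ∨ e = -1 ∨ e = 0) :
    expSeries (fun m => (ρ ^ (e * m) - ρ ^ (-(e * m))) * (ρ ^ m) ^ 2 / (m * (1 - (ρ ^ m) ^ 2))) =
      serreSeries ρ e := by
  have hp : ∀ (m : ℕ) (k : ℤ), ρ ^ (k * m) = (ρ ^ m) ^ k := fun m k => by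
    rw [← zpow_natCast, ← zpow_mul, mul_comm]
  rcases he with rfl | rfl | rfl
  · rw [serreSeries, if_pos rfl, ← expSeries_quad]
    refine expSeries_congr fun m hm => ?_
    have hm' : (m : ℂ) ≠ 0 := by exact_mod_cast hm.ne'
    have h1' := h1 m hm
    have h0' := pow_ne_zero m h0
    rw [zpow_neg, hp, pow_right_comm ρ 2 m, one_pow, zpow_ofNat]
    field_simp
    ring
  · rw [serreSeries, if_neg (by decide), if_pos rfl, ← expSeries_geom]
    refine expSeries_congr fun m hm => ?_
    have hm' : (m : ℂ) ≠ 0 := by exact_mod_cast hm.ne'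
    have h1' := h1 m hm
    have h0' := pow_ne_zero m h0
    rw [zpow_neg, hp, zpow_neg_one]
    field_simp
  · rw [serreSeries, if_neg (by decide), if_neg (by decide), ← expSeries_zero]
    exact expSeries_congr fun m hm => by simp

end ScalarSeries

/-! ### Contractions of the elliptic currents -/

section Contractions

variable {X : AffineType} (q κ p : ℂ)

/-- The ratio `(1 - p^m) / (1 - p^{*m})`. -/
def pRatio (m : ℤ) : ℂ := (1 - p ^ m) / (1 - (p * q ^ (-2 : ℤ)) ^ m)

/-- The contraction exponents of the bosonic parts of the currents. -/
def fockContr (A B : Node X × Bool) (m : ℕ) : ℂ :=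
  κ⁻¹ ^ (mMat X A.1 B.1 * m) * (qInt q (cartan X A.1 B.1 * m) / (qInt q m * m) *
    if A.2 then (if B.2 then -(pRatio q p m * q ^ (-m : ℤ)) else 1)
    else if B.2 then 1 else -((pRatio q p m)⁻¹ * q ^ m))

variable {q κ p}

theorem contr_fockContr (A B : Node X × Bool) : contr (fockContr q κ p) A B =
    PowerSeries.rescale (κ ^ (-mMat X A.1 B.1)) (expSeries fun m =>
      (qInt q (cartan X A.1 B.1 * m) / (qInt q m * m) *
        if A.2 then (if B.2 then -(pRatio q p m * q ^ (-m : ℤ)) else 1)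
        else if B.2 then 1 else -((pRatio q p m)⁻¹ * q ^ m))) := by
  rw [rescale_expSeries]
  refine expSeries_congr fun m hm => ?_
  rw [fockContr, inv_zpow', ← neg_mul, zpow_mul, zpow_natCast]

theorem pstar_pow (m : ℕ) : (p * q ^ (-2 : ℤ)) ^ m = p ^ m * ((q ^ m) ^ 2)⁻¹ := by
  rw [zpow_neg, mul_pow, inv_pow]
  norm_cast
  rw [← pow_mul, ← pow_mul, mul_comm 2 m]

variable (hg : GenericParams q κ p)
include hg

theorem GenericParams.one_sub_p_ne {m : ℕ} (hm : 0 < m) : 1 - p ^ m ≠ 0 := by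
  intro h
  have := hg.p_lt
  have h1 : ‖p ^ m‖ < 1 := by rw [norm_pow]; exact pow_lt_one₀ (norm_nonneg _) this hm.ne'
  rw [← sub_eq_zero.mp h] at h1
  simp at h1

theorem GenericParams.one_sub_pstar_ne {m : ℕ} (hm : 0 < m) : 1 - (p * q ^ (-2 : ℤ)) ^ m ≠ 0 := by
  intro h
  have h1 : ‖(p * q ^ (-2 : ℤ)) ^ m‖ < 1 := by
    rw [norm_pow]; exact pow_lt_one₀ (norm_nonneg _) hg.pstar_lt hm.ne'
  rw [← sub_eq_zero.mp h] at h1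
  simp at h1

theorem GenericParams.one_sub_q_sq_ne {m : ℕ} (hm : 0 < m) : 1 - (q ^ m) ^ 2 ≠ 0 := by
  intro h
  have h1 : ‖(q ^ m) ^ 2‖ < 1 := by
    rw [← pow_mul, norm_pow]; exact pow_lt_one₀ (norm_nonneg _) hg.q_lt (by omega)
  rw [← sub_eq_zero.mp h] at h1
  simp at h1

theorem GenericParams.one_sub_q_inv_sq_ne {m : ℕ} (hm : 0 < m) : 1 - (q⁻¹ ^ m) ^ 2 ≠ 0 := by
  have h := hg.one_sub_q_sq_ne hm
  have h0 := pow_ne_zero m hg.q_ne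
  rw [inv_pow]
  intro hc
  apply h
  field_simp at hc
  linear_combination -hc

theorem qInt_div (a : ℤ) {m : ℕ} (hm : 0 < m) : qInt q (a * m) / (qInt q m * m) =
    (q ^ (a * m) - q ^ (-(a * m))) * q ^ m / (m * ((q ^ m) ^ 2 - 1)) := by
  have h1 := hg.sub_inv_ne
  have h0 := pow_ne_zero m hg.q_ne
  have hm' : (m : ℂ) ≠ 0 := by exact_mod_cast hm.ne'
  have h2 : (q ^ m) ^ 2 - 1 ≠ 0 := by
    intro h; exact hg.one_sub_q_sq_ne hm (by linear_combination -h)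
  have h3 : q ^ m - (q ^ m)⁻¹ ≠ 0 := by
    intro h; apply h2; field_simp at h; linear_combination h
  rw [qInt, qInt, zpow_neg _ (m : ℤ), zpow_natCast]
  have e3 : q ^ m - (q ^ m)⁻¹ = ((q ^ m) ^ 2 - 1) / q ^ m := by field_simp
  rw [e3]
  generalize q - q⁻¹ = d at *
  generalize q ^ (a * (m : ℤ)) = y
  generalize q ^ (-(a * (m : ℤ))) = z
  field_simp

/-- The pole 1 - p^{*m} occurs in both exponents, and on adding them the nome disappears because p^*
= p q^{-2}. What is left is the exponent of `expSeries_serre` at ρ = q⁻¹. -/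
theorem gSeries_mul_contr_plus {e : ℤ} (he : e = 2 ∨ e = -1 ∨ e = 0) :
    gSeries q (p * q ^ (-2 : ℤ)) e * expSeries (fun m => qInt q (e * m) / (qInt q m * m) *
      -(pRatio q p m * q ^ (-m : ℤ))) = serreSeries q⁻¹ e := by
  rw [gSeries_eq, ← expSeries_add, ← expSeries_serre (fun m => hg.one_sub_q_inv_sq_ne)
    (inv_ne_zero hg.q_ne) he]
  refine expSeries_congr fun m hm => ?_
  have h0 := pow_ne_zero m hg.q_ne
  have hm' : (m : ℂ) ≠ 0 := by exact_mod_cast hm.ne'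
  have h2 : (q ^ m) ^ 2 - 1 ≠ 0 := by
    intro h; exact hg.one_sub_q_sq_ne hm (by linear_combination -h)
  have h3 := hg.one_sub_pstar_ne hm
  rw [qInt_div hg e hm, pRatio, zpow_natCast, zpow_natCast, inv_zpow', inv_zpow', neg_neg, zpow_neg _ (m : ℤ),
    zpow_natCast, inv_pow]
  have h4 := pstar_pow (q := q) (p := p) m
  rw [h4] at h3 ⊢
  set Q := q ^ m
  have h5 : Q ^ 2 - p ^ m ≠ 0 := by
    intro h; apply h3; field_simp; linear_combination h
  have h6 : 1 - Q⁻¹ ^ 2 ≠ 0 := by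
    intro h; apply h2; field_simp at h; linear_combination h
  have e6 : 1 - Q⁻¹ ^ 2 = (Q ^ 2 - 1) / Q ^ 2 := by field_simp
  have e3 : 1 - p ^ m * (Q ^ 2)⁻¹ = (Q ^ 2 - p ^ m) / Q ^ 2 := by field_simp
  rw [e6, e3]
  generalize q ^ (e * (m : ℤ)) = y
  generalize q ^ (-(e * (m : ℤ))) = z
  field_simp
  ring

/-- The same cancellation for the primed bosons, now with the pole 1 - p^m, leads to ρ = q. -/
theorem gSeries_mul_contr_minus {e : ℤ} (he : e = 2 ∨ e = -1 ∨ e = 0) :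
    (gSeries q p e)⁻¹ * expSeries (fun m => qInt q (e * m) / (qInt q m * m) *
      -((pRatio q p m)⁻¹ * q ^ m)) = serreSeries q e := by
  rw [gSeries_eq, expSeries_neg, ← expSeries_add, ← expSeries_serre (fun m => hg.one_sub_q_sq_ne)
    hg.q_ne he]
  refine expSeries_congr fun m hm => ?_
  have h0 := pow_ne_zero m hg.q_ne
  have hm' : (m : ℂ) ≠ 0 := by exact_mod_cast hm.ne'
  have h2 := hg.one_sub_q_sq_ne hm
  have h2' : (q ^ m) ^ 2 - 1 ≠ 0 := by
    intro h; exact h2 (by linear_combination -h)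
  have h3 := hg.one_sub_p_ne hm
  rw [qInt_div hg e hm, pRatio, zpow_natCast, zpow_natCast, inv_div]
  have h4 := pstar_pow (q := q) (p := p) m
  rw [h4]
  set Q := q ^ m
  have e2 : 1 - Q ^ 2 = -(Q ^ 2 - 1) := by ring
  rw [e2]
  generalize q ^ (e * (m : ℤ)) = y
  generalize q ^ (-(e * (m : ℤ))) = z
  field_simp
  ring

/-- The normalization of α' is inverse to the elliptic factor in the Heisenberg commutator, so mixed
contractions are independent of p; [2m]/[m] = q^m + q^{-m} yields two geometric series. -/
theorem contr_mixed_two : expSeries (fun m => qInt q (2 * m) / (qInt q m * m) * 1) =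
    qIntSeries q := by
  rw [← expSeries_qInt hg.q_ne hg.sub_inv_ne]
  refine expSeries_congr fun m hm => ?_
  have h0 := pow_ne_zero m hg.q_ne
  have hm' : (m : ℂ) ≠ 0 := by exact_mod_cast hm.ne'
  have h2' : (q ^ m) ^ 2 - 1 ≠ 0 := by
    intro h; exact hg.one_sub_q_sq_ne hm (by linear_combination -h)
  rw [qInt_div hg 2 hm, zpow_neg, mul_comm (2 : ℤ), zpow_mul, zpow_natCast, inv_pow]
  norm_cast
  field_simp
  ring

theorem contr_mixed_neg_one : expSeries (fun m => qInt q (-1 * m) / (qInt q m * m) * 1) =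
    1 - PowerSeries.X := by
  have h := expSeries_linear 1
  rw [map_one, one_mul] at h
  rw [← h]
  refine expSeries_congr fun m hm => ?_
  have h0 := pow_ne_zero m hg.q_ne
  have hm' : (m : ℂ) ≠ 0 := by exact_mod_cast hm.ne'
  have h2' : (q ^ m) ^ 2 - 1 ≠ 0 := by
    intro h; exact hg.one_sub_q_sq_ne hm (by linear_combination -h)
  rw [qInt_div hg (-1) hm, neg_one_mul, neg_neg, zpow_neg, zpow_natCast]
  field_simp
  ring

omit hg in
theorem contr_cartan_zero (f : ℕ → ℂ) : expSeries (fun m => qInt q (0 * m) / (qInt q m * m) * f m) =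
    1 := by
  rw [← expSeries_zero]
  exact expSeries_congr fun m _ => by simp [qInt]

end Contractions

/-! ### Operators acting summand by summand -/

section Diagonal

variable (ι : Type*) {M : Type*} [AddCommGroup M] [Module ℂ M]

/-- Operators on `M` acting on each summand of `⨁_x M`. -/
def diagHom : Module.End ℂ M →ₐ[ℂ] Module.End ℂ (ι →₀ M) :=
  AlgHom.ofLinearMap
    { toFun := fun T => blockOp id fun _ => T
      map_add' := fun S T => Finsupp.lhom_ext fun x m => by simp [blockOp_single]
      map_smul' := fun c T => Finsupp.lhom_ext fun x m => by simp [blockOp_single] }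
    (Finsupp.lhom_ext fun x m => by simp [blockOp_single])
    fun S T => Finsupp.lhom_ext fun x m => by simp [blockOp_single]

variable {ι}

theorem diagHom_single (T : Module.End ℂ M) (x : ι) (m : M) :
    diagHom ι T (Finsupp.single x m) = Finsupp.single x (T m) :=
  blockOp_single _ _ _ _

theorem diagHom_apply (T : Module.End ℂ M) (v : ι →₀ M) (x : ι) : diagHom ι T v x = T (v x) := by
  classical
  induction v using Finsupp.induction_linear with
  | zero => simp
  | add v w hv hw => rw [map_add, Finsupp.add_apply, hv, hw, Finsupp.add_apply, map_add]
  | single y m =>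
    rw [diagHom_single, Finsupp.single_apply, Finsupp.single_apply]
    split_ifs <;> simp

theorem vertexMode_congr {a b a' b' : ℕ → Module.End ℂ M} (ha : ∀ m, 0 < m → a m = a' m)
    (hb : ∀ m, 0 < m → b m = b' m) (s : ℤ) : vertexMode a b s = vertexMode a' b' s := by
  unfold vertexMode
  congr 1
  funext n
  rw [expCoeff_congr ha, expCoeff_congr hb]

/-- The series φ^± are defined from operators on the whole direct sum. A vector has finitely many
components, so local finiteness passes from one summand to the sum, and both ways of summing agree.
-/
theorem vertexMode_diagHom {a b : ℕ → Module.End ℂ M}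
    (hb : ∀ v, ∃ D : ℕ, ∀ r, D ≤ r → expCoeff b r v = 0) (s : ℤ) :
    vertexMode (fun m => diagHom ι (a m)) (fun m => diagHom ι (b m)) s =
      diagHom ι (vertexMode a b s) := by
  set T : ℕ → Module.End ℂ M := fun n => expCoeff a n *
    (if 0 ≤ (n : ℤ) + s then expCoeff b ((n : ℤ) + s).toNat else 0) with hT
  have hfin : ∀ v, {n | T n v ≠ 0}.Finite := by
    intro v
    obtain ⟨D, hD⟩ := hb v
    refine finite_support_of_bound (K := (D - s).toNat) fun n hn => ?_
    rw [hT]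
    simp only
    rw [if_pos (by omega), Module.End.mul_apply, hD _ (by omega), map_zero]
  have hT' : ∀ n, expCoeff (fun m => diagHom ι (a m)) n * (if 0 ≤ (n : ℤ) + s then
      expCoeff (fun m => diagHom ι (b m)) ((n : ℤ) + s).toNat else 0) = diagHom ι (T n) := by
    intro n
    rw [expCoeff_map, expCoeff_map, hT, map_mul]
    split_ifs <;> simp
  have hfin' : ∀ v : ι →₀ M, {n | diagHom ι (T n) v ≠ 0}.Finite := by
    intro v
    refine (v.support.finite_toSet.biUnion fun x _ => hfin (v x)).subset fun n hn => ?_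
    by_contra hc
    refine hn (Finsupp.ext fun x => ?_)
    rw [diagHom_apply]
    by_contra hx
    have hvx : v x ≠ 0 := fun h0 => hx (by rw [h0, map_zero]; rfl)
    exact hc (Set.mem_biUnion (Finset.mem_coe.mpr (Finsupp.mem_support_iff.mpr hvx)) hx)
  have h1 : vertexMode (fun m => diagHom ι (a m)) (fun m => diagHom ι (b m)) s =
      locSum fun n => diagHom ι (T n) := by
    unfold vertexMode
    congr 1
    funext n
    exact hT' n
  have h2 : vertexMode a b s = locSum T := rfl
  rw [h1, h2]
  refine Finsupp.lhom_ext fun x m => ?_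
  rw [diagHom_single, locSum, locSum, dif_pos hfin, dif_pos hfin']
  change ∑ᶠ n, diagHom ι (T n) (Finsupp.single x m) = Finsupp.single x (∑ᶠ n, T n m)
  simp only [diagHom_single]
  exact ((Finsupp.singleAddHom x).map_finsum (hfin m)).symm

end Diagonal

theorem finsum_add_of_bound {M : Type*} [AddCommGroup M] [Module ℂ M] {g h : ℕ → M} {K K' : ℕ}
    (hg : ∀ n, K ≤ n → g n = 0) (hh : ∀ n, K' ≤ n → h n = 0) :
    ∑ᶠ n, (g n + h n) = ∑ᶠ n, g n + ∑ᶠ n, h n :=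
  finsum_add_distrib (show (Function.support g).Finite from finite_support_of_bound hg)
    (show (Function.support h).Finite from finite_support_of_bound hh)

/-! ### Commutators with vertex operators -/

section Commutators

variable {J M : Type*} [AddCommGroup M] [Module ℂ M] {a b : J → ℕ → Module.End ℂ M}
  {c : J → J → ℕ → ℂ} (S : IsVertexSystem a b c)
include S

theorem IsVertexSystem.vertexMode_summand_bound (A : J) (s : ℤ) (v : M) :
    ∃ K : ℕ, ∀ n : ℕ, K ≤ n → expZ (b A) (s + n) v = 0 := by
  obtain ⟨D, _, hD⟩ := S.expZ_nil v
  exact ⟨(D - s).toNat, fun n hn => hD A _ (by omega)⟩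

theorem IsVertexSystem.vertexMode_semiconj (A : J) {T : Module.End ℂ M} {ζ : ℂ} (hζ : ζ ≠ 0)
    (ha : ∀ m, 0 < m → T * a A m = ζ⁻¹ ^ m • (a A m * T))
    (hb : ∀ m, 0 < m → T * b A m = ζ ^ m • (b A m * T)) (s : ℤ) (v : M) :
    T (vertexMode (a A) (b A) s v) = ζ ^ s • vertexMode (a A) (b A) s (T v) := by
  obtain ⟨K, hK⟩ := S.vertexMode_summand_bound A s v
  rw [S.vertexMode_apply, S.vertexMode_apply, wrap, wrap,
    map_finsum_of_bound T (K := K) fun n hn => by rw [hK n hn, map_zero], smul_finsum]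
  refine finsum_congr fun n => ?_
  have h1 := LinearMap.congr_fun (semiconj_expCoeff (S.aa A A) T ζ⁻¹ ha (S.aa A A) n)
    (expZ (b A) (s + n) v)
  rw [Module.End.mul_apply] at h1
  rw [h1, LinearMap.smul_apply, Module.End.mul_apply]
  rcases lt_or_ge (s + n) 0 with h | h
  · simp [expZ_of_neg _ h]
  · have hs : s + (n : ℤ) = ((s + n).toNat : ℕ) := (Int.toNat_of_nonneg h).symm
    have h2 := LinearMap.congr_fun (semiconj_expCoeff (S.bb A A) T ζ hb (S.bb A A) (s + n).toNat) v
    rw [Module.End.mul_apply] at h2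
    rw [hs, expZ_natCast, h2, LinearMap.smul_apply, Module.End.mul_apply, map_smul, smul_smul]
    congr 1
    rw [← zpow_natCast ζ⁻¹, inv_zpow', ← zpow_natCast ζ, ← hs, ← zpow_add₀ hζ]
    congr 1
    ring

theorem IsVertexSystem.vertexMode_commute (A : J) {T : Module.End ℂ M}
    (ha : ∀ m, 0 < m → T * a A m = a A m * T) (hb : ∀ m, 0 < m → T * b A m = b A m * T)
    (s : ℤ) (v : M) : T (vertexMode (a A) (b A) s v) = vertexMode (a A) (b A) s (T v) := by
  have h := S.vertexMode_semiconj A (T := T) one_ne_zero (by simpa using ha) (by simpa using hb) s v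
  simpa using h

/-- An operator with a single scalar commutator, in degree k of the creation exponent, acts on the
vertex operator as multiplication by d z^k, hence shifts modes by k. -/
theorem IsVertexSystem.comm_vertexMode_create (A : J) {T : Module.End ℂ M} {k : ℕ} (hk : 0 < k)
    {d : ℂ} (ha : ∀ m, 0 < m → T * a A m = a A m * T + if m = k then d • 1 else 0)
    (hb : ∀ m, 0 < m → T * b A m = b A m * T) (s : ℤ) (v : M) :
    T (vertexMode (a A) (b A) s v) =
      vertexMode (a A) (b A) s (T v) + d • vertexMode (a A) (b A) (k + s) v := by
  obtain ⟨K, hK⟩ := S.vertexMode_summand_bound A s v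
  obtain ⟨K', hK'⟩ := S.vertexMode_summand_bound A s (T v)
  have hbT : ∀ n : ℤ, T * expZ (b A) n = expZ (b A) n * T := by
    intro n
    unfold expZ
    split_ifs
    · exact (commute_expCoeff (S.bb A A) (fun m hm => hb m hm) _).eq
    · simp
  have key : ∀ n : ℕ, T (expCoeff (a A) n (expZ (b A) (s + n) v)) =
      expCoeff (a A) n (expZ (b A) (s + n) (T v)) +
        d • expZ (a A) ((n : ℤ) - k) (expZ (b A) (s + n) v) := by
    intro n
    have h := LinearMap.congr_fun (comm_expCoeff (S.aa A A) hk ha n) (expZ (b A) (s + n) v)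
    have h2 := LinearMap.congr_fun (hbT (s + n)) v
    rw [Module.End.mul_apply] at h h2
    rw [h, LinearMap.add_apply, Module.End.mul_apply, h2]
    rfl
  rw [S.vertexMode_apply, S.vertexMode_apply, S.vertexMode_apply, wrap, wrap, wrap,
    map_finsum_of_bound T (K := K) fun n hn => by rw [hK n hn, map_zero]]
  simp only [key]
  rw [finsum_add_of_bound (K := K') (fun n hn => by rw [hK' n hn, map_zero])
    (K' := K) (fun n hn => by rw [hK n hn, map_zero, smul_zero]),
    ← smul_finsum]
  congr 2
  rw [finsum_tail (K := K) k (fun n hn => by rw [expZ_of_neg _ (by omega)]; rfl)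
    (fun n hn => by rw [hK n hn, map_zero])]
  refine finsum_congr fun n => ?_
  rw [show ((n + k : ℕ) : ℤ) - k = n by push_cast; ring, expZ_natCast]
  congr 2
  push_cast
  ring_nf

/-- The mirror case: the commutator sits in the annihilation exponent, which multiplies by d z^{-k}.
-/
theorem IsVertexSystem.comm_vertexMode_annihilate (A : J) {T : Module.End ℂ M} {k : ℕ} (hk : 0 < k)
    {d : ℂ} (ha : ∀ m, 0 < m → T * a A m = a A m * T)
    (hb : ∀ m, 0 < m → T * b A m = b A m * T + if m = k then d • 1 else 0) (s : ℤ) (v : M) :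
    T (vertexMode (a A) (b A) s v) =
      vertexMode (a A) (b A) s (T v) + d • vertexMode (a A) (b A) (-k + s) v := by
  obtain ⟨K, hK⟩ := S.vertexMode_summand_bound A s v
  obtain ⟨K', hK'⟩ := S.vertexMode_summand_bound A s (T v)
  obtain ⟨K'', hK''⟩ := S.vertexMode_summand_bound A (-k + s) v
  have key : ∀ n : ℕ, T (expCoeff (a A) n (expZ (b A) (s + n) v)) =
      expCoeff (a A) n (expZ (b A) (s + n) (T v)) +
        d • expCoeff (a A) n (expZ (b A) (-k + s + n) v) := by
    intro n
    have h := LinearMap.congr_fun (comm_expZ (S.bb A A) hk hb (s + n)) v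
    have h2 := LinearMap.congr_fun (commute_expCoeff (S.aa A A) (fun m hm => ha m hm) n).eq
      (expZ (b A) (s + n) v)
    rw [Module.End.mul_apply] at h h2
    rw [h2, Module.End.mul_apply, h, LinearMap.add_apply, map_add, Module.End.mul_apply,
      LinearMap.smul_apply, map_smul, show s + (n : ℤ) - k = -k + s + n by ring]
  rw [S.vertexMode_apply, S.vertexMode_apply, S.vertexMode_apply, wrap, wrap, wrap,
    map_finsum_of_bound T (K := K) fun n hn => by rw [hK n hn, map_zero]]
  simp only [key]
  rw [finsum_add_of_bound (K := K') (fun n hn => by rw [hK' n hn, map_zero])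
    (K' := K'') (fun n hn => by rw [hK'' n hn, map_zero, smul_zero]),
    ← smul_finsum]

end Commutators

/-! ### Vertex operators from a Heisenberg representation -/

section Heisenberg

variable {X : AffineType} {M : Type*} [AddCommGroup M] [Module ℂ M]

/-- The commutator of `α_{i,m}` and `α_{j,-m}`. -/
def heisConst (q κ p : ℂ) (i j : Node X) (m : ℤ) : ℂ :=
  qInt q (cartan X i j * m) / m * ((q ^ m - q ^ (-m)) / (q - q⁻¹)) *
    ((1 - p ^ m) / (1 - (p * q ^ (-2 : ℤ)) ^ m)) * κ ^ (-m * mMat X i j) * q ^ (-m)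

/-- A representation of the Heisenberg algebra of level one in which products of annihilation operators of
large degree kill every vector. -/
structure IsHeisenberg (q κ p : ℂ) (al : Node X → ℤ → Module.End ℂ M) : Prop where
  comm : ∀ (i j : Node X) (m n : ℤ), m ≠ 0 → n ≠ 0 →
    al i m * al j n - al j n * al i m = if m + n = 0 then heisConst q κ p i j m • 1 else 0
  trunc : ∀ v, ∃ D : ℤ, ∀ L : List (Node X × ℤ), (∀ x ∈ L, 0 < x.2) → D ≤ (L.map Prod.snd).sum →
    (L.map fun x => al x.1 x.2).prod v = 0

variable (q κ p : ℂ) (al : Node X → ℤ → Module.End ℂ M)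

/-- The operators `α'_{i,m}`. -/
def primed (i : Node X) (m : ℤ) : Module.End ℂ M :=
  ((1 - (p * q ^ (-2 : ℤ)) ^ m) / (1 - p ^ m) * q ^ m) • al i m

/-- The exponents of the creation parts of the currents. -/
def creation : Node X × Bool → ℕ → Module.End ℂ M
  | (j, true) => fun m => (qInt q m)⁻¹ • al j (-m)
  | (j, false) => fun m => -(qInt q m)⁻¹ • primed q p al j (-m)

/-- The exponents of the annihilation parts of the currents. -/
def annihilation : Node X × Bool → ℕ → Module.End ℂ M
  | (j, true) => fun m => -(qInt q m)⁻¹ • al j m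
  | (j, false) => fun m => (qInt q m)⁻¹ • primed q p al j m

/-- The coefficient of `α_{j,-m}` in the exponents of the currents. -/
def bosonCoeff (e : Bool) (m : ℕ) : ℂ :=
  if e then (qInt q m)⁻¹ else -((qInt q m)⁻¹ * ((pRatio q p m)⁻¹ * q ^ m))

variable {q κ p al}

theorem bosonCoeff_zero (e : Bool) : bosonCoeff q p e 0 = 0 := by
  have : qInt q ((0 : ℕ) : ℤ) = 0 := by simp [qInt]
  rw [bosonCoeff, this]
  simp

theorem annihilation_eq (A : Node X × Bool) (m : ℕ) :
    annihilation q p al A m = -bosonCoeff q p A.2 m • al A.1 m := by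
  obtain ⟨j, e⟩ := A
  cases e
  · simp only [annihilation, primed, bosonCoeff, pRatio, inv_div, smul_smul, zpow_natCast]
    simp
  · simp [annihilation, bosonCoeff]

section Generic

variable (hg : GenericParams q κ p)
include hg

theorem pRatio_neg {m : ℤ} : pRatio q p (-m) = q ^ (-2 * m) * pRatio q p m := by
  have hq := hg.q_ne
  have hp := hg.p_ne
  have h1 : (p * q ^ (-2 : ℤ)) ^ m = p ^ m * q ^ (-2 * m) := by rw [mul_zpow, zpow_mul]
  have h2 : (p * q ^ (-2 : ℤ)) ^ (-m) = (p ^ m)⁻¹ * (q ^ (-2 * m))⁻¹ := by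
    rw [zpow_neg, h1, mul_inv]
  have hP := zpow_ne_zero m hp
  have hQ := zpow_ne_zero (-2 * m) hq
  rw [pRatio, pRatio, h1, h2, zpow_neg]
  generalize p ^ m = P at *
  generalize q ^ (-2 * m) = Q at *
  -- If one denominator vanishes then so does the other, and both quotients are 0 by convention, so
  -- no genericity is needed here.
  by_cases h : 1 - P * Q = 0
  · have h3 : 1 - P⁻¹ * Q⁻¹ = 0 := by
      rw [← mul_inv, ← sub_eq_zero.mp h, inv_one, sub_self]
    rw [h, h3]; simp
  · have h3 : 1 - P⁻¹ * Q⁻¹ ≠ 0 := by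
      intro h'; apply h; field_simp at h'; linear_combination -h'
    field_simp
    ring_nf
    have h4 : P * Q - 1 ≠ 0 := fun h' => h (by linear_combination -h')
    have h5 : -1 + P * Q ≠ 0 := fun h' => h (by linear_combination -h')
    have h6 : 1 - P * Q ≠ 0 := h
    field_simp
    ring

/-- The factor of α' at -m coincides with the one at m, because p^* = p q^{-2} makes the elliptic
ratio change by q^{-2m} under m ↦ -m. One coefficient thus governs both the creation and the
annihilation part of a current. -/
theorem creation_eq (A : Node X × Bool) (m : ℕ) :
    creation q p al A m = bosonCoeff q p A.2 m • al A.1 (-m) := by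
  obtain ⟨j, e⟩ := A
  cases e
  · have h : (1 - (p * q ^ (-2 : ℤ)) ^ (-(m : ℤ))) / (1 - p ^ (-(m : ℤ))) = (pRatio q p (-m))⁻¹ := by
      rw [pRatio, inv_div]
    have hq := zpow_ne_zero m hg.q_ne
    simp only [creation, primed, bosonCoeff, h, smul_smul, Bool.false_eq_true, if_false]
    congr 1
    rw [pRatio_neg hg, mul_inv, ← zpow_neg, mul_right_comm (q ^ (-(-2 * (m : ℤ)))), ← zpow_add₀ hg.q_ne,
      ← zpow_natCast]
    ring_nf
  · simp [creation, bosonCoeff]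

theorem bosonCoeff_mul_heisConst (i : Node X) (A : Node X × Bool) {m : ℕ} (hm : 0 < m) :
    bosonCoeff q p A.2 m * heisConst q κ p i A.1 m = if A.2 then
      qInt q (cartan X i A.1 * m) / m * ((1 - p ^ (m : ℤ)) / (1 - (p * q ^ (-2 : ℤ)) ^ (m : ℤ))) *
        q ^ (-(m : ℤ)) * κ ^ (-(m : ℤ) * mMat X i A.1)
      else -(qInt q (cartan X i A.1 * m) / m * κ ^ (-(m : ℤ) * mMat X i A.1)) := by
  have h1 := hg.qInt_ne (m := m) (by exact_mod_cast hm.ne')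
  have h2 := hg.one_sub_p_ne hm
  have h3 := hg.one_sub_pstar_ne hm
  have hz : q ^ m ≠ 0 := pow_ne_zero m hg.q_ne
  have e1 : (q ^ (m : ℤ) - q ^ (-(m : ℤ))) / (q - q⁻¹) = qInt q m := rfl
  rw [heisConst, e1, bosonCoeff]
  generalize κ ^ (-(m : ℤ) * mMat X i A.1) = k
  generalize qInt q (cartan X i A.1 * m) = Y
  have hm' : (m : ℂ) ≠ 0 := by exact_mod_cast hm.ne'
  have hmZ : ((m : ℤ) : ℂ) = m := by push_cast; rfl
  rw [hmZ]
  split_ifs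
  · field_simp
  · rw [pRatio]
    rw [zpow_neg q (m : ℤ), zpow_natCast, zpow_natCast, zpow_natCast, inv_div]
    generalize (p * q ^ (-2 : ℤ)) ^ m = s at *
    generalize p ^ m = s' at *
    field_simp

theorem bosonCoeff_mul_heisConst_neg (i : Node X) (A : Node X × Bool) {m : ℕ} (hm : 0 < m) :
    -bosonCoeff q p A.2 m * heisConst q κ p i A.1 (-m) = if A.2 then
      qInt q (cartan X i A.1 * -m) / (-m : ℤ) *
        ((1 - p ^ (-m : ℤ)) / (1 - (p * q ^ (-2 : ℤ)) ^ (-m : ℤ))) *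
        q ^ (-(-m : ℤ)) * κ ^ (-(-m : ℤ) * mMat X i A.1)
      else -(qInt q (cartan X i A.1 * -m) / (-m : ℤ) * κ ^ (-(-m : ℤ) * mMat X i A.1)) := by
  have h1 := hg.qInt_ne (m := m) (by exact_mod_cast hm.ne')
  have hP : pRatio q p m ≠ 0 := div_ne_zero (hg.one_sub_p_ne hm) (hg.one_sub_pstar_ne hm)
  have hz : q ^ m ≠ 0 := pow_ne_zero m hg.q_ne
  have e1 : (q ^ (-m : ℤ) - q ^ (-(-m : ℤ))) / (q - q⁻¹) = -qInt q m := qInt_neg q m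
  have e2 : (1 - p ^ (-m : ℤ)) / (1 - (p * q ^ (-2 : ℤ)) ^ (-m : ℤ)) = pRatio q p (-m) := rfl
  rw [heisConst, e1, e2, bosonCoeff, pRatio_neg hg]
  have e3 : q ^ (-2 * (m : ℤ)) = ((q ^ m) ^ 2)⁻¹ := by
    rw [neg_mul, zpow_neg, mul_comm, zpow_mul]; norm_cast
  rw [e3, neg_neg, zpow_natCast]
  generalize κ ^ ((m : ℤ) * mMat X i A.1) = k
  generalize qInt q (cartan X i A.1 * -m) / (-m : ℤ) = Y
  split_ifs
  · field_simp
  · field_simp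

theorem neg_bosonCoeff_mul (A B : Node X × Bool) {m : ℕ} (hm : 0 < m) :
    -(bosonCoeff q p A.2 m * bosonCoeff q p B.2 m) * heisConst q κ p A.1 B.1 m =
      fockContr q κ p A B m := by
  have h1 := hg.qInt_ne (m := m) (by exact_mod_cast hm.ne')
  have hP : pRatio q p m ≠ 0 := div_ne_zero (hg.one_sub_p_ne hm) (hg.one_sub_pstar_ne hm)
  have hz : q ^ m ≠ 0 := pow_ne_zero m hg.q_ne
  have e1 : (q ^ (m : ℤ) - q ^ (-(m : ℤ))) / (q - q⁻¹) = qInt q m := rfl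
  have e2 : (1 - p ^ (m : ℤ)) / (1 - (p * q ^ (-2 : ℤ)) ^ (m : ℤ)) = pRatio q p m := rfl
  have e3 : κ ^ (-(m : ℤ) * mMat X A.1 B.1) = κ⁻¹ ^ (mMat X A.1 B.1 * m) := by
    rw [inv_zpow']; congr 1; ring
  have hm' : (m : ℂ) ≠ 0 := by exact_mod_cast hm.ne'
  have hmZ : ((m : ℤ) : ℂ) = m := by push_cast; rfl
  rw [heisConst, e1, e2, e3, fockContr, bosonCoeff, bosonCoeff, hmZ, zpow_neg, zpow_natCast]
  generalize κ⁻¹ ^ (mMat X A.1 B.1 * m) = k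
  generalize qInt q (cartan X A.1 B.1 * m) = Y
  split_ifs <;> field_simp

variable (H : IsHeisenberg q κ p al)
include H

theorem IsHeisenberg.comm_creation (i : Node X) {k : ℤ} (hk : k ≠ 0) (A : Node X × Bool) {m : ℕ}
    (hm : 0 < m) : al i k * creation q p al A m = creation q p al A m * al i k +
      if (m : ℤ) = k then (bosonCoeff q p A.2 m * heisConst q κ p i A.1 k) • 1 else 0 := by
  have h := H.comm i A.1 k (-m) hk (by omega)
  rw [creation_eq hg, mul_smul_comm, smul_mul_assoc, eq_add_of_sub_eq h, smul_add, add_comm]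
  congr 1
  by_cases hmk : (m : ℤ) = k
  · rw [if_pos hmk, if_pos (by omega), smul_smul]
  · rw [if_neg hmk, if_neg (by omega), smul_zero]

theorem IsHeisenberg.comm_annihilation (i : Node X) {k : ℤ} (hk : k ≠ 0) (A : Node X × Bool) {m : ℕ}
    (hm : 0 < m) : al i k * annihilation q p al A m = annihilation q p al A m * al i k +
      if (m : ℤ) = -k then (-bosonCoeff q p A.2 m * heisConst q κ p i A.1 k) • 1 else 0 := by
  have h := H.comm i A.1 k m hk (by omega)
  rw [annihilation_eq, mul_smul_comm, smul_mul_assoc, eq_add_of_sub_eq h, smul_add, add_comm]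
  congr 1
  by_cases hmk : (m : ℤ) = -k
  · rw [if_pos hmk, if_pos (by omega), smul_smul]
  · rw [if_neg hmk, if_neg (by omega), smul_zero]

/-- The coefficient of degree r is, by its recursion, a combination of products of annihilation
operators of total degree r, and these kill the vector when r is large, uniformly in the scalars. -/
theorem IsHeisenberg.expCoeff_nil (v : M) :
    ∃ D : ℕ, ∀ (A : Node X) (s : ℕ → ℂ) (r : ℕ), D ≤ r →
      expCoeff (fun m => s m • al A m) r v = 0 := by
  obtain ⟨D, hD⟩ := H.trunc v
  -- An arbitrary list of annihilation operators is carried in front: each use of the recursion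
  -- moves one more operator into the list and keeps the total degree.
  have key : ∀ (A : Node X) (s : ℕ → ℂ), (∀ m n, Commute (s m • al A m) (s n • al A n)) →
      ∀ (r : ℕ) (L : List (Node X × ℤ)), (∀ x ∈ L, 0 < x.2) →
      D ≤ (L.map Prod.snd).sum + r →
      (L.map fun x => al x.1 x.2).prod (expCoeff (fun m => s m • al A m) r v) = 0 := by
    intro A s hs r
    induction r using Nat.strong_induction_on with
    | _ r ih =>
      intro L hL hr
      rcases Nat.eq_zero_or_pos r with rfl | hr0
      · rw [expCoeff_zero, Module.End.one_apply]
        exact hD L hL (by simpa using hr)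
      · have hr' : (r : ℂ) ≠ 0 := by exact_mod_cast hr0.ne'
        refine smul_right_injective M hr' ?_
        change (r : ℂ) • _ = (r : ℂ) • _
        rw [smul_zero, ← map_smul, ← LinearMap.smul_apply, expCoeff_rec hs, LinearMap.sum_apply,
          map_sum]
        refine Finset.sum_eq_zero fun x hx => ?_
        have hx' := Finset.HasAntidiagonal.mem_antidiagonal.mp hx
        rcases Nat.eq_zero_or_pos x.1 with h0 | h0
        · simp [h0]
        · have := ih x.2 (by omega) (L ++ [(A, (x.1 : ℤ))]) (by
            intro y hy
            rcases List.mem_append.mp hy with hy | hy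
            · exact hL y hy
            · rw [List.mem_singleton.mp hy]; exact Int.natCast_pos.mpr h0) (by
            rw [List.map_append, List.sum_append]
            simp only [List.map_cons, List.map_nil, List.sum_cons, List.sum_nil]
            omega)
          rw [List.map_append, List.prod_append] at this
          simp only [List.map_cons, List.map_nil, List.prod_singleton, Module.End.mul_apply] at this
          rw [LinearMap.smul_apply, Module.End.mul_apply, LinearMap.smul_apply, map_smul, map_smul,
            this, smul_zero, smul_zero]
  refine ⟨D.toNat, fun A s r hr => ?_⟩
  have hs : ∀ m n : ℕ, 0 < m → 0 < n → Commute (s m • al A m) (s n • al A n) := by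
    intro m n hm hn
    have := H.comm A A m n (by omega) (by omega)
    rw [if_neg (by omega), sub_eq_zero] at this
    exact ((show Commute (al A m) (al A n) from this).smul_left _).smul_right _
  -- Nothing is assumed about α_{A,0}; since the exponential ignores index 0, its coefficient may be
  -- set to 0 to secure commutation of all exponents.
  have h0 := key A (fun m => if m = 0 then 0 else s m) (by
    intro m n
    rcases Nat.eq_zero_or_pos m with rfl | hm
    · simp
    · rcases Nat.eq_zero_or_pos n with rfl | hn
      · simp
      · rw [if_neg hm.ne', if_neg hn.ne']; exact hs m n hm hn) r [] (by simp) (by simp; omega)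
  rw [expCoeff_congr (b := fun m => (if m = 0 then 0 else s m) • al A m) (fun m hm => by
    rw [if_neg hm.ne'])]
  simpa using h0

theorem IsHeisenberg.isVertexSystem :
    IsVertexSystem (creation q p al) (annihilation q p al) (fockContr q κ p) where
  aa A B m n := by
    rw [creation_eq hg, creation_eq hg]
    rcases Nat.eq_zero_or_pos m with rfl | hm
    · rw [bosonCoeff_zero, zero_smul]; exact Commute.zero_left _
    rcases Nat.eq_zero_or_pos n with rfl | hn
    · rw [bosonCoeff_zero, zero_smul]; exact Commute.zero_right _
    have := H.comm A.1 B.1 (-m) (-n) (by omega) (by omega)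
    rw [if_neg (by omega), sub_eq_zero] at this
    exact ((show Commute _ _ from this).smul_left _).smul_right _
  bb A B m n := by
    rw [annihilation_eq, annihilation_eq]
    rcases Nat.eq_zero_or_pos m with rfl | hm
    · rw [bosonCoeff_zero, neg_zero, zero_smul]; exact Commute.zero_left _
    rcases Nat.eq_zero_or_pos n with rfl | hn
    · rw [bosonCoeff_zero, neg_zero, zero_smul]; exact Commute.zero_right _
    have := H.comm A.1 B.1 m n (by omega) (by omega)
    rw [if_neg (by omega), sub_eq_zero] at this
    exact ((show Commute _ _ from this).smul_left _).smul_right _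
  ba A B m n hm hn := by
    rw [annihilation_eq, smul_mul_assoc, H.comm_creation hg A.1 (by omega) B hn, smul_add,
      mul_smul_comm]
    congr 1
    by_cases h : n = m
    · subst h
      rw [if_pos rfl, if_pos rfl, smul_smul, ← neg_bosonCoeff_mul hg A B hm]
      congr 1
      ring
    · rw [if_neg h, if_neg (by omega), smul_zero]
  nil v := by
    obtain ⟨D, hD⟩ := H.expCoeff_nil hg v
    refine ⟨D, fun A r hr => ?_⟩
    rw [expCoeff_congr fun m _ => annihilation_eq A m]
    exact hD A.1 _ r hr

/-- The coefficient in the commutator of `α_{i,m}` with the current `x^±_j`. -/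
theorem IsHeisenberg.al_vertexMode (i : Node X) {m : ℤ} (hm : m ≠ 0) (A : Node X × Bool) (s : ℤ)
    (v : M) : al i m (vertexMode (creation q p al A) (annihilation q p al A) s v) =
      vertexMode (creation q p al A) (annihilation q p al A) s (al i m v) +
      (if A.2 then qInt q (cartan X i A.1 * m) / m * ((1 - p ^ m) / (1 - (p * q ^ (-2 : ℤ)) ^ m)) *
          q ^ (-m) * κ ^ (-m * mMat X i A.1)
        else -(qInt q (cartan X i A.1 * m) / m * κ ^ (-m * mMat X i A.1))) •
      vertexMode (creation q p al A) (annihilation q p al A) (m + s) v := by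
  have S := H.isVertexSystem hg
  -- For m < 0 only the annihilation exponent fails to commute with α_{i,m}, for m > 0 only the
  -- creation exponent.
  rcases lt_or_gt_of_ne hm with h | h
  · obtain ⟨k, rfl⟩ : ∃ k : ℕ, m = -k := ⟨m.natAbs, by omega⟩
    have hk : 0 < k := by omega
    rw [← bosonCoeff_mul_heisConst_neg hg i A hk]
    refine S.comm_vertexMode_annihilate A hk (fun n hn => ?_) (fun n hn => ?_) s v
    · rw [H.comm_creation hg i hm A hn, if_neg (by omega), add_zero]
    · rw [H.comm_annihilation hg i hm A hn]
      congr 1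
      by_cases hnk : n = k
      · rw [if_pos hnk, if_pos (by omega), hnk]
      · rw [if_neg hnk, if_neg (by omega)]
  · obtain ⟨k, rfl⟩ : ∃ k : ℕ, m = k := ⟨m.natAbs, by omega⟩
    have hk : 0 < k := by omega
    have e := bosonCoeff_mul_heisConst hg i A hk
    push_cast at e ⊢
    rw [← e]
    refine S.comm_vertexMode_create A hk (fun n hn => ?_) (fun n hn => ?_) s v
    · rw [H.comm_creation hg i hm A hn]
      congr 1
      by_cases hnk : n = k
      · rw [if_pos hnk, if_pos (by omega), hnk]
      · rw [if_neg hnk, if_neg (by omega)]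
    · rw [H.comm_annihilation hg i hm A hn, if_neg (by omega), add_zero]

end Generic

end Heisenberg

/-! ### Induced modules over the elliptic algebra -/

section Induced

variable {X : AffineType} {M : Type*} [AddCommGroup M] [Module ℂ M] [Module (Mero X) M]

/-- A Heisenberg representation with compatible translations of functions, action of functions, and degree
operator. -/
structure FockData (q κ p : ℂ) (al : Node X → ℤ → Module.End ℂ M) (τ : HStar X → M →ₗ[ℂ] M)
    (dM : M →ₗ[ℂ] M) : Prop extends IsHeisenberg q κ p al where
  τ_zero : τ 0 = LinearMap.id
  τ_add : ∀ η η' m, τ (η + η') m = τ η (τ η' m)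
  τ_smul : ∀ η (g : Mero X) m, τ η (g • m) = shift η g • τ η m
  τ_al : ∀ η i n m, τ η (al i n m) = al i n (τ η m)
  τ_dM : ∀ η m, τ η (dM m) = dM (τ η m)
  al_smul : ∀ i n (g : Mero X) m, al i n (g • m) = g • al i n m
  dM_smul : ∀ (g : Mero X) m, dM (g • m) = g • dM m
  dM_al : ∀ i n m, dM (al i n m) = q ^ n • al i n (dM m)
  dM_bij : Function.Bijective dM

variable {q κ p l : ℂ} {al : Node X → ℤ → Module.End ℂ M} {τ : HStar X → M →ₗ[ℂ] M}
  {dM : M →ₗ[ℂ] M} (F : FockData q κ p al τ dM) (hg : GenericParams q κ p)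
  {lam : Node X → ℤ} {μ : hStar X} [IsScalarTower ℂ (Mero X) M]
include F hg

theorem FockData.vertexMode_commute {T : Module.End ℂ M} (hT : ∀ i n m, T (al i n m) = al i n (T m))
    (A : Node X × Bool) (s : ℤ) (m : M) :
    T (vertexMode (creation q p al A) (annihilation q p al A) s m) =
      vertexMode (creation q p al A) (annihilation q p al A) s (T m) := by
  refine (F.isVertexSystem hg).vertexMode_commute A (fun n _ => ?_) (fun n _ => ?_) s m
  · rw [creation_eq hg]
    exact LinearMap.ext fun v => by simp [hT]
  · rw [annihilation_eq]
    exact LinearMap.ext fun v => by simp [hT]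

theorem FockData.dM_vertexMode (A : Node X × Bool) (s : ℤ) (m : M) :
    dM (vertexMode (creation q p al A) (annihilation q p al A) s m) =
      q ^ s • vertexMode (creation q p al A) (annihilation q p al A) s (dM m) := by
  refine (F.isVertexSystem hg).vertexMode_semiconj A (T := dM) hg.q_ne (fun n _ => ?_)
    (fun n _ => ?_) s m
  · rw [creation_eq hg]
    refine LinearMap.ext fun v => ?_
    simp only [Module.End.mul_apply, LinearMap.smul_apply, map_smul, F.dM_al]
    rw [smul_comm, zpow_neg, inv_pow, zpow_natCast]
  · rw [annihilation_eq]
    refine LinearMap.ext fun v => ?_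
    simp only [Module.End.mul_apply, LinearMap.smul_apply, map_smul, F.dM_al]
    rw [smul_comm, zpow_natCast]

theorem FockData.latticeData : LatticeData q τ
    (fun j s => vertexMode (creation q p al (j, true)) (annihilation q p al (j, true)) s)
    (fun j s => vertexMode (creation q p al (j, false)) (annihilation q p al (j, false)) s) dM where
  τ_zero := F.τ_zero
  τ_add := F.τ_add
  τ_smul := F.τ_smul
  τ_Tp η j s m := F.vertexMode_commute hg (F.τ_al η) _ s m
  τ_Tm η j s m := F.vertexMode_commute hg (F.τ_al η) _ s m
  τ_dM := F.τ_dM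
  Tp_smul j s g m := (F.vertexMode_commute hg (T := Algebra.lsmul ℂ ℂ M g)
    (fun i n m => (F.al_smul i n g m).symm) _ s m).symm
  Tm_smul j s g m := (F.vertexMode_commute hg (T := Algebra.lsmul ℂ ℂ M g)
    (fun i n m => (F.al_smul i n g m).symm) _ s m).symm
  dM_smul := F.dM_smul
  dM_Tp j s m := F.dM_vertexMode hg _ s m
  dM_Tm j s m := F.dM_vertexMode hg _ s m
  dM_bij := F.dM_bij
  trunc j m := by
    obtain ⟨D, hD⟩ := (F.isVertexSystem hg).vertexMode_trunc (j, true) m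
    obtain ⟨D', hD'⟩ := (F.isVertexSystem hg).vertexMode_trunc (j, false) m
    exact ⟨max D D', fun s hs => ⟨hD s (le_trans (le_max_left _ _) hs),
      hD' s (le_trans (le_max_right _ _) hs)⟩⟩

-- At z = qw the exponents of x^+ and x^- add up to those of φ^+, and at z = q⁻¹w to those of φ^-.
-- Each of the four identities rests on q^m - q^{-m} = [m](q - q⁻¹) and p^* = p q^{-2}.
omit [Module (Mero X) M] [IsScalarTower ℂ (Mero X) M] F in
theorem creation_scale_plus (i : Node X) {m : ℕ} (hm : 0 < m) :
    q ^ m • creation q p al (i, true) m + creation q p al (i, false) m =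
      (-(q - q⁻¹) * p ^ m / (1 - p ^ m)) • al i (-m) := by
  rw [creation_eq hg, creation_eq hg, smul_smul, ← add_smul]
  congr 1
  have h1 := hg.qInt_ne (m := m) (by exact_mod_cast hm.ne')
  have h2 := hg.one_sub_p_ne hm
  have h3 := hg.one_sub_pstar_ne hm
  have hz := pow_ne_zero m hg.q_ne
  have e : q ^ m - (q ^ m)⁻¹ = qInt q m * (q - q⁻¹) := by
    rw [qInt, div_mul_cancel₀ _ hg.sub_inv_ne, zpow_neg, zpow_natCast]
  rw [bosonCoeff, bosonCoeff, if_pos rfl, if_neg (by simp), pRatio, zpow_natCast, zpow_natCast,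
    inv_div, pstar_pow]
  generalize q - q⁻¹ = d at *
  generalize q ^ m = Q at *
  generalize qInt q m = y at *
  field_simp at e ⊢
  linear_combination (-p ^ m) * e

omit [Module (Mero X) M] [IsScalarTower ℂ (Mero X) M] F in
theorem annihilation_scale_plus (i : Node X) {m : ℕ} (hm : 0 < m) :
    q⁻¹ ^ m • annihilation q p al (i, true) m + annihilation q p al (i, false) m =
      ((q - q⁻¹) / (1 - p ^ m)) • al i m := by
  rw [annihilation_eq, annihilation_eq, smul_smul, ← add_smul]
  congr 1
  have h1 := hg.qInt_ne (m := m) (by exact_mod_cast hm.ne')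
  have h2 := hg.one_sub_p_ne hm
  have hz := pow_ne_zero m hg.q_ne
  have e : q ^ m - (q ^ m)⁻¹ = qInt q m * (q - q⁻¹) := by
    rw [qInt, div_mul_cancel₀ _ hg.sub_inv_ne, zpow_neg, zpow_natCast]
  rw [bosonCoeff, bosonCoeff, if_pos rfl, if_neg (by simp), pRatio, zpow_natCast, zpow_natCast,
    inv_div, pstar_pow, inv_pow]
  generalize q - q⁻¹ = d at *
  generalize q ^ m = Q at *
  generalize qInt q m = y at *
  field_simp at e ⊢
  linear_combination e

omit [Module (Mero X) M] [IsScalarTower ℂ (Mero X) M] F in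
theorem creation_scale_minus (i : Node X) {m : ℕ} (hm : 0 < m) :
    q⁻¹ ^ m • creation q p al (i, true) m + creation q p al (i, false) m =
      (-(q - q⁻¹) / (1 - p ^ m)) • al i (-m) := by
  rw [creation_eq hg, creation_eq hg, smul_smul, ← add_smul]
  congr 1
  have h1 := hg.qInt_ne (m := m) (by exact_mod_cast hm.ne')
  have h2 := hg.one_sub_p_ne hm
  have hz := pow_ne_zero m hg.q_ne
  have e : q ^ m - (q ^ m)⁻¹ = qInt q m * (q - q⁻¹) := by
    rw [qInt, div_mul_cancel₀ _ hg.sub_inv_ne, zpow_neg, zpow_natCast]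
  rw [bosonCoeff, bosonCoeff, if_pos rfl, if_neg (by simp), pRatio, zpow_natCast, zpow_natCast,
    inv_div, pstar_pow, inv_pow]
  generalize q - q⁻¹ = d at *
  generalize q ^ m = Q at *
  generalize qInt q m = y at *
  field_simp at e ⊢
  linear_combination -e

omit [Module (Mero X) M] [IsScalarTower ℂ (Mero X) M] F in
theorem annihilation_scale_minus (i : Node X) {m : ℕ} (hm : 0 < m) :
    q ^ m • annihilation q p al (i, true) m + annihilation q p al (i, false) m =
      ((q - q⁻¹) * p ^ m / (1 - p ^ m)) • al i m := by
  rw [annihilation_eq, annihilation_eq, smul_smul, ← add_smul]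
  congr 1
  have h1 := hg.qInt_ne (m := m) (by exact_mod_cast hm.ne')
  have h2 := hg.one_sub_p_ne hm
  have hz := pow_ne_zero m hg.q_ne
  have e : q ^ m - (q ^ m)⁻¹ = qInt q m * (q - q⁻¹) := by
    rw [qInt, div_mul_cancel₀ _ hg.sub_inv_ne, zpow_neg, zpow_natCast]
  rw [bosonCoeff, bosonCoeff, if_pos rfl, if_neg (by simp), pRatio, zpow_natCast, zpow_natCast,
    inv_div, pstar_pow]
  generalize q - q⁻¹ = d at *
  generalize q ^ m = Q at *
  generalize qInt q m = y at *
  field_simp at e ⊢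
  linear_combination (p ^ m) * e

variable (q κ p l al τ dM lam μ) in
omit F hg [IsScalarTower ℂ (Mero X) M] in
/-- The operators on `⨁_x M` induced from a Heisenberg representation `M`. -/
def inducedCurrents : UCurrents X (Idx X →₀ M) where
  toCurrents := latticeCurrents q κ l lam μ τ
    (fun j s => vertexMode (fun m => (qInt q m)⁻¹ • al j (-m)) (fun m => -(qInt q m)⁻¹ • al j m) s)
    (fun j s => vertexMode (fun m => -(qInt q m)⁻¹ • primed q p al j (-m))
      (fun m => (qInt q m)⁻¹ • primed q p al j m) s) dM
  al i m := blockOp id fun _ => al i m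
  qc := q ^ (1 / 2 : ℂ) • 1

omit F hg [IsScalarTower ℂ (Mero X) M] in
theorem inducedCurrents_xp (j : Node X) : (inducedCurrents q κ p l al τ dM lam μ).xp j =
    (curP q κ l lam τ j).mode (creation q p al) (annihilation q p al) := rfl

omit F hg [IsScalarTower ℂ (Mero X) M] in
theorem inducedCurrents_xm (j : Node X) : (inducedCurrents q κ p l al τ dM lam μ).xm j =
    (curM κ lam τ j).mode (creation q p al) (annihilation q p al) :=
  (curM_mode q κ l lam τ μ dM (creation q p al) (annihilation q p al)
    (fun j s => vertexMode (creation q p al (j, true)) (annihilation q p al (j, true)) s) j).symm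

omit F hg [IsScalarTower ℂ (Mero X) M] in
theorem inducedCurrents_al (i : Node X) (m : ℤ) : (inducedCurrents q κ p l al τ dM lam μ).al i m =
    diagHom _ (al i m) := rfl

end Induced

/-- No commutation among the exponents is needed: the coefficients are polynomials in them, hence
stay in the centralizer of T. -/
theorem commute_expCoeff_of_commute {R : Type*} [Ring R] [Algebra ℂ R] {a : ℕ → R} {T : R}
    (h : ∀ m, Commute T (a m)) (n : ℕ) : Commute T (expCoeff a n) := by
  set C := Subalgebra.centralizer ℂ ({T} : Set R)
  have ha : ∀ m, a m ∈ C := fun m => Subalgebra.mem_centralizer_iff ℂ |>.mpr fun g hg => by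
    rw [Set.mem_singleton_iff.mp hg]; exact (h m).eq
  have e := expCoeff_map C.val (fun m => (⟨a m, ha m⟩ : C)) n
  have e' : expCoeff a n ∈ C := by
    have : expCoeff a n = C.val (expCoeff (fun m => (⟨a m, ha m⟩ : C)) n) := e
    rw [this]
    exact Subtype.mem _
  exact (Subalgebra.mem_centralizer_iff ℂ).mp e' T (Set.mem_singleton T)

theorem vertexMode_apply_of_commute {M : Type*} [AddCommGroup M] [Module ℂ M] {a b : ℕ → Module.End ℂ M}
    (hb : ∀ v, ∃ D : ℕ, ∀ r, D ≤ r → expCoeff b r v = 0) {T : Module.End ℂ M}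
    (haT : ∀ m, Commute T (a m)) (hbT : ∀ m, Commute T (b m)) (s : ℤ) (v : M) :
    T (vertexMode a b s v) = vertexMode a b s (T v) := by
  set S : ℕ → Module.End ℂ M := fun n => expCoeff a n *
    (if 0 ≤ (n : ℤ) + s then expCoeff b ((n : ℤ) + s).toNat else 0) with hS
  have hfin : ∀ v, {n | S n v ≠ 0}.Finite := by
    intro v
    obtain ⟨D, hD⟩ := hb v
    refine finite_support_of_bound (K := (D - s).toNat) fun n hn => ?_
    rw [hS]
    simp only
    rw [if_pos (by omega), Module.End.mul_apply, hD _ (by omega), map_zero]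
  have hST : ∀ n, Commute T (S n) := by
    intro n
    refine (commute_expCoeff_of_commute haT n).mul_right ?_
    split_ifs
    · exact commute_expCoeff_of_commute hbT _
    · exact Commute.zero_right _
  have h2 : vertexMode a b s = locSum S := rfl
  rw [h2, locSum, dif_pos hfin]
  change T (∑ᶠ n, S n v) = ∑ᶠ n, S n (T v)
  refine (T.toAddMonoidHom.map_finsum (hfin v)).trans ?_
  exact finsum_congr fun n => LinearMap.congr_fun (hST n).eq v

section Induced

variable {X : AffineType} {M : Type*} [AddCommGroup M] [Module ℂ M] [Module (Mero X) M]
  {q κ p l : ℂ} {al : Node X → ℤ → Module.End ℂ M} {τ : HStar X → M →ₗ[ℂ] M}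
  {dM : M →ₗ[ℂ] M} (F : FockData q κ p al τ dM) (hg : GenericParams q κ p)
  {lam : Node X → ℤ} {μ : hStar X} [IsScalarTower ℂ (Mero X) M]
include F hg

theorem FockData.al_xp (i j : Node X) (m n : ℤ) (hm : m ≠ 0) :
    (inducedCurrents q κ p l al τ dM lam μ).al i m * (inducedCurrents q κ p l al τ dM lam μ).xp j n -
      (inducedCurrents q κ p l al τ dM lam μ).xp j n *
        (inducedCurrents q κ p l al τ dM lam μ).al i m =
      (qInt q (cartan X i j * m) / m * ((1 - p ^ m) / (1 - (p * q ^ (-2 : ℤ)) ^ m))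
        * q ^ (-m) * κ ^ (-m * mMat X i j)) •
          (inducedCurrents q κ p l al τ dM lam μ).xp j (m + n) := by
  rw [inducedCurrents_al, inducedCurrents_xp, sub_eq_iff_eq_add]
  refine Finsupp.lhom_ext fun x v => ?_
  have h := F.al_vertexMode hg i hm (j, true) (n + hval lam x.1 j + 1)
    (τ (-(simpleRoot X j, -Qof X (simpleRoot X j))) v)
  rw [if_pos rfl] at h
  rw [LinearMap.add_apply, LinearMap.smul_apply, Module.End.mul_apply, Module.End.mul_apply,
    diagHom_single, Cur.mode_single, Cur.mode_single, Cur.mode_single, diagHom_single,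
    Finsupp.smul_single, ← Finsupp.single_add]
  congr 1
  rw [map_smul]
  change _ • al i m (vertexMode (creation q p al (j, true)) (annihilation q p al (j, true))
    (n + hval lam x.1 j + 1) (τ (-(simpleRoot X j, -Qof X (simpleRoot X j))) v)) = _
  rw [h, smul_add, add_comm, smul_comm, ← F.τ_al, ← add_assoc m, ← add_assoc m]
  rfl

theorem FockData.al_xm (i j : Node X) (m n : ℤ) (hm : m ≠ 0) :
    (inducedCurrents q κ p l al τ dM lam μ).al i m * (inducedCurrents q κ p l al τ dM lam μ).xm j n -
      (inducedCurrents q κ p l al τ dM lam μ).xm j n *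
        (inducedCurrents q κ p l al τ dM lam μ).al i m =
      -(qInt q (cartan X i j * m) / m * κ ^ (-m * mMat X i j)) •
          (inducedCurrents q κ p l al τ dM lam μ).xm j (m + n) := by
  rw [inducedCurrents_al, inducedCurrents_xm, sub_eq_iff_eq_add]
  refine Finsupp.lhom_ext fun x v => ?_
  have h := F.al_vertexMode hg i hm (j, false) (n + -hval lam x.1 j + 1)
    (τ (-(-simpleRoot X j, 0)) v)
  rw [if_neg (by simp)] at h
  rw [LinearMap.add_apply, LinearMap.smul_apply, Module.End.mul_apply, Module.End.mul_apply,
    diagHom_single, Cur.mode_single, Cur.mode_single, Cur.mode_single, diagHom_single,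
    Finsupp.smul_single, ← Finsupp.single_add]
  congr 1
  rw [map_smul]
  change _ • al i m (vertexMode (creation q p al (j, false)) (annihilation q p al (j, false))
    (n + -hval lam x.1 j + 1) (τ (-(-simpleRoot X j, 0)) v)) = _
  rw [h, smul_add, add_comm, smul_comm, ← F.τ_al, ← add_assoc m, ← add_assoc m]
  rfl

theorem FockData.compat (A : Node X × Bool → Node X → Cur (Node X × Bool) (Idx X) M)
    (hA : ∀ e j, ∃ η, (A e j).tr = τ η) (e : Node X × Bool) (j : Node X) :
    (A e j).Compat (creation q p al) (annihilation q p al) := by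
  obtain ⟨η, hη⟩ := hA e j
  intro B s m
  rw [hη]
  exact F.vertexMode_commute hg (F.τ_al η) B s m

theorem FockData.phi_plus (i : Node X) (s : ℤ) :
    (inducedCurrents q κ p l al τ dM lam μ).phiP q p i s =
      latticeK q l lam τ 1 (Pi.single i 1) * blockOp id fun _ =>
        vertexMode (fun n => (-(q - q⁻¹) * p ^ n / (1 - p ^ n)) • al i (-n))
          (fun n => ((q - q⁻¹) / (1 - p ^ n)) • al i n) s := by
  have hn : ∀ v, ∃ D : ℕ, ∀ r, D ≤ r →
      expCoeff (fun n : ℕ => ((q - q⁻¹) / (1 - p ^ n)) • al i n) r v = 0 := by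
    intro v
    obtain ⟨D, hD⟩ := F.expCoeff_nil hg v
    exact ⟨D, fun r hr => hD i _ r hr⟩
  have h := vertexMode_diagHom (ι := Idx X)
    (a := fun n : ℕ => (-(q - q⁻¹) * p ^ n / (1 - p ^ n)) • al i (-n)) hn s
  simp only [map_smul] at h
  rw [UCurrents.phiP]
  exact congrArg₂ _ (latticeCurrents_Kp ..) h

theorem FockData.phi_minus (i : Node X) (s : ℤ) :
    (inducedCurrents q κ p l al τ dM lam μ).phiM q p i s =
      latticeK q l lam τ (-1) (Pi.single i 1) * blockOp id fun _ =>
        vertexMode (fun n => (-(q - q⁻¹) / (1 - p ^ n)) • al i (-n))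
          (fun n => ((q - q⁻¹) * p ^ n / (1 - p ^ n)) • al i n) s := by
  have hn : ∀ v, ∃ D : ℕ, ∀ r, D ≤ r →
      expCoeff (fun n : ℕ => ((q - q⁻¹) * p ^ n / (1 - p ^ n)) • al i n) r v = 0 := by
    intro v
    obtain ⟨D, hD⟩ := F.expCoeff_nil hg v
    exact ⟨D, fun r hr => hD i _ r hr⟩
  have h := vertexMode_diagHom (ι := Idx X)
    (a := fun n : ℕ => (-(q - q⁻¹) / (1 - p ^ n)) • al i (-n)) hn s
  simp only [map_smul] at h
  rw [UCurrents.phiM]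
  exact congrArg₂ _ (latticeCurrents_Km ..) h

theorem FockData.trunc_ind (v : Idx X →₀ M) : ∃ D : ℤ, ∀ L : List (Node X × ℤ), (∀ x ∈ L, 0 < x.2) →
    D ≤ (L.map Prod.snd).sum →
    (L.map fun x => (inducedCurrents q κ p l al τ dM lam μ).al x.1 x.2).prod v = 0 := by
  have hL : ∀ L : List (Node X × ℤ),
      (L.map fun x => (inducedCurrents q κ p l al τ dM lam μ).al x.1 x.2).prod =
        diagHom (Idx X) (L.map fun x => al x.1 x.2).prod := by
    intro L
    rw [map_list_prod, List.map_map]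
    rfl
  simp only [hL]
  induction v using Finsupp.induction_linear with
  | zero => exact ⟨0, fun L _ _ => map_zero _⟩
  | add v w hv hw =>
    obtain ⟨D, hD⟩ := hv
    obtain ⟨D', hD'⟩ := hw
    exact ⟨max D D', fun L h1 h2 => by
      rw [map_add, hD L h1 (le_trans (le_max_left _ _) h2),
        hD' L h1 (le_trans (le_max_right _ _) h2), add_zero]⟩
  | single x m =>
    obtain ⟨D, hD⟩ := F.trunc m
    exact ⟨D, fun L h1 h2 => by rw [diagHom_single, hD L h1 h2, Finsupp.single_zero]⟩

theorem FockData.isUModule : (inducedCurrents q κ p l al τ dM lam μ).IsUModule q κ p l := by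
  have L := F.latticeData hg
  have S := F.isVertexSystem hg
  have hq := hg.q_ne
  have hqt := hg.sub_inv_ne
  have hxp := fun j => inducedCurrents_xp (q := q) (κ := κ) (p := p) (l := l) (al := al) (τ := τ)
    (dM := dM) (lam := lam) (μ := μ) j
  have hxm := fun j => inducedCurrents_xm (q := q) (κ := κ) (p := p) (l := l) (al := al) (τ := τ)
    (dM := dM) (lam := lam) (μ := μ) j
  have τadd := F.τ_add
  have compatP : ∀ j, (curP q κ l lam τ j).Compat (creation q p al) (annihilation q p al) :=
    fun j => F.compat hg (fun _ j => curP q κ l lam τ j) (fun _ j => ⟨_, rfl⟩) (j, true) j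
  have compatM : ∀ j, (curM κ lam τ j).Compat (creation q p al) (annihilation q p al) :=
    fun j => F.compat hg (fun _ j => curM κ lam τ j) (fun _ j => ⟨_, rfl⟩) (j, true) j
  have hu : ∀ i j, cartan X i j ≠ -1 → κ ^ mMat X i j = 1 := fun i j h => by
    rw [mMat_eq_zero h, zpow_zero]
  have hu0 : ∀ i j : Node X, κ ^ mMat X i j ≠ 0 := fun i j => zpow_ne_zero _ hg.κ_ne
  have one : ∀ (A B : ℤ → Module.End ℂ (Idx X →₀ M)) (r t : ℤ) v, ord2 1 A B r t v = A r (B t v) := by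
    intro A B r t v
    rw [ord2_eq_lsum, lsum_one]; simp
  -- Structure function and contraction carry the same rescaling by κ^{-m_ij}, so their product is
  -- computed before rescaling.
  have hP : ∀ i j, PowerSeries.rescale (κ ^ (-mMat X i j))
      (gSeries q (p * q ^ (-2 : ℤ)) (cartan X i j)) *
        contr (fockContr q κ p) (i, true) (j, true) =
      PowerSeries.rescale (κ ^ (-mMat X i j)) (serreSeries q⁻¹ (cartan X i j)) := by
    intro i j
    rw [contr_fockContr, ← map_mul]
    exact congrArg _ (gSeries_mul_contr_plus hg (cartan_mem i j))
  have hM : ∀ i j, PowerSeries.rescale (κ ^ (-mMat X i j)) (gSeries q p (cartan X i j))⁻¹ *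
        contr (fockContr q κ p) (i, false) (j, false) =
      PowerSeries.rescale (κ ^ (-mMat X i j)) (serreSeries q (cartan X i j)) := by
    intro i j
    rw [contr_fockContr, ← map_mul]
    exact congrArg _ (gSeries_mul_contr_minus hg (cartan_mem i j))
  have hX : ∀ i j e, contr (fockContr q κ p) (i, e) (j, !e) =
      PowerSeries.rescale (κ ^ (-mMat X i j))
        (if cartan X i j = 2 then qIntSeries q else if cartan X i j = -1 then 1 - PowerSeries.X
          else 1) := by
    intro i j e
    rw [contr_fockContr]
    congr 1
    have h1 : ∀ m : ℕ, (if (i, e).2 = true then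
        (if (j, !e).2 = true then -(pRatio q p m * q ^ (-m : ℤ)) else 1)
        else if (j, !e).2 = true then 1 else -((pRatio q p m)⁻¹ * q ^ m)) = 1 := by
      intro m; cases e <;> simp
    simp only [h1]
    rcases cartan_mem i j with h | h | h
    · rw [if_pos h, h]; exact contr_mixed_two hg
    · rw [if_neg (by omega), if_pos h, h]; exact contr_mixed_neg_one hg
    · rw [if_neg (by omega), if_neg (by omega), h]; exact contr_cartan_zero fun _ => 1
  have hms : ∀ i j, -mMat X i j = mMat X j i := fun i j => (mMat_antisymm j i).symm
  have hP' : ∀ i j, PowerSeries.rescale (κ ^ (mMat X i j))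
      (gSeries q (p * q ^ (-2 : ℤ)) (cartan X i j)) *
        contr (fockContr q κ p) (j, true) (i, true) =
      PowerSeries.rescale (κ ^ (mMat X i j)) (serreSeries q⁻¹ (cartan X i j)) := by
    intro i j
    have := hP j i
    rwa [hms, cartan_symm] at this
  have hM' : ∀ i j, PowerSeries.rescale (κ ^ (mMat X i j)) (gSeries q p (cartan X i j))⁻¹ *
        contr (fockContr q κ p) (j, false) (i, false) =
      PowerSeries.rescale (κ ^ (mMat X i j)) (serreSeries q (cartan X i j)) := by
    intro i j
    have := hM j i
    rwa [hms, cartan_symm] at this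
  have hsm : ∀ (c : ℂ) (v : Idx X →₀ M), (c • (1 : Module.End ℂ (Idx X →₀ M))) v = c • v :=
    fun c v => rfl
  have hKal : ∀ (s : ℤ) (i j : Node X) (m : ℤ),
      Commute (latticeK q l lam τ s (Pi.single i 1)) (diagHom (Idx X) (al j m)) := by
    intro s i j m
    refine Finsupp.lhom_ext fun x v => ?_
    rw [Module.End.mul_apply, Module.End.mul_apply, diagHom_single, latticeK_apply, latticeK_apply,
      diagHom_single, map_smul, F.τ_al]
  refine { toIsDynamical := L.isDynamical l hq, qc_level := rfl, al_weight := ?_, qd_al := ?_,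
           Kp_al := ?_, Km_al := ?_, trunc_al := F.trunc_ind hg, al_al := ?_,
           al_xp := F.al_xp hg, al_xm := F.al_xm hg, xp_xp := ?_, xm_xm := ?_, xp_xm := ?_,
           serre_p := ?_, serre_m := ?_, serre_p_zero := ?_, serre_m_zero := ?_ }
  · intro i m
    refine hasWeight_blockOp l (fun x g m => ?_) fun x => (add_zero _).symm
    rw [shift_zero, F.al_smul]
  · intro i m
    refine Finsupp.lhom_ext fun x v => ?_
    rw [inducedCurrents_al, LinearMap.smul_apply, Module.End.mul_apply, Module.End.mul_apply,
      diagHom_single]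
    change (latticeCurrents q κ l lam μ τ _ _ dM).qd _ =
      q ^ m • diagHom (Idx X) (al i m) ((latticeCurrents q κ l lam μ τ _ _ dM).qd _)
    rw [latticeCurrents_qd, latticeCurrents_qd, diagHom_single, Finsupp.smul_single, F.dM_al, map_smul,
      smul_comm]
  · intro i j m
    exact (latticeCurrents_Kp q κ l lam μ τ _ _ dM i).symm ▸ hKal 1 i j m
  · intro i j m
    exact (latticeCurrents_Km q κ l lam μ τ _ _ dM i).symm ▸ hKal (-1) i j m
  · intro i j m n hm hn
    rw [inducedCurrents_al, inducedCurrents_al, ← map_mul, ← map_mul, ← map_sub, F.comm i j m n hm hn]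
    split_ifs
    · rw [map_smul, map_one]; rfl
    · rw [map_zero]
  · intro i j r t v
    rw [hxp, hxp]
    have h := S.ord2_exchange_linear (compatP i) (compatP j) (hu0 i j)
      (curP_pair hg.κ_ne τadd i j) (cartan_mem i j) (hu i j) (inv_ne_zero hq)
      (φ := PowerSeries.rescale (κ ^ (-mMat X i j)) (gSeries q (p * q ^ (-2 : ℤ)) (cartan X i j)))
      (φ' := PowerSeries.rescale (κ ^ (mMat X i j)) (gSeries q (p * q ^ (-2 : ℤ)) (cartan X i j)))
      (by rw [← zpow_neg]; exact hP i j) (hP' i j) r t v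
    rw [inv_zpow', neg_neg] at h
    exact h
  · intro i j r t v
    rw [hxm, hxm]
    exact S.ord2_exchange_linear (compatM i) (compatM j) (hu0 i j)
      (curM_pair hg.κ_ne τadd i j) (cartan_mem i j) (hu i j) hq
      (φ := PowerSeries.rescale (κ ^ (-mMat X i j)) (gSeries q p (cartan X i j))⁻¹)
      (φ' := PowerSeries.rescale (κ ^ (mMat X i j)) (gSeries q p (cartan X i j))⁻¹)
      (by rw [← zpow_neg]; exact hM i j) (hM' i j) r t v
  · intro i j r t
    refine LinearMap.ext fun v => ?_
    -- The plain commutator is the mixed relation with structure function 1; here the contraction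
    -- alone supplies the elementary series.
    rw [LinearMap.sub_apply, Module.End.mul_apply, Module.End.mul_apply, ← one, ← one, hxp, hxm]
    rcases cartan_cases i j with ⟨rfl, h⟩ | ⟨h', h⟩ | ⟨h', h⟩
    · have hm : mMat X i i = 0 := mMat_eq_zero (by rw [h]; decide)
      have hc : ∀ e, contr (fockContr q κ p) (i, e) (i, !e) = qIntSeries q := by
        intro e
        rw [hX, if_pos h, hm, neg_zero, zpow_zero, PowerSeries.rescale_one]; rfl
      rw [curP_curM_delta hg.κ_ne τadd S hq compatP compatM i
        (by rw [one_mul]; exact hc true) (by rw [one_mul]; exact hc false)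
        (fun s => vertexMode_congr (fun m hm => creation_scale_plus hg i hm)
          (fun m hm => annihilation_scale_plus hg i hm) s)
        (fun s => vertexMode_congr (fun m hm => creation_scale_minus hg i hm)
          (fun m hm => annihilation_scale_minus hg i hm) s) ?_ ?_, if_pos rfl, F.phi_plus hg,
        F.phi_minus hg]
      · rfl
      · intro η s m
        refine vertexMode_apply_of_commute (fun v => ?_) (fun m => ?_) (fun m => ?_) s m
        · obtain ⟨D, hD⟩ := F.expCoeff_nil hg v
          exact ⟨D, fun r hr => hD i _ r hr⟩
        · exact (show Commute (τ η) _ from LinearMap.ext fun v => F.τ_al η i _ v).smul_right _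
        · exact (show Commute (τ η) _ from LinearMap.ext fun v => F.τ_al η i _ v).smul_right _
      · intro η s m
        refine vertexMode_apply_of_commute (fun v => ?_) (fun m => ?_) (fun m => ?_) s m
        · obtain ⟨D, hD⟩ := F.expCoeff_nil hg v
          exact ⟨D, fun r hr => hD i _ r hr⟩
        · exact (show Commute (τ η) _ from LinearMap.ext fun v => F.τ_al η i _ v).smul_right _
        · exact (show Commute (τ η) _ from LinearMap.ext fun v => F.τ_al η i _ v).smul_right _
    · rw [if_neg h']
      have P := curP_curM_pair (q := q) (l := l) (lam := lam) hg.κ_ne τadd i j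
      rw [h] at P
      refine S.mixed_eq_zero (compatP _) (compatM _) (hu0 i j) P (Or.inl rfl)
        (fun hc => absurd rfl hc) ?_ ?_ r t v
      · rw [one_mul, neg_neg, if_pos rfl, ← zpow_neg]
        refine (hX i j true).trans ?_
        rw [if_neg (by omega), if_pos h, map_sub, map_one, PowerSeries.rescale_X]
      · rw [one_mul, neg_neg, if_pos rfl]
        refine (hX j i false).trans ?_
        rw [cartan_symm, if_neg (by omega), if_pos h, map_sub, map_one, PowerSeries.rescale_X, hms]
    · rw [if_neg h']
      have P := curP_curM_pair (q := q) (l := l) (lam := lam) hg.κ_ne τadd i j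
      rw [h] at P
      refine S.mixed_eq_zero (compatP _) (compatM _) (hu0 i j) P (Or.inr rfl)
        (fun _ => hu i j (by rw [h]; decide)) ?_ ?_ r t v
      · rw [one_mul, neg_zero, if_neg (by decide)]
        refine (hX i j true).trans ?_
        rw [if_neg (by omega), if_neg (by omega), map_one]
      · rw [one_mul, neg_zero, if_neg (by decide)]
        refine (hX j i false).trans ?_
        rw [cartan_symm, if_neg (by omega), if_neg (by omega), map_one]
  · intro i j hij
    rw [hxp, hxp]
    have P := curP_pair (q := q) (l := l) (lam := lam) hg.κ_ne τadd i i
    have P' := curP_pair (q := q) (l := l) (lam := lam) hg.κ_ne τadd i j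
    rw [cartan_self, hu i i (by rw [cartan_self]; decide)] at P
    rw [hij] at P'
    refine S.serreRelation (compatP _) (compatP _) (hu0 i j) (inv_ne_zero hq)
      (by rw [inv_inv, add_comm]) (by simpa using P) (by simpa using P') ?_ ?_ ?_
    · have := hP i i
      rw [cartan_self, mMat_eq_zero (by rw [cartan_self]; decide), neg_zero, zpow_zero,
        PowerSeries.rescale_one] at this
      exact this
    · have := hP i j
      rw [hij, zpow_neg] at this
      exact this
    · have := hP' i j
      rw [hij] at this
      exact this
  · intro i j hij
    rw [hxm, hxm]
    have P := curM_pair (lam := lam) hg.κ_ne τadd i i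
    have P' := curM_pair (lam := lam) hg.κ_ne τadd i j
    rw [cartan_self, hu i i (by rw [cartan_self]; decide)] at P
    rw [hij] at P'
    refine S.serreRelation (compatM _) (compatM _) (hu0 i j) hq rfl
      (by simpa using P) (by simpa using P') ?_ ?_ ?_
    · have := hM i i
      rw [cartan_self, mMat_eq_zero (by rw [cartan_self]; decide), neg_zero, zpow_zero,
        PowerSeries.rescale_one] at this
      exact this
    · have := hM i j
      rw [hij, zpow_neg] at this
      exact this
    · have := hM' i j
      rw [hij] at this
      exact this
  · intro i j hij r t
    rw [hxp, hxp]
    have P := curP_pair (q := q) (l := l) (lam := lam) hg.κ_ne τadd i j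
    rw [hij, hu i j (by rw [hij]; decide)] at P
    have hc : ∀ i j : Node X, cartan X i j = 0 → contr (fockContr q κ p) (i, true) (j, true) = 1 := by
      intro i j h
      rw [contr_fockContr]
      simp only [h]
      rw [contr_cartan_zero, map_one]
    exact S.mode_commute (compatP _) (compatP _) (by simpa using P) (hc i j hij)
      (hc j i (by rw [cartan_symm]; exact hij)) r t
  · intro i j hij r t
    rw [hxm, hxm]
    have P := curM_pair (lam := lam) hg.κ_ne τadd i j
    rw [hij, hu i j (by rw [hij]; decide)] at P
    have hc : ∀ i j : Node X, cartan X i j = 0 → contr (fockContr q κ p) (i, false) (j, false) = 1 := by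
      intro i j h
      rw [contr_fockContr]
      simp only [h]
      rw [contr_cartan_zero, map_one]
    exact S.mode_commute (compatM _) (compatM _) (by simpa using P) (hc i j hij)
      (hc j i (by rw [cartan_symm]; exact hij)) r t

end Induced

/-! ### The polynomial Fock space -/

section PolynomialFock

open MvPolynomial

variable {X : AffineType} (K : Type) [CommRing K] [Algebra ℂ K]

/-- The coefficient of `∂/∂α_{j,-m}` in the action of `α_{i,m}`. -/
def derivCoeff (q κ p : ℂ) (i j : Node X) (m : ℤ) : ℂ :=
  qInt q (cartan X i j * m) * qInt q m / m * ((1 - p ^ m) / (1 - (p * q ^ (-2 : ℤ)) ^ m))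
    * q ^ (-m) * κ ^ (-m * mMat X i j)

/-- The action of `α_{i,m}` on polynomials in `α_{i,-m}` with coefficients in `K`. -/
def polyAl (q κ p : ℂ) (i : Node X) (m : ℤ) : Module.End ℂ (MvPolynomial (Node X × ℕ+) K) :=
  if hm : 0 < m then
    ∑ j, derivCoeff q κ p i j m •
      (MvPolynomial.pderiv (R := K) (j, ⟨m.toNat, by omega⟩)).toLinearMap.restrictScalars ℂ
  else if hm' : m < 0 then
    LinearMap.mulLeft ℂ (MvPolynomial.X (i, ⟨(-m).toNat, by omega⟩))
  else 0

/-- The degree operator on polynomials, multiplying `α_{i,-m}` by `q^{-m}`. -/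
def polyDeg (X : AffineType) (q : ℂ) : Module.End ℂ (MvPolynomial (Node X × ℕ+) K) :=
  ((MvPolynomial.aeval fun x : Node X × ℕ+ =>
    (q ^ (-(x.2 : ℤ))) • (MvPolynomial.X x : MvPolynomial (Node X × ℕ+) K)) :
    MvPolynomial (Node X × ℕ+) K →ₐ[K] MvPolynomial (Node X × ℕ+) K).toLinearMap.restrictScalars ℂ

/-- The degree of a monomial in the `α_{i,-m}`. -/
def monoDeg (s : Node X × ℕ+ →₀ ℕ) : ℕ := Finsupp.weight (fun x : Node X × ℕ+ => (x.2 : ℕ)) s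

variable {K} {q κ p : ℂ}

theorem monoDeg_add (s t : Node X × ℕ+ →₀ ℕ) : monoDeg (s + t) = monoDeg s + monoDeg t :=
  map_add _ _ _

theorem monoDeg_single (x : Node X × ℕ+) (n : ℕ) : monoDeg (Finsupp.single x n) = n * x.2 :=
  Finsupp.weight_single _ _ _

theorem polyAl_pos (i : Node X) (n : ℕ+) (f : MvPolynomial (Node X × ℕ+) K) :
    polyAl K q κ p i n f = ∑ j, derivCoeff q κ p i j n • pderiv (j, n) f := by
  have h : (0 : ℤ) < n := by exact_mod_cast n.pos
  rw [polyAl, dif_pos h, LinearMap.sum_apply]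
  rfl

theorem polyAl_neg (i : Node X) (n : ℕ+) (f : MvPolynomial (Node X × ℕ+) K) :
    polyAl K q κ p i (-n) f = MvPolynomial.X (i, n) * f := by
  have h : (0 : ℤ) < n := by exact_mod_cast n.pos
  rw [polyAl, dif_neg (by omega), dif_pos (by omega)]
  change MvPolynomial.X (i, ⟨(- -(n : ℤ)).toNat, _⟩) * f = _
  congr 3
  refine Subtype.ext ?_
  change (- -(n : ℤ)).toNat = (n : ℕ)
  omega

theorem int_cases {m : ℤ} (hm : m ≠ 0) : ∃ n : ℕ+, m = n ∨ m = -n := by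
  rcases lt_or_gt_of_ne hm with h | h
  · exact ⟨⟨(-m).toNat, by omega⟩, Or.inr (by simp; omega)⟩
  · exact ⟨⟨m.toNat, by omega⟩, Or.inl (by simp; omega)⟩

theorem pderiv_comm {σ : Type*} (a b : σ) (f : MvPolynomial σ K) :
    pderiv a (pderiv b f) = pderiv b (pderiv a f) := by
  classical
  ext s
  simp only [coeff_pderiv, Finsupp.add_apply]
  rw [add_right_comm]
  by_cases h : a = b
  · subst h; rfl
  · simp [Finsupp.single_eq_of_ne h, Finsupp.single_eq_of_ne (Ne.symm h)]
    ring

theorem polyAl_pos_neg (i j : Node X) (m n : ℕ+) (f : MvPolynomial (Node X × ℕ+) K) :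
    polyAl K q κ p i m (polyAl K q κ p j (-n) f) =
      polyAl K q κ p j (-n) (polyAl K q κ p i m f) +
        if m = n then derivCoeff q κ p i j m • f else 0 := by
  classical
  rw [polyAl_neg, polyAl_neg, polyAl_pos, polyAl_pos]
  have h : ∀ k, derivCoeff q κ p i k m • pderiv (k, m) (MvPolynomial.X (j, n) * f) =
      MvPolynomial.X (j, n) * (derivCoeff q κ p i k m • pderiv (k, m) f) +
        if k = j then (if m = n then derivCoeff q κ p i j m • f else 0) else 0 := by
    intro k
    rw [pderiv_mul, smul_add, mul_smul_comm, add_comm]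
    congr 1
    by_cases hk : k = j
    · subst hk
      by_cases hm : m = n
      · subst hm
        rw [pderiv_X_self, one_mul, if_pos rfl, if_pos rfl]
      · rw [pderiv_X_of_ne (by intro hc; exact hm (Prod.ext_iff.mp hc).2.symm), zero_mul, smul_zero,
          if_pos rfl, if_neg hm]
    · rw [pderiv_X_of_ne (by intro hc; exact hk (Prod.ext_iff.mp hc).1.symm), zero_mul, smul_zero,
        if_neg hk]
  simp only [h, Finset.sum_add_distrib, ← Finset.mul_sum]
  rw [Finset.sum_ite_eq' Finset.univ j, if_pos (Finset.mem_univ j)]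

theorem heisConst_eq (i j : Node X) (m : ℤ) :
    heisConst q κ p i j m = derivCoeff q κ p i j m := by
  rw [heisConst, derivCoeff, show (q ^ m - q ^ (-m)) / (q - q⁻¹) = qInt q m from rfl]
  ring

/-- Consistency of the Heisenberg relation under exchanging the two generators: a_ij is symmetric,
m_ij antisymmetric, and the powers of q from the elliptic ratio and from q^{-m} compensate. -/
theorem heisConst_neg (hg : GenericParams q κ p) (i j : Node X) (m : ℤ) :
    heisConst q κ p i j (-m) = -heisConst q κ p j i m := by
  have e : ∀ m, (1 - p ^ m) / (1 - (p * q ^ (-2 : ℤ)) ^ m) = pRatio q p m := fun m => rfl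
  rw [heisConst_eq, heisConst_eq, derivCoeff, derivCoeff, e, e, pRatio_neg hg, mul_neg, qInt_neg, qInt_neg,
    cartan_symm, mMat_antisymm, neg_neg, mul_neg, neg_mul, neg_neg,
    show q ^ (-2 * m) = q ^ (-m) * q ^ (-m) by rw [← zpow_add₀ hg.q_ne]; congr 1; ring, Int.cast_neg,
    neg_mul, zpow_neg q m]
  have hz := zpow_ne_zero m hg.q_ne
  have hi : q ^ m * (q ^ m)⁻¹ = 1 := mul_inv_cancel₀ hz
  rw [show m * -mMat X j i = -(m * mMat X j i) by ring]
  generalize κ ^ (-(m * mMat X j i)) = k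
  by_cases hm : (m : ℂ) = 0
  · simp [hm]
  · field_simp

/-- Polynomials of degree at most `d`. -/
def degLE (K : Type) [CommRing K] [Algebra ℂ K] (X : AffineType) (d : ℤ) :
    Submodule ℂ (MvPolynomial (Node X × ℕ+) K) where
  carrier := {f | ∀ s, d < monoDeg s → coeff s f = 0}
  add_mem' hf hg s hs := by rw [coeff_add, hf s hs, hg s hs, add_zero]
  zero_mem' s _ := coeff_zero s
  smul_mem' c f hf s hs := by rw [coeff_smul, hf s hs, smul_zero]

theorem polyAl_degLE (i : Node X) {m : ℤ} (hm : 0 < m) {d : ℤ} {f : MvPolynomial (Node X × ℕ+) K}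
    (hf : f ∈ degLE K X d) : polyAl K q κ p i m f ∈ degLE K X (d - m) := by
  obtain ⟨n, rfl⟩ : ∃ n : ℕ+, m = n := ⟨⟨m.toNat, by omega⟩, by simp; omega⟩
  rw [polyAl_pos]
  refine Submodule.sum_mem _ fun j _ => Submodule.smul_mem _ _ fun s hs => ?_
  rw [coeff_pderiv, hf, zero_mul]
  rw [monoDeg_add, monoDeg_single]
  push_cast
  omega

theorem exists_degLE (f : MvPolynomial (Node X × ℕ+) K) : ∃ d : ℤ, f ∈ degLE K X d := by
  refine ⟨(f.support.sup monoDeg : ℕ), fun s hs => ?_⟩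
  by_contra hc
  have := Finset.le_sup (f := monoDeg) (mem_support_iff.mpr hc)
  omega

theorem polyAl_isHeisenberg (hg : GenericParams q κ p) :
    IsHeisenberg q κ p (polyAl (X := X) K q κ p) where
  comm i j m n hm hn := by
    refine LinearMap.ext fun f => ?_
    rw [LinearMap.sub_apply, Module.End.mul_apply, Module.End.mul_apply]
    obtain ⟨a, rfl | rfl⟩ := int_cases hm <;> obtain ⟨b, rfl | rfl⟩ := int_cases hn
    · have ha : (0 : ℤ) < a := by exact_mod_cast a.pos
      have hb : (0 : ℤ) < b := by exact_mod_cast b.pos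
      rw [if_neg (by omega), LinearMap.zero_apply, sub_eq_zero, polyAl_pos, polyAl_pos, polyAl_pos,
        polyAl_pos]
      simp only [map_sum, Derivation.map_smul_of_tower, Finset.smul_sum, pderiv_comm (K := K) (_, a)]
      rw [Finset.sum_comm]
      refine Finset.sum_congr rfl fun k _ => Finset.sum_congr rfl fun k' _ => ?_
      rw [smul_comm]
    · rw [polyAl_pos_neg, add_sub_cancel_left]
      by_cases h : a = b
      · rw [if_pos h, if_pos (by rw [h]; ring), heisConst_eq]; rfl
      · have : (a : ℤ) ≠ b := fun h' => h (by exact_mod_cast h')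
        rw [if_neg h, if_neg (by omega)]; rfl
    -- This is the previous case with the generators exchanged, so the constant enters with opposite
    -- sign and is matched by `heisConst_neg`.
    · rw [polyAl_pos_neg, sub_add_cancel_left]
      by_cases h : b = a
      · rw [if_pos h, if_pos (by rw [h]; ring), heisConst_neg hg, heisConst_eq, h]
        exact (neg_smul _ f).symm
      · have : (b : ℤ) ≠ a := fun h' => h (by exact_mod_cast h')
        rw [if_neg h, if_neg (by omega), neg_zero]; rfl
    · have ha : (0 : ℤ) < a := by exact_mod_cast a.pos
      have hb : (0 : ℤ) < b := by exact_mod_cast b.pos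
      rw [if_neg (by omega), LinearMap.zero_apply, sub_eq_zero, polyAl_neg, polyAl_neg, polyAl_neg,
        polyAl_neg, mul_left_comm]
  trunc f := by
    obtain ⟨d, hd⟩ := exists_degLE f
    have key : ∀ L : List (Node X × ℤ), (∀ x ∈ L, 0 < x.2) →
        (L.map fun x => polyAl K q κ p x.1 x.2).prod f ∈ degLE K X (d - (L.map Prod.snd).sum) := by
      intro L
      induction L with
      | nil => intro _; simpa using hd
      | cons x L ih =>
        intro hL
        have h1 := ih fun y hy => hL y (List.mem_cons_of_mem _ hy)
        have h2 := polyAl_degLE (q := q) (κ := κ) (p := p) x.1 (hL x List.mem_cons_self) h1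
        rw [List.map_cons (f := Prod.snd), List.sum_cons, List.map_cons, List.prod_cons,
          Module.End.mul_apply, show ∀ a b : ℤ, d - (a + b) = d - b - a from fun a b => by ring]
        exact h2
    -- A total degree above d leaves a polynomial of negative degree, and monomial degrees are
    -- nonnegative.
    refine ⟨d + 1, fun L hL hs => ?_⟩
    ext s
    rw [coeff_zero]
    exact key L hL s (by omega)

theorem coeff_polyDeg (f : MvPolynomial (Node X × ℕ+) K) (s : Node X × ℕ+ →₀ ℕ) (hq : q ≠ 0) :
    coeff s (polyDeg K X q f) = q ^ (-(monoDeg s : ℤ)) • coeff s f := by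
  classical
  induction f using MvPolynomial.induction_on generalizing s with
  | C a =>
    change coeff s (aeval _ (C a)) = _
    rw [aeval_C, algebraMap_eq, coeff_C]
    split_ifs with h
    · subst h; simp [monoDeg]
    · simp
  | add f g hf hg => rw [map_add, coeff_add, hf, hg, coeff_add, smul_add]
  | mul_X f x hf =>
    have h : polyDeg K X q (f * MvPolynomial.X x) =
        q ^ (-(x.2 : ℤ)) • (polyDeg K X q f * MvPolynomial.X x) := by
      change aeval _ (f * MvPolynomial.X x) = _ • (aeval _ f * _)
      rw [map_mul, aeval_X, mul_smul_comm]
    rw [h, coeff_smul, coeff_mul_X', coeff_mul_X']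
    split_ifs with hs
    · have hs' : s - Finsupp.single x 1 + Finsupp.single x 1 = s := by
        refine tsub_add_cancel_of_le (Finsupp.single_le_iff.mpr ?_)
        exact Nat.one_le_iff_ne_zero.mpr (Finsupp.mem_support_iff.mp hs)
      have hd := congrArg monoDeg hs'
      rw [monoDeg_add, monoDeg_single, one_mul] at hd
      rw [hf, smul_smul, ← zpow_add₀ hq]
      congr 2
      rw [← hd]
      push_cast
      ring
    · simp

theorem polyDeg_al (hq : q ≠ 0) (i : Node X) (n : ℤ) (f : MvPolynomial (Node X × ℕ+) K) :
    polyDeg K X q (polyAl K q κ p i n f) = q ^ n • polyAl K q κ p i n (polyDeg K X q f) := by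
  classical
  rcases eq_or_ne n 0 with rfl | hn
  · simp [polyAl]
  obtain ⟨a, rfl | rfl⟩ := int_cases hn
  · ext s
    rw [coeff_polyDeg _ _ hq, coeff_smul, polyAl_pos, polyAl_pos, coeff_sum, coeff_sum,
      Finset.smul_sum, Finset.smul_sum]
    refine Finset.sum_congr rfl fun j _ => ?_
    rw [coeff_smul, coeff_smul, coeff_pderiv, coeff_pderiv, coeff_polyDeg _ _ hq, smul_mul_assoc,
      smul_comm, smul_comm (q ^ (a : ℤ)), smul_smul (q ^ (a : ℤ)), ← zpow_add₀ hq, monoDeg_add,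
      monoDeg_single]
    congr 3
    push_cast
    ring
  · rw [polyAl_neg, polyAl_neg]
    change aeval _ (MvPolynomial.X (i, a) * f) = _ • (_ * aeval _ f)
    rw [map_mul, aeval_X, smul_mul_assoc]

theorem polyDeg_bij (hq : q ≠ 0) : Function.Bijective (polyDeg K X q) := by
  refine Function.bijective_iff_has_inverse.mpr ⟨polyDeg K X q⁻¹, fun f => ?_, fun f => ?_⟩ <;>
  · ext s
    rw [coeff_polyDeg _ _ (by simpa using hq), coeff_polyDeg _ _ (by simpa using hq), smul_smul,
      ← mul_zpow]
    simp [hq]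

theorem polyAl_map {φ : K →ₐ[ℂ] K} (i : Node X) (n : ℤ) (f : MvPolynomial (Node X × ℕ+) K) :
    mapAlgHom φ (polyAl K q κ p i n f) = polyAl K q κ p i n (mapAlgHom φ f) := by
  rcases eq_or_ne n 0 with rfl | hn
  · simp [polyAl]
  obtain ⟨a, rfl | rfl⟩ := int_cases hn
  · rw [polyAl_pos, polyAl_pos, map_sum]
    refine Finset.sum_congr rfl fun j _ => ?_
    rw [map_smul, mapAlgHom_apply, mapAlgHom_apply, pderiv_map]
  · rw [polyAl_neg, polyAl_neg, map_mul]
    congr 1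
    exact map_X _ _

theorem polyAl_smul (i : Node X) (n : ℤ) (g : K) (f : MvPolynomial (Node X × ℕ+) K) :
    polyAl K q κ p i n (g • f) = g • polyAl K q κ p i n f := by
  rcases eq_or_ne n 0 with rfl | hn
  · simp [polyAl]
  obtain ⟨a, rfl | rfl⟩ := int_cases hn
  · rw [polyAl_pos, polyAl_pos, Finset.smul_sum]
    refine Finset.sum_congr rfl fun j _ => ?_
    rw [Derivation.map_smul, smul_comm]
  · rw [polyAl_neg, polyAl_neg, mul_smul_comm]

theorem polyDeg_map {φ : K →ₐ[ℂ] K} (hq : q ≠ 0) (f : MvPolynomial (Node X × ℕ+) K) :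
    mapAlgHom φ (polyDeg K X q f) = polyDeg K X q (mapAlgHom φ f) := by
  ext s
  rw [coeff_polyDeg _ _ hq, mapAlgHom_apply, mapAlgHom_apply, coeff_map, coeff_map,
    coeff_polyDeg _ _ hq]
  exact map_smul φ _ _

theorem mapAlgHom_smul_coeff (φ : K →ₐ[ℂ] K) (g : K) (f : MvPolynomial (Node X × ℕ+) K) :
    mapAlgHom φ (g • f) = φ g • mapAlgHom φ f := by
  rw [smul_eq_C_mul, map_mul, smul_eq_C_mul]
  congr 1
  exact map_C _ _

end PolynomialFock

/-! ### The Fock space over meromorphic functions -/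

section Instantiation

variable {X : AffineType} {q κ p l : ℂ} {lam : Node X → ℤ} {μ : hStar X}

/-- Translation of the coefficients of polynomials. -/
def fockShift (η : HStar X) : Fock X →ₗ[ℂ] Fock X :=
  (MvPolynomial.mapAlgHom (shift η).toAlgHom).toLinearMap

instance : IsScalarTower ℂ (Mero X) (Fock X) :=
  inferInstanceAs (IsScalarTower ℂ (Mero X) (MvPolynomial _ _))

theorem fockShift_coeff (η : HStar X) (f : Fock X) (s : Node X × ℕ+ →₀ ℕ) :
    MvPolynomial.coeff s (fockShift η f) = shift η (MvPolynomial.coeff s f) :=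
  MvPolynomial.coeff_map _ _ _

theorem fockData (hg : GenericParams q κ p) :
    FockData q κ p (fun i m => polyAl (Mero X) q κ p i m) fockShift (polyDeg (Mero X) X q) where
  toIsHeisenberg := polyAl_isHeisenberg hg
  τ_zero := LinearMap.ext fun f => MvPolynomial.ext _ _ fun s => by
    rw [fockShift_coeff, shift_zero]; rfl
  τ_add η η' f := MvPolynomial.ext _ _ fun s => by
    rw [fockShift_coeff, fockShift_coeff, fockShift_coeff, shift_shift]
  τ_smul η g f := mapAlgHom_smul_coeff _ g f
  τ_al η i n f := polyAl_map i n f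
  τ_dM η f := polyDeg_map hg.q_ne f
  al_smul i n g f := polyAl_smul i n g f
  dM_smul g f := map_smul (MvPolynomial.aeval _) g f
  dM_al i n f := polyDeg_al hg.q_ne i n f
  dM_bij := polyDeg_bij hg.q_ne

theorem IndModule_eq : IndModule q κ p l lam μ =
    inducedCurrents q κ p l (fun i m => polyAl (Mero X) q κ p i m) fockShift (polyDeg (Mero X) X q)
      lam μ := rfl

set_option maxHeartbeats 1000000 in
theorem IndModule_isUModule (hg : GenericParams q κ p) :
    (IndModule q κ p l lam μ).IsUModule q κ p l := by
  have h := (fockData (X := X) hg).isUModule (l := l) (lam := lam) (μ := μ) hg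
  exact IndModule_eq ▸ h

end Instantiation

/-! ### Separation of points by entire functions -/

section Separation

/-- A product of functions L - L(y), one for each point y to be avoided, with L a continuous
functional separating y from x. -/
theorem exists_entire_separating {E : Type} [NormedAddCommGroup E] [NormedSpace ℂ E] {x : E}
    (s : Finset E) (hx : x ∉ s) : ∃ f : Entire E, f.1 x ≠ 0 ∧ ∀ y ∈ s, f.1 y = 0 := by
  classical
  induction s using Finset.induction_on with
  | empty => exact ⟨1, one_ne_zero, by simp⟩
  | insert y s _ ih =>
    rw [Finset.mem_insert, not_or] at hx
    obtain ⟨f, hf, hs⟩ := ih hx.2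
    obtain ⟨L, hL⟩ := SeparatingDual.exists_separating_of_ne (R := ℂ) hx.1
    set g : Entire E := ⟨fun z => L z - L y, fun z => (L.analyticAt z).sub analyticAt_const⟩
    refine ⟨g * f, mul_ne_zero (sub_ne_zero.mpr hL) hf, fun z hz => ?_⟩
    change (L z - L y) * f.1 z = 0
    rcases Finset.mem_insert.mp hz with rfl | hz
    · rw [sub_self, zero_mul]
    · rw [hs z hz, mul_zero]

theorem eq_of_entire_eq {E : Type} [NormedAddCommGroup E] [NormedSpace ℂ E] {x y : E}
    (h : ∀ f : Entire E, f.1 x = f.1 y) : x = y := by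
  by_contra hxy
  obtain ⟨f, hf, hs⟩ := exists_entire_separating {y} (x := x) (by simpa using hxy)
  exact hf ((h f).trans (hs y (by simp)))

end Separation

/-! ### Submodules and weights of the lattice modules -/

section LatticeSubmodules

variable {X : AffineType} {M : Type*} [AddCommGroup M] [Module ℂ M] [Module (Mero X) M]
  [IsScalarTower ℂ (Mero X) M] {q κ l : ℂ} {lam : Node X → ℤ} {μ : hStar X}
  {τ : HStar X → M →ₗ[ℂ] M} {Tp Tm : Node X → ℤ → M →ₗ[ℂ] M} {dM : M →ₗ[ℂ] M}

theorem complex_smul_mem {U : Submodule (Mero X) (Idx X →₀ M)} (c : ℂ) {v : Idx X →₀ M}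
    (hv : v ∈ U) : c • v ∈ U := by
  rw [← algebraMap_smul (Mero X) c v]
  exact U.smul_mem _ hv

theorem complex_smul_mem_iff {U : Submodule (Mero X) (Idx X →₀ M)} {c : ℂ} (hc : c ≠ 0)
    {v : Idx X →₀ M} : c • v ∈ U ↔ v ∈ U := by
  refine ⟨fun h => ?_, complex_smul_mem c⟩
  have := complex_smul_mem c⁻¹ h
  rwa [smul_smul, inv_mul_cancel₀ hc, one_smul] at this

theorem evHom_apply (f : Entire (HStar X)) (v : Idx X →₀ M) (x : Idx X) :
    evHom M lam μ f v x = f.1 (weightOf lam μ x) • v x := by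
  classical
  induction v using Finsupp.induction_linear with
  | zero => simp
  | add v w hv hw => rw [map_add, Finsupp.add_apply, hv, hw, Finsupp.add_apply, smul_add]
  | single y m =>
    have h : evHom M lam μ f (Finsupp.single y m) =
      Finsupp.single y (f.1 (weightOf lam μ y) • m) := blockOp_single _ _ _ _
    rw [h, Finsupp.single_apply, Finsupp.single_apply]
    split_ifs with hy
    · rw [hy]
    · rw [smul_zero]

/-- Weights of basis vectors are distinct, so some entire function vanishes at all weights in the
support except that of x; it projects v onto a nonzero multiple of its component. -/
theorem single_mem_of_ev {U : Submodule (Mero X) (Idx X →₀ M)}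
    (hU : ∀ (f : Entire (HStar X)), ∀ v ∈ U, evHom M lam μ f v ∈ U) {v : Idx X →₀ M} (hv : v ∈ U)
    (x : Idx X) : Finsupp.single x (v x) ∈ U := by
  classical
  obtain ⟨f, hf, hs⟩ := exists_entire_separating (x := weightOf lam μ x)
    ((v.support.erase x).image (weightOf lam μ)) (by
      intro h
      obtain ⟨y, hy, hxy⟩ := Finset.mem_image.mp h
      exact Finset.ne_of_mem_erase hy (weightOf_injective lam μ hxy))
  have h : evHom M lam μ f v = f.1 (weightOf lam μ x) • Finsupp.single x (v x) := by
    ext y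
    rw [evHom_apply, Finsupp.smul_apply, Finsupp.single_apply]
    split_ifs with hy
    · rw [hy]
    · rw [smul_zero]
      by_cases hy' : v y = 0
      · rw [hy', smul_zero]
      · rw [hs _ (Finset.mem_image_of_mem _ (Finset.mem_erase.mpr
          ⟨fun h => hy h.symm, Finsupp.mem_support_iff.mpr hy'⟩)), zero_smul]
  have h2 := hU f v hv
  rw [h] at h2
  exact (complex_smul_mem_iff hf).mp h2

/-- K^+_j moves the dynamical index in both directions, since stability includes its inverse, and
one suitable mode of each current moves the root lattice index. All constants met on the way are
nonzero, so the vacuum reaches every position. -/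
theorem eq_top_of_single_mem (hq : q ≠ 0) (hκ : κ ≠ 0) {U : Submodule (Mero X) (Idx X →₀ M)}
    (hU : (latticeCurrents q κ l lam μ τ Tp Tm dM).Stable U) {e : M} (hτ : ∀ η, τ η e = e)
    (hTp : ∀ j, Tp j 0 e = e) (hTm : ∀ j, Tm j 0 e = e)
    (he : ∀ x, Finsupp.single x e ∈ U → ∀ m, Finsupp.single x m ∈ U) {x₀ : Idx X}
    (hx₀ : Finsupp.single x₀ e ∈ U) : U = ⊤ := by
  have hscal : ∀ {c : ℂ} (_ : c ≠ 0) (x : Idx X),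
      Finsupp.single x (c • e) ∈ U ↔ Finsupp.single x e ∈ U := by
    intro c hc x
    rw [← Finsupp.smul_single, complex_smul_mem_iff hc]
  have hd := dynConst_ne_zero hq l lam
  have hK : ∀ j β ν, Finsupp.single ((β, ν) : Idx X) e ∈ U ↔
      Finsupp.single ((β, dynMove (-Pi.single j 1) ν) : Idx X) e ∈ U := by
    intro j β ν
    rw [← hU.Kp j, latticeCurrents_Kp, latticeK_apply, hτ]
    exact hscal (mul_ne_zero (zpow_ne_zero _ hq) (zpow_ne_zero _ hd)) _
  have hKγ : ∀ (γ : Node X → ℤ) β ν, Finsupp.single ((β, ν) : Idx X) e ∈ U ↔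
      Finsupp.single ((β, dynMove γ ν) : Idx X) e ∈ U := by
    intro γ
    induction γ using Pi.single_induction with
    | zero => intro β ν; rw [dynMove_zero]
    | add γ γ' h h' => intro β ν; rw [← dynMove_dynMove, ← h, ← h']
    | single j m =>
      have h1 : ∀ β ν, Finsupp.single ((β, ν) : Idx X) e ∈ U ↔
          Finsupp.single ((β, dynMove (Pi.single j 1) ν) : Idx X) e ∈ U := by
        intro β ν
        rw [hK j β (dynMove (Pi.single j 1) ν), dynMove_dynMove, neg_add_cancel, dynMove_zero]
      induction m using Int.induction_on with
      | zero => intro β ν; rw [Pi.single_zero, dynMove_zero]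
      | succ m ih => intro β ν; rw [Pi.single_add, ← dynMove_dynMove, ← ih, ← h1]
      | pred m ih =>
        intro β ν
        have hn : (Pi.single j (-1) : Node X → ℤ) = -Pi.single j 1 :=
          Pi.single_neg (f := fun _ => ℤ) j 1
        rw [sub_eq_add_neg, Pi.single_add, ← dynMove_dynMove, ← ih, hn, ← hK]
  have hβ1 : ∀ j β ν, Finsupp.single ((β, ν) : Idx X) e ∈ U →
      Finsupp.single ((β + Pi.single j 1, ν) : Idx X) e ∈ U := by
    intro j β ν h
    -- This mode number makes the vertex operator act through its coefficient of degree 0, which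
    -- fixes the vacuum.
    have h1 := hU.xp j (-hval lam β j - 1) _ h
    rw [latticeCurrents_xp, hτ, show -hval lam β j - 1 + hval lam β j + 1 = 0 by ring, hTp,
      hscal (mul_ne_zero (twist_ne_zero hκ _ _) (zpow_ne_zero _ hd))] at h1
    exact (hKγ _ _ _).mpr h1
  have hβ2 : ∀ j β ν, Finsupp.single ((β, ν) : Idx X) e ∈ U →
      Finsupp.single ((β + Pi.single j (-1), ν) : Idx X) e ∈ U := by
    intro j β ν h
    have h1 := hU.xm j (hval lam β j - 1) _ h
    rw [latticeCurrents_xm, hτ, show hval lam β j - 1 - hval lam β j + 1 = 0 by ring, hTm,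
      hscal (twist_ne_zero hκ _ _)] at h1
    exact h1
  have hβγ : ∀ (γ : Node X → ℤ) β ν, Finsupp.single ((β, ν) : Idx X) e ∈ U →
      Finsupp.single ((β + γ, ν) : Idx X) e ∈ U := by
    intro γ
    induction γ using Pi.single_induction with
    | zero => intro β ν h; rwa [add_zero]
    | add γ γ' h h' => intro β ν h0; rw [← add_assoc]; exact h' _ _ (h _ _ h0)
    | single j m =>
      induction m using Int.induction_on with
      | zero => intro β ν h; rwa [Pi.single_zero, add_zero]
      | succ m ih => intro β ν h; rw [Pi.single_add, ← add_assoc]; exact hβ1 _ _ _ (ih _ _ h)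
      | pred m ih =>
        intro β ν h
        rw [sub_eq_add_neg, Pi.single_add, ← add_assoc]
        exact hβ2 _ _ _ (ih _ _ h)
  have hall : ∀ x : Idx X, Finsupp.single x e ∈ U := by
    rintro ⟨β, ν⟩
    obtain ⟨β₀, ν₀⟩ := x₀
    have h1 := hβγ (β - β₀) _ _ hx₀
    rw [add_sub_cancel] at h1
    have h2 := (hKγ (fun i => ν.1 i - ν₀.1 i) _ _).mp h1
    -- Both indices vanish at the affine node, so the difference is moved without any reduction.
    have h3 : dynMove (fun i => ν.1 i - ν₀.1 i) ν₀ = ν := by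
      ext i
      simp [dynMove, ν.2, ν₀.2]
    rwa [h3] at h2
  refine eq_top_iff.mpr fun v _ => ?_
  induction v using Finsupp.induction_linear with
  | zero => exact U.zero_mem
  | add v w hv hw => exact U.add_mem (hv trivial) (hw trivial)
  | single x m => exact he x (hall x) m

/-- The image of a weight vector has the same weight, which must occur among the weights of the
target; comparing values on the h_i gives the claim. -/
theorem vacuumWeight_eq_of_equivalent {lam' : Node X → ℤ} {μ' : hStar X} [Nontrivial M]
    {κ' l' : ℂ}
    (h : (latticeCurrents q κ l lam μ τ Tp Tm dM).Equivalent
      (latticeCurrents q κ' l' lam' μ' τ Tp Tm dM)) :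
    ∃ β : Node X → ℤ, ∀ i, lam i - lam' i = ∑ j, cartan X i j * β j := by
  obtain ⟨φ, hφ⟩ := h
  obtain ⟨m, hm⟩ := exists_ne (0 : M)
  set x₀ : Idx X := (0, ⟨0, rfl⟩) with hx₀
  set v : Idx X →₀ M := Finsupp.single x₀ m with hv
  have hv0 : v ≠ 0 := by rw [hv]; simpa using hm
  have hφv : φ v ≠ 0 := by simpa using hv0
  obtain ⟨y, hy⟩ := Finsupp.ne_iff.mp hφv
  rw [Finsupp.zero_apply] at hy
  have hw : weightOf lam μ x₀ = weightOf lam' μ' y := by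
    refine eq_of_entire_eq fun f => ?_
    have h1 := (hφ v).2.2.2.2.2 f
    change φ (evHom M lam μ f v) = evHom M lam' μ' f (φ v) at h1
    have h2 : evHom M lam μ f v = f.1 (weightOf lam μ x₀) • v := by
      rw [hv, Finsupp.smul_single]; exact blockOp_single _ _ _ _
    rw [h2] at h1
    have h4 : φ (f.1 (weightOf lam μ x₀) • v) = f.1 (weightOf lam μ x₀) • φ v := by
      rw [← algebraMap_smul (Mero X) _ v, map_smul, algebraMap_smul]
    rw [h4] at h1
    have h3 := DFunLike.congr_fun h1 y
    rw [evHom_apply, Finsupp.smul_apply, ← sub_eq_zero, ← sub_smul] at h3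
    exact sub_eq_zero.mp ((smul_eq_zero.mp h3).resolve_right hy)
  refine ⟨y.1, fun i => ?_⟩
  have h1 := congrArg (fun ξ => ξ.1.1 i) hw
  simp only [weightOf_fst_fst] at h1
  have h2 : hval lam x₀.1 i = hval lam' y.1 i := by exact_mod_cast h1
  rw [hval, hval, hx₀] at h2
  simp only [Pi.zero_apply, mul_zero, Finset.sum_const_zero, add_zero] at h2
  omega

end LatticeSubmodules

/-! ### Exponents of the degree operator -/

section Grading

/-- Absolute values decide: |q^e| is at least |q|^C, while |q^{ω+n}| tends to 0. No choice of
logarithm of the eigenvalue matters. -/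
theorem exists_zpow_ne_cpow {q : ℂ} (hq : q ≠ 0) (hq1 : ‖q‖ < 1) (C : ℤ) (ω : ℂ) :
    ∃ n₀ : ℕ, ∀ n > n₀, ∀ e : ℤ, e ≤ C → q ^ e ≠ q ^ (ω + (n : ℂ)) := by
  have hn : 0 < ‖q‖ := norm_pos_iff.mpr hq
  obtain ⟨n₀, h₀⟩ := exists_pow_lt_of_lt_one
    (show 0 < ‖q‖ ^ C / (‖q ^ ω‖ + 1) by positivity) hq1
  refine ⟨n₀, fun n hn' e he h => ?_⟩
  rw [Complex.cpow_add _ _ hq, Complex.cpow_natCast] at h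
  have h1 := congrArg norm h
  rw [norm_zpow, norm_mul, norm_pow] at h1
  have h2 : ‖q‖ ^ C ≤ ‖q‖ ^ e := zpow_le_zpow_right_of_le_one₀ hn hq1.le he
  have h3 : ‖q‖ ^ n ≤ ‖q‖ ^ n₀ := pow_le_pow_of_le_one hn.le hq1.le hn'.le
  have h4 : 0 < ‖q‖ ^ n := pow_pos hn n
  rw [lt_div_iff₀ (by positivity)] at h₀
  have h5 : 0 ≤ ‖q ^ ω‖ := norm_nonneg _
  nlinarith

end Grading

/-! ### Vertex operators on the vacuum -/

section Vacuum

variable {J M : Type*} [AddCommGroup M] [Module ℂ M] {a b : J → ℕ → Module.End ℂ M}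
  {c : J → J → ℕ → ℂ} (S : IsVertexSystem a b c)
include S

theorem IsVertexSystem.expZ_vacuum (A : J) {e : M} (he : ∀ m, 0 < m → b A m e = 0) (k : ℤ) :
    expZ (b A) k e = if k = 0 then e else 0 := by
  rcases lt_or_ge k 0 with h | h
  · rw [expZ_of_neg _ h, if_neg h.ne]; rfl
  · lift k to ℕ using h
    rw [expZ_natCast]
    rcases Nat.eq_zero_or_pos k with rfl | hk
    · simp
    · have hk' : (k : ℂ) ≠ 0 := by exact_mod_cast hk.ne'
      rw [if_neg (by exact_mod_cast hk.ne')]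
      have h1 : ∀ x ∈ Finset.HasAntidiagonal.antidiagonal k,
          ((x.1 : ℂ) • (b A x.1 * expCoeff (b A) x.2)) e = 0 := by
        intro x _
        rcases Nat.eq_zero_or_pos x.1 with h0 | h0
        · simp [h0]
        · rw [LinearMap.smul_apply, ((commute_expCoeff (S.bb A A) (fun m _ => S.bb A A x.1 m) x.2)).eq,
            Module.End.mul_apply, he _ h0, map_zero, smul_zero]
      have h2 := LinearMap.congr_fun (expCoeff_rec (S.bb A A) k) e
      rw [LinearMap.sum_apply, Finset.sum_eq_zero h1, LinearMap.smul_apply] at h2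
      exact (smul_eq_zero.mp h2).resolve_left hk'

theorem IsVertexSystem.vertexMode_vacuum_pos (A : J) {e : M} (he : ∀ m, 0 < m → b A m e = 0) {s : ℤ}
    (hs : 0 < s) : vertexMode (a A) (b A) s e = 0 := by
  rw [S.vertexMode_apply]
  refine wrap_eq_zero _ fun n hn => ?_
  rw [S.expZ_vacuum A he, if_neg (by omega)]

theorem IsVertexSystem.vertexMode_vacuum_zero (A : J) {e : M} (he : ∀ m, 0 < m → b A m e = 0) :
    vertexMode (a A) (b A) 0 e = e := by
  rw [S.vertexMode_apply, wrap, finsum_eq_single _ 0 fun n hn => by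
    rw [S.expZ_vacuum A he, if_neg (by omega), map_zero]]
  rw [S.expZ_vacuum A he, if_pos (by simp), expCoeff_zero, Module.End.one_apply]

end Vacuum

/-! ### Irreducibility of the Fock space -/

section FockIrreducible

open MvPolynomial

variable {X : AffineType} {K : Type} [Field K] [Algebra ℂ K] {q κ p : ℂ}
  (hg : GenericParams q κ p)

theorem polyAl_one (i : Node X) {n : ℤ} (hn : 0 < n) :
    polyAl K q κ p i n (1 : MvPolynomial (Node X × ℕ+) K) = 0 := by
  obtain ⟨a, rfl⟩ : ∃ a : ℕ+, n = a := ⟨⟨n.toNat, by omega⟩, by simp; omega⟩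
  rw [polyAl_pos]
  exact Finset.sum_eq_zero fun j _ => by rw [pderiv_one, smul_zero]

include hg in
-- The annihilation operators of degree n are the partial derivatives of that degree transformed by
-- a matrix, invertible by `heisenberg_nondegenerate`.
theorem exists_pderiv_eq (j : Node X) (n : ℕ+) : ∃ c : Node X → ℂ,
    ∀ f : MvPolynomial (Node X × ℕ+) K,
      pderiv (j, n) f = ∑ i, c i • polyAl K q κ p i n f := by
  have hn : (0 : ℤ) < n := by exact_mod_cast n.pos
  set A : Matrix (Node X) (Node X) ℂ := fun i j => derivCoeff q κ p i j n with hA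
  have hdet : A.det ≠ 0 := by
    intro h0
    obtain ⟨v, hv, hAv⟩ := Matrix.exists_mulVec_eq_zero_iff.mpr h0
    refine hv (heisenberg_nondegenerate hg hn fun i => ?_)
    have h1 : ∑ j, derivCoeff q κ p i j n * v j = 0 := congrFun hAv i
    have hc : qInt q n / (n : ℤ) * ((1 - p ^ (n : ℤ)) / (1 - (p * q ^ (-2 : ℤ)) ^ (n : ℤ))) *
        q ^ (-(n : ℤ)) ≠ 0 := by
      refine mul_ne_zero (mul_ne_zero (div_ne_zero (hg.qInt_ne hn.ne') (by exact_mod_cast hn.ne')) ?_)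
        (zpow_ne_zero _ hg.q_ne)
      have h2 := hg.one_sub_p_ne n.pos
      have h3 := hg.one_sub_pstar_ne n.pos
      rw [zpow_natCast, zpow_natCast]
      exact div_ne_zero h2 h3
    refine (mul_eq_zero.mp ?_).resolve_left hc
    rw [Finset.mul_sum, ← h1]
    refine Finset.sum_congr rfl fun j _ => ?_
    rw [derivCoeff]
    ring
  have hinv : A⁻¹ * A = 1 := Matrix.nonsing_inv_mul A (isUnit_iff_ne_zero.mpr hdet)
  refine ⟨fun i => A⁻¹ j i, fun f => ?_⟩
  have h1 : ∀ k, ∑ i, A⁻¹ j i * A i k = if j = k then 1 else 0 := fun k => by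
    rw [← Matrix.mul_apply, hinv, Matrix.one_apply]
  simp only [polyAl_pos, Finset.smul_sum, smul_smul]
  rw [Finset.sum_comm]
  simp only [← Finset.sum_smul]
  have h2 : ∀ k, (∑ i, A⁻¹ j i * derivCoeff q κ p i k n) = if j = k then 1 else 0 := h1
  simp only [h2, ite_smul, one_smul, zero_smul]
  rw [Finset.sum_ite_eq Finset.univ j, if_pos (Finset.mem_univ j)]

include hg in
-- Partial derivatives preserve N and lower the degree, so after finitely many of them a nonzero
-- constant is reached.
theorem one_mem_of_polyAl {N : Submodule K (MvPolynomial (Node X × ℕ+) K)}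
    (hN : ∀ i (n : ℕ+), ∀ f ∈ N, polyAl K q κ p i n f ∈ N) {f : MvPolynomial (Node X × ℕ+) K}
    (hf : f ∈ N) (hf0 : f ≠ 0) : (1 : MvPolynomial (Node X × ℕ+) K) ∈ N := by
  have hD : ∀ x, ∀ f ∈ N, pderiv x f ∈ N := by
    rintro ⟨j, n⟩ f hf
    obtain ⟨c, hc⟩ := exists_pderiv_eq (K := K) hg j n
    rw [hc]
    refine N.sum_mem fun i _ => ?_
    rw [← algebraMap_smul K (c i)]
    exact N.smul_mem _ (hN i n f hf)
  have key : ∀ (d : ℕ) (f : MvPolynomial (Node X × ℕ+) K), f ∈ N → f ≠ 0 → f ∈ degLE K X d →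
      (1 : MvPolynomial (Node X × ℕ+) K) ∈ N := by
    intro d
    induction d using Nat.strong_induction_on with
    | _ d ih =>
      intro f hf hf0 hd
      by_cases hx : ∃ x, pderiv x f ≠ 0
      · obtain ⟨x, hx⟩ := hx
        have h1 : pderiv x f ∈ degLE K X (d - x.2) := by
          intro s hs
          rw [coeff_pderiv, hd, zero_mul]
          rw [monoDeg_add, monoDeg_single]
          push_cast
          omega
        have h2 : (0 : ℤ) ≤ d - x.2 := by
          by_contra hneg
          refine hx ?_
          ext s
          rw [coeff_zero]
          exact h1 s (by omega)
        have h3 := x.2.pos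
        refine ih (d - x.2) (by omega) _ (hD x f hf) hx ?_
        rwa [Nat.cast_sub (by omega)]
      -- If all partial derivatives vanish the polynomial is constant, because the exponents are
      -- invertible in a field containing ℂ.
      · push Not at hx
        have hc : f = C (coeff 0 f) := by
          ext s
          rw [coeff_C]
          split_ifs with hs
          · rw [hs]
          · obtain ⟨x, hsx⟩ : ∃ x, s x ≠ 0 := by
              by_contra hc
              push Not at hc
              exact hs (Finsupp.ext fun x => (hc x).symm)
            have hs' : s - Finsupp.single x 1 + Finsupp.single x 1 = s :=
              tsub_add_cancel_of_le (Finsupp.single_le_iff.mpr (Nat.one_le_iff_ne_zero.mpr hsx))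
            have h1 := congrArg (coeff (s - Finsupp.single x 1)) (hx x)
            rw [coeff_pderiv, hs', coeff_zero] at h1
            refine (mul_eq_zero.mp h1).resolve_right ?_
            have h2 (n : ℕ) : (n : K) + 1 ≠ 0 := by
              have h3 : algebraMap ℂ K ((n : ℂ) + 1) ≠ 0 := by
                rw [map_ne_zero]
                exact Nat.cast_add_one_ne_zero _
              simpa using h3
            exact h2 _
        have h0 : coeff 0 f ≠ 0 := fun h => hf0 (by rw [hc, h, map_zero])
        have h1 := N.smul_mem (coeff 0 f)⁻¹ hf
        rw [hc, smul_eq_C_mul, ← map_mul, coeff_C, if_pos rfl, inv_mul_cancel₀ h0, map_one] at h1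
        exact h1
  obtain ⟨d, hd⟩ := exists_degLE f
  refine key d.toNat f hf hf0 fun s hs => hd s (by omega)

theorem eq_top_of_polyAl {N : Submodule K (MvPolynomial (Node X × ℕ+) K)}
    (hN : ∀ i (n : ℕ+), ∀ f ∈ N, polyAl K q κ p i (-n) f ∈ N)
    (h1 : (1 : MvPolynomial (Node X × ℕ+) K) ∈ N) (f : MvPolynomial (Node X × ℕ+) K) : f ∈ N := by
  induction f using MvPolynomial.induction_on with
  | C a =>
    have := N.smul_mem a h1
    rwa [smul_eq_C_mul, mul_one] at this
  | add f g hf hg => exact N.add_mem hf hg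
  | mul_X f x hf =>
    have := hN x.1 x.2 f hf
    rwa [polyAl_neg, mul_comm] at this

end FockIrreducible

/-! ### Grading and irreducibility over the lattice -/

section LatticeIrreducible

variable {X : AffineType} {M : Type*} [AddCommGroup M] [Module ℂ M] [Module (Mero X) M]
  {q κ p l : ℂ} {lam : Node X → ℤ} {μ : hStar X}
  {τ : HStar X → M →ₗ[ℂ] M} {Tp Tm : Node X → ℤ → M →ₗ[ℂ] M} {dM : M →ₗ[ℂ] M}

theorem latticeCurrents_qd_apply (v : Idx X →₀ M) (x : Idx X) :
    (latticeCurrents q κ l lam μ τ Tp Tm dM).qd v x = q ^ (-energy lam x.1) • dM (v x) := by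
  classical
  induction v using Finsupp.induction_linear with
  | zero => simp
  | add v w hv hw => rw [map_add, Finsupp.add_apply, hv, hw, Finsupp.add_apply, map_add, smul_add]
  | single y m =>
    rw [latticeCurrents_qd, Finsupp.single_apply, Finsupp.single_apply]
    split_ifs with hy
    · rw [hy]
    · rw [map_zero, smul_zero]

/-- The eigenvalues of q^d are q^{-E(β)-k} with k ≥ 0. Their exponents are integers bounded above by
C, so `exists_zpow_ne_cpow` excludes q^{ω+n} for large n. -/
theorem latticeCurrents_isTruncatedGraded (hq : q ≠ 0) (hq1 : ‖q‖ < 1) {C : ℤ}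
    (hC : ∀ β, -C ≤ energy lam β)
    (hspan : Submodule.span ℂ {m : M | ∃ k : ℕ, dM m = q ^ (-(k : ℤ)) • m} = ⊤)
    (heig : ∀ z : ℂ, (∀ k : ℕ, q ^ (-(k : ℤ)) ≠ z) → ∀ m, dM m = z • m → m = 0) :
    (latticeCurrents q κ l lam μ τ Tp Tm dM).IsTruncatedGraded q := by
  refine ⟨?_, fun ω => ?_⟩
  · rw [eq_top_iff]
    intro v _
    induction v using Finsupp.induction_linear with
    | zero => exact Submodule.zero_mem _
    | add v w hv hw => exact Submodule.add_mem _ (hv trivial) (hw trivial)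
    | single x m =>
      have h1 : m ∈ Submodule.span ℂ {m : M | ∃ k : ℕ, dM m = q ^ (-(k : ℤ)) • m} := hspan ▸ trivial
      induction h1 using Submodule.span_induction with
      | mem m hm =>
        obtain ⟨k, hk⟩ := hm
        refine Submodule.subset_span ⟨((-energy lam x.1 + -(k : ℤ) : ℤ) : ℂ), ?_⟩
        rw [latticeCurrents_qd, hk, smul_smul, Complex.cpow_intCast, zpow_add₀ hq,
          Finsupp.smul_single]
      | zero => rw [Finsupp.single_zero]; exact Submodule.zero_mem _
      | add m m' _ _ h h' => rw [Finsupp.single_add]; exact Submodule.add_mem _ (h trivial) (h' trivial)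
      | smul c m _ h => rw [← Finsupp.smul_single]; exact Submodule.smul_mem _ _ (h trivial)
  · obtain ⟨n₀, hn₀⟩ := exists_zpow_ne_cpow hq hq1 C ω
    refine ⟨n₀, fun n hn v hv => Finsupp.ext fun x => ?_⟩
    have h1 : q ^ (-energy lam x.1) • dM (v x) = q ^ (ω + (n : ℂ)) • v x := by
      rw [← latticeCurrents_qd_apply (κ := κ) (l := l) (μ := μ) (τ := τ) (Tp := Tp) (Tm := Tm), hv,
        Finsupp.smul_apply]
    refine heig (q ^ energy lam x.1 * q ^ (ω + (n : ℂ))) (fun k hk => ?_) _ ?_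
    · have h2 := hC x.1
      refine hn₀ n hn (-energy lam x.1 + -(k : ℤ)) (by omega) ?_
      rw [zpow_add₀ hq, hk, ← mul_assoc, ← zpow_add₀ hq, neg_add_cancel, zpow_zero, one_mul]
    · rw [mul_smul, ← h1, smul_smul, ← zpow_add₀ hq, add_neg_cancel, zpow_zero, one_smul]

variable [IsScalarTower ℂ (Mero X) M]

theorem latticeCurrents_irreducible (hq : q ≠ 0) (hκ : κ ≠ 0) {e : M} (he : e ≠ 0)
    (hτ : ∀ η, τ η e = e) (hTp : ∀ j, Tp j 0 e = e) (hTm : ∀ j, Tm j 0 e = e)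
    (h1 : ∀ m : M, m ≠ 0 → ∃ g : Mero X, g • m = e) (h2 : ∀ m : M, ∃ g : Mero X, g • e = m) :
    (latticeCurrents q κ l lam μ τ Tp Tm dM).Irreducible := by
  refine ⟨⟨Finsupp.single (0, ⟨0, rfl⟩) e, 0, by simpa using he⟩, fun U hU => ?_⟩
  rw [or_iff_not_imp_left]
  intro hbot
  obtain ⟨v, hv, hv0⟩ := U.ne_bot_iff.mp hbot
  obtain ⟨x, hx⟩ := Finsupp.ne_iff.mp hv0
  obtain ⟨g, hgx⟩ := h1 (v x) hx
  refine eq_top_of_single_mem hq hκ hU hτ hTp hTm (fun y hy m => ?_) (x₀ := x) ?_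
  · obtain ⟨g', rfl⟩ := h2 m
    rw [← Finsupp.smul_single]
    exact U.smul_mem _ hy
  · rw [← hgx, ← Finsupp.smul_single]
    exact U.smul_mem _ (single_mem_of_ev hU.ev hv x)

end LatticeIrreducible

/-! ### Irreducibility and highest weight vectors of induced modules -/

section InducedIrreducible

variable {X : AffineType} {M : Type*} [AddCommGroup M] [Module ℂ M] [Module (Mero X) M]
  {q κ p l : ℂ} {al : Node X → ℤ → Module.End ℂ M} {τ : HStar X → M →ₗ[ℂ] M}
  {dM : M →ₗ[ℂ] M} {lam : Node X → ℤ} {μ : hStar X}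

/-- An invariant vacuum vector of an irreducible representation of the Heisenberg algebra. -/
structure IsVacuum (al : Node X → ℤ → Module.End ℂ M) (τ : HStar X → M →ₗ[ℂ] M) (e : M) : Prop where
  ne_zero : e ≠ 0
  al_pos : ∀ i n, 0 < n → al i n e = 0
  τ_eq : ∀ η, τ η e = e
  irreducible : ∀ N : Submodule (Mero X) M, (∀ i n, n ≠ 0 → ∀ m ∈ N, al i n m ∈ N) →
    ∀ m ∈ N, m ≠ 0 → N = ⊤

theorem inducedCurrents_isTruncatedGraded (hq : q ≠ 0) (hq1 : ‖q‖ < 1) {C : ℤ}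
    (hC : ∀ β, -C ≤ energy lam β)
    (hspan : Submodule.span ℂ {m : M | ∃ k : ℕ, dM m = q ^ (-(k : ℤ)) • m} = ⊤)
    (heig : ∀ z : ℂ, (∀ k : ℕ, q ^ (-(k : ℤ)) ≠ z) → ∀ m, dM m = z • m → m = 0) :
    (inducedCurrents q κ p l al τ dM lam μ).IsTruncatedGraded q :=
  latticeCurrents_isTruncatedGraded hq hq1 hC hspan heig

variable [IsScalarTower ℂ (Mero X) M] (F : FockData q κ p al τ dM) (hg : GenericParams q κ p) {e : M}
  (V : IsVacuum al τ e)
include F hg V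

theorem IsVacuum.annihilation (A : Node X × Bool) (m : ℕ) (hm : 0 < m) :
    annihilation q p al A m e = 0 := by
  rw [annihilation_eq, LinearMap.smul_apply, V.al_pos _ _ (by exact_mod_cast hm), smul_zero]

/-- Irreducibility of the coefficient space passes from any nonzero component to the vacuum at the
same position, and the lattice motions do the rest. The same statement yields irreducibility and
cyclicity of the vacuum vector. -/
theorem IsVacuum.eq_top_of_mem {U : Submodule (Mero X) (Idx X →₀ M)}
    (hU : (inducedCurrents q κ p l al τ dM lam μ).Stable U) {v : Idx X →₀ M} (hv : v ∈ U)
    (hv0 : v ≠ 0) : U = ⊤ := by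
  have S := F.isVertexSystem hg
  obtain ⟨x, hx⟩ := Finsupp.ne_iff.mp hv0
  have hN : ∀ y m, Finsupp.single y m ∈ U → m ≠ 0 → ∀ m', Finsupp.single y m' ∈ U := by
    intro y m hm hm0 m'
    have h1 := V.irreducible (U.comap (Finsupp.lsingle y)) (fun i n hn m hm => by
      have h2 := hU.al i n hn _ hm
      rwa [inducedCurrents_al, Finsupp.lsingle_apply, diagHom_single] at h2) m hm hm0
    have h3 : m' ∈ U.comap (Finsupp.lsingle y) := h1 ▸ trivial
    exact h3
  exact eq_top_of_single_mem hg.q_ne hg.κ_ne hU.toStable V.τ_eq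
    (fun j => S.vertexMode_vacuum_zero (j, true) (V.annihilation F hg _))
    (fun j => S.vertexMode_vacuum_zero (j, false) (V.annihilation F hg _))
    (fun y hy m => hN y e hy V.ne_zero m)
    (hN x _ (single_mem_of_ev hU.ev hv x) hx e)

theorem IsVacuum.irreducible_induced : (inducedCurrents q κ p l al τ dM lam μ).Irreducible := by
  refine ⟨⟨Finsupp.single (0, ⟨0, rfl⟩) e, 0, by simpa using V.ne_zero⟩, fun U hU => ?_⟩
  rw [or_iff_not_imp_left]
  intro hbot
  obtain ⟨v, hv, hv0⟩ := U.ne_bot_iff.mp hbot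
  exact V.eq_top_of_mem F hg hU hv hv0

omit F hg V in
theorem hval_zero (i : Node X) : hval lam 0 i = lam i := by simp [hval]

/-- At β = 0 the factor z^{h_i+1} shifts the mode number by λ_i + 1, and a vertex operator
annihilates the vacuum in positive degrees. -/
theorem IsVacuum.xp_eq_zero (i : Node X) (n : ℤ) (hn : 0 < n + lam i + 1) :
    (inducedCurrents q κ p l al τ dM lam μ).xp i n (Finsupp.single (0, ⟨0, rfl⟩) e) = 0 := by
  have h := latticeCurrents_xp q κ l lam μ τ
    (fun j s => vertexMode (creation q p al (j, true)) (EllToroidal.annihilation q p al (j, true)) s)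
    (fun j s => vertexMode (creation q p al (j, false)) (EllToroidal.annihilation q p al (j, false)) s) dM
    i n 0 ⟨0, rfl⟩ e
  refine h.trans ?_
  rw [V.τ_eq, hval_zero, (F.isVertexSystem hg).vertexMode_vacuum_pos (i, true)
    (V.annihilation F hg _) hn, smul_zero, Finsupp.single_zero]

theorem IsVacuum.xm_eq_zero (i : Node X) (n : ℤ) (hn : 0 < n - lam i + 1) :
    (inducedCurrents q κ p l al τ dM lam μ).xm i n (Finsupp.single (0, ⟨0, rfl⟩) e) = 0 := by
  have h := latticeCurrents_xm q κ l lam μ τ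
    (fun j s => vertexMode (creation q p al (j, true)) (EllToroidal.annihilation q p al (j, true)) s)
    (fun j s => vertexMode (creation q p al (j, false)) (EllToroidal.annihilation q p al (j, false)) s) dM
    i n 0 ⟨0, rfl⟩ e
  refine h.trans ?_
  rw [V.τ_eq, hval_zero, (F.isVertexSystem hg).vertexMode_vacuum_pos (i, false)
    (V.annihilation F hg _) hn, smul_zero, Finsupp.single_zero]

omit F hg V in
theorem weightOf_zero : weightOf lam μ (0, ⟨0, rfl⟩) = (toWeight X lam, Qof X μ) := by
  simp [weightOf, toWeight]

omit F hg V in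
theorem inducedCurrents_isWeight : (inducedCurrents q κ p l al τ dM lam μ).IsWeight
    (toWeight X lam + μ - μ, Qof X μ) (Finsupp.single (0, ⟨0, rfl⟩) e) := by
  intro f
  refine (latticeCurrents_ev q κ l lam μ τ _ _ dM f _ e).trans ?_
  rw [weightOf_zero, add_sub_cancel_right, Finsupp.smul_single]

theorem IsVacuum.isHorizontalHighestWeightVector (h1 : ∀ i, -1 ≤ lam i) (h2 : ∀ i, lam i ≤ 1)
    (h3 : ∀ i, i ≠ 0 → 0 ≤ lam i) :
    (inducedCurrents q κ p l al τ dM lam μ).IsHorizontalHighestWeightVector (toWeight X lam + μ) μ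
      (Finsupp.single (0, ⟨0, rfl⟩) e) where
  ne_zero := by simpa using V.ne_zero
  cyclic U hU hv := V.eq_top_of_mem F hg hU hv (by simpa using V.ne_zero)
  weight := inducedCurrents_isWeight
  al_pos i n hn := by
    rw [inducedCurrents_al, diagHom_single, V.al_pos i n hn, Finsupp.single_zero]
  xp_pos i n hn := V.xp_eq_zero F hg i n (by have := h1 i; omega)
  xm_pos i n hn := V.xm_eq_zero F hg i n (by have := h2 i; omega)
  xp_zero i hi := V.xp_eq_zero F hg i 0 (by have := h3 i hi; omega)

theorem IsVacuum.isHighestWeightVector (h2 : ∀ i, lam i ≤ 1) (h3 : ∀ i, 0 ≤ lam i) :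
    (inducedCurrents q κ p l al τ dM lam μ).IsHighestWeightVector (toWeight X lam + μ) μ
      (Finsupp.single (0, ⟨0, rfl⟩) e) where
  ne_zero := by simpa using V.ne_zero
  cyclic U hU hv := V.eq_top_of_mem F hg hU hv (by simpa using V.ne_zero)
  weight := inducedCurrents_isWeight
  al i n hn := by
    rw [inducedCurrents_al, diagHom_single, V.al_pos i n hn, Finsupp.single_zero]
  xp i n hn := V.xp_eq_zero F hg i n (by have := h3 i; omega)
  xm i n hn := V.xm_eq_zero F hg i n (by have := h2 i; omega)

end InducedIrreducible

/-! ### Eigenvectors of the Fock degree -/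

section PolyGrading

open MvPolynomial

variable {X : AffineType} {K : Type} [Field K] [Algebra ℂ K] {q : ℂ}

theorem span_polyDeg_eigenvectors (hq : q ≠ 0) : Submodule.span ℂ
    {f : MvPolynomial (Node X × ℕ+) K | ∃ k : ℕ, polyDeg K X q f = q ^ (-(k : ℤ)) • f} = ⊤ := by
  classical
  rw [eq_top_iff]
  intro f _
  rw [f.as_sum]
  refine Submodule.sum_mem _ fun s _ => Submodule.subset_span ⟨monoDeg s, ?_⟩
  ext t
  rw [coeff_polyDeg _ _ hq, coeff_smul, coeff_monomial]
  split_ifs with h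
  · rw [h]
  · rw [smul_zero, smul_zero]

theorem eq_zero_of_polyDeg_eq (hq : q ≠ 0) (z : ℂ) (hz : ∀ k : ℕ, q ^ (-(k : ℤ)) ≠ z)
    (f : MvPolynomial (Node X × ℕ+) K) (hf : polyDeg K X q f = z • f) : f = 0 := by
  ext s
  have h1 := congrArg (coeff s) hf
  rw [coeff_polyDeg f s hq, coeff_smul, ← sub_eq_zero, ← sub_smul,
    ← algebraMap_smul K (_ : ℂ), smul_eq_mul] at h1
  rw [coeff_zero]
  refine (mul_eq_zero.mp h1).resolve_left ?_
  rw [← ne_eq, map_ne_zero]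
  exact sub_ne_zero.mpr (hz _)

end PolyGrading

/-! ### The modules of the theorem -/

section MainResults

variable {X : AffineType} {q κ p l : ℂ} {lam : Node X → ℤ} {μ : hStar X}

theorem latticeCurrents_isTruncatedGraded_id {M : Type*} [AddCommGroup M] [Module ℂ M]
    [Module (Mero X) M] {τ : HStar X → M →ₗ[ℂ] M} {Tp Tm : Node X → ℤ → M →ₗ[ℂ] M}
    (hq : q ≠ 0) (hq1 : ‖q‖ < 1) {C : ℤ} (hC : ∀ β, -C ≤ energy lam β) :
    (latticeCurrents q κ l lam μ τ Tp Tm LinearMap.id).IsTruncatedGraded q := by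
  refine latticeCurrents_isTruncatedGraded hq hq1 hC (eq_top_iff.mpr fun m _ =>
    Submodule.subset_span ⟨0, by simp⟩) fun z hz m hm => ?_
  have h1 : ((1 : ℂ) - z) • m = 0 := by rw [sub_smul, one_smul, ← hm, LinearMap.id_apply, sub_self]
  exact (smul_eq_zero.mp h1).resolve_left (sub_ne_zero.mpr (by simpa using hz 0))

theorem WModule_isTruncatedGraded (hg : GenericParams q κ p) {C : ℤ}
    (hC : ∀ β, -C ≤ energy lam β) : (WModule q κ l lam μ).IsTruncatedGraded q := by
  unfold WModule
  exact latticeCurrents_isTruncatedGraded_id hg.q_ne hg.q_lt hC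

theorem WModule_irreducible (hg : GenericParams q κ p) : (WModule q κ l lam μ).Irreducible := by
  unfold WModule
  exact latticeCurrents_irreducible hg.q_ne hg.κ_ne (e := (1 : Mero X)) one_ne_zero
    (fun η => map_one (shift η)) (fun _ => rfl) (fun _ => rfl)
    (fun m hm => ⟨m⁻¹, inv_mul_cancel₀ hm⟩) (fun m => ⟨m, mul_one m⟩)

theorem eq_of_WModule_equivalent {ε : ℤ} {a b : Node X} {μ' : hStar X} (ha : label X a = 1)
    (hb : label X b = 1) (h : (WModule q κ l (vacuumWeight X ε a) μ).Equivalent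
      (WModule q κ l (vacuumWeight X ε b) μ')) : a = b := by
  unfold WModule at h
  obtain ⟨β, hβ⟩ := vacuumWeight_eq_of_equivalent h
  refine eq_of_single_sub_single ha hb (β := β) fun i => ?_
  rw [← hβ i]
  simp only [vacuumWeight, Pi.add_apply, Pi.sub_apply]
  ring

set_option maxHeartbeats 1000000 in
theorem IndModule_isTruncatedGraded (hg : GenericParams q κ p) {C : ℤ}
    (hC : ∀ β, -C ≤ energy lam β) : (IndModule q κ p l lam μ).IsTruncatedGraded q := by
  have h := inducedCurrents_isTruncatedGraded (κ := κ) (p := p) (l := l) (μ := μ)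
    (al := fun i m => polyAl (Mero X) q κ p i m) (τ := fockShift) hg.q_ne hg.q_lt hC
    (span_polyDeg_eigenvectors (K := Mero X) (X := X) hg.q_ne) (eq_zero_of_polyDeg_eq hg.q_ne)
  exact IndModule_eq ▸ h

theorem fock_isVacuum (hg : GenericParams q κ p) :
    IsVacuum (fun i m => polyAl (Mero X) q κ p i m) fockShift (1 : Fock X) where
  ne_zero := one_ne_zero
  al_pos i n hn := polyAl_one i hn
  τ_eq η := map_one (MvPolynomial.mapAlgHom (shift η).toAlgHom)
  irreducible N hN f hf hf0 := by
    refine eq_top_iff.mpr fun f' _ => ?_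
    refine eq_top_of_polyAl (q := q) (κ := κ) (p := p)
      (fun i n => hN i _ (by have := n.pos; omega))
      (one_mem_of_polyAl hg (fun i n => hN i _ (by have := n.pos; omega)) hf hf0) f'

set_option maxHeartbeats 1000000 in
theorem IndModule_irreducible (hg : GenericParams q κ p) :
    (IndModule q κ p l lam μ).Irreducible := by
  have h := (fock_isVacuum (X := X) hg).irreducible_induced (l := l) (lam := lam) (μ := μ)
    (fockData hg) hg
  exact IndModule_eq ▸ h

set_option maxHeartbeats 1000000 in
theorem IndModule_isHorizontalHighestWeightVector (hg : GenericParams q κ p)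
    (h1 : ∀ i, -1 ≤ lam i) (h2 : ∀ i, lam i ≤ 1) (h3 : ∀ i, i ≠ 0 → 0 ≤ lam i) :
    (IndModule q κ p l lam μ).IsHorizontalHighestWeightVector (toWeight X lam + μ) μ
      (Finsupp.single (0, ⟨0, rfl⟩) 1) := by
  have h := (fock_isVacuum (X := X) hg).isHorizontalHighestWeightVector (l := l) (μ := μ)
    (fockData hg) hg h1 h2 h3
  exact IndModule_eq ▸ h

set_option maxHeartbeats 1000000 in
theorem IndModule_isHighestWeightVector (hg : GenericParams q κ p)
    (h2 : ∀ i, lam i ≤ 1) (h3 : ∀ i, 0 ≤ lam i) :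
    (IndModule q κ p l lam μ).IsHighestWeightVector (toWeight X lam + μ) μ
      (Finsupp.single (0, ⟨0, rfl⟩) 1) := by
  have h := (fock_isVacuum (X := X) hg).isHighestWeightVector (l := l) (μ := μ)
    (fockData hg) hg h2 h3
  exact IndModule_eq ▸ h

theorem vacuumWeight_zero (a : Node X) :
    vacuumWeight X 0 a = Pi.single a 1 - Pi.single 0 1 := by
  rw [vacuumWeight, zero_smul, add_zero]

/-- The value -1 occurs only at the affine node for ε = 0 and a ≠ 0; there x^+_{0,0} need not kill
the vacuum, which is why the last bound needs ε = 1 or a = 0. -/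
theorem vacuumWeight_bounds {ε : ℤ} (hε : ε = 0 ∨ ε = 1) (a i : Node X) :
    -1 ≤ vacuumWeight X ε a i ∧ vacuumWeight X ε a i ≤ 1 ∧ (i ≠ 0 → 0 ≤ vacuumWeight X ε a i) ∧
      (ε = 1 ∨ a = 0 → 0 ≤ vacuumWeight X ε a i) := by
  simp only [vacuumWeight, Pi.add_apply, Pi.sub_apply, Pi.smul_apply, Pi.single_apply, smul_eq_mul]
  rcases hε with rfl | rfl <;> by_cases hi : i = 0 <;> by_cases ha : i = a <;> subst_vars <;> simp_all

end MainResults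

end EllToroidal

end

theorem mainTheorem5 (X : EllToroidal.AffineType) (q κ p l : ℂ)
    (hgen : EllToroidal.GenericParams q κ p) (ε : ℤ) (hε : ε = 0 ∨ ε = 1) :
    (∀ (a : EllToroidal.Node X) (μ : EllToroidal.hStar X), EllToroidal.label X a = 1 →
      (EllToroidal.WModule q κ l (EllToroidal.vacuumWeight X ε a) μ).IsZModule q κ l ∧
      (ε = 0 →
        (EllToroidal.WModule q κ l (EllToroidal.vacuumWeight X ε a) μ).IsTruncatedGraded q) ∧
      (EllToroidal.WModule q κ l (EllToroidal.vacuumWeight X ε a) μ).Irreducible) ∧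
    (∀ (a b : EllToroidal.Node X) (μ μ' : EllToroidal.hStar X),
      EllToroidal.label X a = 1 → EllToroidal.label X b = 1 →
      (EllToroidal.WModule q κ l (EllToroidal.vacuumWeight X ε a) μ).Equivalent
        (EllToroidal.WModule q κ l (EllToroidal.vacuumWeight X ε b) μ') → a = b) ∧
    (∀ (a : EllToroidal.Node X) (μ : EllToroidal.hStar X), EllToroidal.label X a = 1 →
      (EllToroidal.IndModule q κ p l (EllToroidal.vacuumWeight X ε a) μ).IsUModule q κ p l ∧
      (ε = 0 →
        (EllToroidal.IndModule q κ p l (EllToroidal.vacuumWeight X ε a) μ).IsTruncatedGraded q) ∧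
      (EllToroidal.IndModule q κ p l (EllToroidal.vacuumWeight X ε a) μ).Irreducible ∧
      (EllToroidal.IndModule q κ p l (EllToroidal.vacuumWeight X ε a) μ).IsHorizontalHighestWeightVector
        (EllToroidal.toWeight X (EllToroidal.vacuumWeight X ε a) + μ) μ
        (Finsupp.single (0, ⟨0, rfl⟩) 1) ∧
      ((ε = 1 ∨ a = 0) →
        (EllToroidal.IndModule q κ p l (EllToroidal.vacuumWeight X ε a) μ).IsHighestWeightVector
          (EllToroidal.toWeight X (EllToroidal.vacuumWeight X ε a) + μ) μ
          (Finsupp.single (0, ⟨0, rfl⟩) 1))) := by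
  have hb := EllToroidal.vacuumWeight_bounds (X := X) hε
  have hC : ∀ a : EllToroidal.Node X, EllToroidal.label X a = 1 → ε = 0 →
      ∃ C : ℤ, ∀ β, -C ≤ EllToroidal.energy (EllToroidal.vacuumWeight X ε a) β := by
    rintro a ha rfl
    rw [EllToroidal.vacuumWeight_zero]
    exact EllToroidal.energy_bound a ha
  refine ⟨fun a μ ha => ⟨EllToroidal.WModule_isZModule hgen, fun h0 => ?_,
    EllToroidal.WModule_irreducible hgen⟩,
    fun a b μ μ' ha hb' h => EllToroidal.eq_of_WModule_equivalent ha hb' h,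
    fun a μ ha => ⟨EllToroidal.IndModule_isUModule hgen, fun h0 => ?_,
      EllToroidal.IndModule_irreducible hgen,
      EllToroidal.IndModule_isHorizontalHighestWeightVector hgen (fun i => (hb a i).1)
        (fun i => (hb a i).2.1) (fun i => (hb a i).2.2.1),
      fun h => EllToroidal.IndModule_isHighestWeightVector hgen (fun i => (hb a i).2.1)
        (fun i => (hb a i).2.2.2 h)⟩⟩
  · obtain ⟨C, hC⟩ := hC a ha h0
    exact EllToroidal.WModule_isTruncatedGraded hgen hC
  · obtain ⟨C, hC⟩ := hC a ha h0
    exact EllToroidal.IndModule_isTruncatedGraded hgen hC
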